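/- Let $k\ge 2$, $\tau\ge 0$, and let $f=\sum_{i=1}^k f_i x^{e_i}\in\mathbb R[x]$ with integers $0=e_1<e_2<\dots<e_k\le n$ and $2^{-\tau}\le |f_i|\le 2^{\tau}$. Let $m,r>0$ be real numbers with $m\ge r+2Rnr$, where $R=2^{8k+4}n^{5k+16}$. All logarithms are to base $2$, and $\Delta_\rho(c)\subset\mathbb C$ is the open disk with center $c$ and radius $\rho$. Let $f^{[0]}=f$, let $f^{[i+1]}$ be the derivative of $f^{[i]}$ divided by the highest power of $x$ dividing it, and put $M_{\mathcal D_f}(x)=\min_{0\le i\le k-1}|f^{[i]}(x)|$. A point $m'$ of the multipoint $\{m+(j-k^2)\tfrac{r}{k^2}: 0\le j\le 2k^2\}$ is called admissible if $M_{\mathcal D_f}(m')\ge\frac18 M_{\mathcal D_f}(x)$ for all points $x$ of the multipoint. For a disk $\Delta_\rho(c)$ write $f(c+\rho x)=\sum_i a_ix^i$. The $\tilde T_l$-test on $\Delta_\rho(c)$ compares $E_\ell=|a_l|$ with $E_r=\frac{65}{64}\sum_{0\le i\le k^2,\,i\ne l}|a_i|$ by a soft predicate: it answers True only if $E_\ell>E_r$,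 False only if $E_\ell\le E_r$, and Undecided only if $\frac{128}{129}E_\ell<E_r\le\frac{129}{128}E_\ell$; it succeeds if the answer is True. The wrapper algorithm computes an admissible point $m'$ and then, for $i=0,\dots,k$ and for each $i$ for $l=0,\dots,k$, performs the $\tilde T_l$-test on $\Delta_{\rho_i}(m')$, $\rho_i=16n(256n^5)^i\cdot 2r$; at the first success it returns the disk $\Delta_{\rho_i}(m')$ and the number $l$. Then every run of the algorithm (for every choice of admissible point and all legitimate answers of the soft predicate) returns a disk $\Delta_{r'}(m')$ and a number $l$ such that $\Delta_r(m)\subseteq\Delta_{r'}(m')$, $r'\le Rr$, $m-r\le m'\le m+r$, and $f$ has exactly $l$ roots in $\Delta_{r'}(m')$, counted with multiplicity. Moreover, the algorithm can be implemented by one program that receives $n$, $k$ and $e_1,\dots,e_k$ as integers and has access to $f_1,\dots,f_k$, $m$ and $r$ through oracles which, for any positive integer $\kappa$, provide an approximation $w/2^{\kappa+1}$, $w\in\mathbb Z$, with error less than $2^{-\kappa}$, at a cost of at most $$\tilde O\Big(k^{5}(k+\log n)\big(k^{2}\log n+n\log\max(1,m)+\tau+\log\max(1,\tfrac1r)\big)\Big)$$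 bit operations. Here the program runs on a random access machine with integer arithmetic whose instructions are charged by the bit lengths of the numbers and addresses they handle (multiplications and divisions of numbers with $b$ bits in total are charged $O(b\log^2 b)$, and an oracle query with precision $\kappa$ is charged $\kappa$ plus the bit lengths of its arguments and of its answer), it outputs the indices of $m'$ in the multipoint and of the disk together with $l$, and $\tilde O(X)$ means at most $K\,X\,\log^{c}(2+X)$ with absolute constants $K,c$. -/

import Mathlib

open Polynomial

noncomputable section

namespace SparseRoots

/-! ### Sparse polynomials and their fractional derivatives -/

/-- An `(n, k, τ)`-nomial `f = ∑ i, f_i x ^ e_i` with `0 = e_1 < e_2 < ⋯ < e_k ≤ n`, `k ≥ 2` and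
`2 ^ (-τ) ≤ |f_i| ≤ 2 ^ τ`. The index set `{1, …, k}` is `Fin k` here. -/
structure Nomial (n k : ℕ) (τ : ℝ) where
  coef : Fin k → ℝ
  expo : Fin k → ℕ
  two_le : 2 ≤ k
  expo_zero : expo ⟨0, by omega⟩ = 0
  expo_strictMono : StrictMono expo
  expo_le : ∀ i, expo i ≤ n
  le_abs_coef : ∀ i, (2 : ℝ) ^ (-τ) ≤ |coef i|
  abs_coef_le : ∀ i, |coef i| ≤ (2 : ℝ) ^ τ

/-- The polynomial `∑ i, f_i x ^ e_i`. -/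
def Nomial.poly {n k : ℕ} {τ : ℝ} (f : Nomial n k τ) : ℝ[X] :=
  ∑ i, C (f.coef i) * X ^ f.expo i

/-- The first fractional derivative: `p'` divided by the highest power of `x` dividing `p'`. -/
def fracDeriv (p : ℝ[X]) : ℝ[X] :=
  divX^[(derivative p).natTrailingDegree] (derivative p)

/-- `M(x) = min (|f(x)|, |f^[1](x)|, …, |f^[k-1](x)|)`, the minimum over the tuple of all non-zero
fractional derivatives of `f`. -/
def Nomial.minAbs {n k : ℕ} {τ : ℝ} (f : Nomial n k τ) (x : ℝ) : ℝ :=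
  ⨅ i : Fin k, |(fracDeriv^[(i : ℕ)] f.poly).eval x|

/-- The number of complex roots, counted with multiplicity, of a real polynomial in the open disk
with real center `c` and radius `ρ`. -/
def rootCount (p : ℝ[X]) (c ρ : ℝ) : ℕ :=
  open Classical in
  Multiset.countP (fun z : ℂ => z ∈ Metric.ball (c : ℂ) ρ) (p.map Complex.ofRealHom).roots

/-! ### Admissible points -/

/-- The `j`-th point, `0 ≤ j ≤ 2t`, of the multipoint `m[t; δ]`. -/
def multipointAt (m : ℝ) (t : ℕ) (δ : ℝ) (j : ℕ) : ℝ := m + ((j : ℝ) - t) * δ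

/-- The multipoint `m[t; δ]`. -/
def multipoint (m : ℝ) (t : ℕ) (δ : ℝ) : Set ℝ := {x | ∃ j ≤ 2 * t, x = multipointAt m t δ j}

/-- `x` is `(g, S)`-admissible. -/
def IsAdmissible (g : ℝ → ℝ) (S : Set ℝ) (x : ℝ) : Prop :=
  x ∈ S ∧ ∀ y ∈ S, 1 / 8 * |g y| ≤ |g x|

/-! ### Soft predicates and the truncated Pellet test -/

/-- The three possible answers of a soft predicate. -/
inductive Verdict
  | yes
  | no
  | undecided
  deriving DecidableEq

/-- `v` is a legitimate answer of the soft version, with tolerance `δ`, of the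
predicate `El > Er`. Near equality more than one answer is legitimate. -/
def SoftAnswer (δ El Er : ℝ) : Verdict → Prop
  | .yes => Er < El
  | .no => El ≤ Er
  | .undecided => 1 / (1 + δ) * El < Er ∧ Er ≤ (1 + δ) * El

/-- The coefficient `a_i` of `p(c + ρ x) = ∑ i, a_i x ^ i`. -/
def diskCoeff (p : ℝ[X]) (c ρ : ℝ) (i : ℕ) : ℝ := (p.comp (C c + C ρ * X)).coeff i

/-- `v` is a legitimate answer of the truncated soft `T_l`-test for a `k`-nomial `p` on the disk with
center `c` and radius `ρ`: the soft predicate with tolerance `1/128` for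
`|a_l| > 65/64 * ∑_{i ≤ k^2, i ≠ l} |a_i|`. -/
def TestAnswer (p : ℝ[X]) (k : ℕ) (c ρ : ℝ) (l : ℕ) (v : Verdict) : Prop :=
  SoftAnswer (1 / 128) |diskCoeff p c ρ l|
    (65 / 64 * ∑ i ∈ (Finset.range (k ^ 2 + 1)).erase l, |diskCoeff p c ρ i|) v

/-! ### The wrapper algorithm -/

/-- `R = 2 ^ (8k+4) n ^ (5k+16)`. -/
def blowup (n k : ℕ) : ℝ := 2 ^ (8 * k + 4) * (n : ℝ) ^ (5 * k + 16)

/-- The `j`-th point of the multipoint `m[k^2; r/k^2]`. -/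
def candidate (k : ℕ) (m r : ℝ) (j : ℕ) : ℝ := multipointAt m (k ^ 2) (r / k ^ 2) j

/-- The radius `16 n M ^ i (2 r)`, with `M = 256 n ^ 5`, of the disk tested in round `i`. -/
def testRadius (n : ℕ) (r : ℝ) (i : ℕ) : ℝ := 16 * n * (256 * (n : ℝ) ^ 5) ^ i * (2 * r)

/-- The choices made in a run of the wrapper algorithm on `f` and the disk `Δ_r(m)`: the index `j` of
the admissible point that it computes, and for all `i, l ≤ k` the answer `v i l` of the truncated
soft `T_l`-test on the `i`-th disk around that point. -/
structure IsRun {n k : ℕ} {τ : ℝ} (f : Nomial n k τ) (m r : ℝ) (j : ℕ)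
    (v : ℕ → ℕ → Verdict) : Prop where
  index_le : j ≤ 2 * k ^ 2
  admissible : IsAdmissible f.minAbs (multipoint m (k ^ 2) (r / k ^ 2)) (candidate k m r j)
  answers : ∀ i ≤ k, ∀ l ≤ k,
    TestAnswer f.poly k (candidate k m r j) (testRadius n r i) l (v i l)

/-- What a run with test answers `v` returns: the first pair `(i, l)`, in the order of the two nested
loops (`i` outer, `l` inner, both from `0` to `k`), whose test succeeds; `none` if there is none.
The pair stands for the `i`-th disk together with the number `l`. -/
def runOutput (k : ℕ) (v : ℕ → ℕ → Verdict) : Option (ℕ × ℕ) :=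
  (List.product (List.range (k + 1)) (List.range (k + 1))).find?
    (fun p => decide (v p.1 p.2 = Verdict.yes))

/-! ### Bit cost: a random access machine with logarithmic cost and real-number oracles

A program has finitely many integer registers and an unbounded integer memory that is accessed by
computed addresses. Real inputs are only accessible through dyadic approximations. Every instruction
is charged by the bit lengths of the numbers and addresses it handles. -/

/-- Bit length of an integer (with one bit for the sign). -/
def bitLen (z : ℤ) : ℕ := z.natAbs.size + 1

/-- The number of bit operations charged for a multiplication or a division with remainder whose
operands have `b` bits in total: `b (log b) ^ 2`, which fast integer arithmetic attains. -/
def mulCost (b : ℕ) : ℕ := b * b.size ^ 2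

/-- The machine's programs; natural numbers name registers. -/
inductive Program
  /-- `d := z` -/
  | const (d : ℕ) (z : ℤ)
  /-- `d := a + b` -/
  | add (d a b : ℕ)
  /-- `d := a - b` -/
  | sub (d a b : ℕ)
  /-- `d := a * b` -/
  | mul (d a b : ℕ)
  /-- `d := a / b` (integer division) -/
  | div (d a b : ℕ)
  /-- `d := memory[a]` -/
  | load (d a : ℕ)
  /-- `memory[a] := b` -/
  | store (a b : ℕ)
  /-- `d :=` the oracle's approximation, with precision `b`, of real input number `a` -/
  | query (d a b : ℕ)
  /-- `p; q` -/
  | seq (p q : Program)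
  /-- `if a > 0 then p else q` -/
  | branch (a : ℕ) (p q : Program)
  /-- `while a > 0 do p` -/
  | loop (a : ℕ) (p : Program)

/-- Contents of the registers and of the memory. -/
structure State where
  reg : ℕ → ℤ
  mem : ℕ → ℤ

/-- Write `z` into register `d`. -/
def State.setReg (s : State) (d : ℕ) (z : ℤ) : State := ⟨Function.update s.reg d z, s.mem⟩

/-- Write `z` into memory cell `a`. -/
def State.setMem (s : State) (a : ℕ) (z : ℤ) : State := ⟨s.reg, Function.update s.mem a z⟩

/-- `Exec O p s s' t`: with oracle `O`, program `p` started in state `s` halts in state `s'` after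
`t` bit operations. -/
inductive Exec (O : ℕ → ℕ → ℤ) : Program → State → State → ℕ → Prop
  | const (d : ℕ) (z : ℤ) (s : State) : Exec O (.const d z) s (s.setReg d z) (bitLen z)
  | add (d a b : ℕ) (s : State) :
      Exec O (.add d a b) s (s.setReg d (s.reg a + s.reg b)) (bitLen (s.reg a) + bitLen (s.reg b))
  | sub (d a b : ℕ) (s : State) :
      Exec O (.sub d a b) s (s.setReg d (s.reg a - s.reg b)) (bitLen (s.reg a) + bitLen (s.reg b))
  | mul (d a b : ℕ) (s : State) :
      Exec O (.mul d a b) s (s.setReg d (s.reg a * s.reg b))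
        (mulCost (bitLen (s.reg a) + bitLen (s.reg b)))
  | div (d a b : ℕ) (s : State) :
      Exec O (.div d a b) s (s.setReg d (s.reg a / s.reg b))
        (mulCost (bitLen (s.reg a) + bitLen (s.reg b)))
  | load (d a : ℕ) (s : State) :
      Exec O (.load d a) s (s.setReg d (s.mem (s.reg a).toNat))
        (bitLen (s.reg a) + bitLen (s.mem (s.reg a).toNat))
  | store (a b : ℕ) (s : State) :
      Exec O (.store a b) s (s.setMem (s.reg a).toNat (s.reg b))
        (bitLen (s.reg a) + bitLen (s.reg b))
  | query (d a b : ℕ) (s : State) :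
      Exec O (.query d a b) s (s.setReg d (O (s.reg a).toNat (s.reg b).toNat))
        (bitLen (s.reg a) + bitLen (s.reg b) + (s.reg b).toNat
          + bitLen (O (s.reg a).toNat (s.reg b).toNat))
  | seq {p q : Program} {s₁ s₂ s₃ : State} {t u : ℕ} :
      Exec O p s₁ s₂ t → Exec O q s₂ s₃ u → Exec O (.seq p q) s₁ s₃ (t + u)
  | branch_pos {a : ℕ} {p q : Program} {s s' : State} {t : ℕ} :
      0 < s.reg a → Exec O p s s' t → Exec O (.branch a p q) s s' (bitLen (s.reg a) + t)
  | branch_neg {a : ℕ} {p q : Program} {s s' : State} {t : ℕ} :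
      s.reg a ≤ 0 → Exec O q s s' t → Exec O (.branch a p q) s s' (bitLen (s.reg a) + t)
  | loop_done {a : ℕ} {p : Program} {s : State} :
      s.reg a ≤ 0 → Exec O (.loop a p) s s (bitLen (s.reg a))
  | loop_step {a : ℕ} {p : Program} {s₁ s₂ s₃ : State} {t u : ℕ} :
      0 < s₁.reg a → Exec O p s₁ s₂ t → Exec O (.loop a p) s₂ s₃ u →
        Exec O (.loop a p) s₁ s₃ (bitLen (s₁.reg a) + t + u)

/-- The integer `w` encodes an absolute `κ`-bit approximation `w / 2 ^ (κ + 1)` of `x`. -/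
def IsApprox (x : ℝ) (κ : ℕ) (w : ℤ) : Prop := |x - w / 2 ^ (κ + 1)| < (2 : ℝ) ^ (-(κ : ℤ))

/-- `O` is an oracle for the real inputs: number `i < k` is the coefficient `f_i`, number `k` is the
center `m` of the input disk, and number `k + 1` is its radius `r`. -/
structure IsOracle {n k : ℕ} {τ : ℝ} (f : Nomial n k τ) (m r : ℝ) (O : ℕ → ℕ → ℤ) : Prop where
  coef : ∀ i : Fin k, ∀ κ : ℕ, 0 < κ → IsApprox (f.coef i) κ (O i κ)
  center : ∀ κ : ℕ, 0 < κ → IsApprox m κ (O k κ)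
  radius : ∀ κ : ℕ, 0 < κ → IsApprox r κ (O (k + 1) κ)

/-- The initial state: `k` and `n` in registers `0` and `1`, and the exponents `e_1, …, e_k` in the
first `k` memory cells; everything else is `0`. -/
def Nomial.initState {n k : ℕ} {τ : ℝ} (f : Nomial n k τ) : State where
  reg := fun d => if d = 0 then (k : ℤ) else if d = 1 then (n : ℤ) else 0
  mem := fun a => if h : a < k then (f.expo ⟨a, h⟩ : ℤ) else 0

/-- The final state `s` reports `(j, i, l)` in its first three registers. -/
def Reports (s : State) (j i l : ℕ) : Prop := s.reg 0 = j ∧ s.reg 1 = i ∧ s.reg 2 = l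

/-- `k^5 (k + log n) (k^2 log n + n log max(1, m) + τ + log max(1, 1/r))`, with logarithms to
base `2`. -/
def costBound (n k : ℕ) (τ m r : ℝ) : ℝ :=
  (k : ℝ) ^ 5 * (k + Real.logb 2 n) *
    ((k : ℝ) ^ 2 * Real.logb 2 n + n * Real.logb 2 (max 1 m) + τ + Real.logb 2 (max 1 (1 / r)))

end SparseRoots

end

open SparseRoots

noncomputable section

namespace SparseRoots

/-! Correctness rests on sparsity. With masses `b_t = f_t c ^ e_t` the number `c ^ j f^(j)(c)` is
the `j`-th falling moment of `k` point masses. A monic polynomial of degree `k` vanishes at all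
exponents, so the first `k` moments control all others (`abs_fallMoment_le`). The lower bound on `m`
gives `c ≥ n ^ 16 ρ` for every tested disk, and then the Taylor coefficients from the `k`-th on are
negligible (`Nomial.abs_diskCoeff_tail`). Hence a success of the truncated test, with its spare
factor `65/64`, is a Pellet certificate for the number of roots (`rootCount_eq_of_dominant`,
`Nomial.rootCount_of_yes`).

Some test must succeed. As the radius grows, the index of the largest of the first `k` coefficients
can only increase. It takes at most `k` values, so around one of the first `k` radii it does not
change; there this coefficient beats the others by powers of `8`, and True is the only legitimate
answer (`exists_dominant_scale`, `Nomial.exists_forced_yes`).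

For the complexity one needs a point where all fractional derivatives are large. By Descartes' rule
they have at most `k (k - 1)` distinct positive roots in total, whereas `k ^ 2` points of the
multipoint have disjoint neighbourhoods; so one neighbourhood is free of roots, and there the mean
value theorem carries a lower bound from the last fractional derivative down to `f`
(`Nomial.exists_large_minAbs`). Moreover the minimum at `c` is at most `|f(c)|`, the zeroth Taylor
coefficient, so one precision serves both the choice of the point and all tests. The program knows
neither `τ` nor that minimum. It doubles its precision until a criterion computed from its own data
holds. The criterion is sound (`Selected.decides`), and it holds once the precision is of the order
of `k * inputSize` (`Selected.sufficient`, `exists_params`).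

The bit cost is the number of steps times a uniform cost per step. Programs are verified in a Hoare
logic `Tri` that counts steps while all registers stay below `2 ^ β`; real quantities are
represented by fixed-point lower approximations `Low`. The count `k ^ 4 (k + log n)`
(`wrapperSteps_le`) times a bit length of order `k * inputSize` is the asserted bound up to
logarithms (`cost_le`). -/

/-! ### Pellet's theorem via the argument principle. -/

/-- The logarithmic derivative integral of a complex polynomial counts its roots in the disk. -/
theorem circleIntegral_logDeriv_eq_count (p : ℂ[X]) (hp : p ≠ 0) (c : ℂ) (ρ : ℝ) (hρ : 0 < ρ)
    (h : ∀ z ∈ Metric.sphere c ρ, p.eval z ≠ 0) :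
    (∮ z in C(c, ρ), (derivative p).eval z / p.eval z) =
      2 * Real.pi * Complex.I *
        (open Classical in Multiset.countP (fun z : ℂ => z ∈ Metric.ball c ρ) p.roots : ℕ) := by
  classical
  -- Stated for an arbitrary multiset so that roots can be peeled off one at a time with their
  -- multiplicities: each `1 / (z - a)` integrates to `2πi` or, by Cauchy's theorem, to `0`.
  have key : ∀ S : Multiset ℂ, (∀ a ∈ S, a ∉ Metric.sphere c ρ) →
      CircleIntegrable (fun z => (S.map fun a => (z - a)⁻¹).sum) c ρ ∧
      (∮ z in C(c, ρ), (S.map fun a => (z - a)⁻¹).sum) =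
        2 * Real.pi * Complex.I * (Multiset.countP (fun z : ℂ => z ∈ Metric.ball c ρ) S : ℕ) := by
    intro S
    induction S using Multiset.induction_on with
    | empty => intro _; simp [circleIntegral]
    | cons a S ih =>
      intro hS
      obtain ⟨i1, i2⟩ := ih fun b hb => hS b (Multiset.mem_cons_of_mem hb)
      have ha := hS a (Multiset.mem_cons_self a S)
      have i0 : CircleIntegrable (fun z => (z - a)⁻¹) c ρ := by
        rw [circleIntegrable_sub_inv_iff]
        right
        rwa [abs_of_pos hρ]
      have hsum : (fun z => (Multiset.map (fun a => (z - a)⁻¹) (a ::ₘ S)).sum) =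
          fun z => (z - a)⁻¹ + (S.map fun a => (z - a)⁻¹).sum := by
        funext z; simp
      rw [hsum]
      refine ⟨i0.add i1, ?_⟩
      rw [circleIntegral.integral_add i0 i1, i2, Multiset.countP_cons]
      by_cases hb : a ∈ Metric.ball c ρ
      · rw [circleIntegral.integral_sub_inv_of_mem_ball hb]
        simp only [hb, if_true]; push_cast; ring
      · simp only [hb, if_false, add_zero]
        have : (∮ z in C(c, ρ), (z - a)⁻¹) = 0 := by
          have hcl : ∀ z ∈ Metric.closedBall c ρ, z - a ≠ 0 := by
            intro z hz h0
            rw [sub_eq_zero] at h0; subst h0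
            rw [Metric.mem_closedBall] at hz
            rw [Metric.mem_ball] at hb
            rw [Metric.mem_sphere] at ha
            exact ha (le_antisymm hz (not_lt.mp hb))
          refine Complex.circleIntegral_eq_zero_of_differentiable_on_off_countable hρ.le
            (s := ∅) (by simp) ?_ ?_
          · exact ContinuousOn.inv₀ (by fun_prop) hcl
          · intro z hz
            have := hcl z (Metric.ball_subset_closedBall hz.1)
            fun_prop (disch := assumption)
        rw [this, zero_add]
  have hroots : ∀ a ∈ p.roots, a ∉ Metric.sphere c ρ := fun a ha hs =>
    h a hs (by simpa using (mem_roots hp).1 ha)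
  rw [← (key p.roots hroots).2]
  refine circleIntegral.integral_congr hρ.le fun z hz => ?_
  have hs : p.Splits := IsAlgClosed.splits p
  have := hs.eval_derivative_div_eval_of_ne_zero (h z hz)
  simpa [one_div] using this

/-- Pellet's theorem: a dominating Taylor coefficient counts the roots in a disk. -/
theorem rootCount_eq_of_dominant (p : ℝ[X]) (c ρ : ℝ) (hρ : 0 < ρ) (N l : ℕ)
    (hN : p.natDegree ≤ N) (hl : l ≤ N)
    (hdom : ∑ i ∈ (Finset.range (N + 1)).erase l, |diskCoeff p c ρ i| < |diskCoeff p c ρ l|) :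
    rootCount p c ρ = l := by
  classical
  set a : ℕ → ℝ := diskCoeff p c ρ with ha
  have hal : a l ≠ 0 := by
    intro h0
    rw [h0, abs_zero] at hdom
    exact absurd hdom (not_lt.mpr (Finset.sum_nonneg fun _ _ => abs_nonneg _))
  set P : ℂ[X] := p.map Complex.ofRealHom with hP
  have hev : ∀ z : ℂ, P.eval z = ∑ i ∈ Finset.range (N + 1), (a i : ℂ) * ((z - c) / ρ) ^ i := by
    intro z
    set w : ℂ := (z - c) / ρ with hw
    have hz : z = c + ρ * w := by
      have : (ρ : ℂ) ≠ 0 := by exact_mod_cast hρ.ne'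
      rw [hw]; field_simp; ring
    set q := p.comp (C c + C ρ * X) with hq
    have hqd : q.natDegree < N + 1 := by
      have h1 : (C c + C ρ * X : ℝ[X]).natDegree ≤ 1 := by compute_degree
      have : q.natDegree ≤ p.natDegree * 1 := natDegree_comp_le.trans (Nat.mul_le_mul_left _ h1)
      omega
    have : P.eval z = (q.map Complex.ofRealHom).eval w := by
      rw [hq, Polynomial.map_comp, eval_comp, hz, hP]
      simp
    rw [this, eval_eq_sum_range' (lt_of_le_of_lt natDegree_map_le hqd)]
    refine Finset.sum_congr rfl fun i _ => ?_
    rw [coeff_map]; rfl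
  have hP0 : P ≠ 0 := by
    intro h0
    have : p = 0 := by
      rw [hP] at h0
      exact (Polynomial.map_eq_zero _).1 h0
    apply hal
    rw [ha, diskCoeff, this]; simp
  -- the quotient by the dominating term
  set g : ℂ → ℂ := fun w => 1 + ∑ i ∈ (Finset.range (N + 1)).erase l,
    ((a i / a l : ℝ) : ℂ) * w ^ ((i : ℤ) - l) with hg
  -- On the unit circle every power of `w` has modulus one, so dominance says that `g - 1` has
  -- modulus below one. Hence `g` avoids the negative axis and does not wind around the origin.
  have hgw : ∀ w : ℂ, ‖w‖ = 1 → g w ∈ Complex.slitPlane := by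
    intro w hw
    refine Complex.mem_slitPlane_of_norm_lt_one (z := _) ?_
    refine lt_of_le_of_lt (norm_sum_le _ _) ?_
    have : ∀ i ∈ (Finset.range (N + 1)).erase l,
        ‖((a i / a l : ℝ) : ℂ) * w ^ ((i : ℤ) - l)‖ = |a i| / |a l| := by
      intro i _
      rw [norm_mul, norm_zpow, hw, one_zpow, mul_one, Complex.norm_real, Real.norm_eq_abs, abs_div]
    rw [Finset.sum_congr rfl this, ← Finset.sum_div, div_lt_one (abs_pos.mpr hal)]
    exact hdom
  have hPg : ∀ z : ℂ, z ≠ c → P.eval z = a l * ((z - c) / ρ) ^ l * g ((z - c) / ρ) := by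
    intro z hz
    have hw0 : (z - c) / (ρ : ℂ) ≠ 0 :=
      div_ne_zero (sub_ne_zero.mpr hz) (by exact_mod_cast hρ.ne')
    rw [hev, hg]
    simp only
    rw [← Finset.add_sum_erase _ _ (Finset.mem_range.mpr (Nat.lt_succ_of_le hl)), mul_add, mul_one,
      Finset.mul_sum]
    congr 1
    refine Finset.sum_congr rfl fun i _ => ?_
    have hal' : (a l : ℂ) ≠ 0 := by exact_mod_cast hal
    rw [zpow_sub₀ hw0, zpow_natCast, zpow_natCast]
    push_cast
    field_simp
  have hnc : ∀ z ∈ Metric.sphere (c : ℂ) ρ, z ≠ c ∧ ‖(z - c) / (ρ : ℂ)‖ = 1 := by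
    intro z hz
    rw [mem_sphere_iff_norm] at hz
    constructor
    · rintro rfl; simp at hz; exact hρ.ne hz
    · rw [norm_div, hz, Complex.norm_real, Real.norm_eq_abs, abs_of_pos hρ, div_self hρ.ne']
  have hne : ∀ z ∈ Metric.sphere (c : ℂ) ρ, P.eval z ≠ 0 := by
    intro z hz
    obtain ⟨h1, h2⟩ := hnc z hz
    rw [hPg z h1]
    have hw0 : (z - c) / (ρ : ℂ) ≠ 0 := by
      intro h; rw [h] at h2; simp at h2
    exact mul_ne_zero (mul_ne_zero (by exact_mod_cast hal) (pow_ne_zero _ hw0))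
      (Complex.slitPlane_ne_zero (hgw _ h2))
  have hcount := circleIntegral_logDeriv_eq_count P hP0 c ρ hρ hne
  have hint : (∮ z in C((c : ℂ), ρ), (derivative P).eval z / P.eval z) =
      2 * Real.pi * Complex.I * l := by
    have hgd : ∀ z ∈ Metric.sphere (c : ℂ) ρ,
        DifferentiableAt ℂ (fun z : ℂ => g ((z - c) / ρ)) z := by
      intro z hz
      obtain ⟨h1, h2⟩ := hnc z hz
      have hw0 : (z - c) / (ρ : ℂ) ≠ 0 := by
        intro h; rw [h] at h2; simp at h2
      have : DifferentiableAt ℂ g ((z - c) / ρ) := by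
        rw [hg]
        refine DifferentiableAt.const_add _ (DifferentiableAt.fun_sum fun i _ => ?_)
        exact (differentiableAt_zpow.mpr (Or.inl hw0)).const_mul _
      have hin : DifferentiableAt ℂ (fun z : ℂ => (z - c) / (ρ : ℂ)) z := by fun_prop
      exact DifferentiableAt.comp (g := g) (f := fun z : ℂ => (z - c) / (ρ : ℂ)) z this hin
    have hld : ∀ z ∈ Metric.sphere (c : ℂ) ρ, (derivative P).eval z / P.eval z =
        l * (z - c)⁻¹ + deriv (fun z : ℂ => g ((z - c) / ρ)) z / g ((z - c) / ρ) := by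
      intro z hz
      obtain ⟨h1, h2⟩ := hnc z hz
      have hzc : z - (c : ℂ) ≠ 0 := sub_ne_zero.mpr h1
      have hρ' : (ρ : ℂ) ≠ 0 := by exact_mod_cast hρ.ne'
      have hg0 := Complex.slitPlane_ne_zero (hgw _ h2)
      have hal' : (a l : ℂ) ≠ 0 := by exact_mod_cast hal
      have hd1 : HasDerivAt (fun z : ℂ => (a l : ℂ) * ((z - c) / ρ) ^ l * g ((z - c) / ρ))
          ((a l : ℂ) * (l * ((z - c) / ρ) ^ (l - 1) * (1 / ρ)) * g ((z - c) / ρ) +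
            (a l : ℂ) * ((z - c) / ρ) ^ l * deriv (fun z : ℂ => g ((z - c) / ρ)) z) z := by
        have hb : HasDerivAt (fun z : ℂ => (z - c) / (ρ : ℂ)) (1 / ρ) z :=
          ((hasDerivAt_id z).sub_const (c : ℂ)).div_const _
        exact ((hb.pow l).const_mul (a l : ℂ)).mul (hgd z hz).hasDerivAt
      have hd2 : HasDerivAt (fun z => P.eval z) ((derivative P).eval z) z := P.hasDerivAt z
      have hee : (fun z => P.eval z) =ᶠ[nhds z]
          (fun z : ℂ => (a l : ℂ) * ((z - c) / ρ) ^ l * g ((z - c) / ρ)) := by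
        filter_upwards [isOpen_ne.mem_nhds h1] with y hy using hPg y hy
      rw [(hd2.congr_of_eventuallyEq hee.symm).unique hd1, hPg z h1]
      rcases Nat.eq_zero_or_pos l with h0 | h0
      · subst h0; simp; field_simp
      · obtain ⟨l', rfl⟩ := Nat.exists_eq_succ_of_ne_zero h0.ne'
        simp only [Nat.succ_eq_add_one, Nat.add_sub_cancel]
        rw [pow_succ]
        field_simp
    rw [circleIntegral.integral_congr hρ.le hld]
    -- The principal logarithm of `g` is a single-valued primitive of `g'/g` on the circle, so this
    -- part integrates to zero and only the contribution `l` of the power is left.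
    have hlog : ∀ z ∈ Metric.sphere (c : ℂ) ρ, HasDerivWithinAt
        (fun z : ℂ => Complex.log (g ((z - c) / ρ)))
        (deriv (fun z : ℂ => g ((z - c) / ρ)) z / g ((z - c) / ρ)) (Metric.sphere (c : ℂ) ρ) z := by
      intro z hz
      exact ((hgd z hz).hasDerivAt.clog (hgw _ (hnc z hz).2)).hasDerivWithinAt
    have hz0 := circleIntegral.integral_eq_zero_of_hasDerivWithinAt hρ.le hlog
    have hi1 : CircleIntegrable (fun z : ℂ => (l : ℂ) * (z - c)⁻¹) c ρ := by
      apply ContinuousOn.circleIntegrable hρ.le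
      refine ContinuousOn.mul continuousOn_const (ContinuousOn.inv₀ (by fun_prop) ?_)
      exact fun z hz => sub_ne_zero.mpr (hnc z hz).1
    have hi2 : CircleIntegrable (fun z : ℂ => deriv (fun z : ℂ => g ((z - c) / ρ)) z /
        g ((z - c) / ρ)) c ρ := by
      apply ContinuousOn.circleIntegrable hρ.le
      -- Continuity of `g'/g` is read off from the decomposition `hld`: it is a difference of two
      -- visibly continuous functions.
      have h1 : ContinuousOn (fun z : ℂ => (derivative P).eval z / P.eval z - l * (z - c)⁻¹)
          (Metric.sphere (c : ℂ) ρ) := by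
        refine ContinuousOn.sub (ContinuousOn.div (by fun_prop) (by fun_prop) hne) ?_
        refine ContinuousOn.mul continuousOn_const (ContinuousOn.inv₀ (by fun_prop) ?_)
        exact fun z hz => sub_ne_zero.mpr (hnc z hz).1
      refine h1.congr fun z hz => ?_
      exact (sub_eq_of_eq_add' (hld z hz)).symm
    rw [circleIntegral.integral_add hi1 hi2, hz0, add_zero, circleIntegral.integral_const_mul,
      circleIntegral.integral_sub_inv_of_mem_ball (Metric.mem_ball_self hρ)]
    ring
  rw [hint] at hcount
  have h2 : (2 * Real.pi * Complex.I : ℂ) ≠ 0 := by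
    simp [Real.pi_ne_zero]
  have := mul_left_cancel₀ h2 hcount
  have h3 : l = Multiset.countP (fun z : ℂ => z ∈ Metric.ball (c : ℂ) ρ) P.roots := by
    exact_mod_cast this
  rw [rootCount]
  convert h3.symm

/-! ### Taylor coefficients of a sparse polynomial -/

/-- The sum `∑ t, f_t ∏_{s < i} (e_t - g_s) x ^ (e_t - g_i)`. With `g_s = e_s` this is the `i`-th
fractional derivative, with `g_s = s` the ordinary one. -/
def Nomial.gsum {n k : ℕ} {τ : ℝ} (f : Nomial n k τ) (g : ℕ → ℕ) (i : ℕ) (x : ℝ) : ℝ :=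
  ∑ t, f.coef t * (∏ s ∈ Finset.range i, ((f.expo t : ℝ) - g s)) * x ^ (f.expo t - g i)

theorem Nomial.le_succ {n k : ℕ} {τ : ℝ} (f : Nomial n k τ) : k ≤ n + 1 := by
  have : Function.Injective (fun i : Fin k => (⟨f.expo i, Nat.lt_succ_of_le (f.expo_le i)⟩ :
      Fin (n + 1))) := fun a b h => f.expo_strictMono.injective (by simpa using h)
  simpa using Fintype.card_le_of_injective _ this

theorem Nomial.one_le {n k : ℕ} {τ : ℝ} (f : Nomial n k τ) : 1 ≤ n := by
  have h1 := f.le_succ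
  have h2 := f.two_le
  omega

theorem prod_sub_eq_zero_of_lt {e u : ℕ} (h : e < u) :
    ∏ s ∈ Finset.range u, ((e : ℝ) - s) = 0 :=
  Finset.prod_eq_zero (Finset.mem_range.mpr h) (sub_self _)

theorem choose_mul_factorial_eq_prod (e u : ℕ) :
    (e.choose u : ℝ) * u.factorial = ∏ s ∈ Finset.range u, ((e : ℝ) - s) := by
  have h := Nat.descFactorial_eq_factorial_mul_choose e u
  have h2 : (e.descFactorial u : ℝ) = ∏ s ∈ Finset.range u, ((e : ℝ) - s) := by
    rcases lt_or_ge e u with hlt | hle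
    · rw [prod_sub_eq_zero_of_lt hlt, Nat.descFactorial_of_lt hlt, Nat.cast_zero]
    · rw [Nat.descFactorial_eq_prod_range, Nat.cast_prod]
      refine Finset.prod_congr rfl fun s hs => ?_
      rw [Nat.cast_sub (by have := Finset.mem_range.1 hs; omega)]
  rw [← h2, h]; push_cast; ring

/-- Taylor's formula. The truncated exponent `e_t - u` does no harm, since for `e_t < u` the falling
product already vanishes. -/
theorem Nomial.diskCoeff_eq {n k : ℕ} {τ : ℝ} (f : Nomial n k τ) (c ρ : ℝ) (u : ℕ) :
    diskCoeff f.poly c ρ u = f.gsum id u c * (ρ ^ u / u.factorial) := by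
  have hX : (C c + C ρ * X : ℝ[X]) = (X + C c).comp (C ρ * X) := by simp [add_comm]
  rw [diskCoeff, hX, ← comp_assoc, comp_C_mul_X_coeff, Nomial.gsum, Finset.sum_mul, Nomial.poly,
    Polynomial.sum_comp, finsetSum_coeff, Finset.sum_mul]
  refine Finset.sum_congr rfl fun t _ => ?_
  rw [mul_comp, C_comp, pow_comp, X_comp, coeff_C_mul, coeff_X_add_C_pow]
  have := choose_mul_factorial_eq_prod (f.expo t) u
  have h0 : (u.factorial : ℝ) ≠ 0 := by positivity
  simp only [id]
  rw [← this]
  field_simp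

/-- The moments `∑ t, b_t e_t (e_t - 1) ⋯ (e_t - j + 1)`. -/
def fallMoment {k : ℕ} (b : Fin k → ℝ) (e : Fin k → ℕ) (j : ℕ) : ℝ :=
  ∑ t, b t * ∏ s ∈ Finset.range j, ((e t : ℝ) - s)

/-- Turns derivatives at `c` into moments on the exponents; the point `c` survives only in the
masses. -/
theorem Nomial.gsum_mul_pow {n k : ℕ} {τ : ℝ} (f : Nomial n k τ) (c : ℝ) (j : ℕ) :
    f.gsum id j c * c ^ j = fallMoment (fun t => f.coef t * c ^ f.expo t) f.expo j := by
  rw [Nomial.gsum, fallMoment, Finset.sum_mul]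
  refine Finset.sum_congr rfl fun t _ => ?_
  rcases lt_or_ge (f.expo t) j with h | h
  · simp only [id]; rw [prod_sub_eq_zero_of_lt h]; simp
  · simp only [id]
    have : c ^ f.expo t = c ^ (f.expo t - j) * c ^ j := by rw [← pow_add, Nat.sub_add_cancel h]
    rw [this]; ring

/-- The falling moments of `k` point masses on `{0, …, n}` are controlled by the first `k`. -/
theorem abs_fallMoment_le {n k : ℕ} (hk : 0 < k) (hn : 0 < n) (b : Fin k → ℝ) (e : Fin k → ℕ)
    (he : ∀ t, e t ≤ n) (Y Z : ℝ) (hY : 2 * k * n ≤ Y) (hZ : 0 ≤ Z)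
    (h : ∀ v < k, |fallMoment b e v| ≤ Z * Y ^ v) (j : ℕ) : |fallMoment b e j| ≤ Z * Y ^ j := by
  have hk' : (1 : ℝ) ≤ k := by exact_mod_cast hk
  have hn' : (1 : ℝ) ≤ n := by exact_mod_cast hn
  have hYpos : 0 < Y := by nlinarith
  induction j using Nat.strong_induction_on with
  | _ j ih =>
    rcases lt_or_ge j k with hjk | hjk
    · exact h j hjk
    rcases lt_or_ge n j with hnj | hnj
    · have : fallMoment b e j = 0 := Finset.sum_eq_zero fun t _ => by
        rw [prod_sub_eq_zero_of_lt (lt_of_le_of_lt (he t) hnj), mul_zero]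
      rw [this, abs_zero]; positivity
    set E : ℕ → ℕ := fun s => if h : s < k then e ⟨s, h⟩ else 0 with hE
    have hEn : ∀ s, E s ≤ n := by
      intro s; rw [hE]; dsimp only; split_ifs
      · exact he _
      · omega
    -- `D p m` is the `m`-th falling moment after the masses have been multiplied by the first `p`
    -- factors `e - E s`. Splitting `e - E p = (e - m) + (m - E p)` gives the recursion `hstep`, and
    -- for `p = k` all masses are zero.
    set D : ℕ → ℕ → ℝ := fun p m => ∑ t, b t * (∏ s ∈ Finset.range m, ((e t : ℝ) - s)) *
      ∏ s ∈ Finset.range p, ((e t : ℝ) - E s) with hD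
    have hstep : ∀ p m, D (p + 1) m = D p (m + 1) + ((m : ℝ) - E p) * D p m := by
      intro p m
      simp only [hD]
      rw [Finset.mul_sum, ← Finset.sum_add_distrib]
      refine Finset.sum_congr rfl fun t _ => ?_
      rw [Finset.prod_range_succ, Finset.prod_range_succ]; ring
    have hD0 : ∀ m, D 0 m = fallMoment b e m := by
      intro m; simp [hD, fallMoment]
    have hdiff : ∀ m p, m ≤ n → |(m : ℝ) - E p| ≤ n := by
      intro m p hm
      have h1 : (E p : ℝ) ≤ n := by exact_mod_cast hEn p
      have h2 : (m : ℝ) ≤ n := by exact_mod_cast hm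
      have h3 : (0 : ℝ) ≤ E p := by positivity
      have h4 : (0 : ℝ) ≤ m := by positivity
      rw [abs_le]; constructor <;> linarith
    have hlow : ∀ p m, m + p < j → |D p m| ≤ Z * Y ^ m * (Y + n) ^ p := by
      intro p
      induction p with
      | zero => intro m hm; rw [hD0, pow_zero, mul_one]; exact ih m (by omega)
      | succ p ihp =>
        intro m hm
        rw [hstep]
        have h1 := ihp (m + 1) (by omega)
        have h2 := ihp m (by omega)
        have h3 := hdiff m p (by omega)
        calc |D p (m + 1) + ((m : ℝ) - E p) * D p m|
            ≤ |D p (m + 1)| + |(m : ℝ) - E p| * |D p m| := by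
              rw [← abs_mul]; exact abs_add_le _ _
          _ ≤ Z * Y ^ (m + 1) * (Y + n) ^ p + n * (Z * Y ^ m * (Y + n) ^ p) := by gcongr
          _ = _ := by ring
    -- On the antidiagonal `m + p = j` the `j`-th moment enters with coefficient one; everything
    -- else has lower order and is bounded by `hlow`.
    have heq : ∀ p m, m + p = j →
        |D p m - fallMoment b e j| ≤ Z * Y ^ m * ((Y + n) ^ p - Y ^ p) := by
      intro p
      induction p with
      | zero => intro m hm; rw [hD0, ← hm]; simp
      | succ p ihp =>
        intro m hm
        rw [hstep]
        have h1 := ihp (m + 1) (by omega)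
        have h2 := hlow p m (by omega)
        have h3 := hdiff m p (by omega)
        calc |D p (m + 1) + ((m : ℝ) - E p) * D p m - fallMoment b e j|
            = |(D p (m + 1) - fallMoment b e j) + ((m : ℝ) - E p) * D p m| := by congr 1; ring
          _ ≤ |D p (m + 1) - fallMoment b e j| + |(m : ℝ) - E p| * |D p m| := by
              rw [← abs_mul]; exact abs_add_le _ _
          _ ≤ Z * Y ^ (m + 1) * ((Y + n) ^ p - Y ^ p) + n * (Z * Y ^ m * (Y + n) ^ p) := by
              gcongr
          _ = _ := by ring
    have hDk : D k (j - k) = 0 := by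
      refine Finset.sum_eq_zero fun t _ => ?_
      have : ∏ s ∈ Finset.range k, ((e t : ℝ) - E s) = 0 := by
        refine Finset.prod_eq_zero (Finset.mem_range.mpr t.2) ?_
        simp [hE]
      rw [this, mul_zero]
    have hfin := heq k (j - k) (by omega)
    rw [hDk, zero_sub, abs_neg] at hfin
    -- Bernoulli gives `(1 - n/(Y+n)) ^ k ≥ 1 - kn/(Y+n) ≥ 1/2`; this is what `Y ≥ 2kn` is for.
    have hbern : (Y + n) ^ k ≤ 2 * Y ^ k := by
      have h0 : 0 < Y + n := by linarith
      have h1 : -2 ≤ -((n : ℝ) / (Y + n)) := by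
        have : (n : ℝ) / (Y + n) ≤ 1 := by rw [div_le_one h0]; linarith
        linarith
      have h2 := one_add_mul_le_pow h1 k
      have h3 : 1 + -((n : ℝ) / (Y + n)) = Y / (Y + n) := by field_simp; ring
      have h4 : (1 : ℝ) / 2 ≤ 1 + k * -((n : ℝ) / (Y + n)) := by
        have : (k : ℝ) * (n / (Y + n)) ≤ 1 / 2 := by
          rw [mul_div_assoc', div_le_div_iff₀ h0 (by norm_num)]; nlinarith
        linarith
      rw [h3, div_pow] at h2
      have h5 := h4.trans h2
      rw [div_le_div_iff₀ (by norm_num) (by positivity)] at h5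
      linarith
    calc |fallMoment b e j| ≤ Z * Y ^ (j - k) * ((Y + n) ^ k - Y ^ k) := hfin
      _ ≤ Z * Y ^ (j - k) * Y ^ k := by gcongr; linarith
      _ = Z * Y ^ j := by rw [mul_assoc, ← pow_add, Nat.sub_add_cancel hjk]

/-- On a disk of small radius the Taylor coefficients from the `k`-th on decay geometrically. -/
theorem Nomial.abs_diskCoeff_tail {n k : ℕ} {τ : ℝ} (f : Nomial n k τ) {c ρ A : ℝ} (hρ : 0 < ρ)
    (hs : ρ * (n : ℝ) ^ 16 ≤ c) (hA : ∀ u < k, |diskCoeff f.poly c ρ u| ≤ A) {j : ℕ}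
    (hj : k ≤ j) : |diskCoeff f.poly c ρ j| ≤ A * (1 / 2 ^ 12) ^ (j - k + 1) := by
  have hk2 := f.two_le
  have hn1 := f.one_le
  have hkn := f.le_succ
  have hA0 : 0 ≤ A := (abs_nonneg _).trans (hA 0 (by omega))
  have hn' : (1 : ℝ) ≤ n := by exact_mod_cast hn1
  have hc : 0 < c := lt_of_lt_of_le (by positivity) hs
  rcases Nat.lt_or_ge n 2 with hn2 | hn2
  -- Here `n = 1`, and `j ≥ k ≥ 2` exceeds the degree. The estimate of `η` below needs `n ≥ 2`.
  · have : diskCoeff f.poly c ρ j = 0 := by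
      rw [f.diskCoeff_eq, Nomial.gsum, Finset.sum_eq_zero, zero_mul]
      intro t _
      have h1 := f.expo_le t
      simp only [id]
      rw [prod_sub_eq_zero_of_lt (by omega)]; simp
    rw [this, abs_zero]; positivity
  set b : Fin k → ℝ := fun t => f.coef t * c ^ f.expo t
  have hmom : ∀ v, diskCoeff f.poly c ρ v =
      fallMoment b f.expo v * ((ρ / c) ^ v / v.factorial) := by
    intro v
    rw [f.diskCoeff_eq, ← f.gsum_mul_pow, div_pow]
    field_simp
  set Y : ℝ := 2 * k * n with hYd
  have hYpos : 0 < Y := by positivity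
  set η : ℝ := Y * (ρ / c) with hη
  have hηpos : 0 < η := by positivity
  -- From `k ≤ 2n` one has `Y ≤ 4n²`, so `η ≤ 4 / n ^ 14`: this is where the separation `n ^ 16` is
  -- used.
  have hη1 : η ≤ 1 / 2 ^ 12 := by
    have h1 : (k : ℝ) ≤ 2 * n := by
      have : k ≤ 2 * n := by omega
      exact_mod_cast this
    have h2 : (2 : ℝ) ^ 14 ≤ (n : ℝ) ^ 14 := by
      have : (2 : ℝ) ≤ n := by exact_mod_cast hn2
      gcongr
    have h3 : Y ≤ 4 * (n : ℝ) ^ 2 := by rw [hYd]; nlinarith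
    have h4 : ρ / c ≤ 1 / (n : ℝ) ^ 16 := by
      rw [div_le_div_iff₀ hc (by positivity)]; linarith
    calc η ≤ 4 * (n : ℝ) ^ 2 * (1 / (n : ℝ) ^ 16) := by rw [hη]; gcongr
      _ = 4 / (n : ℝ) ^ 14 := by field_simp
      _ ≤ 4 / 2 ^ 14 := by gcongr
      _ = 1 / 2 ^ 12 := by norm_num
  have hη1' : η ≤ 1 := hη1.trans (by norm_num)
  -- In terms of `η` the bound on the `v`-th coefficient bounds the `v`-th moment by `A v! / η ^ v *
  -- Y ^ v`; since `η ≤ 1` the worst case is `v = k - 1`.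
  set Z : ℝ := A * (k - 1).factorial / η ^ (k - 1) with hZd
  have hZ0 : 0 ≤ Z := by positivity
  have hbase : ∀ v < k, |fallMoment b f.expo v| ≤ Z * Y ^ v := by
    intro v hv
    have h1 := hA v hv
    rw [hmom, abs_mul, abs_of_pos (by positivity : 0 < (ρ / c) ^ v / (v.factorial : ℝ))] at h1
    have h2 : (ρ / c) ^ v = η ^ v / Y ^ v := by rw [hη, mul_pow]; field_simp
    rw [h2] at h1
    have h3 : |fallMoment b f.expo v| ≤ A * v.factorial / η ^ v * Y ^ v := by
      have h5 : |fallMoment b f.expo v| = |fallMoment b f.expo v| *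
        (η ^ v / Y ^ v / v.factorial) * (v.factorial / η ^ v * Y ^ v) := by field_simp
      rw [h5]
      calc _ ≤ A * (v.factorial / η ^ v * Y ^ v) := by gcongr
        _ = _ := by ring
    refine h3.trans ?_
    rw [hZd]
    have h4 : (v.factorial : ℝ) ≤ (k - 1).factorial := by
      exact_mod_cast Nat.factorial_le (by omega)
    have h5 : η ^ (k - 1) ≤ η ^ v := pow_le_pow_of_le_one hηpos.le hη1' (by omega)
    gcongr
  have hall := abs_fallMoment_le (by omega) (by omega) b f.expo f.expo_le Y Z le_rfl hZ0 hbase j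
  rw [hmom, abs_mul, abs_of_pos (by positivity : 0 < (ρ / c) ^ j / (j.factorial : ℝ))]
  calc |fallMoment b f.expo j| * ((ρ / c) ^ j / j.factorial)
      ≤ Z * Y ^ j * ((ρ / c) ^ j / j.factorial) := by gcongr
    _ = Z * η ^ j / j.factorial := by rw [hη, mul_pow]; ring
    _ = A * ((k - 1).factorial / j.factorial) * η ^ (j - k + 1) := by
        have : η ^ j = η ^ (k - 1) * η ^ (j - k + 1) := by rw [← pow_add]; congr 1; omega
        rw [hZd, this]; field_simp
    _ ≤ A * 1 * (1 / 2 ^ 12) ^ (j - k + 1) := by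
        have : ((k - 1).factorial : ℝ) / j.factorial ≤ 1 := by
          rw [div_le_one (by positivity)]
          exact_mod_cast Nat.factorial_le (by omega)
        gcongr
    _ = _ := by ring

/-- A geometric series of ratio `2 ^ (-12)` whose first term is at most `A / 2 ^ 12`. The induction
carries the explicit remainder so that it closes. -/
theorem Nomial.sum_diskCoeff_tail {n k : ℕ} {τ : ℝ} (f : Nomial n k τ) {c ρ A : ℝ} (hρ : 0 < ρ)
    (hs : ρ * (n : ℝ) ^ 16 ≤ c) (hA : ∀ u < k, |diskCoeff f.poly c ρ u| ≤ A) {a b : ℕ}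
    (hj : k ≤ a) : ∑ j ∈ Finset.Ico a b, |diskCoeff f.poly c ρ j| ≤ A / 2 ^ 11 := by
  have hA0 : 0 ≤ A := (abs_nonneg _).trans (hA 0 (by have := f.two_le; omega))
  have key : ∀ b, ∑ j ∈ Finset.Ico a b, |diskCoeff f.poly c ρ j| ≤
      A / 2 ^ 11 - A / 2 ^ 11 * (1 / 2 ^ 12) ^ (b - a) := by
    intro b
    induction b with
    | zero => simp
    | succ b ih =>
      rcases lt_or_ge b a with h | h
      · rw [Finset.Ico_eq_empty (by omega), Nat.sub_eq_zero_of_le (by omega)]; simp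
      · rw [Finset.sum_Ico_succ_top h]
        have h1 := f.abs_diskCoeff_tail hρ hs hA (hj.trans h)
        have h2 : ((1 : ℝ) / 2 ^ 12) ^ (b - k + 1) ≤ (1 / 2 ^ 12) ^ (b - a + 1) :=
          pow_le_pow_of_le_one (by norm_num) (by norm_num) (by omega)
        have h3 := h1.trans (mul_le_mul_of_nonneg_left h2 hA0)
        rw [show b + 1 - a = b - a + 1 by omega]
        rw [pow_succ (1 / 2 ^ 12 : ℝ)] at h3 ⊢
        have h4 : 0 ≤ A * (1 / 2 ^ 12 : ℝ) ^ (b - a) := by positivity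
        linarith
  have := key b
  have h4 : 0 ≤ A / 2 ^ 11 * (1 / 2 ^ 12 : ℝ) ^ (b - a) := by positivity
  linarith

/-! ### A radius at which one coefficient dominates -/

/-- The distance weight `8 ^ (-|u - l|)`, zero at `u = l`. -/
theorem sum_dist_weight_le (K l : ℕ) :
    ∑ u ∈ (Finset.range K).erase l, (1 / 8 : ℝ) ^ ((u - l) + (l - u)) ≤ 2 / 7 := by
  set w : ℕ → ℝ := fun u => if u = l then 0 else (1 / 8 : ℝ) ^ ((u - l) + (l - u)) with hw
  have h0 : ∑ u ∈ (Finset.range K).erase l, (1 / 8 : ℝ) ^ ((u - l) + (l - u)) =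
      ∑ u ∈ Finset.range K, w u := by
    rw [← Finset.sum_erase (Finset.range K) (a := l) (f := w) (by simp [hw])]
    refine Finset.sum_congr rfl fun u hu => ?_
    rw [hw]; simp [Finset.ne_of_mem_erase hu]
  rw [h0]
  -- The two sides of `l` are separate geometric series, each of total at most `1/7`; the bounds
  -- keep the remainders to make the inductions work.
  have h1 : ∀ K ≤ l, ∑ u ∈ Finset.range K, w u ≤ (1 / 8) ^ (l - K) / 7 := by
    intro K
    induction K with
    | zero => intro _; rw [Finset.sum_range_zero]; positivity
    | succ K ih =>
      intro hK
      rw [Finset.sum_range_succ]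
      have h2 := ih (by omega)
      have h3 : w K = (1 / 8) ^ (l - K) := by
        rw [hw]; dsimp only
        rw [if_neg (by omega), show K - l = 0 by omega, zero_add]
      rw [h3]
      obtain ⟨d, rfl⟩ := Nat.exists_eq_add_of_le hK
      rw [show K + 1 + d - K = d + 1 by omega, pow_succ] at h2
      rw [show K + 1 + d - K = d + 1 by omega, show K + 1 + d - (K + 1) = d by omega, pow_succ]
      linarith
  rcases le_or_gt K l with h | h
  · refine (h1 K h).trans ?_
    have : ((1 : ℝ) / 8) ^ (l - K) ≤ 1 := pow_le_one₀ (by norm_num) (by norm_num)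
    linarith
  · have h2 : ∀ d, ∑ u ∈ Finset.range (l + 1 + d), w u ≤ 2 / 7 - (1 / 8) ^ d / 7 := by
      intro d
      induction d with
      | zero =>
        rw [add_zero, Finset.sum_range_succ]
        have := h1 l le_rfl
        have h3 : w l = 0 := by simp [hw]
        rw [h3]; simp at this ⊢; linarith
      | succ d ih =>
        rw [← add_assoc, Finset.sum_range_succ]
        have h3 : w (l + 1 + d) = (1 / 8) ^ (d + 1) := by
          rw [hw]; dsimp only
          rw [if_neg (by omega)]; congr 1; omega
        rw [h3, pow_succ]
        linarith
    obtain ⟨d, rfl⟩ := Nat.exists_eq_add_of_lt h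
    have := h2 d
    have h3 : (0 : ℝ) ≤ (1 / 8) ^ d := by positivity
    rw [show l + d + 1 = l + 1 + d by ring]
    linarith

/-- Among `k` well separated scales there is one at which one of `k` monomials dominates. -/
theorem exists_dominant_scale {k : ℕ} (α : ℕ → ℝ) (hpos : ∃ u < k, 0 < α u)
    (Λ : ℝ) (hΛ : 64 < Λ) :
    ∃ i < k, ∃ l < k, 0 < α l ∧ ∀ u < k,
      α u * (Λ ^ i) ^ u ≤ α l * (Λ ^ i) ^ l * (1 / 8) ^ ((u - l) + (l - u)) := by
  obtain ⟨u₀, hu₀, hu₀'⟩ := hpos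
  have hΛ0 : 0 < Λ := by linarith
  have hmax : ∀ ρ : ℝ, ∃ l, 0 < ρ → l < k ∧ 0 < α l ∧ ∀ u < k, α u * ρ ^ u ≤ α l * ρ ^ l := by
    intro ρ
    obtain ⟨l, hl, hl'⟩ := Finset.exists_max_image (Finset.range k) (fun u => α u * ρ ^ u)
      ⟨u₀, Finset.mem_range.mpr hu₀⟩
    refine ⟨l, fun hρ => ⟨Finset.mem_range.1 hl, ?_,
      fun u hu => hl' u (Finset.mem_range.mpr hu)⟩⟩
    have h1 := hl' u₀ (Finset.mem_range.mpr hu₀)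
    have h2 : 0 < α u₀ * ρ ^ u₀ := by positivity
    exact pos_of_mul_pos_left (lt_of_lt_of_le h2 h1) (by positivity)
  choose L hL using hmax
  -- If a smaller index were maximal at the larger radius, comparing the two monomials at both radii
  -- would give opposite inequalities for their growth.
  have hmono : ∀ ρ ρ' : ℝ, 0 < ρ → ρ < ρ' → L ρ ≤ L ρ' := by
    intro ρ ρ' h0 h1
    by_contra hlt
    push Not at hlt
    obtain ⟨a1, a2, a3⟩ := hL ρ h0
    obtain ⟨b1, b2, b3⟩ := hL ρ' (h0.trans h1)
    have c1 := a3 _ b1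
    have c2 := b3 _ a1
    obtain ⟨d, hd⟩ := Nat.exists_eq_add_of_lt hlt
    rw [hd] at c1 c2 a2
    set p := L ρ'
    have hρ' := h0.trans h1
    rw [add_assoc, pow_add, ← mul_assoc, mul_right_comm] at c1 c2
    have e1 : α p ≤ α (p + (d + 1)) * ρ ^ (d + 1) :=
      le_of_mul_le_mul_right c1 (by positivity)
    have e2 : α (p + (d + 1)) * ρ' ^ (d + 1) ≤ α p :=
      le_of_mul_le_mul_right c2 (by positivity)
    have e3 : ρ ^ (d + 1) < ρ' ^ (d + 1) := pow_lt_pow_left₀ h1 h0.le (by omega)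
    have e4 := mul_lt_mul_of_pos_left e3 a2
    rw [add_assoc] at e4
    linarith
  -- The windows `[Λ^i / 8, 8 Λ^i]` are disjoint because `Λ > 64`. If the maximal index jumped in
  -- each of the `k` windows it would reach `k`.
  have hkey : ∃ i < k, L (Λ ^ i / 8) = L (Λ ^ i * 8) := by
    by_contra hno
    push Not at hno
    have hlt : ∀ i < k, L (Λ ^ i / 8) + 1 ≤ L (Λ ^ i * 8) := by
      intro i hi
      have h1 : Λ ^ i / 8 < Λ ^ i * 8 := by
        have : 0 < Λ ^ i := by positivity
        linarith
      have := hmono _ _ (by positivity) h1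
      have := hno i hi
      omega
    have : ∀ i < k, i + 1 ≤ L (Λ ^ i * 8) := by
      intro i
      induction i with
      | zero => intro hi; have := hlt 0 hi; omega
      | succ i ih =>
        intro hi
        have h1 := ih (by omega)
        have h2 := hlt (i + 1) hi
        have h3 : Λ ^ i * 8 < Λ ^ (i + 1) / 8 := by
          have : 0 < Λ ^ i := by positivity
          rw [pow_succ]; nlinarith
        have := hmono _ _ (by positivity) h3
        omega
    have hk : 0 < k := by omega
    have h1 := this (k - 1) (by omega)
    have h2 := (hL (Λ ^ (k - 1) * 8) (by positivity)).1
    omega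
  obtain ⟨i, hi, hLi⟩ := hkey
  obtain ⟨a1, a2, a3⟩ := hL (Λ ^ i / 8) (by positivity)
  obtain ⟨b1, b2, b3⟩ := hL (Λ ^ i * 8) (by positivity)
  rw [← hLi] at b3
  set l := L (Λ ^ i / 8)
  refine ⟨i, hi, l, a1, a2, fun u hu => ?_⟩
  -- Maximality of `l` at the left end of the window yields the factor `8 ^ (-|u - l|)` for `u ≤ l`,
  -- at the right end for `u ≥ l`.
  rcases le_total u l with h | h
  · have h1 := a3 u hu
    obtain ⟨d, hd⟩ := Nat.exists_eq_add_of_le h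
    rw [show u - l + (l - u) = d by omega]
    rw [hd] at h1 ⊢
    rw [div_pow, div_pow, pow_add 8, pow_add] at h1
    rw [pow_add, one_div, inv_pow]
    have h8 : (0 : ℝ) < 8 ^ u := by positivity
    have h8' : (0 : ℝ) < 8 ^ d := by positivity
    field_simp at h1 ⊢
    linarith
  · have h1 := b3 u hu
    obtain ⟨d, hd⟩ := Nat.exists_eq_add_of_le h
    rw [show u - l + (l - u) = d by omega]
    rw [hd] at h1 ⊢
    rw [mul_pow, mul_pow, pow_add 8] at h1
    rw [one_div, inv_pow]
    have h8 : (0 : ℝ) < 8 ^ l := by positivity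
    have h8' : (0 : ℝ) < 8 ^ d := by positivity
    have h2 : α (l + d) * (Λ ^ i) ^ (l + d) * 8 ^ d ≤ α l * (Λ ^ i) ^ l := by
      refine le_of_mul_le_mul_right ?_ h8
      linarith
    rw [← div_eq_mul_inv, le_div_iff₀ h8']
    exact h2

/-! ### Correctness of every run -/

theorem Nomial.coef_ne_zero {n k : ℕ} {τ : ℝ} (f : Nomial n k τ) (t : Fin k) : f.coef t ≠ 0 := by
  have h1 := f.le_abs_coef t
  have h2 : (0 : ℝ) < 2 ^ (-τ) := by positivity
  exact abs_pos.1 (h2.trans_le h1)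

theorem Nomial.poly_ne_zero {n k : ℕ} {τ : ℝ} (f : Nomial n k τ) : f.poly ≠ 0 := by
  intro h
  have ht : 0 < k := by have := f.two_le; omega
  have h1 : f.poly.coeff (f.expo ⟨0, ht⟩) = f.coef ⟨0, ht⟩ := by
    rw [Nomial.poly, finsetSum_coeff, Finset.sum_eq_single ⟨0, ht⟩]
    · simp
    · intro b _ hb
      rw [coeff_C_mul_X_pow, if_neg]
      exact fun h => hb (f.expo_strictMono.injective h).symm
    · simp
  rw [h, coeff_zero] at h1
  exact f.coef_ne_zero _ h1.symm

theorem Nomial.natDegree_poly_le {n k : ℕ} {τ : ℝ} (f : Nomial n k τ) : f.poly.natDegree ≤ n :=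
  natDegree_sum_le_of_forall_le _ _ fun t _ =>
    (natDegree_C_mul_X_pow_le _ _).trans (f.expo_le t)

/-- If the first `k` coefficients vanished, the tail bound with `A = 0` would kill all others, and
undoing the substitution would give `f = 0`. -/
theorem Nomial.exists_diskCoeff_pos {n k : ℕ} {τ : ℝ} (f : Nomial n k τ) {c ρ : ℝ} (hρ : 0 < ρ)
    (hs : ρ * (n : ℝ) ^ 16 ≤ c) : ∃ u < k, 0 < |diskCoeff f.poly c ρ u| := by
  by_contra hno
  push Not at hno
  have hall : ∀ j, diskCoeff f.poly c ρ j = 0 := by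
    intro j
    rcases lt_or_ge j k with h | h
    · exact abs_eq_zero.1 (le_antisymm (hno j h) (abs_nonneg _))
    · have := f.abs_diskCoeff_tail hρ hs hno h
      rw [zero_mul] at this
      exact abs_eq_zero.1 (le_antisymm this (abs_nonneg _))
  have h0 : f.poly.comp (C c + C ρ * X) = 0 := by
    ext j; rw [coeff_zero]; exact hall j
  have h1 : (f.poly.comp (C c + C ρ * X)).comp (C ρ⁻¹ * (X - C c)) = f.poly := by
    rw [comp_assoc]
    have : (C c + C ρ * X : ℝ[X]).comp (C ρ⁻¹ * (X - C c)) = X := by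
      simp only [add_comp, C_comp, mul_comp, X_comp]
      rw [← mul_assoc, ← C_mul, mul_inv_cancel₀ hρ.ne']
      simp
    rw [this, comp_X]
  rw [h0, zero_comp] at h1
  exact f.poly_ne_zero h1.symm

theorem candidate_mem {k : ℕ} (hk : 0 < k) {m r : ℝ} (hr : 0 < r) {j : ℕ} (hj : j ≤ 2 * k ^ 2) :
    m - r ≤ candidate k m r j ∧ candidate k m r j ≤ m + r := by
  have hk' : (0 : ℝ) < (k : ℝ) ^ 2 := by positivity
  have hj' : (j : ℝ) ≤ 2 * (k : ℝ) ^ 2 := by exact_mod_cast hj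
  have hj0 : (0 : ℝ) ≤ j := by positivity
  have h1 : ((j : ℝ) - (k : ℝ) ^ 2) * (r / (k : ℝ) ^ 2) = (j / (k : ℝ) ^ 2 - 1) * r := by
    field_simp
  have h2 : (j : ℝ) / (k : ℝ) ^ 2 ≤ 2 := by rw [div_le_iff₀ hk']; exact hj'
  have h3 : 0 ≤ (j : ℝ) / (k : ℝ) ^ 2 := by positivity
  rw [candidate, multipointAt]
  push_cast
  rw [h1]
  constructor <;> nlinarith

theorem testRadius_pos {n : ℕ} (hn : 0 < n) {r : ℝ} (hr : 0 < r) (i : ℕ) :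
    0 < testRadius n r i := by
  rw [testRadius]; positivity

theorem one_le_spread {n : ℕ} (hn : 0 < n) : (1 : ℝ) ≤ 256 * (n : ℝ) ^ 5 := by
  have : (1 : ℝ) ≤ (n : ℝ) ^ 5 := one_le_pow₀ (by exact_mod_cast hn)
  linarith

theorem testRadius_le {n k : ℕ} (hn : 0 < n) {r : ℝ} (hr : 0 < r) {i : ℕ} (hi : i ≤ k) :
    testRadius n r i ≤ 2 ^ (8 * k + 5) * (n : ℝ) ^ (5 * k + 1) * r := by
  have h1 : (256 * (n : ℝ) ^ 5) ^ i ≤ (256 * (n : ℝ) ^ 5) ^ k :=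
    pow_le_pow_right₀ (one_le_spread hn) hi
  have h2 : 16 * (n : ℝ) * (256 * (n : ℝ) ^ 5) ^ k * (2 * r) =
      2 ^ (8 * k + 5) * (n : ℝ) ^ (5 * k + 1) * r := by
    rw [mul_pow, ← pow_mul, show (256 : ℝ) = 2 ^ 8 by norm_num, ← pow_mul]; ring
  rw [testRadius, ← h2]
  gcongr

/-- Explains the shape of `R`: the term `2 R n r` equals `n ^ 16` times the bound for the last
radius, so every tested disk satisfies the separation required by the tail estimate. -/
theorem testRadius_mul_le {n k : ℕ} (hn : 0 < n) {m r c : ℝ} (hr : 0 < r)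
    (hm : r + 2 * blowup n k * n * r ≤ m) (hc : m - r ≤ c) {i : ℕ} (hi : i ≤ k) :
    testRadius n r i * (n : ℝ) ^ 16 ≤ c := by
  have h1 := testRadius_le hn hr hi
  have h2 : 2 * blowup n k * n * r =
      2 ^ (8 * k + 5) * (n : ℝ) ^ (5 * k + 1) * r * (n : ℝ) ^ 16 := by
    rw [blowup]; ring
  calc testRadius n r i * (n : ℝ) ^ 16
      ≤ 2 ^ (8 * k + 5) * (n : ℝ) ^ (5 * k + 1) * r * (n : ℝ) ^ 16 := by gcongr
    _ ≤ c := by rw [← h2]; linarith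

/-- The strict inequality matters: for `n = 1` and `i = k` the radius is twice the bound. The first
success must therefore come before the last radius. -/
theorem testRadius_le_blowup {n k : ℕ} (hn : 0 < n) {r : ℝ} (hr : 0 < r) {i : ℕ} (hi : i < k) :
    testRadius n r i ≤ blowup n k * r := by
  obtain ⟨k, rfl⟩ : ∃ k', k = k' + 1 := ⟨k - 1, by omega⟩
  refine (testRadius_le (k := k) hn hr (by omega)).trans ?_
  rw [blowup]
  have hn' : (1 : ℝ) ≤ n := by exact_mod_cast hn
  have h1 : (2 : ℝ) ^ (8 * k + 5) ≤ 2 ^ (8 * (k + 1) + 4) :=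
    pow_le_pow_right₀ (by norm_num) (by omega)
  have h2 : (n : ℝ) ^ (5 * k + 1) ≤ (n : ℝ) ^ (5 * (k + 1) + 16) :=
    pow_le_pow_right₀ hn' (by omega)
  gcongr

/-- Puts the coefficients at all radii into the form required by `exists_dominant_scale`, with `Λ =
256 n ^ 5`. -/
theorem diskCoeff_testRadius (p : ℝ[X]) (n : ℕ) (c r : ℝ) (i u : ℕ) :
    diskCoeff p c (testRadius n r i) u =
      diskCoeff p c (testRadius n r 0) u * ((256 * (n : ℝ) ^ 5) ^ i) ^ u := by
  have h : ∀ ρ : ℝ, diskCoeff p c ρ u = (p.comp (X + C c)).coeff u * ρ ^ u := by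
    intro ρ
    have hX : (C c + C ρ * X : ℝ[X]) = (X + C c).comp (C ρ * X) := by simp [add_comm]
    rw [diskCoeff, hX, ← comp_assoc, comp_C_mul_X_coeff]
  rw [h, h, mul_assoc, ← mul_pow]
  congr 2
  rw [testRadius, testRadius]; ring

/-- A positive test answer certifies the number of roots. -/
theorem Nomial.rootCount_of_yes {n k : ℕ} {τ : ℝ} (f : Nomial n k τ) {c ρ : ℝ} (hρ : 0 < ρ)
    (hs : ρ * (n : ℝ) ^ 16 ≤ c) {l : ℕ} (hl : l ≤ k)
    (h : TestAnswer f.poly k c ρ l .yes) : rootCount f.poly c ρ = l := by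
  have hk := f.two_le
  have hkk : k ≤ k ^ 2 := Nat.le_self_pow (by norm_num) k
  simp only [TestAnswer, SoftAnswer] at h
  set a := fun i => |diskCoeff f.poly c ρ i| with ha
  set S := ∑ i ∈ (Finset.range (k ^ 2 + 1)).erase l, a i with hS
  change 65 / 64 * S < a l at h
  have ha0 : ∀ i, 0 ≤ a i := fun i => abs_nonneg _
  have hS0 : 0 ≤ S := Finset.sum_nonneg fun i _ => ha0 i
  have hA : ∀ u < k, a u ≤ a l := by
    intro u hu
    rcases eq_or_ne u l with rfl | hne
    · exact le_rfl
    · have : a u ≤ S := Finset.single_le_sum (f := a) (fun i _ => ha0 i)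
        (Finset.mem_erase.mpr ⟨hne, Finset.mem_range.mpr (by omega)⟩)
      linarith
  -- The range up to `n + k ^ 2` covers the full Taylor expansion and the truncated sum at once.
  refine rootCount_eq_of_dominant f.poly c ρ hρ (n + k ^ 2) l
    (f.natDegree_poly_le.trans (by omega)) (by omega) ?_
  have ht := f.sum_diskCoeff_tail hρ hs hA (a := k ^ 2 + 1) (b := n + k ^ 2 + 1) (by omega)
  have hsplit : ∑ i ∈ (Finset.range (n + k ^ 2 + 1)).erase l, a i =
      S + ∑ i ∈ Finset.Ico (k ^ 2 + 1) (n + k ^ 2 + 1), a i := by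
    have h1 := Finset.sum_range_add_sum_Ico a (show k ^ 2 + 1 ≤ n + k ^ 2 + 1 by omega)
    have h2 := Finset.add_sum_erase (Finset.range (n + k ^ 2 + 1)) a
      (Finset.mem_range.mpr (show l < n + k ^ 2 + 1 by omega))
    have h3 := Finset.add_sum_erase (Finset.range (k ^ 2 + 1)) a
      (Finset.mem_range.mpr (show l < k ^ 2 + 1 by omega))
    linarith
  change ∑ i ∈ (Finset.range (n + k ^ 2 + 1)).erase l, a i < a l
  change ∑ i ∈ Finset.Ico (k ^ 2 + 1) (n + k ^ 2 + 1), a i ≤ _ at ht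
  have hal : 0 < a l := by linarith
  rw [hsplit]
  -- The factor `65/64` leaves a slack of at least `a l / 65`, which exceeds the discarded tail.
  have : a l / 2 ^ 11 < a l / 1024 := by norm_num; linarith
  linarith

/-- The sum in the truncated test differs little from the sum over the first `k + 1` terms. -/
theorem Nomial.testSum_le {n k : ℕ} {τ : ℝ} (f : Nomial n k τ) {c ρ A : ℝ} (hρ : 0 < ρ)
    (hs : ρ * (n : ℝ) ^ 16 ≤ c) (hA : ∀ u < k, |diskCoeff f.poly c ρ u| ≤ A) {b l : ℕ}
    (hb : k ≤ b) (hb' : b ≤ k ^ 2 + 1) :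
    ∑ i ∈ (Finset.range b).erase l, |diskCoeff f.poly c ρ i| ≤
      ∑ i ∈ (Finset.range (k ^ 2 + 1)).erase l, |diskCoeff f.poly c ρ i| ∧
    ∑ i ∈ (Finset.range (k ^ 2 + 1)).erase l, |diskCoeff f.poly c ρ i| ≤
      ∑ i ∈ (Finset.range b).erase l, |diskCoeff f.poly c ρ i| + A / 2 ^ 11 := by
  set a := fun i => |diskCoeff f.poly c ρ i| with ha
  have ha0 : ∀ i, 0 ≤ a i := fun i => abs_nonneg _
  have hsub : (Finset.range b).erase l ⊆ (Finset.range (k ^ 2 + 1)).erase l :=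
    Finset.erase_subset_erase _ (Finset.range_subset_range.mpr hb')
  refine ⟨Finset.sum_le_sum_of_subset_of_nonneg hsub fun i _ _ => ha0 i, ?_⟩
  have ht := f.sum_diskCoeff_tail hρ hs hA (a := b) (b := k ^ 2 + 1) hb
  rw [← Finset.sum_sdiff hsub, add_comm]
  gcongr
  refine le_trans (Finset.sum_le_sum_of_subset_of_nonneg ?_ fun i _ _ => ha0 i) ht
  intro i hi
  simp only [Finset.mem_sdiff, Finset.mem_erase, Finset.mem_range, Finset.mem_Ico, not_and,
    not_lt] at hi ⊢
  exact ⟨hi.2 hi.1.1, hi.1.2⟩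

/-- At one of the first `k` radii some test cannot fail. -/
theorem Nomial.exists_forced_yes {n k : ℕ} {τ : ℝ} (f : Nomial n k τ) {m r c : ℝ} (hr : 0 < r)
    (hm : r + 2 * blowup n k * n * r ≤ m) (hc : m - r ≤ c) :
    ∃ i < k, ∃ l < k, ∀ v, TestAnswer f.poly k c (testRadius n r i) l v → v = .yes := by
  have hk := f.two_le
  have hn := f.one_le
  have hkk : k ≤ k ^ 2 := Nat.le_self_pow (by norm_num) k
  have hΛ : (64 : ℝ) < 256 * (n : ℝ) ^ 5 := by
    have : (1 : ℝ) ≤ (n : ℝ) ^ 5 := one_le_pow₀ (by exact_mod_cast hn)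
    linarith
  obtain ⟨i, hi, l, hl, hpos, hdom⟩ := exists_dominant_scale
    (fun u => |diskCoeff f.poly c (testRadius n r 0) u|)
    (f.exists_diskCoeff_pos (testRadius_pos hn hr 0) (testRadius_mul_le hn hr hm hc (Nat.zero_le k)))
    (256 * (n : ℝ) ^ 5) hΛ
  have hΛ0 : (0 : ℝ) < 256 * (n : ℝ) ^ 5 := by linarith
  have habs : ∀ u, |diskCoeff f.poly c (testRadius n r 0) u| * ((256 * (n : ℝ) ^ 5) ^ i) ^ u =
      |diskCoeff f.poly c (testRadius n r i) u| := by
    intro u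
    rw [diskCoeff_testRadius f.poly n c r i u, abs_mul, abs_of_pos (a := (_ : ℝ) ^ u)
      (by positivity)]
  have hal : 0 < |diskCoeff f.poly c (testRadius n r i) l| := by
    rw [← habs]; positivity
  simp only [habs] at hdom
  refine ⟨i, hi, l, hl, fun v hv => ?_⟩
  set a := fun u => |diskCoeff f.poly c (testRadius n r i) u| with ha
  have hA : ∀ u < k, a u ≤ a l := by
    intro u hu
    refine (hdom u hu).trans (mul_le_of_le_one_right hal.le ?_)
    exact pow_le_one₀ (by norm_num) (by norm_num)
  have hsum := (f.testSum_le (testRadius_pos hn hr i) (testRadius_mul_le hn hr hm hc hi.le) hA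
    (b := k) (l := l) le_rfl (by omega)).2
  have hsum2 : ∑ u ∈ (Finset.range k).erase l, a u ≤ a l * (2 / 7) := by
    refine le_trans (Finset.sum_le_sum (g := fun u => a l * (1 / 8 : ℝ) ^ ((u - l) + (l - u)))
      fun u hu => hdom u (Finset.mem_range.1 (Finset.mem_of_mem_erase hu))) ?_
    rw [← Finset.mul_sum]
    have := sum_dist_weight_le k l
    gcongr
  rw [TestAnswer] at hv
  set S := ∑ i_1 ∈ (Finset.range (k ^ 2 + 1)).erase l, a i_1 with hS
  change SoftAnswer (1 / 128) (a l) (65 / 64 * S) v at hv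
  change S ≤ ∑ u ∈ (Finset.range k).erase l, a u + a l / 2 ^ 11 at hsum
  change 0 < a l at hal
  have h11 : a l / 2 ^ 11 ≤ a l / 1000 := by norm_num; linarith
  -- Since `65/64 * (2/7 + 1/1000)` is far below `128/129`, both other answers are illegitimate.
  cases v with
  | yes => rfl
  | no => simp only [SoftAnswer] at hv; linarith
  | undecided => simp only [SoftAnswer] at hv; norm_num at hv; linarith [hv.1]

theorem runOutput_eq_find (k : ℕ) (v : ℕ → ℕ → Verdict) : runOutput k v =
    (List.range (k + 1) ×ˢ List.range (k + 1)).find?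
      (fun p => decide (v p.1 p.2 = Verdict.yes)) := rfl

/-- Searching the pairs `(i, l)` in the order of the nested loops finds the first good one. -/
theorem runOutput_eq_some_iff {k : ℕ} {v : ℕ → ℕ → Verdict} {i l : ℕ} :
    runOutput k v = some (i, l) ↔ i ≤ k ∧ l ≤ k ∧ v i l = .yes ∧
      ∀ i' ≤ k, ∀ l' ≤ k, v i' l' = .yes → i < i' ∨ i = i' ∧ l ≤ l' := by
  -- The list of pairs is strictly increasing in the lexicographic order, so its first good entry is
  -- the least good one.
  have hsorted : ∀ (L₁ L₂ : List ℕ), L₁.Pairwise (· < ·) → L₂.Pairwise (· < ·) →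
      (L₁ ×ˢ L₂).Pairwise (fun p q => p.1 < q.1 ∨ p.1 = q.1 ∧ p.2 < q.2) := by
    intro L₁ L₂ h1 h2
    induction L₁ with
    | nil => simp
    | cons a L ih =>
      rw [List.product_cons, List.pairwise_append]
      rw [List.pairwise_cons] at h1
      refine ⟨?_, ih h1.2, ?_⟩
      · rw [List.pairwise_map]; exact h2.imp fun h => Or.inr ⟨rfl, h⟩
      · intro p hp q hq
        rw [List.mem_map] at hp
        obtain ⟨b, _, rfl⟩ := hp
        obtain ⟨q1, q2⟩ := q
        rw [List.mem_product] at hq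
        exact Or.inl (h1.1 _ hq.1)
  have hgen : ∀ (L : List (ℕ × ℕ)) (P : ℕ × ℕ → Bool),
      L.Pairwise (fun p q => p.1 < q.1 ∨ p.1 = q.1 ∧ p.2 < q.2) → ∀ x,
      (L.find? P = some x ↔ x ∈ L ∧ P x = true ∧
        ∀ y ∈ L, P y = true → x.1 < y.1 ∨ x.1 = y.1 ∧ x.2 ≤ y.2) := by
    intro L P hL x
    induction L with
    | nil => simp
    | cons a L ih =>
      rw [List.pairwise_cons] at hL
      have ih := ih hL.2
      rw [List.find?_cons]
      cases hPa : P a with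
      | true =>
        simp only [Option.some.injEq]
        constructor
        · rintro rfl
          refine ⟨by simp, hPa, fun y hy _ => ?_⟩
          rcases List.mem_cons.1 hy with rfl | hy
          · exact Or.inr ⟨rfl, le_rfl⟩
          · exact (hL.1 y hy).imp_right fun h => ⟨h.1, h.2.le⟩
        · rintro ⟨hx, _, hmin⟩
          have h1 := hmin a (by simp) hPa
          rcases List.mem_cons.1 hx with rfl | hx
          · rfl
          · have h2 := hL.1 x hx
            exfalso; omega
      | false =>
        simp only
        rw [ih]
        constructor
        · rintro ⟨h1, h2, h3⟩
          refine ⟨by simp [h1], h2, fun y hy hPy => ?_⟩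
          rcases List.mem_cons.1 hy with rfl | hy
          · rw [hPa] at hPy; cases hPy
          · exact h3 y hy hPy
        · rintro ⟨h1, h2, h3⟩
          refine ⟨?_, h2, fun y hy hPy => h3 y (by simp [hy]) hPy⟩
          rcases List.mem_cons.1 h1 with rfl | hy
          · rw [hPa] at h2; cases h2
          · exact hy
  rw [runOutput_eq_find, hgen _ _ (hsorted _ _ List.pairwise_lt_range List.pairwise_lt_range)]
  constructor
  · rintro ⟨h1, h2, h3⟩
    rw [List.mem_product, List.mem_range, List.mem_range] at h1
    refine ⟨by omega, by omega, by simpa using h2, fun i' hi' l' hl' hv => ?_⟩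
    exact h3 (i', l') (by rw [List.mem_product, List.mem_range, List.mem_range]; omega)
      (by simpa using hv)
  · rintro ⟨h1, h2, h3, h4⟩
    refine ⟨by rw [List.mem_product, List.mem_range, List.mem_range]; omega, by simpa using h3,
      ?_⟩
    rintro ⟨i', l'⟩ hy hv
    rw [List.mem_product, List.mem_range, List.mem_range] at hy
    exact h4 i' (by omega) l' (by omega) (by simpa using hv)

theorem exists_runOutput {k : ℕ} {v : ℕ → ℕ → Verdict} {i₀ l₀ : ℕ} (hi : i₀ ≤ k) (hl : l₀ ≤ k)
    (h : v i₀ l₀ = .yes) : ∃ i l, runOutput k v = some (i, l) := by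
  rcases hro : runOutput k v with _ | ⟨i, l⟩
  · rw [runOutput_eq_find, List.find?_eq_none] at hro
    exact absurd h (by simpa using hro (i₀, l₀) (by
      rw [List.mem_product, List.mem_range, List.mem_range]; omega))
  · exact ⟨i, l, rfl⟩

/-- A forced success at some `i₀ < k` puts the first success at a radius of index below `k`. This
gives termination and the bound on the radius; the number of roots comes from the certificate, and
the inclusion from the radius being at least `2 r`. -/
theorem run_correct (n k : ℕ) (τ : ℝ) (f : Nomial n k τ) (m r : ℝ) (hr : 0 < r)
    (hm : r + 2 * blowup n k * n * r ≤ m) (j : ℕ) (v : ℕ → ℕ → Verdict) (hrun : IsRun f m r j v) :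
    ∃ i l : ℕ, runOutput k v = some (i, l) ∧
      Metric.ball (m : ℂ) r ⊆ Metric.ball (candidate k m r j : ℂ) (testRadius n r i) ∧
      testRadius n r i ≤ blowup n k * r ∧
      m - r ≤ candidate k m r j ∧ candidate k m r j ≤ m + r ∧
      rootCount f.poly (candidate k m r j) (testRadius n r i) = l := by
  have hk := f.two_le
  have hn := f.one_le
  obtain ⟨hc1, hc2⟩ := candidate_mem (by omega) hr (m := m) hrun.index_le
  obtain ⟨i₀, hi₀, l₀, hl₀, hyes⟩ := f.exists_forced_yes hr hm hc1
  have hv₀ := hyes _ (hrun.answers i₀ hi₀.le l₀ hl₀.le)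
  obtain ⟨i, l, hil⟩ := exists_runOutput hi₀.le hl₀.le hv₀
  obtain ⟨hi, hl, hvil, hmin⟩ := runOutput_eq_some_iff.1 hil
  have hii : i < k := by
    have := hmin i₀ hi₀.le l₀ hl₀.le hv₀
    omega
  refine ⟨i, l, hil, ?_, testRadius_le_blowup hn hr hii, hc1, hc2, ?_⟩
  · refine Metric.ball_subset_ball' ?_
    have h1 : dist (m : ℂ) (candidate k m r j : ℂ) ≤ r := by
      rw [Complex.dist_eq, ← Complex.ofReal_sub, Complex.norm_real, Real.norm_eq_abs, abs_le]
      constructor <;> linarith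
    have h2 : 2 * r ≤ testRadius n r i := by
      have h3 : (1 : ℝ) ≤ (256 * (n : ℝ) ^ 5) ^ i := one_le_pow₀ (one_le_spread hn)
      have h4 : (1 : ℝ) ≤ n := by exact_mod_cast hn
      have h5 : (1 : ℝ) ≤ 16 * n * (256 * (n : ℝ) ^ 5) ^ i := by nlinarith
      rw [testRadius]; nlinarith
    linarith
  · have := hrun.answers i hi l hl
    rw [hvil] at this
    exact f.rootCount_of_yes (testRadius_pos hn hr i) (testRadius_mul_le hn hr hm hc1 hi) hl this

/-! ### Fractional derivatives -/

theorem natTrailingDegree_X_pow_mul' {q : ℝ[X]} (hq : q.coeff 0 ≠ 0) (d : ℕ) :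
    (X ^ d * q).natTrailingDegree = d := by
  have hq0 : q ≠ 0 := fun h => hq (by rw [h, coeff_zero])
  rw [mul_comm, natTrailingDegree_mul_X_pow hq0]
  have : q.natTrailingDegree = 0 := natTrailingDegree_eq_zero.2 (Or.inr hq)
  omega

theorem divX_iterate_X_pow_mul (q : ℝ[X]) (d : ℕ) : divX^[d] (X ^ d * q) = q := by
  induction d with
  | zero => simp
  | succ d ih =>
    rw [Function.iterate_succ_apply, pow_succ', mul_assoc]
    rw [show divX (X * (X ^ d * q)) = X ^ d * q by
      ext i; rw [coeff_divX, coeff_X_mul]]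
    exact ih

/-- The exponents, extended by zero. -/
def Nomial.expoN {n k : ℕ} {τ : ℝ} (f : Nomial n k τ) (s : ℕ) : ℕ :=
  if h : s < k then f.expo ⟨s, h⟩ else 0

theorem Nomial.expoN_coe {n k : ℕ} {τ : ℝ} (f : Nomial n k τ) (t : Fin k) :
    f.expoN t = f.expo t := by simp [Nomial.expoN]

theorem Nomial.expoN_le {n k : ℕ} {τ : ℝ} (f : Nomial n k τ) (s : ℕ) : f.expoN s ≤ n := by
  rw [Nomial.expoN]; split_ifs
  · exact f.expo_le _
  · omega

theorem Nomial.expoN_lt {n k : ℕ} {τ : ℝ} (f : Nomial n k τ) {s t : ℕ} (ht : t < k) (h : s < t) :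
    f.expoN s < f.expoN t := by
  rw [Nomial.expoN, Nomial.expoN, dif_pos (h.trans ht), dif_pos ht]
  exact f.expo_strictMono (by simpa using h)

/-- The coefficients of the fractional derivatives. -/
def Nomial.fracCoef {n k : ℕ} {τ : ℝ} (f : Nomial n k τ) (i : ℕ) (t : Fin k) : ℝ :=
  f.coef t * ∏ s ∈ Finset.range i, ((f.expo t : ℝ) - f.expoN s)

theorem Nomial.fracCoef_eq_zero {n k : ℕ} {τ : ℝ} (f : Nomial n k τ) {i : ℕ} {t : Fin k}
    (h : (t : ℕ) < i) : f.fracCoef i t = 0 := by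
  rw [Nomial.fracCoef, Finset.prod_eq_zero (Finset.mem_range.mpr h), mul_zero]
  rw [f.expoN_coe, sub_self]

theorem Nomial.one_le_prod {n k : ℕ} {τ : ℝ} (f : Nomial n k τ) (i : ℕ) (hi : i < k) :
    1 ≤ ∏ s ∈ Finset.range i, ((f.expo ⟨i, hi⟩ : ℝ) - f.expoN s) := by
  have : ∀ s ∈ Finset.range i, (1 : ℝ) ≤ (f.expo ⟨i, hi⟩ : ℝ) - f.expoN s := by
    intro s hs
    have h1 := f.expoN_lt hi (Finset.mem_range.1 hs)
    have h2 : f.expoN i = f.expo ⟨i, hi⟩ := f.expoN_coe ⟨i, hi⟩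
    rw [← h2]
    have h3 : (f.expoN s : ℝ) + 1 ≤ f.expoN i := by exact_mod_cast h1
    linarith
  calc (1 : ℝ) = ∏ s ∈ Finset.range i, (1 : ℝ) := by simp
    _ ≤ _ := Finset.prod_le_prod (fun _ _ => zero_le_one) this

/-- The `i`-th fractional derivative, written out. -/
def Nomial.fracPoly {n k : ℕ} {τ : ℝ} (f : Nomial n k τ) (i : ℕ) : ℝ[X] :=
  ∑ t, C (f.fracCoef i t) * X ^ (f.expo t - f.expoN i)

/-- Differentiation multiplies the term of index `t` by `e_t - e_i`. This removes the term of index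
`i`, and from all later ones the power of order `e_{i+1} - e_i - 1` can be split off. -/
theorem Nomial.derivative_fracPoly {n k : ℕ} {τ : ℝ} (f : Nomial n k τ) {i : ℕ} (hi : i + 1 < k) :
    derivative (f.fracPoly i) =
      X ^ (f.expoN (i + 1) - f.expoN i - 1) * f.fracPoly (i + 1) := by
  rw [Nomial.fracPoly, Nomial.fracPoly, derivative_sum, Finset.mul_sum]
  refine Finset.sum_congr rfl fun t _ => ?_
  rw [derivative_C_mul_X_pow]
  have hsucc : f.fracCoef (i + 1) t = f.fracCoef i t * ((f.expo t : ℝ) - f.expoN i) := by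
    rw [Nomial.fracCoef, Nomial.fracCoef, Finset.prod_range_succ]; ring
  rcases lt_trichotomy (t : ℕ) i with h | h | h
  · rw [hsucc, f.fracCoef_eq_zero h]; simp
  · have h1 : f.expo t = f.expoN i := by rw [← f.expoN_coe, h]
    rw [hsucc, h1]; simp
  · have h1 := f.expoN_lt t.2 h
    rw [f.expoN_coe] at h1
    have h2 : f.expoN (i + 1) ≤ f.expo t := by
      rcases eq_or_lt_of_le (Nat.succ_le_of_lt h) with h3 | h3
      · rw [← f.expoN_coe, ← h3]
      · have := f.expoN_lt t.2 h3
        rw [f.expoN_coe] at this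
        exact this.le
    have h3 := f.expoN_lt hi (Nat.lt_succ_self i)
    rw [hsucc, Nat.cast_sub h1.le]
    have h4 : f.expo t - f.expoN i - 1 =
      (f.expoN (i + 1) - f.expoN i - 1) + (f.expo t - f.expoN (i + 1)) := by omega
    rw [h4, pow_add]; ring

theorem Nomial.fracPoly_coeff_zero {n k : ℕ} {τ : ℝ} (f : Nomial n k τ) {i : ℕ} (hi : i < k) :
    (f.fracPoly i).coeff 0 ≠ 0 := by
  rw [Nomial.fracPoly, finsetSum_coeff, Finset.sum_eq_single ⟨i, hi⟩]
  · have h1 : f.expo ⟨i, hi⟩ = f.expoN i := (f.expoN_coe ⟨i, hi⟩).symm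
    rw [h1, Nat.sub_self, pow_zero, mul_one, coeff_C_zero, Nomial.fracCoef]
    refine mul_ne_zero (f.coef_ne_zero _) ?_
    have := f.one_le_prod i hi
    linarith
  · intro t _ ht
    rw [coeff_C_mul_X_pow]
    split_ifs with h
    · rcases lt_or_gt_of_ne (fun h => ht (Fin.ext h) : (t : ℕ) ≠ i) with h1 | h1
      · exact f.fracCoef_eq_zero h1
      · have := f.expoN_lt t.2 h1
        rw [f.expoN_coe] at this
        omega
    · rfl
  · simp

/-- The next explicit polynomial has a nonzero constant term, so the power split off in
`Nomial.derivative_fracPoly` is exactly the one that `fracDeriv` removes. -/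
theorem Nomial.fracDeriv_iterate {n k : ℕ} {τ : ℝ} (f : Nomial n k τ) :
    ∀ i < k, fracDeriv^[i] f.poly = f.fracPoly i := by
  intro i
  induction i with
  | zero =>
    intro h0
    rw [Function.iterate_zero, id, Nomial.poly, Nomial.fracPoly]
    refine Finset.sum_congr rfl fun t _ => ?_
    have : f.expoN 0 = 0 := by rw [Nomial.expoN, dif_pos h0]; exact f.expo_zero
    rw [this]; simp [Nomial.fracCoef]
  | succ i ih =>
    intro hi
    rw [Function.iterate_succ_apply', ih (by omega), fracDeriv, f.derivative_fracPoly hi,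
      natTrailingDegree_X_pow_mul' (f.fracPoly_coeff_zero hi), divX_iterate_X_pow_mul]

theorem Nomial.eval_fracPoly {n k : ℕ} {τ : ℝ} (f : Nomial n k τ) (i : ℕ) (x : ℝ) :
    (f.fracPoly i).eval x = f.gsum f.expoN i x := by
  rw [Nomial.fracPoly, eval_finsetSum, Nomial.gsum]
  refine Finset.sum_congr rfl fun t _ => ?_
  rw [eval_mul, eval_C, eval_pow, eval_X, Nomial.fracCoef]

theorem Nomial.minAbs_le {n k : ℕ} {τ : ℝ} (f : Nomial n k τ) (x : ℝ) {i : ℕ} (hi : i < k) :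
    f.minAbs x ≤ |f.gsum f.expoN i x| := by
  rw [← f.eval_fracPoly, ← f.fracDeriv_iterate i hi]
  exact ciInf_le (Set.finite_range _).bddBelow (⟨i, hi⟩ : Fin k)

theorem Nomial.le_minAbs {n k : ℕ} {τ : ℝ} (f : Nomial n k τ) (x : ℝ) {B : ℝ}
    (h : ∀ i < k, B ≤ |f.gsum f.expoN i x|) : B ≤ f.minAbs x := by
  have : Nonempty (Fin k) := ⟨⟨0, by have := f.two_le; omega⟩⟩
  refine le_ciInf fun i => ?_
  rw [f.fracDeriv_iterate i i.2, f.eval_fracPoly]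
  exact h i i.2

theorem Nomial.minAbs_nonneg {n k : ℕ} {τ : ℝ} (f : Nomial n k τ) (x : ℝ) : 0 ≤ f.minAbs x :=
  f.le_minAbs x fun _ _ => abs_nonneg _

/-! ### Positive roots of the fractional derivatives -/

/-- Removing the leading term destroys at most one sign variation, and a monomial has none. Together
with Descartes' rule this bounds the positive roots by the number of terms minus one. -/
theorem signVariations_lt_card_support : ∀ (c : ℕ) (P : ℝ[X]), P ≠ 0 → P.support.card = c →
    P.signVariations < c := by
  intro c
  induction c with
  | zero =>
    intro P hP h
    exact absurd (Polynomial.support_eq_empty.1 (Finset.card_eq_zero.1 h)) hP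
  | succ c ih =>
    intro P hP h
    have h1 := P.card_support_eraseLead' h
    rcases eq_or_ne P.eraseLead 0 with h0 | h0
    · have h2 := P.eraseLead_add_monomial_natDegree_leadingCoeff
      rw [h0, zero_add] at h2
      rw [← h2, signVariations_monomial]; omega
    · have := ih _ h0 h1
      have := signVariations_le_eraseLead_succ (P := P)
      omega

theorem Nomial.card_support_fracPoly {n k : ℕ} {τ : ℝ} (f : Nomial n k τ) (i : ℕ) :
    (f.fracPoly i).support.card ≤ k := by
  have : (f.fracPoly i).support ⊆ Finset.univ.image (fun t => f.expo t - f.expoN i) := by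
    intro d hd
    rw [mem_support_iff, Nomial.fracPoly, finsetSum_coeff] at hd
    obtain ⟨t, _, ht⟩ := Finset.exists_ne_zero_of_sum_ne_zero hd
    rw [coeff_C_mul_X_pow] at ht
    rw [Finset.mem_image]
    refine ⟨t, Finset.mem_univ _, ?_⟩
    by_contra hne
    exact ht (if_neg (fun h => hne h.symm))
  calc _ ≤ _ := Finset.card_le_card this
    _ ≤ _ := Finset.card_image_le
    _ = k := by simp

theorem Nomial.card_pos_roots {n k : ℕ} {τ : ℝ} (f : Nomial n k τ) {i : ℕ} (hi : i < k) :
    ((f.fracPoly i).roots.toFinset.filter (fun x => 0 < x)).card ≤ k - 1 := by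
  have h0 : f.fracPoly i ≠ 0 := fun h => f.fracPoly_coeff_zero hi (by rw [h, coeff_zero])
  have h1 := signVariations_lt_card_support _ _ h0 rfl
  have h2 := f.card_support_fracPoly i
  have h3 := roots_countP_pos_le_signVariations (P := f.fracPoly i)
  have h4 : ((f.fracPoly i).roots.toFinset.filter (fun x => 0 < x)).card ≤
      (f.fracPoly i).roots.countP (0 < ·) := by
    rw [Multiset.countP_eq_card_filter, ← Multiset.toFinset_filter]
    exact Multiset.toFinset_card_le _
  omega

/-- Some point of the multipoint has no root of a fractional derivative near it. -/
theorem Nomial.exists_root_free {n k : ℕ} {τ : ℝ} (f : Nomial n k τ) {m r : ℝ} (hr : 0 < r)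
    (hm : r < m) : ∃ j, 1 ≤ j ∧ j + 1 ≤ 2 * k ^ 2 ∧ ∀ i < k, ∀ y,
      |y - candidate k m r j| < r / k ^ 2 → (f.fracPoly i).eval y ≠ 0 := by
  classical
  have hk := f.two_le
  by_contra hno
  push Not at hno
  have hk0 : (0 : ℝ) < (k : ℝ) ^ 2 := by positivity
  set δ := r / (k : ℝ) ^ 2 with hδ
  have hδ0 : 0 < δ := by positivity
  -- Only odd indices are used: neighbouring points are then `2δ` apart, so the open intervals of
  -- radius `δ` are disjoint and lie to the right of `m - r > 0`.
  have hch : ∀ p : ℕ, ∃ y, p < k ^ 2 → |y - candidate k m r (2 * p + 1)| < δ ∧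
      ∃ i < k, (f.fracPoly i).eval y = 0 := by
    intro p
    by_cases hp : p < k ^ 2
    · obtain ⟨i, hi, y, hy, hy'⟩ := hno (2 * p + 1) (by omega) (by omega)
      exact ⟨y, fun _ => ⟨hy, i, hi, hy'⟩⟩
    · exact ⟨0, fun h => absurd h hp⟩
  choose Y hY using hch
  set S := (Finset.range k).biUnion
    (fun i => (f.fracPoly i).roots.toFinset.filter (fun x => 0 < x)) with hS
  have hScard : S.card ≤ k * (k - 1) := by
    refine (Finset.card_biUnion_le_card_mul _ _ (k - 1) fun i hi =>
      f.card_pos_roots (Finset.mem_range.1 hi)).trans ?_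
    simp
  have hcand : ∀ j, candidate k m r j = m + ((j : ℝ) - (k : ℝ) ^ 2) * δ := by
    intro j; rw [candidate, multipointAt]; push_cast; rfl
  have hmaps : ∀ p ∈ Finset.range (k ^ 2), Y p ∈ S := by
    intro p hp
    obtain ⟨h1, i, hi, h2⟩ := hY p (Finset.mem_range.1 hp)
    rw [hS, Finset.mem_biUnion]
    refine ⟨i, Finset.mem_range.mpr hi, ?_⟩
    rw [Finset.mem_filter, Multiset.mem_toFinset, mem_roots
      (fun h => f.fracPoly_coeff_zero hi (by rw [h, coeff_zero]))]
    refine ⟨h2, ?_⟩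
    rw [hcand, abs_lt] at h1
    have h3 : (k : ℝ) ^ 2 * δ = r := by rw [hδ]; field_simp
    have h4 : (0 : ℝ) ≤ (p : ℝ) * δ := by positivity
    push_cast at h1
    nlinarith [h1.1]
  -- Disjoint intervals make the chosen roots distinct: `k ^ 2` positive roots against at most `k (k
  -- - 1)`.
  have hinj : Set.InjOn Y (Finset.range (k ^ 2) : Set ℕ) := by
    intro p hp q hq hpq
    rw [Finset.mem_coe, Finset.mem_range] at hp hq
    have h1 := (hY p hp).1
    have h2 := (hY q hq).1
    rw [← hpq, hcand, abs_lt] at h2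
    rw [hcand, abs_lt] at h1
    push_cast at h1 h2
    have h3 : ((p : ℝ) - q) * δ < 1 * δ := by linarith [h1.1, h2.2]
    have h4 : ((q : ℝ) - p) * δ < 1 * δ := by linarith [h1.2, h2.1]
    have h5 := lt_of_mul_lt_mul_right h3 hδ0.le
    have h6 := lt_of_mul_lt_mul_right h4 hδ0.le
    have h7 : p < q + 1 := by exact_mod_cast (by linarith : (p : ℝ) < q + 1)
    have h8 : q < p + 1 := by exact_mod_cast (by linarith : (q : ℝ) < p + 1)
    omega
  have hcard := Finset.card_le_card_of_injOn Y hmaps hinj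
  rw [Finset.card_range] at hcard
  have : k * (k - 1) < k ^ 2 := by
    rw [pow_two]; exact Nat.mul_lt_mul_of_pos_left (by omega) (by omega)
  omega

/-! ### A lower bound for the best admissible value -/

/-- A polynomial without roots on an interval keeps its sign. -/
theorem mul_pos_of_root_free (p : ℝ[X]) {x δ : ℝ} (h : ∀ y, |y - x| < δ → p.eval y ≠ 0) {u v : ℝ}
    (hu : |u - x| < δ) (hv : |v - x| < δ) : 0 < p.eval u * p.eval v := by
  by_contra hno
  have hpre : IsPreconnected (Metric.ball x δ) := (convex_ball x δ).isPreconnected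
  have hmem : ∀ w, |w - x| < δ → w ∈ Metric.ball x δ := fun w hw => by
    rwa [Metric.mem_ball, Real.dist_eq]
  have hlt : p.eval u * p.eval v < 0 :=
    lt_of_le_of_ne (not_lt.1 hno) (mul_ne_zero (h u hu) (h v hv))
  have hex : ∃ w ∈ Metric.ball x δ, p.eval w = 0 := by
    rcases mul_neg_iff.1 hlt with ⟨h1, h2⟩ | ⟨h1, h2⟩
    · exact hpre.intermediate_value (hmem v hv) (hmem u hu) p.continuousOn ⟨h2.le, h1.le⟩
    · exact hpre.intermediate_value (hmem u hu) (hmem v hv) p.continuousOn ⟨h1.le, h2.le⟩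
  obtain ⟨w, hw, hw0⟩ := hex
  rw [Metric.mem_ball, Real.dist_eq] at hw
  exact h w hw hw0

/-- A function with large monotone derivative and constant sign is large. -/
theorem le_abs_of_derivative (p q : ℝ[X]) (d : ℕ) (hd : derivative p = X ^ d * q) {x δ y h η κ : ℝ}
    (hp : ∀ y, |y - x| < δ → p.eval y ≠ 0) (hq : ∀ y, |y - x| < δ → q.eval y ≠ 0)
    (hh : 0 < h) (hy : |y - x| + h < δ) (hη : 0 ≤ η)
    (hqη : ∀ z, |z - x| ≤ |y - x| + h → η ≤ |q.eval z|)
    (hz : ∀ z, |z - x| < δ → 0 < z ∧ κ ≤ z ^ d) : h * κ * η ≤ |p.eval y| := by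
  -- Stepping by `h` to either side changes `p` by at least `h κ η` in absolute value, and in the
  -- same direction along the axis, because `q` keeps its sign.
  obtain ⟨c₁, ⟨hc1, hc1'⟩, hc⟩ := exists_hasDerivAt_eq_slope (fun z => p.eval z)
    (fun z => (derivative p).eval z) (show y - h < y by linarith) p.continuousOn
    (fun z _ => p.hasDerivAt z)
  obtain ⟨c₂, ⟨hc2, hc2'⟩, hc'⟩ := exists_hasDerivAt_eq_slope (fun z => p.eval z)
    (fun z => (derivative p).eval z) (show y < y + h by linarith) p.continuousOn
    (fun z _ => p.hasDerivAt z)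
  have hyl := neg_abs_le (y - x)
  have hyr := le_abs_self (y - x)
  have near : ∀ z, y - h ≤ z → z ≤ y + h → |z - x| ≤ |y - x| + h := by
    intro z h1 h2
    rw [abs_le]; constructor <;> linarith
  have hn1 := near c₁ (by linarith) (by linarith)
  have hn2 := near c₂ (by linarith) (by linarith)
  have hny := near y (by linarith) (by linarith)
  have hnl := near (y - h) (by linarith) (by linarith)
  have hnr := near (y + h) (by linarith) (by linarith)
  have e1 : p.eval y - p.eval (y - h) = h * (c₁ ^ d * q.eval c₁) := by
    rw [hd, eval_mul, eval_pow, eval_X, sub_sub_cancel] at hc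
    rw [hc]; field_simp
  have e2 : p.eval (y + h) - p.eval y = h * (c₂ ^ d * q.eval c₂) := by
    rw [hd, eval_mul, eval_pow, eval_X, add_sub_cancel_left] at hc'
    rw [hc']; field_simp
  obtain ⟨k1, k1'⟩ := hz c₁ (by linarith)
  obtain ⟨k2, k2'⟩ := hz c₂ (by linarith)
  have s0 := mul_pos_of_root_free q hq (u := c₁) (v := c₂) (by linarith) (by linarith)
  have s1 := mul_pos_of_root_free p hp (u := y - h) (v := y) (by linarith) (by linarith)
  have s2 := mul_pos_of_root_free p hp (u := y + h) (v := y) (by linarith) (by linarith)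
  have g1 := hqη c₁ hn1
  have g2 := hqη c₂ hn2
  have b1 : h * κ * η ≤ h * (c₁ ^ d * |q.eval c₁|) := by
    rw [mul_assoc]; gcongr
  have b2 : h * κ * η ≤ h * (c₂ ^ d * |q.eval c₂|) := by
    rw [mul_assoc]; gcongr
  -- The values of `p` at `y - h`, `y`, `y + h` share a sign. On one of the two sides `p` moves
  -- towards zero without crossing it, so `|p(y)|` is at least the change on that side. The
  -- inconsistent sign patterns are discarded.
  rcases mul_pos_iff.1 s0 with ⟨q1, q2⟩ | ⟨q1, q2⟩ <;>
  rcases mul_pos_iff.1 s1 with ⟨p1, p2⟩ | ⟨p1, p2⟩ <;>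
  rcases mul_pos_iff.1 s2 with ⟨r1, r2⟩ | ⟨r1, r2⟩ <;>
  first
  | (exfalso; linarith)
  | (first
      | rw [abs_of_pos q1] at b1
      | rw [abs_of_neg q1] at b1
     first
      | rw [abs_of_pos q2] at b2
      | rw [abs_of_neg q2] at b2
     first
      | rw [abs_of_pos p2]
      | rw [abs_of_neg p2]
     linarith)

/-! ### Size of the coefficients and distortion of powers over the input interval. -/

theorem Nomial.one_le_height {n k : ℕ} {τ : ℝ} (f : Nomial n k τ) : (1 : ℝ) ≤ 2 ^ τ := by
  have h := (f.le_abs_coef ⟨0, by have := f.two_le; omega⟩).trans (f.abs_coef_le _)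
  rw [Real.rpow_neg (by norm_num)] at h
  have h0 : (0 : ℝ) < 2 ^ τ := by positivity
  by_contra hlt
  push Not at hlt
  have : (1 : ℝ) < (2 ^ τ)⁻¹ := (one_lt_inv₀ h0).2 hlt
  linarith

theorem abs_prod_sub_le {g : ℕ → ℕ} {N e : ℕ} (i : ℕ) (he : e ≤ N) (hg : ∀ s < i, g s ≤ N) :
    |∏ s ∈ Finset.range i, ((e : ℝ) - g s)| ≤ (N : ℝ) ^ i := by
  rw [Finset.abs_prod]
  calc _ ≤ ∏ s ∈ Finset.range i, (N : ℝ) := by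
        refine Finset.prod_le_prod (fun _ _ => abs_nonneg _) fun s hs => ?_
        have h1 : (e : ℝ) ≤ N := by exact_mod_cast he
        have h2 : (g s : ℝ) ≤ N := by exact_mod_cast hg s (Finset.mem_range.1 hs)
        have h3 : (0 : ℝ) ≤ e := by positivity
        have h4 : (0 : ℝ) ≤ g s := by positivity
        rw [abs_le]; constructor <;> linarith
    _ = _ := by simp

theorem Nomial.abs_fracCoef_le {n k : ℕ} {τ : ℝ} (f : Nomial n k τ) {i : ℕ} (hi : i < k)
    (t : Fin k) : |f.fracCoef i t| ≤ 2 ^ τ * (n : ℝ) ^ k := by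
  have hn : (1 : ℝ) ≤ n := by exact_mod_cast f.one_le
  rw [Nomial.fracCoef, abs_mul]
  have h1 := abs_prod_sub_le (g := f.expoN) i (f.expo_le t) fun s _ => f.expoN_le s
  have h2 : (n : ℝ) ^ i ≤ (n : ℝ) ^ k := pow_le_pow_right₀ hn hi.le
  have h3 := f.abs_coef_le t
  have h4 := f.one_le_height
  gcongr
  exact h1.trans h2

theorem Nomial.le_abs_fracCoef {n k : ℕ} {τ : ℝ} (f : Nomial n k τ) {i : ℕ} (hi : i < k) :
    (2 ^ τ)⁻¹ ≤ |f.fracCoef i ⟨i, hi⟩| := by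
  rw [Nomial.fracCoef, abs_mul, ← Real.rpow_neg (by norm_num)]
  have h1 := f.le_abs_coef ⟨i, hi⟩
  have h2 := (f.one_le_prod i hi).trans (le_abs_self _)
  calc (2 : ℝ) ^ (-τ) = 2 ^ (-τ) * 1 := (mul_one _).symm
    _ ≤ _ := by gcongr

/-- The quotient `(m - r)/(m + r)` is at least `1 - 1/(2n)`, so by Bernoulli powers up to `n` vary
by a factor of at most two over the whole multipoint. -/
theorem half_pow_le {n d : ℕ} {m r : ℝ} (hr : 0 < r) (hn : (1 : ℝ) ≤ n)
    (hm : r + 4 * n * r ≤ m) (hd : d ≤ n) : (m + r) ^ d / 2 ≤ (m - r) ^ d := by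
  have hn0 : 0 < 4 * n * r := by positivity
  have hb0 : 0 < m + r := by linarith
  have h1 : 1 - 1 / (2 * n) ≤ (m - r) / (m + r) := by
    rw [le_div_iff₀ hb0]
    have : 2 * r ≤ 1 / (2 * (n : ℝ)) * (m + r) := by
      rw [div_mul_eq_mul_div, le_div_iff₀ (by positivity)]; linarith
    linarith
  have h0 : (1 : ℝ) / (2 * n) ≤ 1 / 2 := by
    rw [div_le_div_iff₀ (by positivity) (by norm_num)]; linarith
  have h2 := one_add_mul_le_pow (a := -(1 / (2 * (n : ℝ)))) (by linarith) d
  have h3 : (1 - 1 / (2 * (n : ℝ))) ^ d ≤ ((m - r) / (m + r)) ^ d :=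
    pow_le_pow_left₀ (by linarith) h1 d
  have h4 : (d : ℝ) * (1 / (2 * n)) ≤ 1 / 2 := by
    have : (d : ℝ) ≤ n := by exact_mod_cast hd
    rw [mul_one_div, div_le_div_iff₀ (by positivity) (by norm_num)]; linarith
  have h5 : 1 / 2 ≤ ((m - r) / (m + r)) ^ d := by
    rw [← sub_eq_add_neg] at h2
    linarith
  rw [div_pow, le_div_iff₀ (by positivity)] at h5
  linarith

/-- Where the higher terms are negligible a fractional derivative is about its constant term. -/
theorem Nomial.le_abs_fracPoly_of_small {n k : ℕ} {τ : ℝ} (f : Nomial n k τ) {i : ℕ}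
    (hi : i + 1 < k) {y b : ℝ} (hy : 0 < y) (hyb : y ≤ b) (hb : b ≤ 1)
    (h : k * (n : ℝ) ^ k * (2 ^ τ) ^ 2 * b ^ (f.expoN (i + 1) - f.expoN i) ≤ 1 / 2) :
    (2 * 2 ^ τ)⁻¹ ≤ |(f.fracPoly i).eval y| := by
  set Φ : ℝ := 2 ^ τ with hΦ
  have hi' : i < k := by omega
  set d := f.expoN (i + 1) - f.expoN i
  have hb0 : 0 < b := hy.trans_le hyb
  rw [Nomial.fracPoly, eval_finsetSum, ← Finset.add_sum_erase _ _ (Finset.mem_univ ⟨i, hi'⟩)]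
  have h2 : f.expo ⟨i, hi'⟩ = f.expoN i := (f.expoN_coe ⟨i, hi'⟩).symm
  rw [h2, Nat.sub_self, pow_zero, mul_one, eval_C]
  have h3 : |∑ t ∈ Finset.univ.erase ⟨i, hi'⟩,
      eval y (C (f.fracCoef i t) * X ^ (f.expo t - f.expoN i))| ≤
      k * (Φ * (n : ℝ) ^ k * b ^ d) := by
    refine (Finset.abs_sum_le_sum_abs _ _).trans ?_
    have hc : ((Finset.univ.erase (⟨i, hi'⟩ : Fin k)).card : ℝ) ≤ k := by
      have := Finset.card_erase_le (a := (⟨i, hi'⟩ : Fin k)) (s := Finset.univ)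
      rw [Finset.card_univ, Fintype.card_fin] at this
      exact_mod_cast this
    refine (Finset.sum_le_card_nsmul _ _ (Φ * (n : ℝ) ^ k * b ^ d) ?_).trans ?_
    · intro t ht
      have hti : (t : ℕ) ≠ i := fun h => (Finset.ne_of_mem_erase ht) (Fin.ext h)
      rw [eval_mul, eval_C, eval_pow, eval_X, abs_mul]
      rcases lt_or_gt_of_ne hti with h4 | h4
      · rw [f.fracCoef_eq_zero h4, abs_zero, zero_mul]; positivity
      · have h5 : f.expoN (i + 1) ≤ f.expo t := by
          rcases eq_or_lt_of_le (Nat.succ_le_of_lt h4) with h3 | h3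
          · rw [← f.expoN_coe, ← h3]
          · have := f.expoN_lt t.2 h3
            rw [f.expoN_coe] at this
            exact this.le
        have h6 : |y ^ (f.expo t - f.expoN i)| ≤ b ^ d := by
          rw [abs_of_pos (pow_pos hy _)]
          calc y ^ (f.expo t - f.expoN i) ≤ b ^ (f.expo t - f.expoN i) :=
                pow_le_pow_left₀ hy.le hyb _
            _ ≤ b ^ d := pow_le_pow_of_le_one hb0.le hb (by omega)
        have := f.abs_fracCoef_le hi' t
        gcongr
    · rw [nsmul_eq_mul]; gcongr
  have h4 := f.le_abs_fracCoef hi'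
  have h5 : k * (Φ * (n : ℝ) ^ k * b ^ d) ≤ (2 * Φ)⁻¹ := by
    have h6 : k * (Φ * (n : ℝ) ^ k * b ^ d) =
      (k * (n : ℝ) ^ k * Φ ^ 2 * b ^ d) * Φ⁻¹ := by field_simp
    rw [h6, mul_inv]
    have : 0 < Φ⁻¹ := by positivity
    nlinarith
  have h7 : Φ⁻¹ = (2 * Φ)⁻¹ + (2 * Φ)⁻¹ := by field_simp; norm_num
  rw [← hΦ] at h4
  have h8 := abs_sub_abs_le_abs_sub (f.fracCoef i ⟨i, hi'⟩)
    (-∑ t ∈ Finset.univ.erase ⟨i, hi'⟩,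
      eval y (C (f.fracCoef i t) * X ^ (f.expo t - f.expoN i)))
  rw [sub_neg_eq_add, abs_neg] at h8
  linarith

/-- Descending induction over the fractional derivatives near a point without roots. The last one is
a nonzero constant. Passing from `i + 1` to `i` costs a factor `θ`: either the higher terms of the
`i`-th one are negligible against its constant term, or the power of `x` in its derivative is
bounded below and `le_abs_of_derivative` applies. -/
theorem Nomial.exists_large_minAbs {n k : ℕ} {τ : ℝ} (f : Nomial n k τ) {m r : ℝ} (hr : 0 < r)
    (hm : r + 2 * blowup n k * n * r ≤ m) :
    ∃ j ≤ 2 * k ^ 2, (2 * 2 ^ τ)⁻¹ * (min 1 r / (8 * k ^ 4 * (n : ℝ) ^ k * (2 ^ τ) ^ 2)) ^ k ≤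
      f.minAbs (candidate k m r j) := by
  have hk := f.two_le
  have hk' : (2 : ℝ) ≤ k := by exact_mod_cast hk
  have hn : (1 : ℝ) ≤ n := by exact_mod_cast f.one_le
  set Φ : ℝ := 2 ^ τ with hΦ
  have hΦ1 : 1 ≤ Φ := f.one_le_height
  have hbl : 1 ≤ blowup n k := by
    rw [blowup]
    have h1 : (1 : ℝ) ≤ 2 ^ (8 * k + 4) := one_le_pow₀ (by norm_num)
    have h2 : (1 : ℝ) ≤ (n : ℝ) ^ (5 * k + 16) := one_le_pow₀ hn
    nlinarith
  have hm4 : r + 4 * n * r ≤ m := by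
    have : 2 ≤ blowup n k := by
      rw [blowup]
      have h1 : (2 : ℝ) ^ 1 ≤ 2 ^ (8 * k + 4) := pow_le_pow_right₀ (by norm_num) (by omega)
      have h2 : (1 : ℝ) ≤ (n : ℝ) ^ (5 * k + 16) := one_le_pow₀ hn
      nlinarith
    have : 4 * (n : ℝ) * r ≤ 2 * blowup n k * n * r := by
      have h3 : 0 ≤ (n : ℝ) * r := by positivity
      nlinarith
    linarith
  have hrn : r ≤ n * r := by nlinarith
  have hrm : r < m := by linarith
  obtain ⟨j, hj1, hj2, hj⟩ := f.exists_root_free hr hrm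
  refine ⟨j, by omega, ?_⟩
  set x := candidate k m r j with hx
  set δ := r / (k : ℝ) ^ 2 with hδ
  have hk0 : (0 : ℝ) < (k : ℝ) ^ 2 := by positivity
  have hδ0 : 0 < δ := by positivity
  set a := m - r with ha
  set b := m + r with hb
  have ha0 : 0 < a := by rw [ha]; linarith
  have hab' : ∀ z, |z - x| < δ → a ≤ z ∧ z ≤ b := by
    intro z hz
    have hcand : x = m + ((j : ℝ) - (k : ℝ) ^ 2) * δ := by
      rw [hx, candidate, multipointAt]; push_cast; rfl
    have h3 : (k : ℝ) ^ 2 * δ = r := by rw [hδ]; field_simp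
    have h4 : (1 : ℝ) ≤ j := by exact_mod_cast hj1
    have h5 : (j : ℝ) + 1 ≤ 2 * (k : ℝ) ^ 2 := by exact_mod_cast hj2
    have h6 := mul_le_mul_of_nonneg_right h4 hδ0.le
    have h7 := mul_le_mul_of_nonneg_right h5 hδ0.le
    rw [hcand, abs_lt] at hz
    constructor
    · rw [ha]; nlinarith [hz.1]
    · rw [hb]; nlinarith [hz.2]
  have hratio : ∀ d ≤ n, b ^ d / 2 ≤ a ^ d := fun d hd => half_pow_le hr hn hm4 hd
  -- Chosen below `h κ`, where `κ = 1/(4 k n^k Φ²)` bounds the split-off power from below; the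
  -- estimate `k + 1 ≤ 2k` produces `8 k ^ 4`. The minimum with `1` ensures `θ ≤ 1`.
  set θ := min 1 r / (8 * k ^ 4 * (n : ℝ) ^ k * Φ ^ 2) with hθ
  have hnk : (1 : ℝ) ≤ (n : ℝ) ^ k := one_le_pow₀ hn
  have hden1 : 1 ≤ 8 * (k : ℝ) ^ 4 * (n : ℝ) ^ k * Φ ^ 2 := by
    have h1 : (1 : ℝ) ≤ (k : ℝ) ^ 4 := one_le_pow₀ (by linarith)
    have h2 : (1 : ℝ) ≤ Φ ^ 2 := one_le_pow₀ hΦ1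
    have h3 : (1 : ℝ) ≤ (k : ℝ) ^ 4 * (n : ℝ) ^ k := one_le_mul_of_one_le_of_one_le h1 hnk
    have h4 := one_le_mul_of_one_le_of_one_le h3 h2
    nlinarith
  have hθ0 : 0 < θ := by
    have : 0 < min 1 r := lt_min one_pos hr
    positivity
  have hθ1 : θ ≤ 1 := by
    rw [hθ, div_le_one (by linarith)]
    exact (min_le_left _ _).trans hden1
  set h := δ / (k + 1) with hh
  have hh0 : 0 < h := by positivity
  have hθh : θ ≤ h * (4 * k * (n : ℝ) ^ k * Φ ^ 2)⁻¹ := by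
    have h1 : h * (4 * k * (n : ℝ) ^ k * Φ ^ 2)⁻¹ =
        r / (4 * k ^ 3 * (k + 1) * (n : ℝ) ^ k * Φ ^ 2) := by
      rw [hh, hδ]; field_simp
    rw [h1, hθ]
    have h2 : 4 * (k : ℝ) ^ 3 * (k + 1) ≤ 8 * k ^ 4 := by
      have h3 := mul_le_mul_of_nonneg_left (show (k : ℝ) + 1 ≤ 2 * k by linarith)
        (show (0 : ℝ) ≤ 4 * k ^ 3 by positivity)
      linarith
    exact div_le_div₀ hr.le (min_le_right _ _) (by positivity) (by gcongr)
  -- The bound for `i` on a neighbourhood needs the bound for `i + 1` on one wider by `h`. The radii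
  -- `h (i + 1)` provide this and stay below `δ = h (k + 1)`.
  have main : ∀ p i, p + i + 1 = k → ∀ y, |y - x| ≤ h * (i + 1) →
      (2 * Φ)⁻¹ * θ ^ p ≤ |(f.fracPoly i).eval y| := by
    intro p
    induction p with
    | zero =>
      intro i hi y _
      have hik : i < k := by omega
      rw [Nomial.fracPoly, eval_finsetSum, Finset.sum_eq_single ⟨i, hik⟩]
      · have h1 : f.expo ⟨i, hik⟩ = f.expoN i := (f.expoN_coe ⟨i, hik⟩).symm
        rw [h1, Nat.sub_self]
        simp only [pow_zero, mul_one, eval_C]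
        refine le_trans ?_ (f.le_abs_fracCoef hik)
        rw [mul_inv]
        have : 0 < Φ⁻¹ := by positivity
        linarith
      · intro t _ ht
        rw [f.fracCoef_eq_zero]
        · simp
        · have := t.2
          have : (t : ℕ) ≠ i := fun h => ht (Fin.ext h)
          omega
      · simp
    | succ p ih =>
      intro i hi y hy
      have hik : i + 1 < k := by omega
      have hik' : i < k := by omega
      have hih : h * ((i : ℝ) + 1) + h < δ := by
        have h1 : ((i : ℝ) + 1) + 1 < k + 1 := by
          have : (i : ℝ) + 1 < k := by exact_mod_cast hik
          linarith
        have h2 : h * (k + 1) = δ := by rw [hh]; field_simp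
        nlinarith
      have hyδ : |y - x| < δ := by linarith
      have hincr := f.expoN_lt hik (Nat.lt_succ_self i)
      set d := f.expoN (i + 1) - f.expoN i with hd
      have hdn : d ≤ n := by have := f.expoN_le (i + 1); omega
      have hd1 : 1 ≤ d := by omega
      have hb0 : 0 < b := by rw [hb]; linarith
      -- If this fails, either `b > 1` or `b ^ d` is not small; in both cases `b ^ (d - 1)`, and by
      -- `hratio` also `z ^ (d - 1)` on the interval, has a lower bound.
      by_cases hA : b ≤ 1 ∧ k * (n : ℝ) ^ k * Φ ^ 2 * b ^ d ≤ 1 / 2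
      · obtain ⟨hb1, hA⟩ := hA
        have h1 : (2 * Φ)⁻¹ * θ ^ (p + 1) ≤ (2 * Φ)⁻¹ :=
          mul_le_of_le_one_right (by positivity) (pow_le_one₀ hθ0.le hθ1)
        refine h1.trans ?_
        obtain ⟨hya, hyb⟩ := hab' y hyδ
        exact f.le_abs_fracPoly_of_small hik (ha0.trans_le hya) hyb hb1 hA
      · have hκ : ∀ z, |z - x| < δ → 0 < z ∧ (4 * k * (n : ℝ) ^ k * Φ ^ 2)⁻¹ ≤ z ^ (d - 1) := by
          intro z hz
          obtain ⟨hza, hzb⟩ := hab' z hz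
          refine ⟨by linarith, ?_⟩
          have h1 : a ^ (d - 1) ≤ z ^ (d - 1) := pow_le_pow_left₀ ha0.le hza _
          have h2 := hratio (d - 1) (by omega)
          have h3 : (2 * (k * (n : ℝ) ^ k * Φ ^ 2))⁻¹ ≤ b ^ (d - 1) := by
            have hP : 1 ≤ k * (n : ℝ) ^ k * Φ ^ 2 :=
              one_le_mul_of_one_le_of_one_le
                (one_le_mul_of_one_le_of_one_le (by linarith) hnk) (one_le_pow₀ hΦ1)
            rcases le_or_gt 1 b with hb1 | hb1
            · refine le_trans (inv_le_one_of_one_le₀ (by linarith)) (one_le_pow₀ hb1)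
            · have h4 : 1 / 2 < k * (n : ℝ) ^ k * Φ ^ 2 * b ^ d := by
                by_contra hlt
                exact hA ⟨hb1.le, not_lt.1 hlt⟩
              have h5 : b ^ d ≤ b ^ (d - 1) := pow_le_pow_of_le_one hb0.le hb1.le (by omega)
              refine le_trans ?_ h5
              rw [inv_le_iff_one_le_mul₀ (by positivity)]
              linarith
          have h6 : (4 * k * (n : ℝ) ^ k * Φ ^ 2)⁻¹ = (2 * (k * (n : ℝ) ^ k * Φ ^ 2))⁻¹ / 2 := by
            field_simp; norm_num
          rw [h6]; linarith
        have hη0 : 0 ≤ (2 * Φ)⁻¹ * θ ^ p := by positivity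
        have hyh : |y - x| + h < δ := lt_of_le_of_lt (add_le_add_left hy h) hih
        have hyi : ∀ z, |z - x| ≤ |y - x| + h → |z - x| ≤ h * (((i + 1 : ℕ) : ℝ) + 1) := by
          intro z hz
          rw [Nat.cast_add, Nat.cast_one, mul_add h, mul_one]
          exact hz.trans (add_le_add_left hy h)
        have hder := le_abs_of_derivative (f.fracPoly i) (f.fracPoly (i + 1)) (d - 1)
          (f.derivative_fracPoly hik) (x := x) (δ := δ) (y := y) (h := h)
          (η := (2 * Φ)⁻¹ * θ ^ p) (hj i hik') (hj (i + 1) hik) hh0 hyh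
          hη0 (κ := (4 * k * (n : ℝ) ^ k * Φ ^ 2)⁻¹)
          (fun z hz => ih (i + 1) (by omega) z (hyi z hz)) hκ
        refine le_trans ?_ hder
        calc (2 * Φ)⁻¹ * θ ^ (p + 1) = θ * ((2 * Φ)⁻¹ * θ ^ p) := by ring
          _ ≤ h * (4 * k * (n : ℝ) ^ k * Φ ^ 2)⁻¹ * ((2 * Φ)⁻¹ * θ ^ p) := by gcongr
  refine f.le_minAbs x fun i hi => ?_
  rw [← f.eval_fracPoly]
  refine le_trans ?_ (main (k - 1 - i) i (by omega) x (by simp; positivity))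
  have := pow_le_pow_of_le_one hθ0.le hθ1 (show k - 1 - i ≤ k by omega)
  gcongr

/-! ### Compiling expressions -/

/-- Arithmetic expressions over registers and memory. -/
inductive Arith
  | lit (z : ℤ)
  | var (a : ℕ)
  | add (e₁ e₂ : Arith)
  | sub (e₁ e₂ : Arith)
  | mul (e₁ e₂ : Arith)
  | div (e₁ e₂ : Arith)
  | mem (e : Arith)

namespace Arith

/-- The value of an expression for memory contents `μ` and register contents `σ`. -/
def eval (μ σ : ℕ → ℤ) : Arith → ℤ
  | lit z => z
  | var a => σ a
  | add e₁ e₂ => eval μ σ e₁ + eval μ σ e₂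
  | sub e₁ e₂ => eval μ σ e₁ - eval μ σ e₂
  | mul e₁ e₂ => eval μ σ e₁ * eval μ σ e₂
  | div e₁ e₂ => eval μ σ e₁ / eval μ σ e₂
  | mem e => μ (eval μ σ e).toNat

/-- The number of leaves. -/
def width : Arith → ℕ
  | lit _ => 1
  | var _ => 1
  | add e₁ e₂ => width e₁ + width e₂
  | sub e₁ e₂ => width e₁ + width e₂
  | mul e₁ e₂ => width e₁ + width e₂
  | div e₁ e₂ => width e₁ + width e₂
  | mem e => width e

/-- The number of nodes. -/
def nodes : Arith → ℕ
  | lit _ => 1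
  | var _ => 1
  | add e₁ e₂ => nodes e₁ + nodes e₂ + 1
  | sub e₁ e₂ => nodes e₁ + nodes e₂ + 1
  | mul e₁ e₂ => nodes e₁ + nodes e₂ + 1
  | div e₁ e₂ => nodes e₁ + nodes e₂ + 1
  | mem e => nodes e + 1

/-- Only registers below `64` and constants of less than `64` bits occur. -/
def leavesOk : Arith → Bool
  | lit z => decide (z.natAbs < 2 ^ 64)
  | var a => decide (a < 64)
  | add e₁ e₂ => leavesOk e₁ && leavesOk e₂
  | sub e₁ e₂ => leavesOk e₁ && leavesOk e₂
  | mul e₁ e₂ => leavesOk e₁ && leavesOk e₂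
  | div e₁ e₂ => leavesOk e₁ && leavesOk e₂
  | mem e => leavesOk e

/-- The expressions that a single assignment may evaluate. -/
def ok (e : Arith) : Bool := leavesOk e && decide (width e ≤ 32) && decide (nodes e ≤ 100)

/-- Code that evaluates an expression into register `d`, using registers from `d` on. -/
def code : Arith → ℕ → Program
  | lit z, d => .const d z
  -- The machine has no copy instruction; a register is copied by adding zero.
  | var a, d => .seq (.const (d + 1) 0) (.add d a (d + 1))
  | add e₁ e₂, d => .seq (code e₁ d) (.seq (code e₂ (d + 1)) (.add d d (d + 1)))
  | sub e₁ e₂, d => .seq (code e₁ d) (.seq (code e₂ (d + 1)) (.sub d d (d + 1)))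
  | mul e₁ e₂, d => .seq (code e₁ d) (.seq (code e₂ (d + 1)) (.mul d d (d + 1)))
  | div e₁ e₂, d => .seq (code e₁ d) (.seq (code e₂ (d + 1)) (.div d d (d + 1)))
  | mem e, d => .seq (code e d) (.load d d)

end Arith

theorem State.setReg_self (s : State) (d : ℕ) (z : ℤ) : (s.setReg d z).reg d = z := by
  rw [State.setReg]; exact Function.update_self _ _ _

theorem State.setReg_of_ne (s : State) {d a : ℕ} (z : ℤ) (h : a ≠ d) :
    (s.setReg d z).reg a = s.reg a := by
  rw [State.setReg]; exact Function.update_of_ne h _ _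

theorem bitLen_le {z : ℤ} {b : ℕ} (h : z.natAbs < 2 ^ b) : bitLen z ≤ b + 1 :=
  Nat.add_le_add_right (Nat.size_le.2 h) 1

theorem mulCost_mono {a b : ℕ} (h : a ≤ b) : mulCost a ≤ mulCost b :=
  Nat.mul_le_mul h (Nat.pow_le_pow_left (Nat.size_le_size h) 2)

theorem le_mulCost (b : ℕ) : b ≤ mulCost b := by
  rcases Nat.eq_zero_or_pos b with rfl | h
  · simp
  · have : 0 < b.size := Nat.size_pos.2 h
    exact Nat.le_mul_of_pos_right _ (by positivity)

theorem natAbs_add_lt {a b : ℤ} {m n : ℕ} (hm : 1 ≤ m) (hn : 1 ≤ n) (ha : a.natAbs < 2 ^ m)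
    (hb : b.natAbs < 2 ^ n) : (a + b).natAbs < 2 ^ (m + n) := by
  have h0 := Int.natAbs_add_le a b
  have h1 : 2 ^ m + 2 ^ n ≤ 2 ^ (m + n) := by
    obtain ⟨m, rfl⟩ : ∃ m', m = m' + 1 := ⟨m - 1, by omega⟩
    obtain ⟨n, rfl⟩ : ∃ n', n = n' + 1 := ⟨n - 1, by omega⟩
    have e1 : 1 ≤ 2 ^ m := Nat.one_le_two_pow
    have e2 : 1 ≤ 2 ^ n := Nat.one_le_two_pow
    have : 2 ^ (m + 1 + (n + 1)) = 4 * (2 ^ m * 2 ^ n) := by ring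
    rw [this, pow_succ, pow_succ]
    nlinarith
  omega

theorem natAbs_mul_lt {a b : ℤ} {m n : ℕ} (ha : a.natAbs < 2 ^ m) (hb : b.natAbs < 2 ^ n) :
    (a * b).natAbs < 2 ^ (m + n) := by
  rw [Int.natAbs_mul, pow_add]
  exact Nat.mul_lt_mul'' ha hb

namespace Arith

/-- Registers below `64` and the memory hold numbers of at most `β` bits. -/
def Bounded (β : ℕ) (μ σ : ℕ → ℤ) : Prop :=
  (∀ a, (μ a).natAbs < 2 ^ β) ∧ ∀ d < 64, (σ d).natAbs < 2 ^ β

theorem width_pos (e : Arith) : 1 ≤ e.width := by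
  induction e with
  | lit | var => exact le_rfl
  | add _ _ h _ | sub _ _ h _ | mul _ _ h _ | div _ _ h _ => exact h.trans (Nat.le_add_right _ _)
  | mem _ h => exact h

/-- Bit lengths at most add up over the leaves: sums and products need the bits of both operands,
quotients do not grow, and a memory access returns to `β` bits. -/
theorem natAbs_eval_lt {β : ℕ} (hβ : 64 ≤ β) {μ σ : ℕ → ℤ} (hb : Bounded β μ σ) (e : Arith)
    (he : e.leavesOk = true) : (e.eval μ σ).natAbs < 2 ^ (e.width * β) := by
  have hw : ∀ e : Arith, 1 ≤ e.width * β := fun e =>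
    Nat.one_le_iff_ne_zero.2 (Nat.mul_ne_zero (by have := e.width_pos; omega) (by omega))
  induction e with
  | lit z =>
    rw [width, one_mul]
    exact (of_decide_eq_true he).trans_le (Nat.pow_le_pow_right (by norm_num) hβ)
  | var a => rw [width, one_mul]; exact hb.2 a (of_decide_eq_true he)
  | add e₁ e₂ h1 h2 =>
    rw [leavesOk, Bool.and_eq_true] at he
    rw [eval, width, add_mul]
    exact natAbs_add_lt (hw e₁) (hw e₂) (h1 he.1) (h2 he.2)
  | sub e₁ e₂ h1 h2 =>
    rw [leavesOk, Bool.and_eq_true] at he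
    rw [eval, width, add_mul, sub_eq_add_neg]
    exact natAbs_add_lt (hw e₁) (hw e₂) (h1 he.1) (by rw [Int.natAbs_neg]; exact h2 he.2)
  | mul e₁ e₂ h1 h2 =>
    rw [leavesOk, Bool.and_eq_true] at he
    rw [eval, width, add_mul]
    exact natAbs_mul_lt (h1 he.1) (h2 he.2)
  | div e₁ e₂ h1 h2 =>
    rw [leavesOk, Bool.and_eq_true] at he
    rw [eval, width, add_mul]
    refine lt_of_le_of_lt (Int.natAbs_ediv_le_natAbs _ _) ((h1 he.1).trans_le ?_)
    exact Nat.pow_le_pow_right (by norm_num) (Nat.le_add_right _ _)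
  | mem e h =>
    refine (hb.1 _).trans_le (Nat.pow_le_pow_right (by norm_num) ?_)
    exact Nat.le_mul_of_pos_left _ e.width_pos

/-- The code for `d` leaves all registers below `d` alone. Thus the variables, which live below `64
≤ d`, keep their values, and the first operand survives in `d` while the second is evaluated from `d
+ 1` on. -/
theorem exec_code (O : ℕ → ℕ → ℤ) {β : ℕ} (hβ : 64 ≤ β) {μ σ : ℕ → ℤ} (hb : Bounded β μ σ)
    (C : ℕ) (e : Arith) (he : e.leavesOk = true) (hC : e.width * β + 4 ≤ C) :
    ∀ (d : ℕ) (s : State), 64 ≤ d → s.mem = μ → (∀ a < 64, s.reg a = σ a) →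
      ∃ s' t, Exec O (e.code d) s s' t ∧ t ≤ 3 * e.nodes * mulCost C ∧ s'.mem = μ ∧
        s'.reg d = e.eval μ σ ∧ ∀ a < d, s'.reg a = s.reg a := by
  have hcost : ∀ b, b ≤ C → b ≤ mulCost C := fun b h => h.trans (le_mulCost C)
  -- The four binary operations differ only in the instruction, its value `g` and its cost `κ`, so
  -- they are treated together.
  have hbin : ∀ (op : ℕ → ℕ → ℕ → Program) (g : ℤ → ℤ → ℤ) (κ : ℕ → ℕ),
      (∀ d a b s, Exec O (op d a b) s (s.setReg d (g (s.reg a) (s.reg b)))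
        (κ (bitLen (s.reg a) + bitLen (s.reg b)))) → (∀ b ≤ C, κ b ≤ mulCost C) →
      ∀ e₁ e₂ : Arith, e₁.leavesOk = true → e₂.leavesOk = true →
      (e₁.width + e₂.width) * β + 4 ≤ C →
      (∀ (d : ℕ) (s : State), 64 ≤ d → s.mem = μ → (∀ a < 64, s.reg a = σ a) →
      ∃ s' t, Exec O (e₁.code d) s s' t ∧ t ≤ 3 * e₁.nodes * mulCost C ∧ s'.mem = μ ∧
        s'.reg d = e₁.eval μ σ ∧ ∀ a < d, s'.reg a = s.reg a) →
      (∀ (d : ℕ) (s : State), 64 ≤ d → s.mem = μ → (∀ a < 64, s.reg a = σ a) →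
      ∃ s' t, Exec O (e₂.code d) s s' t ∧ t ≤ 3 * e₂.nodes * mulCost C ∧ s'.mem = μ ∧
        s'.reg d = e₂.eval μ σ ∧ ∀ a < d, s'.reg a = s.reg a) →
      ∀ (d : ℕ) (s : State), 64 ≤ d → s.mem = μ → (∀ a < 64, s.reg a = σ a) →
      ∃ s' t, Exec O (.seq (e₁.code d) (.seq (e₂.code (d + 1)) (op d d (d + 1)))) s s' t ∧
        t ≤ 3 * (e₁.nodes + e₂.nodes + 1) * mulCost C ∧ s'.mem = μ ∧
        s'.reg d = g (e₁.eval μ σ) (e₂.eval μ σ) ∧ ∀ a < d, s'.reg a = s.reg a := by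
    intro op g κ hop hκ e₁ e₂ ho1 ho2 hC h1 h2 d s hd hm hr
    obtain ⟨s1, t1, x1, c1, m1, v1, r1⟩ := h1 d s hd hm hr
    obtain ⟨s2, t2, x2, c2, m2, v2, r2⟩ := h2 (d + 1) s1 (by omega) m1
      (fun a ha => (r1 a (by omega)).trans (hr a ha))
    have v1' : s2.reg d = e₁.eval μ σ := (r2 d (by omega)).trans v1
    refine ⟨_, _, .seq x1 (.seq x2 (hop d d (d + 1) s2)), ?_, m2, ?_, ?_⟩
    · have b1 := bitLen_le (natAbs_eval_lt hβ hb e₁ ho1)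
      have b2 := bitLen_le (natAbs_eval_lt hβ hb e₂ ho2)
      rw [v1', v2]
      have := hκ (bitLen (e₁.eval μ σ) + bitLen (e₂.eval μ σ)) (by rw [add_mul] at hC; omega)
      have e : 3 * (e₁.nodes + e₂.nodes + 1) * mulCost C =
        3 * e₁.nodes * mulCost C + (3 * e₂.nodes * mulCost C + 3 * mulCost C) := by ring
      omega
    · rw [State.setReg_self, v1', v2]
    · intro a ha
      rw [State.setReg_of_ne _ _ (by omega), r2 a (by omega), r1 a ha]
  induction e with
  | lit z =>
    intro d s hd hm hr
    refine ⟨_, _, .const d z s, ?_, hm, by rw [State.setReg_self]; rfl, ?_⟩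
    · have h1 := bitLen_le (natAbs_eval_lt hβ hb (lit z) he)
      change bitLen z ≤ _ at h1
      have := hcost (bitLen z) (by omega)
      rw [nodes]; omega
    · intro a ha; rw [State.setReg_of_ne _ _ (by omega)]
  | var a =>
    intro d s hd hm hr
    have ha : a < 64 := of_decide_eq_true he
    refine ⟨_, _, .seq (.const (d + 1) 0 s) (.add d a (d + 1) _), ?_, hm, ?_, ?_⟩
    · have h1 := bitLen_le (hb.2 a ha)
      have h2 : (s.setReg (d + 1) 0).reg a = σ a := by
        rw [State.setReg_of_ne _ _ (by omega), hr a ha]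
      have h3 : (s.setReg (d + 1) 0).reg (d + 1) = 0 := by rw [State.setReg_self]
      rw [h2, h3]
      have h4 : bitLen 0 = 1 := rfl
      rw [width] at hC
      have := hcost (bitLen (σ a) + bitLen 0) (by omega)
      have := hcost (bitLen 0) (by omega)
      rw [nodes]; omega
    · rw [State.setReg_self, State.setReg_self, State.setReg_of_ne _ _ (by omega), hr a ha,
        add_zero, eval]
    · intro b hb'
      rw [State.setReg_of_ne _ _ (by omega), State.setReg_of_ne _ _ (by omega)]
  | add e₁ e₂ h1 h2 =>
    rw [leavesOk, Bool.and_eq_true] at he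
    rw [width] at hC
    have hC' := hC
    rw [add_mul] at hC'
    exact hbin .add (· + ·) id (fun d a b s => .add d a b s) hcost e₁ e₂ he.1 he.2 hC
      (h1 he.1 (by omega)) (h2 he.2 (by omega))
  | sub e₁ e₂ h1 h2 =>
    rw [leavesOk, Bool.and_eq_true] at he
    rw [width] at hC
    have hC' := hC
    rw [add_mul] at hC'
    exact hbin .sub (· - ·) id (fun d a b s => .sub d a b s) hcost e₁ e₂ he.1 he.2 hC
      (h1 he.1 (by omega)) (h2 he.2 (by omega))
  | mul e₁ e₂ h1 h2 =>
    rw [leavesOk, Bool.and_eq_true] at he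
    rw [width] at hC
    have hC' := hC
    rw [add_mul] at hC'
    exact hbin .mul (· * ·) mulCost (fun d a b s => .mul d a b s) (fun b hb => mulCost_mono hb)
      e₁ e₂ he.1 he.2 hC (h1 he.1 (by omega)) (h2 he.2 (by omega))
  | div e₁ e₂ h1 h2 =>
    rw [leavesOk, Bool.and_eq_true] at he
    rw [width] at hC
    have hC' := hC
    rw [add_mul] at hC'
    exact hbin .div (· / ·) mulCost (fun d a b s => .div d a b s) (fun b hb => mulCost_mono hb)
      e₁ e₂ he.1 he.2 hC (h1 he.1 (by omega)) (h2 he.2 (by omega))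
  | mem e h =>
    intro d s hd hm hr
    rw [width] at hC
    obtain ⟨s1, t1, x1, c1, m1, v1, r1⟩ := h he hC d s hd hm hr
    refine ⟨_, _, .seq x1 (.load d d s1), ?_, m1, ?_, ?_⟩
    · have b1 := bitLen_le (natAbs_eval_lt hβ hb e he)
      have b2 := bitLen_le (hb.1 (e.eval μ σ).toNat)
      have hw : β ≤ e.width * β := Nat.le_mul_of_pos_left _ e.width_pos
      rw [v1, m1]
      have h1 := hcost (bitLen (e.eval μ σ)) (by omega)
      have h2 := hcost (bitLen (μ (e.eval μ σ).toNat)) (by omega)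
      have e' : 3 * (e.nodes + 1) * mulCost C = 3 * e.nodes * mulCost C + 3 * mulCost C := by ring
      rw [nodes]; omega
    · rw [State.setReg_self, v1, m1]; rfl
    · intro a ha
      rw [State.setReg_of_ne _ _ (by omega), r1 a ha]

end Arith

/-! ### Total correctness with a step count -/

/-- `x := e` -/
def assign (x : ℕ) (e : Arith) : Program :=
  .seq (e.code 64) (.seq (.const 65 0) (.add x 64 65))

/-- A sequence of programs. -/
def block : List Program → Program
  | [] => .const 64 0
  | p :: ps => .seq p (block ps)

/-- The cost of a step when all numbers have at most `β` bits. -/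
def stepCost (β : ℕ) : ℕ := 400 * mulCost (40 * β)

/-- `s` has memory `μ` and register contents `σ` below `64`, all of at most `β` bits. -/
def Represents (β : ℕ) (μ σ : ℕ → ℤ) (s : State) : Prop :=
  s.mem = μ ∧ (∀ d < 64, s.reg d = σ d) ∧ Arith.Bounded β μ σ

/-- Started with register contents `σ`, the program halts within `N` steps, with all numbers of at
most `β` bits, and with register contents that satisfy `Q`. -/
def Tri (O : ℕ → ℕ → ℤ) (μ : ℕ → ℤ) (β : ℕ) (P : Program) (σ : ℕ → ℤ) (N : ℕ)
    (Q : (ℕ → ℤ) → Prop) : Prop :=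
  ∀ s, Represents β μ σ s → ∃ s' t σ', Exec O P s s' t ∧ t ≤ N * stepCost β ∧
    Represents β μ σ' s' ∧ Q σ'

section Rules

variable {O : ℕ → ℕ → ℤ} {μ : ℕ → ℤ} {β : ℕ} {σ : ℕ → ℤ} {Q : (ℕ → ℤ) → Prop}

theorem Tri.mono {P : Program} {N N' : ℕ} {Q' : (ℕ → ℤ) → Prop} (h : Tri O μ β P σ N Q)
    (hN : N ≤ N') (hQ : ∀ σ', Q σ' → Q' σ') : Tri O μ β P σ N' Q' := by
  intro s hs
  obtain ⟨s', t, σ', h1, h2, h3, h4⟩ := h s hs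
  exact ⟨s', t, σ', h1, h2.trans (Nat.mul_le_mul_right _ hN), h3, hQ _ h4⟩

theorem Tri.steps {P : Program} {N N' : ℕ} (h : Tri O μ β P σ N Q) (hN : N ≤ N') :
    Tri O μ β P σ N' Q := h.mono hN fun _ h => h

/-- The postcondition of the first program is itself a triple for the second, which therefore may
refer to the intermediate registers without an explicit midcondition. -/
theorem Tri.seq {p q : Program} {N₁ N₂ : ℕ}
    (h : Tri O μ β p σ N₁ fun σ' => Tri O μ β q σ' N₂ Q) :
    Tri O μ β (.seq p q) σ (N₁ + N₂) Q := by
  intro s hs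
  obtain ⟨s', t, σ', h1, h2, h3, h4⟩ := h s hs
  obtain ⟨s'', t', σ'', g1, g2, g3, g4⟩ := h4 s' h3
  exact ⟨s'', t + t', σ'', .seq h1 g1, by rw [add_mul]; omega, g3, g4⟩

theorem Tri.nil (hβ : 64 ≤ β) (h : Q σ) : Tri O μ β (block []) σ 1 Q := by
  intro s hs
  refine ⟨_, _, σ, .const 64 0 s, ?_, ⟨hs.1, ?_, hs.2.2⟩, h⟩
  · have h1 : bitLen 0 = 1 := rfl
    have := le_mulCost (40 * β)
    rw [stepCost]; omega
  · intro d hd; rw [State.setReg_of_ne _ _ (by omega), hs.2.1 d hd]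

theorem Tri.cons {p : Program} {ps : List Program} {N₁ N₂ : ℕ}
    (h : Tri O μ β p σ N₁ fun σ' => Tri O μ β (block ps) σ' N₂ Q) :
    Tri O μ β (block (p :: ps)) σ (N₁ + N₂) Q := Tri.seq h

theorem Arith.Bounded.update {x : ℕ} {v : ℤ} (hb : Arith.Bounded β μ σ) (hv : v.natAbs < 2 ^ β) :
    Arith.Bounded β μ (Function.update σ x v) := by
  refine ⟨hb.1, fun d hd => ?_⟩
  rw [Function.update_apply]
  split_ifs
  · exact hv
  · exact hb.2 d hd

/-- An admissible expression has at most `100` nodes, each costing at most three multiplications,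
and its operands have at most `32 β` bits plus a few; the remainder of `stepCost` pays for the final
copy. -/
theorem Tri.assign (hβ : 64 ≤ β) {x : ℕ} {e : Arith} (he : e.ok = true)
    (hv : (e.eval μ σ).natAbs < 2 ^ β) (h : Q (Function.update σ x (e.eval μ σ))) :
    Tri O μ β (SparseRoots.assign x e) σ 1 Q := by
  intro s hs
  rw [Arith.ok, Bool.and_eq_true, Bool.and_eq_true] at he
  obtain ⟨⟨he1, he2⟩, he3⟩ := he
  have he2 : e.width ≤ 32 := of_decide_eq_true he2
  have he3 : e.nodes ≤ 100 := of_decide_eq_true he3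
  have hw : e.width * β ≤ 32 * β := Nat.mul_le_mul_right _ he2
  obtain ⟨s1, t1, x1, c1, m1, v1, r1⟩ := Arith.exec_code O hβ hs.2.2 (40 * β) e he1 (by omega)
    64 s le_rfl hs.1 hs.2.1
  refine ⟨_, _, _, .seq x1 (.seq (.const 65 0 s1) (.add x 64 65 _)), ?_, ⟨m1, ?_, ?_⟩, h⟩
  · have h2 : (s1.setReg 65 0).reg 64 = e.eval μ σ := by
      rw [State.setReg_of_ne _ _ (by norm_num), v1]
    have h3 : (s1.setReg 65 0).reg 65 = 0 := by rw [State.setReg_self]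
    rw [h2, h3]
    have h4 : bitLen 0 = 1 := rfl
    have h5 := bitLen_le hv
    have h6 := le_mulCost (40 * β)
    have h7 : 3 * e.nodes * mulCost (40 * β) ≤ 300 * mulCost (40 * β) :=
      Nat.mul_le_mul_right _ (by omega)
    rw [stepCost]; omega
  · intro d hd
    rcases eq_or_ne d x with rfl | hne
    · rw [State.setReg_self, State.setReg_self, State.setReg_of_ne _ _ (by norm_num), v1,
        Function.update_self, add_zero]
    · rw [State.setReg_of_ne _ _ hne, State.setReg_of_ne _ _ (by omega), r1 d (by omega),
        hs.2.1 d hd, Function.update_of_ne hne]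
  · exact hs.2.2.update hv

/-- The value is passed as a separate `v`, so that the symbolic register contents stay in closed
form instead of accumulating nested evaluations. -/
theorem Tri.assign_cons (hβ : 64 ≤ β) {x : ℕ} {e : Arith} {ps : List Program} {N : ℕ}
    (v : ℤ) (he : e.ok = true) (hev : e.eval μ σ = v) (hv : v.natAbs < 2 ^ β)
    (h : Tri O μ β (block ps) (Function.update σ x v) N Q) :
    Tri O μ β (block (SparseRoots.assign x e :: ps)) σ (1 + N) Q := by
  subst hev
  exact Tri.cons (Tri.assign hβ he hv h)

theorem Tri.query (hβ : 64 ≤ β) {d a b : ℕ} (ha : a < 64) (hb : b < 64)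
    (hκ : (σ b).toNat ≤ β) (hv : (O (σ a).toNat (σ b).toNat).natAbs < 2 ^ β)
    (h : Q (Function.update σ d (O (σ a).toNat (σ b).toNat))) :
    Tri O μ β (.query d a b) σ 1 Q := by
  intro s hs
  have h1 := hs.2.1 a ha
  have h2 := hs.2.1 b hb
  refine ⟨_, _, _, .query d a b s, ?_, ⟨hs.1, ?_, hs.2.2.update hv⟩, h⟩
  · rw [h1, h2]
    have b1 := bitLen_le (hs.2.2.2 a ha)
    have b2 := bitLen_le (hs.2.2.2 b hb)
    have b3 := bitLen_le hv
    have h6 := le_mulCost (40 * β)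
    rw [stepCost]; omega
  · intro c hc
    simp only [State.setReg]
    rw [Function.update_apply, Function.update_apply, hs.2.1 c hc, h1, h2]

theorem Tri.branch (hβ : 64 ≤ β) {a : ℕ} {p q : Program} {N : ℕ} (ha : a < 64)
    (hp : 0 < σ a → Tri O μ β p σ N Q) (hq : σ a ≤ 0 → Tri O μ β q σ N Q) :
    Tri O μ β (.branch a p q) σ (N + 1) Q := by
  intro s hs
  have h1 := hs.2.1 a ha
  have b1 := bitLen_le (hs.2.2.2 a ha)
  have h6 := le_mulCost (40 * β)
  have hc : bitLen (s.reg a) ≤ stepCost β := by rw [h1, stepCost]; omega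
  rcases lt_or_ge 0 (σ a) with h | h
  · obtain ⟨s', t, σ', g1, g2, g3, g4⟩ := hp h s hs
    exact ⟨s', _, σ', .branch_pos (by rw [h1]; exact h) g1, by rw [add_mul]; omega, g3, g4⟩
  · obtain ⟨s', t, σ', g1, g2, g3, g4⟩ := hq h s hs
    exact ⟨s', _, σ', .branch_neg (by rw [h1]; exact h) g1, by rw [add_mul]; omega, g3, g4⟩

/-- The invariant is indexed by the round. The body has to be analysed only when the guard is
positive, and it must then also show that fewer than `L` rounds have passed. -/
theorem Tri.loop (hβ : 64 ≤ β) {a : ℕ} {body : Program} {N L : ℕ} (ha : a < 64)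
    (I : ℕ → (ℕ → ℤ) → Prop)
    (hbody : ∀ p σ, I p σ → 0 < σ a → p < L ∧ Tri O μ β body σ N (I (p + 1)))
    (hdone : ∀ p σ, I p σ → σ a ≤ 0 → Q σ) {p₀ : ℕ} (hL : p₀ ≤ L) (h0 : I p₀ σ) :
    Tri O μ β (.loop a body) σ ((L - p₀) * (N + 1) + 1) Q := by
  obtain ⟨g, hg⟩ : ∃ g, L - p₀ = g := ⟨_, rfl⟩
  rw [hg]
  induction g generalizing p₀ σ with
  | zero =>
    intro s hs
    have h1 := hs.2.1 a ha
    have b1 := bitLen_le (hs.2.2.2 a ha)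
    have h6 := le_mulCost (40 * β)
    have hc : bitLen (s.reg a) ≤ stepCost β := by rw [h1, stepCost]; omega
    rcases lt_or_ge 0 (σ a) with h | h
    · have := (hbody p₀ σ h0 h).1; omega
    · exact ⟨s, _, σ, .loop_done (by rw [h1]; exact h), by omega, hs, hdone p₀ σ h0 h⟩
  | succ g ih =>
    intro s hs
    have h1 := hs.2.1 a ha
    have b1 := bitLen_le (hs.2.2.2 a ha)
    have h6 := le_mulCost (40 * β)
    have hc : bitLen (s.reg a) ≤ stepCost β := by rw [h1, stepCost]; omega
    rcases lt_or_ge 0 (σ a) with h | h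
    · obtain ⟨hp, hb⟩ := hbody p₀ σ h0 h
      obtain ⟨s', t, σ', g1, g2, g3, g4⟩ := hb s hs
      obtain ⟨s'', t', σ'', k1, k2, k3, k4⟩ := ih (p₀ := p₀ + 1) (by omega) g4 (by omega) s' g3
      refine ⟨s'', _, σ'', .loop_step (by rw [h1]; exact h) g1 k1, ?_, k3, k4⟩
      calc bitLen (s.reg a) + t + t' ≤ stepCost β + N * stepCost β +
            (g * (N + 1) + 1) * stepCost β := by omega
        _ = ((g + 1) * (N + 1) + 1) * stepCost β := by ring
    · refine ⟨s, _, σ, .loop_done (by rw [h1]; exact h), ?_, hs, hdone p₀ σ h0 h⟩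
      refine hc.trans (Nat.le_mul_of_pos_left _ (by omega))

end Rules

/-! ### Fixed-point arithmetic with lower approximations -/

/-- The integer `z` is a lower approximation of `v ∈ [0, X ^ e]` in units of `1 / W`, with an error
of at most `c X ^ e` units. -/
structure Low (W : ℤ) (X c : ℝ) (z : ℤ) (v : ℝ) (e : ℕ) : Prop where
  nonneg : 0 ≤ z
  le : (z : ℝ) ≤ v * W
  error : v * W - z ≤ c * X ^ e
  val_nonneg : 0 ≤ v
  val_le : v ≤ X ^ e

section Low

variable {W : ℤ} {X c : ℝ} {z : ℤ} {v : ℝ} {e : ℕ}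

theorem Low.one (hW : 0 < W) : Low W X 0 W 1 0 :=
  ⟨hW.le, by simp, by simp, zero_le_one, by simp⟩

theorem Low.le_pow (hW : 0 < W) (h : Low W X c z v e) : (z : ℝ) ≤ X ^ e * W := by
  have : (0 : ℝ) < W := by exact_mod_cast hW
  exact h.le.trans (mul_le_mul_of_nonneg_right h.val_le this.le)

theorem Low.mono (h : Low W X c z v e) {c' : ℝ} (hX : 1 ≤ X) (hc : c ≤ c') : Low W X c' z v e :=
  ⟨h.nonneg, h.le, h.error.trans (by gcongr), h.val_nonneg, h.val_le⟩

/-- The error of a product is `v₁ (v₂ W - z₂) + (v₁ W - z₁) z₂ / W`. As the approximations are from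
below, `z₂ / W ≤ X ^ e₂` holds without loss, so the relative constants simply add; rounding down
costs the extra `1`. -/
theorem Low.mul_div (hW : 0 < W) (hX : 1 ≤ X) {c₁ c₂ : ℝ} {z₁ z₂ : ℤ} {v₁ v₂ : ℝ} {e₁ e₂ : ℕ}
    (h₁ : Low W X c₁ z₁ v₁ e₁) (h₂ : Low W X c₂ z₂ v₂ e₂) {d : ℤ} (hd : 0 < d) :
    Low W X (c₁ + c₂ + 1) (z₁ * z₂ / (W * d)) (v₁ * v₂ / d) (e₁ + e₂) := by
  have hW' : (0 : ℝ) < W := by exact_mod_cast hW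
  have hd' : (1 : ℝ) ≤ d := by exact_mod_cast hd
  have hd0 : (0 : ℝ) < d := by linarith
  have hWd : 0 < W * d := mul_pos hW hd
  have hWd' : (0 : ℝ) < (W : ℝ) * d := mul_pos hW' hd0
  have z1 : (0 : ℝ) ≤ z₁ := by exact_mod_cast h₁.nonneg
  have z2 : (0 : ℝ) ≤ z₂ := by exact_mod_cast h₂.nonneg
  have f1 : ((z₁ * z₂ / (W * d) : ℤ) : ℝ) ≤ (z₁ * z₂ : ℝ) / (W * d) := by
    rw [le_div_iff₀ hWd']
    exact_mod_cast Int.ediv_mul_le (z₁ * z₂) hWd.ne'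
  have f2 : (z₁ * z₂ : ℝ) / (W * d) < ((z₁ * z₂ / (W * d) : ℤ) : ℝ) + 1 := by
    rw [div_lt_iff₀ hWd']
    have := Int.lt_ediv_add_one_mul_self (z₁ * z₂) hWd
    exact_mod_cast this
  have hXe : (1 : ℝ) ≤ X ^ (e₁ + e₂) := one_le_pow₀ hX
  have g1 : (z₁ * z₂ : ℝ) ≤ v₁ * W * (v₂ * W) := mul_le_mul h₁.le h₂.le z2
    (mul_nonneg h₁.val_nonneg hW'.le)
  have hvv : v₁ * v₂ ≤ X ^ (e₁ + e₂) := by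
    rw [pow_add]; exact mul_le_mul h₁.val_le h₂.val_le h₂.val_nonneg (by positivity)
  refine ⟨Int.ediv_nonneg (mul_nonneg h₁.nonneg h₂.nonneg) hWd.le, ?_, ?_, ?_, ?_⟩
  · refine f1.trans ?_
    rw [div_le_iff₀ hWd']
    calc (z₁ * z₂ : ℝ) ≤ v₁ * W * (v₂ * W) := g1
      _ = v₁ * v₂ / d * W * (W * d) := by field_simp
  · have e1 : v₁ * v₂ * W - z₁ * z₂ / W ≤ (c₁ + c₂) * X ^ (e₁ + e₂) := by
      have e2 : v₁ * v₂ * W - z₁ * z₂ / W =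
          v₁ * (v₂ * W - z₂) + (v₁ * W - z₁) * (z₂ / W) := by field_simp; ring
      have e3 : (z₂ : ℝ) / W ≤ X ^ e₂ := by
        rw [div_le_iff₀ hW']; exact h₂.le_pow hW
      have e4 : v₁ * (v₂ * W - z₂) ≤ X ^ e₁ * (c₂ * X ^ e₂) :=
        mul_le_mul h₁.val_le h₂.error (sub_nonneg.2 h₂.le) (by positivity)
      have e5 : (v₁ * W - z₁) * (z₂ / W) ≤ c₁ * X ^ e₁ * X ^ e₂ :=
        mul_le_mul h₁.error e3 (by positivity) ((sub_nonneg.2 h₁.le).trans h₁.error)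
      rw [e2, pow_add]; linarith
    have e0 : 0 ≤ v₁ * v₂ * W - z₁ * z₂ / W := by
      rw [sub_nonneg, div_le_iff₀ hW']; linarith
    have e6 : v₁ * v₂ / d * W - (z₁ * z₂ : ℝ) / (W * d) ≤ v₁ * v₂ * W - z₁ * z₂ / W := by
      have : v₁ * v₂ / d * W - (z₁ * z₂ : ℝ) / (W * d) =
        (v₁ * v₂ * W - z₁ * z₂ / W) / d := by field_simp
      rw [this]
      exact div_le_self e0 hd'
    linarith
  · exact div_nonneg (mul_nonneg h₁.val_nonneg h₂.val_nonneg) hd0.le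
  · exact (div_le_self (mul_nonneg h₁.val_nonneg h₂.val_nonneg) hd').trans hvv

theorem Low.mul (hW : 0 < W) (hX : 1 ≤ X) {c₁ c₂ : ℝ} {z₁ z₂ : ℤ} {v₁ v₂ : ℝ} {e₁ e₂ : ℕ}
    (h₁ : Low W X c₁ z₁ v₁ e₁) (h₂ : Low W X c₂ z₂ v₂ e₂) :
    Low W X (c₁ + c₂ + 1) (z₁ * z₂ / W) (v₁ * v₂) (e₁ + e₂) := by
  simpa using h₁.mul_div hW hX h₂ one_pos

end Low

/-! ### Oracle answers -/

/-- The unit is `1 / W = 2 ^ (-(κ + 1))`, so the oracle's error `2 ^ (-κ)` amounts to two units. -/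
theorem IsApprox.abs_sub_lt {x : ℝ} {κ : ℕ} {w W : ℤ} (hW : W = 2 ^ (κ + 1)) (h : IsApprox x κ w) :
    |x * W - w| < 2 := by
  have hW' : (W : ℝ) = 2 ^ (κ + 1) := by rw [hW]; norm_num
  have hpos : (0 : ℝ) < W := by rw [hW']; positivity
  rw [IsApprox, ← hW'] at h
  have h1 : |x - w / W| * W < 2 ^ (-(κ : ℤ)) * W := mul_lt_mul_of_pos_right h hpos
  rw [← abs_of_pos hpos, ← abs_mul, abs_of_pos hpos] at h1
  have h2 : (x - w / W) * W = x * W - w := by field_simp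
  have h3 : (2 : ℝ) ^ (-(κ : ℤ)) * W = 2 := by
    rw [hW', zpow_neg, zpow_natCast, pow_succ]; field_simp
  rwa [h2, h3] at h1

/-- The fixed-point multipoint: the computed point approximates the true one from below. -/
theorem low_candidate {k : ℕ} (hk : 0 < k) {m r X : ℝ} (hr : 0 < r) (hrm : r < m)
    (hX : m + r ≤ X) (hX1 : 1 ≤ X) {W wm wr : ℤ} (hW : 0 < W) (hm : |m * W - wm| < 2)
    (hwr : |r * W - wr| < 2) {j : ℕ} (hj : j ≤ 2 * k ^ 2) {x : ℤ}
    (hx : x = max 0 ((wm * ((k : ℤ) * k) + ((j : ℤ) - (k : ℤ) * k) * wr) / ((k : ℤ) * k) - 4)) :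
    Low W X 15 x (candidate k m r j) 1 := by
  obtain ⟨hc1, hc2⟩ := candidate_mem hk hr (m := m) hj
  have hW' : (0 : ℝ) < W := by exact_mod_cast hW
  have hkk : 0 < (k : ℤ) * k := by positivity
  have hkk' : (0 : ℝ) < (k : ℝ) * k := by positivity
  set q := (wm * ((k : ℤ) * k) + ((j : ℤ) - (k : ℤ) * k) * wr) / ((k : ℤ) * k) with hq
  set u : ℝ := ((j : ℝ) - k * k) / (k * k) with hu
  have hu1 : |u| ≤ 1 := by
    rw [hu, abs_div, abs_of_pos hkk', div_le_one hkk', abs_le]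
    have : (j : ℝ) ≤ 2 * (k * k) := by
      have : j ≤ 2 * (k * k) := by rw [← pow_two]; exact hj
      exact_mod_cast this
    have : (0 : ℝ) ≤ j := by positivity
    constructor <;> linarith
  have hcand : candidate k m r j = m + u * r := by
    rw [candidate, multipointAt, hu]; push_cast; field_simp
  have hreal : ((wm * ((k : ℤ) * k) + ((j : ℤ) - (k : ℤ) * k) * wr : ℤ) : ℝ) / (k * k) =
      wm + u * wr := by
    rw [hu]; push_cast; field_simp
  have f1 : (q : ℝ) ≤ wm + u * wr := by
    rw [← hreal, le_div_iff₀ hkk']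
    have h := Int.ediv_mul_le (wm * ((k : ℤ) * k) + ((j : ℤ) - (k : ℤ) * k) * wr) hkk.ne'
    rw [← hq] at h
    have h' := (Int.cast_le (R := ℝ)).2 h
    push_cast at h' ⊢
    exact h'
  have f2 : (wm + u * wr : ℝ) < q + 1 := by
    rw [← hreal, div_lt_iff₀ hkk']
    have := Int.lt_ediv_add_one_mul_self
      (wm * ((k : ℤ) * k) + ((j : ℤ) - (k : ℤ) * k) * wr) hkk
    rw [← hq] at this
    have h' := (Int.cast_lt (R := ℝ)).2 this
    push_cast at h' ⊢
    exact h'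
  have hur : |u * (r * W - wr)| < 2 := by
    rw [abs_mul]
    calc |u| * |r * W - wr| ≤ 1 * |r * W - wr| := by gcongr
      _ < 2 := by linarith
  rw [abs_lt] at hm hur
  have hval : (candidate k m r j) * W = m * W + u * (r * W) := by rw [hcand]; ring
  have hcpos : 0 < candidate k m r j := by linarith
  -- The two oracle errors are below `2` units each, since `|u| ≤ 1`, and the floor loses less than
  -- `1`. Subtracting `4` turns `q` into a lower approximation with an error of at most `9`, within
  -- the allowed `15`.
  have hq1 : (q : ℝ) - 4 ≤ candidate k m r j * W := by rw [hval]; linarith [hm.1, hur.1]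
  have hq2 : candidate k m r j * W - 9 ≤ (q : ℝ) - 4 := by rw [hval]; linarith [hm.2, hur.2]
  have hxr : (x : ℝ) = max 0 ((q : ℝ) - 4) := by rw [hx]; push_cast; rfl
  refine ⟨by rw [hx]; exact le_max_left _ _, ?_, ?_, hcpos.le, by rw [pow_one]; linarith⟩
  · rw [hxr]; exact max_le (by positivity) hq1
  · have := le_max_right (0 : ℝ) ((q : ℝ) - 4)
    rw [hxr, pow_one]; linarith

/-- The product of a lower bound for `r` with an integer approximates a radius from below. -/
theorem low_radius {r X : ℝ} (hr : 0 < r) {W wr N x : ℤ} (hN : 0 < N) (hX1 : 1 ≤ X)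
    (hW : 0 < W) (hwr : |r * W - wr| < 2) (hX : N * r ≤ X) (hx : x = max 0 ((wr - 2) * N)) :
    Low W X (4 * N) x (N * r) 1 := by
  have hW' : (0 : ℝ) < W := by exact_mod_cast hW
  have hN' : (0 : ℝ) < N := by exact_mod_cast hN
  rw [abs_lt] at hwr
  have hxr : (x : ℝ) = max 0 (((wr : ℝ) - 2) * N) := by rw [hx]; push_cast; rfl
  refine ⟨by rw [hx]; exact le_max_left _ _, ?_, ?_, by positivity, by rw [pow_one]; exact hX⟩
  · rw [hxr]
    refine max_le (by positivity) ?_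
    have : ((wr : ℝ) - 2) ≤ r * W := by linarith [hwr.1]
    nlinarith
  · have h1 := le_max_right (0 : ℝ) (((wr : ℝ) - 2) * N)
    rw [← hxr] at h1
    have h2 : (r * W - (wr - 2)) * N ≤ 4 * N := by
      have : r * W - ((wr : ℝ) - 2) ≤ 4 := by linarith [hwr.2]
      gcongr
    rw [pow_one]
    have h3 : 4 * (N : ℝ) ≤ 4 * N * X := le_mul_of_one_le_right (by positivity) hX1
    linarith

/-! ### Error of a term and of a test coefficient -/

theorem abs_mul_sub_mul_le {a b a' b' A B α β : ℝ} (h1 : |a - a'| ≤ α) (h2 : |b - b'| ≤ β)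
    (ha : |a| ≤ A) (hb : |b'| ≤ B) : |a * b - a' * b'| ≤ A * β + α * B := by
  have : a * b - a' * b' = a * (b - b') + (a - a') * b' := by ring
  rw [this]
  calc _ ≤ |a| * |b - b'| + |a - a'| * |b'| := by
        rw [← abs_mul, ← abs_mul]; exact abs_add_le _ _
    _ ≤ A * β + α * B := by
        have := (abs_nonneg _).trans h1
        have := (abs_nonneg _).trans ha
        gcongr

/-- The coefficients, extended by zero. -/
def Nomial.coefN {n k : ℕ} {τ : ℝ} (f : Nomial n k τ) (s : ℕ) : ℝ :=
  if h : s < k then f.coef ⟨s, h⟩ else 0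

/-- The term of index `t` of `gsum`. -/
def Nomial.gterm {n k : ℕ} {τ : ℝ} (f : Nomial n k τ) (g : ℕ → ℕ) (i : ℕ) (x : ℝ) (t : ℕ) : ℝ :=
  f.coefN t * (∏ s ∈ Finset.range i, ((f.expoN t : ℝ) - g s)) * x ^ (f.expoN t - g i)

theorem Nomial.gsum_eq_sum_range {n k : ℕ} {τ : ℝ} (f : Nomial n k τ) (g : ℕ → ℕ) (i : ℕ) (x : ℝ) :
    f.gsum g i x = ∑ t ∈ Finset.range k, f.gterm g i x t := by
  rw [Finset.sum_range, Nomial.gsum]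
  refine Finset.sum_congr rfl fun t _ => ?_
  rw [Nomial.gterm, f.expoN_coe, Nomial.coefN, dif_pos t.2]

/-- The error of one term, `18 n (2n)^k Φ X^n`. -/
def termErr (n k : ℕ) (Φ X : ℝ) : ℝ := 18 * n * (2 * n) ^ k * Φ * X ^ n

/-- The integer product is exact; errors come from the coefficient (two units) and from the power
(`16 n X ^ n` units). Nodes up to `2n` are allowed because the ordinary derivatives use `s ≤ k ≤ n +
1`. -/
theorem Nomial.gterm_error {n k : ℕ} {τ : ℝ} (f : Nomial n k τ) {g : ℕ → ℕ} {i : ℕ} {x Φ X : ℝ}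
    (hi : i ≤ k) (hg : ∀ s < i, g s ≤ 2 * n) {W fw z : ℤ} (hW : 0 < W) {t : ℕ}
    (hX : 1 ≤ X) (hΦ : 1 ≤ Φ) (hft : |f.coefN t| ≤ Φ) (hfw : |f.coefN t * W - fw| < 2)
    (hz : Low W X (16 * (f.expoN t - g i : ℕ)) z (x ^ (f.expoN t - g i)) (f.expoN t - g i)) :
    |f.gterm g i x t * W ^ 2 - fw * (∏ s ∈ Finset.range i, ((f.expoN t : ℝ) - g s)) * z| ≤
      W * termErr n k Φ X := by
  have hn : (1 : ℝ) ≤ n := by exact_mod_cast f.one_le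
  have hW' : (0 : ℝ) < W := by exact_mod_cast hW
  set d := f.expoN t - g i with hd
  have hdn : d ≤ n := by have := f.expoN_le t; omega
  have hdn' : (d : ℝ) ≤ n := by exact_mod_cast hdn
  have hXd : X ^ d ≤ X ^ n := pow_le_pow_right₀ hX hdn
  set w := ∏ s ∈ Finset.range i, ((f.expoN t : ℝ) - g s) with hw
  have hwle : |w| ≤ (2 * n) ^ k := by
    have h1 := abs_prod_sub_le (N := 2 * n) (g := g) (e := f.expoN t) i
      (by have := f.expoN_le t; omega) hg
    push_cast at h1
    exact h1.trans (pow_le_pow_right₀ (by linarith) hi)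
  have h2 : |x ^ d * W - z| ≤ 16 * n * X ^ n := by
    rw [abs_of_nonneg (sub_nonneg.2 hz.le)]
    refine hz.error.trans ?_
    gcongr
  have hzb : |(z : ℝ)| ≤ X ^ n * W := by
    have : (0 : ℝ) ≤ z := by exact_mod_cast hz.nonneg
    rw [abs_of_nonneg this]
    refine (hz.le_pow hW).trans ?_
    gcongr
  have hfW : |f.coefN t * W| ≤ Φ * W := by rw [abs_mul, abs_of_pos hW']; gcongr
  have key := abs_mul_sub_mul_le hfw.le h2 hfW hzb
  have e1 : f.gterm g i x t * W ^ 2 - fw * w * z =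
      w * (f.coefN t * W * (x ^ d * W) - fw * z) := by
    rw [Nomial.gterm, ← hw, ← hd]; ring
  rw [e1, abs_mul]
  calc |w| * |f.coefN t * W * (x ^ d * W) - fw * z|
      ≤ (2 * n) ^ k * (Φ * W * (16 * n * X ^ n) + 2 * (X ^ n * W)) := by gcongr
    _ = W * ((2 * n) ^ k * (16 * (n * Φ) + 2) * X ^ n) := by ring
    _ ≤ W * ((2 * n) ^ k * (18 * (n * Φ)) * X ^ n) := by
        have : 1 ≤ n * Φ := one_le_mul_of_one_le_of_one_le hn hΦ
        have : 16 * (n * Φ) + 2 ≤ 18 * (n * Φ) := by linarith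
        gcongr
    _ = W * termErr n k Φ X := by rw [termErr]; ring

theorem Nomial.abs_gterm_le {n k : ℕ} {τ : ℝ} (f : Nomial n k τ) {g : ℕ → ℕ} {i : ℕ} {x Φ X : ℝ}
    (hi : i ≤ k) (hg : ∀ s < i, g s ≤ 2 * n) {t : ℕ}
    (hX : 1 ≤ X) (hx0 : 0 ≤ x) (hx : x ≤ X) (hft : |f.coefN t| ≤ Φ) :
    |f.gterm g i x t| ≤ Φ * (2 * n) ^ k * X ^ n := by
  have hn : (1 : ℝ) ≤ n := by exact_mod_cast f.one_le
  have h1 := abs_prod_sub_le (N := 2 * n) (g := g) (e := f.expoN t) i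
      (by have := f.expoN_le t; omega) hg
  push_cast at h1
  have h2 := h1.trans (pow_le_pow_right₀ (show (1 : ℝ) ≤ 2 * n by linarith) hi)
  have h3 : |x ^ (f.expoN t - g i)| ≤ X ^ n := by
    rw [abs_of_nonneg (by positivity)]
    exact (pow_le_pow_left₀ hx0 hx _).trans
      (pow_le_pow_right₀ hX (by have := f.expoN_le t; omega))
  rw [Nomial.gterm, abs_mul, abs_mul]
  have := (abs_nonneg _).trans hft
  gcongr

/-! ### Subroutines -/

open Arith in
/-- Register `18 := (register 17) ^ (register 16)` in fixed point. -/
def powCode : Program := block [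
  assign 18 (var 3),
  .loop 16 (block [
    assign 19 (sub (var 16) (mul (lit 2) (div (var 16) (lit 2)))),
    .branch 19 (assign 18 (div (mul (var 18) (var 17)) (var 3))) (block []),
    assign 17 (div (mul (var 17) (var 17)) (var 3)),
    assign 16 (div (var 16) (lit 2))])]

open Arith in
/-- The node `g_s`, for the index `s` in register `14`: the exponent `e_s` or, if register `6` is
`1`, the number `s`. -/
def nodeArith : Arith :=
  add (mul (var 6) (var 14)) (mul (sub (lit 1) (var 6)) (mem (var 14)))

open Arith in
/-- Register `9 := ∑ t, f_t ∏_{s < i} (e_t - g_s) x ^ (e_t - g_i)` for `i` in register `8` and `x`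
in register `7`. -/
def sumCode : Program := block [
  assign 9 (lit 0), assign 10 (lit 0), assign 11 (var 0),
  .loop 11 (block [
    assign 12 (mem (var 10)),
    .query 13 10 2,
    assign 14 (lit 0), assign 15 (var 8),
    .loop 15 (block [
      assign 13 (mul (var 13) (sub (var 12) nodeArith)),
      assign 14 (add (var 14) (lit 1)),
      assign 15 (sub (var 15) (lit 1))]),
    assign 17 (var 7),
    -- The inner loop leaves register `14` at `i`, so the node is now `g_i`. A negative difference
    -- makes `powCode` return `x ^ 0`, in agreement with truncated subtraction.
    assign 16 (sub (var 12) nodeArith),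
    powCode,
    assign 9 (add (var 9) (mul (var 13) (var 18))),
    assign 10 (add (var 10) (lit 1)),
    assign 11 (sub (var 11) (lit 1))])]

/-- The registers outside `L` are unchanged. -/
def Agree (L : List ℕ) (σ σ' : ℕ → ℤ) : Prop := ∀ d, d ∉ L → σ' d = σ d

theorem Agree.refl (L : List ℕ) (σ : ℕ → ℤ) : Agree L σ σ := fun _ _ => rfl

theorem Agree.trans {L : List ℕ} {σ σ' σ'' : ℕ → ℤ} (h : Agree L σ σ') (h' : Agree L σ' σ'') :
    Agree L σ σ'' := fun d hd => (h' d hd).trans (h d hd)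

theorem Agree.sub {L L' : List ℕ} {σ σ' : ℕ → ℤ} (h : Agree L σ σ') (hL : L ⊆ L') :
    Agree L' σ σ' := fun d hd => h d fun h' => hd (hL h')

theorem Agree.update {L : List ℕ} {σ σ' : ℕ → ℤ} (h : Agree L σ σ') {x : ℕ} (hx : x ∈ L) (v : ℤ) :
    Agree L σ (Function.update σ' x v) := fun d hd => by
  rw [Function.update_of_ne (fun e => hd (by rw [e]; exact hx)), h d hd]

/-! ### Size budget for all registers. -/

/-- The size of the numbers that occur is governed by a single quantity `Z`. -/
structure Scale (n k β : ℕ) (W : ℤ) (X Φ Z : ℝ) : Prop where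
  bits : 64 ≤ β
  pow_lt : Z ^ 20 < 2 ^ β
  large : 2 ^ 64 ≤ Z
  W_pos : 0 < W
  W_le : (W : ℝ) ≤ Z
  one_le_X : 1 ≤ X
  X_pow : X ^ (n + 1) ≤ Z
  one_le_coef : 1 ≤ Φ
  coef_le : Φ + 3 ≤ Z
  n_pos : 1 ≤ n
  n_pow : (2 * n : ℝ) ^ k ≤ Z
  two_le : 2 ≤ k
  k_le : k ≤ n + 1
  k_le' : (k : ℝ) + 2 ≤ Z
  n_le : 2 * (n : ℝ) + 2 ≤ Z
  spread : 32 * (n : ℝ) * (256 * (n : ℝ) ^ 5) ^ (k + 1) ≤ Z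

namespace Scale

variable {n k β : ℕ} {W : ℤ} {X Φ Z : ℝ}

theorem one_le (h : Scale n k β W X Φ Z) : 1 ≤ Z := le_trans (by norm_num) h.large

theorem fits (h : Scale n k β W X Φ Z) (a : ℕ) (ha : a ≤ 20) {v : ℤ} (hv : |(v : ℝ)| ≤ Z ^ a) :
    v.natAbs < 2 ^ β := by
  have h1 : |(v : ℝ)| < 2 ^ β :=
    hv.trans_lt ((pow_le_pow_right₀ h.one_le ha).trans_lt h.pow_lt)
  rw [← Int.cast_abs, Int.abs_eq_natAbs] at h1
  exact_mod_cast h1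

theorem fits_nat (h : Scale n k β W X Φ Z) {v : ℤ} (h0 : 0 ≤ v) (hv : (v : ℝ) ≤ Z) :
    v.natAbs < 2 ^ β :=
  h.fits 1 (by norm_num) (by
    rw [abs_of_nonneg (by exact_mod_cast h0), pow_one]; exact hv)

theorem fits_lit (h : Scale n k β W X Φ Z) {v : ℤ} (hv : v.natAbs < 2 ^ 64) :
    v.natAbs < 2 ^ β := hv.trans_le (Nat.pow_le_pow_right (by norm_num) h.bits)

theorem fits_index (h : Scale n k β W X Φ Z) {v : ℤ} (h0 : -1 ≤ v) (hv : v ≤ k + 2) :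
    v.natAbs < 2 ^ β := by
  refine h.fits 1 (by norm_num) ?_
  have h1 : (-1 : ℝ) ≤ v := by exact_mod_cast h0
  have h2 : (v : ℝ) ≤ k + 2 := by exact_mod_cast hv
  have h3 := h.k_le'
  have h4 := h.one_le
  rw [pow_one, abs_le]; constructor <;> linarith

theorem fits_sub (h : Scale n k β W X Φ Z) {a b : ℕ} (ha : a ≤ n) (hb : b ≤ 2 * n) :
    ((a : ℤ) - b).natAbs < 2 ^ β := by
  refine h.fits 1 (by norm_num) ?_
  have h1 : (a : ℝ) ≤ n := by exact_mod_cast ha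
  have h2 : (b : ℝ) ≤ 2 * n := by exact_mod_cast hb
  have h3 := h.n_le
  have h4 : (0 : ℝ) ≤ a := by positivity
  have h5 : (0 : ℝ) ≤ b := by positivity
  push_cast
  rw [pow_one, abs_le]; constructor <;> linarith

theorem X_pow_le (h : Scale n k β W X Φ Z) {a : ℕ} (ha : a ≤ n + 1) : X ^ a ≤ Z :=
  (pow_le_pow_right₀ h.one_le_X ha).trans h.X_pow

theorem W_pos' (h : Scale n k β W X Φ Z) : (0 : ℝ) < W := by exact_mod_cast h.W_pos

theorem Z_pos (h : Scale n k β W X Φ Z) : 0 < Z := zero_lt_one.trans_le h.one_le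

theorem X_pos (h : Scale n k β W X Φ Z) : 0 < X := zero_lt_one.trans_le h.one_le_X

end Scale

/-- Exponents up to `2n + 2` are admitted because the last squaring of the base in `powCode` may
overshoot to `2n`, and products with a radius must fit too. -/
theorem Low.le_cube {n k β : ℕ} {W : ℤ} {X Φ Z : ℝ} (h : Scale n k β W X Φ Z) {c : ℝ} {z : ℤ}
    {v : ℝ} {e : ℕ} (hz : Low W X c z v e) (he : e ≤ 2 * n + 2) : (z : ℝ) ≤ Z ^ 3 := by
  have h1 : X ^ e ≤ X ^ (n + 1) * X ^ (n + 1) := by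
    rw [← pow_add]; exact pow_le_pow_right₀ h.one_le_X (by omega)
  have h2 := h.X_pow
  have h3 := h.X_pos
  have h4 := h.Z_pos
  have h5 := h.W_pos'
  have h6 := h.W_le
  calc (z : ℝ) ≤ X ^ e * W := hz.le_pow h.W_pos
    _ ≤ (X ^ (n + 1) * X ^ (n + 1)) * W := by gcongr
    _ ≤ (Z * Z) * Z := by gcongr
    _ = Z ^ 3 := by ring

/-- A lower approximation of a number below `X ^ (2n + 2)` fits. -/
theorem Low.fits {n k β : ℕ} {W : ℤ} {X Φ Z : ℝ} (h : Scale n k β W X Φ Z) {c : ℝ} {z : ℤ} {v : ℝ}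
    {e : ℕ} (hz : Low W X c z v e) (he : e ≤ 2 * n + 2) : z.natAbs < 2 ^ β := by
  refine h.fits 3 (by norm_num) ?_
  rw [abs_of_nonneg (by exact_mod_cast hz.nonneg)]
  exact hz.le_cube h he

/-- The number of steps of `powCode`. -/
def powSteps (n : ℕ) : ℕ := 7 * n.size + 3

theorem powCode_spec {O : ℕ → ℕ → ℤ} {μ : ℕ → ℤ} {n k β : ℕ} {W : ℤ} {X Φ Z : ℝ}
    (S : Scale n k β W X Φ Z) {σ : ℕ → ℤ} (hW : σ 3 = W) {c x : ℝ}
    (hx : Low W X c (σ 17) x 1) {e : ℕ} (he : (σ 16).toNat = e) (hen : e ≤ n) :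
    Tri O μ β powCode σ (powSteps n) fun σ' =>
      Low W X ((c + 1) * e) (σ' 18) (x ^ e) e ∧ Agree [16, 17, 18, 19] σ σ' := by
  have hWp := S.W_pos
  -- Square and multiply: after `p` rounds the accumulator holds `x ^ a` and the base `x ^ (2 ^ p)`,
  -- where `a` plus `2 ^ p` times the remaining exponent is `e`. The error constants `(c + 1) a` and
  -- `(c + 1) 2 ^ p - 1` are reproduced by the rule `c₁ + c₂ + 1`.
  refine Tri.steps (N := 1 + (((n.size - 0) * (6 + 1) + 1) + 1))
    (Tri.assign_cons S.bits W (by decide) hW ?_ (Tri.cons (Tri.loop S.bits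
    (by norm_num) (L := n.size) (N := 6) (p₀ := 0) (fun p σ' => ∃ a, a + 2 ^ p * (σ' 16).toNat = e ∧
      (σ' 16).toNat = e / 2 ^ p ∧ (0 < σ' 16 → Low W X ((c + 1) * 2 ^ p - 1) (σ' 17)
        (x ^ (2 ^ p)) (2 ^ p)) ∧ Low W X ((c + 1) * a) (σ' 18) (x ^ a) a ∧
        Agree [16, 17, 18, 19] σ σ') ?_ ?_ ?_ ?_))) ?_
  · exact S.fits_nat hWp.le S.W_le
  · rintro p σ' ⟨a, ha, h16, h17, h18, hag⟩ hpos
    have h17 := h17 hpos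
    have h3 : σ' 3 = W := (hag 3 (by decide)).trans hW
    obtain ⟨q, hq⟩ : ∃ q : ℕ, σ' 16 = q := ⟨(σ' 16).toNat, by omega⟩
    rw [hq, Int.toNat_natCast] at h16 ha
    have hq0 : 0 < q := by omega
    have h2p : 2 ^ p ≤ e := by nlinarith
    refine ⟨Nat.lt_size.2 (h2p.trans hen), ?_⟩
    have hpar : ∀ σ₁ : ℕ → ℤ, σ₁ 19 = ((q % 2 : ℕ) : ℤ) → Agree [19] σ' σ₁ →
        Tri O μ β (.branch 19 (assign 18 (.div (.mul (.var 18) (.var 17)) (.var 3))) (block []))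
          σ₁ 2 fun σ₂ => Low W X ((c + 1) * (a + 2 ^ p * (q % 2) : ℕ)) (σ₂ 18)
            (x ^ (a + 2 ^ p * (q % 2))) (a + 2 ^ p * (q % 2)) ∧ Agree [18, 19] σ' σ₂ := by
      intro σ₁ h19 hag1
      have g18 : σ₁ 18 = σ' 18 := hag1 18 (by decide)
      have g17 : σ₁ 17 = σ' 17 := hag1 17 (by decide)
      have g3 : σ₁ 3 = W := (hag1 3 (by decide)).trans h3
      refine Tri.branch S.bits (by norm_num) (fun hp => ?_) (fun hn => ?_)
      · have hodd : q % 2 = 1 := by omega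
        have hm := h18.mul hWp S.one_le_X h17
        have hm' : Low W X ((c + 1) * (a + 2 ^ p * (q % 2) : ℕ)) (σ' 18 * σ' 17 / W)
            (x ^ (a + 2 ^ p * (q % 2))) (a + 2 ^ p * (q % 2)) := by
          rw [hodd, mul_one, pow_add]
          refine hm.mono S.one_le_X (le_of_eq ?_)
          push_cast; ring
        have hev : Arith.eval μ σ₁ (.div (.mul (.var 18) (.var 17)) (.var 3)) =
            σ' 18 * σ' 17 / W := by simp only [Arith.eval, g18, g17, g3]
        refine Tri.assign S.bits (by decide) ?_ ?_
        · rw [hev]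
          refine hm'.fits S ?_
          have : 2 ^ p * (q % 2) ≤ 2 ^ p * q := Nat.mul_le_mul_left _ (Nat.mod_le _ _)
          omega
        · rw [hev]
          refine ⟨by rw [Function.update_self]; exact hm', ?_⟩
          exact (hag1.sub (by simp)).update (by simp) _
      · have heven : q % 2 = 0 := by omega
        refine Tri.nil S.bits ⟨?_, hag1.sub (by simp)⟩
        rw [heven, mul_zero, add_zero, g18]
        exact h18
    have hdiv : q = 2 * (q / 2) + q % 2 := by omega
    have hqe : q ≤ e := by rw [h16]; exact Nat.div_le_self _ _
    refine Tri.steps (Tri.assign_cons S.bits ((q % 2 : ℕ) : ℤ) (by decide) ?_ ?_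
      (Tri.cons (Tri.mono (hpar _ (Function.update_self _ _ _)
        ((Agree.refl _ _).update (by simp) _)) le_rfl ?_))) (N := 1 + (2 + (1 + (1 + 1)))) le_rfl
    · simp only [Arith.eval, hq]
      omega
    · exact S.fits_lit (by omega)
    · rintro σ₂ ⟨k18, kag⟩
      have k17 : σ₂ 17 = σ' 17 := kag 17 (by decide)
      have k16 : σ₂ 16 = q := (kag 16 (by decide)).trans hq
      have k3 : σ₂ 3 = W := (kag 3 (by decide)).trans h3
      have hsq := h17.mul hWp S.one_le_X h17
      refine Tri.assign_cons S.bits (σ' 17 * σ' 17 / W) (by decide) ?_ ?_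
        (Tri.assign_cons S.bits ((q / 2 : ℕ) : ℤ) (by decide) ?_ ?_ (Tri.nil S.bits ?_))
      · simp only [Arith.eval, k17, k3]
      · exact hsq.fits S (by omega)
      · simp only [Arith.eval, Function.update_of_ne (show (16 : ℕ) ≠ 17 by norm_num), k16]
        omega
      · refine S.fits_nat (by positivity) ?_
        have h1 : ((q / 2 : ℕ) : ℝ) ≤ n := by exact_mod_cast (by omega : q / 2 ≤ n)
        have := S.n_le
        have h0 : (0 : ℝ) ≤ n := by positivity
        rw [Int.cast_natCast]
        linarith
      · refine ⟨a + 2 ^ p * (q % 2), ?_, ?_, ?_, ?_, ?_⟩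
        · rw [Function.update_self, Int.toNat_natCast, ← ha, pow_succ]
          nth_rewrite 3 [hdiv]
          ring
        · rw [Function.update_self, Int.toNat_natCast, pow_succ, ← Nat.div_div_eq_div_mul, ← h16]
        · intro _
          have e2 : 2 ^ (p + 1) = 2 ^ p + 2 ^ p := by ring
          rw [Function.update_of_ne (by norm_num), Function.update_self, e2, pow_add x]
          refine hsq.mono S.one_le_X (le_of_eq ?_)
          ring
        · rw [Function.update_of_ne (by norm_num), Function.update_of_ne (by norm_num)]
          exact k18
        · exact ((hag.trans (kag.sub (by simp))).update (by simp) _).update (by simp) _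
  · rintro p σ' ⟨a, ha, h16, _, h18, hag⟩ hle
    have h0 : (σ' 16).toNat = 0 := by omega
    rw [h0, mul_zero, add_zero] at ha
    subst ha
    exact Tri.nil S.bits ⟨h18, hag⟩
  · omega
  · have h16 : Function.update σ 18 W 16 = σ 16 := Function.update_of_ne (by norm_num) _ _
    refine ⟨0, ?_, ?_, ?_, ?_, (Agree.refl _ _).update (by simp) _⟩
    · rw [h16, he]; simp
    · rw [h16, he]; simp
    · intro _
      rw [Function.update_of_ne (by norm_num)]
      simpa using hx
    · rw [Function.update_self]
      simpa using Low.one (X := X) hWp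
  · rw [powSteps]; omega

/-! ### Evaluation of the fractional derivatives and of the test coefficients -/

/-- The memory holds the exponents, the oracle is read with precision `κ`, and all quantities are
within the given scale. -/
structure Env {n k : ℕ} {τ : ℝ} (f : Nomial n k τ) (O : ℕ → ℕ → ℤ) (μ : ℕ → ℤ) (β κ : ℕ) (W : ℤ)
    (X Φ Z : ℝ) : Prop where
  scale : Scale n k β W X Φ Z
  mem_eq : ∀ a, μ a = f.expoN a
  prec_le : κ ≤ β
  coef_le : ∀ t, |f.coefN t| ≤ Φ
  oracle : ∀ t < k, |f.coefN t * W - O t κ| < 2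

/-- The registers that hold `k`, `n`, the precision and the unit. -/
structure Header (k n κ : ℕ) (W : ℤ) (σ : ℕ → ℤ) : Prop where
  k_eq : σ 0 = k
  n_eq : σ 1 = n
  prec_eq : σ 2 = κ
  unit_eq : σ 3 = W

theorem Header.agree {k n κ : ℕ} {W : ℤ} {σ σ' : ℕ → ℤ} (h : Header k n κ W σ) {L : List ℕ}
    (hag : Agree L σ σ') (hL : L.all (fun d => decide (3 < d)) = true) : Header k n κ W σ' := by
  have : ∀ d ≤ 3, d ∉ L := fun d hd hdL => by
    have := List.all_eq_true.1 hL d hdL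
    simp only [decide_eq_true_eq] at this
    omega
  exact ⟨(hag 0 (this 0 (by norm_num))).trans h.k_eq, (hag 1 (this 1 (by norm_num))).trans h.n_eq,
    (hag 2 (this 2 (by norm_num))).trans h.prec_eq, (hag 3 (this 3 (by norm_num))).trans h.unit_eq⟩

/-- The number of steps of `sumCode`. -/
def sumSteps (n k : ℕ) : ℕ := k * (5 * k + 7 * n.size + 15) + 5

section Sum

variable {n k : ℕ} {τ : ℝ} {f : Nomial n k τ} {O : ℕ → ℕ → ℤ} {μ : ℕ → ℤ} {β κ : ℕ} {W : ℤ}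
  {X Φ Z : ℝ}

theorem Scale.prod_le (S : Scale n k β W X Φ Z) {e p : ℕ} {g : ℕ → ℕ} (he : e ≤ n) (hp : p ≤ k)
    (hg : ∀ s < p, g s ≤ 2 * n) : |∏ s ∈ Finset.range p, ((e : ℝ) - g s)| ≤ Z := by
  have h1 := abs_prod_sub_le (N := 2 * n) (g := g) (e := e) p (by omega) hg
  push_cast at h1
  have hn : (1 : ℝ) ≤ n := by exact_mod_cast S.n_pos
  exact (h1.trans (pow_le_pow_right₀ (by linarith) hp)).trans S.n_pow

theorem Env.abs_oracle_le (E : Env f O μ β κ W X Φ Z) {t : ℕ} (ht : t < k) :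
    |(O t κ : ℝ)| ≤ Z ^ 2 := by
  have S := E.scale
  have h1 := abs_lt.1 (E.oracle t ht)
  have h2 := abs_le.1 (E.coef_le t)
  have h3 := S.W_pos'
  have h3' : (1 : ℝ) ≤ W := by exact_mod_cast S.W_pos
  have h4 := S.W_le
  have h5 := S.coef_le
  have h6 : f.coefN t * W ≤ Φ * W := by gcongr; exact h2.2
  have h7 : -Φ * W ≤ f.coefN t * W := by gcongr; exact h2.1
  have h8 : (Φ + 3) * W ≤ Z * Z := mul_le_mul h5 h4 h3.le S.Z_pos.le
  rw [abs_le]; constructor <;> nlinarith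

/-- The exact term contributes `Z ^ 5`, its error `18 / 2 = 9` times as much because `n ≤ Z / 2`. -/
theorem Scale.term_le (S : Scale n k β W X Φ Z) : Φ * (2 * n) ^ k * X ^ n * W ^ 2 +
    W * termErr n k Φ X ≤ 10 * Z ^ 5 := by
  have h1 : Φ ≤ Z := by have := S.coef_le; linarith
  have h2 := S.n_pow
  have h3 := S.X_pow_le (Nat.le_succ n)
  have h4 := S.W_le
  have h5 : (n : ℝ) ≤ Z / 2 := by have := S.n_le; linarith
  have z := S.Z_pos
  have w := S.W_pos'
  have x := S.X_pos
  have p := S.one_le_coef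
  have e1 : Φ * (2 * n) ^ k * X ^ n * W ^ 2 ≤ Z * Z * Z * Z ^ 2 := by gcongr
  have e2 : W * termErr n k Φ X ≤ Z * (18 * (Z / 2) * Z * Z * Z) := by
    rw [termErr]; gcongr
  calc _ ≤ Z * Z * Z * Z ^ 2 + Z * (18 * (Z / 2) * Z * Z * Z) := add_le_add e1 e2
    _ = 10 * Z ^ 5 := by ring

theorem Scale.partial_le (S : Scale n k β W X Φ Z) {t : ℕ} (ht : t ≤ k) :
    (t : ℝ) * (10 * Z ^ 5) ≤ Z ^ 7 := by
  have h1 : (t : ℝ) ≤ Z := by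
    have : (t : ℝ) ≤ k := by exact_mod_cast ht
    have := S.k_le'
    linarith
  have h2 : (10 : ℝ) ≤ Z := le_trans (by norm_num) S.large
  have := S.Z_pos
  calc (t : ℝ) * (10 * Z ^ 5) ≤ Z * (Z * Z ^ 5) := by gcongr
    _ = Z ^ 7 := by ring

theorem abs_partial_le (E : Env f O μ β κ W X Φ Z) {g : ℕ → ℕ} {i : ℕ} {x : ℝ}
    (hi : i ≤ k) (hg : ∀ s < i, g s ≤ 2 * n) (hx0 : 0 ≤ x) (hx : x ≤ X) {t : ℕ} (ht : t ≤ k) {v : ℤ}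
    (hv : |(v : ℝ) - (∑ t ∈ Finset.range t, f.gterm g i x t) * W ^ 2| ≤
      t * (W * termErr n k Φ X)) : |(v : ℝ)| ≤ Z ^ 7 := by
  have S := E.scale
  have h1 : |∑ t ∈ Finset.range t, f.gterm g i x t| ≤ t * (Φ * (2 * n) ^ k * X ^ n) := by
    refine (Finset.abs_sum_le_sum_abs _ _).trans ((Finset.sum_le_card_nsmul _ _ _ fun s _ =>
      f.abs_gterm_le hi hg S.one_le_X hx0 hx (E.coef_le s)).trans ?_)
    rw [Finset.card_range, nsmul_eq_mul]
  have hW : (0 : ℝ) ≤ (W : ℝ) ^ 2 := by positivity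
  have h2 : |(∑ t ∈ Finset.range t, f.gterm g i x t) * (W : ℝ) ^ 2| ≤
      t * (Φ * (2 * n) ^ k * X ^ n) * W ^ 2 := by
    rw [abs_mul, abs_of_nonneg hW]; gcongr
  have h3 := abs_sub_abs_le_abs_sub (v : ℝ) ((∑ t ∈ Finset.range t, f.gterm g i x t) * (W : ℝ) ^ 2)
  have h4 := S.partial_le ht
  have h5 := mul_le_mul_of_nonneg_left S.term_le (show (0 : ℝ) ≤ t by positivity)
  linarith

/-- One factor after the other. -/
theorem prodLoop_spec (E : Env f O μ β κ W X Φ Z) {g : ℕ → ℕ} {i : ℕ} (hi : i ≤ k)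
    (hg : ∀ s ≤ i, g s ≤ 2 * n) {σ : ℕ → ℤ}
    (hnode : ∀ s ≤ i, σ 6 * s + (1 - σ 6) * μ s = g s) {t : ℕ} (ht : t < k)
    (h12 : σ 12 = f.expoN t) (h13 : σ 13 = O t κ) (h14 : σ 14 = 0) (h15 : σ 15 = i) :
    Tri O μ β (.loop 15 (block [
      assign 13 (.mul (.var 13) (.sub (.var 12) nodeArith)),
      assign 14 (.add (.var 14) (.lit 1)),
      assign 15 (.sub (.var 15) (.lit 1))])) σ (5 * k + 1) fun σ' =>
        (σ' 13 : ℝ) = O t κ * ∏ s ∈ Finset.range i, ((f.expoN t : ℝ) - g s) ∧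
        σ' 14 = i ∧ Agree [13, 14, 15] σ σ' := by
  have S := E.scale
  refine Tri.steps (N := ((i - 0) * (4 + 1) + 1)) (Tri.loop S.bits (by norm_num) (L := i) (p₀ := 0)
    (fun p σ' => p ≤ i ∧
      (σ' 13 : ℝ) = O t κ * ∏ s ∈ Finset.range p, ((f.expoN t : ℝ) - g s) ∧
      σ' 14 = p ∧ σ' 15 = i - p ∧ Agree [13, 14, 15] σ σ') ?_ ?_ (Nat.zero_le _) ?_) (by omega)
  · rintro p σ' ⟨hp, k13, k14, k15, hag⟩ hpos
    have hpi : p < i := by omega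
    have k6 := hag 6 (by decide)
    have k12 := (hag 12 (by decide)).trans h12
    have hn : ∀ ρ : ℕ → ℤ, ρ 6 = σ 6 → ρ 14 = p → nodeArith.eval μ ρ = g p := by
      intro ρ e6 e14
      simp only [nodeArith, Arith.eval, e6, e14, Int.toNat_natCast]
      exact hnode p hpi.le
    have hval : ((σ' 13 * ((f.expoN t : ℤ) - g p) : ℤ) : ℝ) =
        O t κ * ∏ s ∈ Finset.range (p + 1), ((f.expoN t : ℝ) - g s) := by
      rw [Finset.prod_range_succ]; push_cast; rw [k13]; ring
    refine ⟨hpi, Tri.steps (N := 1 + (1 + (1 + 1))) (Tri.assign_cons S.bits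
      (σ' 13 * ((f.expoN t : ℤ) - g p)) (by decide) ?_ ?_
      (Tri.assign_cons S.bits ((p + 1 : ℕ) : ℤ) (by decide) ?_ ?_
      (Tri.assign_cons S.bits ((i : ℤ) - (p + 1 : ℕ)) (by decide) ?_ ?_
      (Tri.nil S.bits ⟨hpi, ?_, ?_, ?_, ?_⟩)))) le_rfl⟩
    · simp only [Arith.eval, hn σ' k6 k14, k12]
    · refine S.fits 3 (by norm_num) ?_
      rw [hval, abs_mul]
      have h1 := E.abs_oracle_le ht
      have h2 := S.prod_le (e := f.expoN t) (p := p + 1) (g := g) (f.expoN_le t) (by omega)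
        (fun s hs => hg s (by omega))
      calc _ ≤ Z ^ 2 * Z := mul_le_mul h1 h2 (abs_nonneg _) (by positivity)
        _ = Z ^ 3 := by ring
    · simp [Arith.eval, k14]
    · exact S.fits_index (by omega) (by push_cast; omega)
    · simp [Arith.eval, k15]; ring
    · exact S.fits_index (by push_cast; omega) (by push_cast; omega)
    · simpa using hval
    · simp
    · simp
    · exact ((hag.update (by simp) _).update (by simp) _).update (by simp) _
  · rintro p σ' ⟨hp, k13, k14, k15, hag⟩ hle
    obtain rfl : p = i := by omega
    exact ⟨k13, k14, hag⟩
  · exact ⟨Nat.zero_le _, by simp [h13], by simp [h14], by simp [h15], Agree.refl _ _⟩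

/-- One routine serves both kinds of derivatives: register `6` equal to `0` selects the exponents as
nodes, equal to `1` the integers. Coefficient and power each carry a factor `W`, so the result is in
units of `W ^ (-2)`. -/
theorem sumCode_spec (E : Env f O μ β κ W X Φ Z) {g : ℕ → ℕ} {i : ℕ} (hi : i ≤ k)
    (hg : ∀ s ≤ i, g s ≤ 2 * n) {σ : ℕ → ℤ} (hσ : Header k n κ W σ)
    (hnode : ∀ s ≤ i, σ 6 * s + (1 - σ 6) * μ s = g s) {x : ℝ}
    (hx : Low W X 15 (σ 7) x 1) (h8 : σ 8 = i) :
    Tri O μ β sumCode σ (sumSteps n k) fun σ' =>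
      |(σ' 9 : ℝ) - f.gsum g i x * W ^ 2| ≤ k * (W * termErr n k Φ X) ∧ |(σ' 9 : ℝ)| ≤ Z ^ 7 ∧
        Agree [9, 10, 11, 12, 13, 14, 15, 16, 17, 18, 19] σ σ' := by
  have S := E.scale
  have hx1 : x ≤ X := by simpa using hx.val_le
  have hfin : ∀ t ≤ k, ∀ v : ℤ, |(v : ℝ) - (∑ t ∈ Finset.range t, f.gterm g i x t) * W ^ 2| ≤
      t * (W * termErr n k Φ X) → |(v : ℝ)| ≤ Z ^ 7 := fun t ht v hv =>
    abs_partial_le E hi (fun s hs => hg s hs.le) hx.val_nonneg hx1 ht hv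
  have hterm : 0 ≤ W * termErr n k Φ X := by
    have := S.W_pos'
    have := S.one_le_coef
    have := S.X_pos
    rw [termErr]; positivity
  refine Tri.steps (N := 1 + (1 + (1 + (((k - 0) * ((5 * k + 7 * n.size + 14) + 1) + 1) + 1))))
    (Tri.assign_cons S.bits 0 (by decide) rfl (S.fits_lit (by norm_num))
    (Tri.assign_cons S.bits 0 (by decide) rfl (S.fits_lit (by norm_num))
    (Tri.assign_cons S.bits k (by decide) (by simp [Arith.eval, hσ.k_eq])
      (S.fits_index (by omega) (by omega))
    (Tri.cons (Tri.loop S.bits (by norm_num) (L := k) (p₀ := 0)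
    (fun t σ' => t ≤ k ∧
      |(σ' 9 : ℝ) - (∑ t ∈ Finset.range t, f.gterm g i x t) * W ^ 2| ≤
        t * (W * termErr n k Φ X) ∧ σ' 10 = t ∧ σ' 11 = k - t ∧
      Agree [9, 10, 11, 12, 13, 14, 15, 16, 17, 18, 19] σ σ') ?_ ?_ (Nat.zero_le _) ?_)))))
    (le_of_eq (by rw [sumSteps, Nat.sub_zero]; ring))
  · rintro t σ₁ ⟨ht, k9, k10, k11, hag⟩ hpos
    have htk : t < k := by omega
    have hH := hσ.agree hag (by decide)
    refine ⟨htk, Tri.steps (N := 1 + (1 + (1 + (1 + ((5 * k + 1) + (1 + (1 + (powSteps n +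
      (1 + (1 + (1 + 1)))))))))))
      (Tri.assign_cons S.bits (f.expoN t) (by decide) (by simp [Arith.eval, k10, E.mem_eq]) ?_
      (Tri.cons (Tri.query S.bits (by norm_num) (by norm_num) ?_ ?_
      (Tri.assign_cons S.bits 0 (by decide) rfl (S.fits_lit (by norm_num))
      (Tri.assign_cons S.bits i (by decide) ?_ (S.fits_index (by omega) (by omega))
      (Tri.cons (Tri.mono (prodLoop_spec E hi hg (t := t) ?_ htk ?_ ?_ ?_ ?_) le_rfl ?_))))))) ?_⟩
    · exact S.fits_nat (by positivity) (by
        have h1 : (f.expoN t : ℝ) ≤ n := by exact_mod_cast f.expoN_le t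
        have h2 := S.n_le
        have h0 : (0 : ℝ) ≤ n := by positivity
        rw [Int.cast_natCast]; linarith)
    · simpa [hH.prec_eq] using E.prec_le
    · simpa [k10, hH.prec_eq] using S.fits 2 (by norm_num) (E.abs_oracle_le htk)
    · simp [Arith.eval, (hag 8 (by decide)).trans h8]
    · intro s hs
      simpa [hag 6 (by decide)] using hnode s hs
    · simp
    · simp [k10, hH.prec_eq]
    · simp
    · simp
    · rintro σ₂ ⟨m13, m14, mag⟩
      have hag2 : Agree [9, 10, 11, 12, 13, 14, 15, 16, 17, 18, 19] σ σ₂ :=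
        ((((hag.update (by simp) _).update (by simp) _).update (by simp) _).update (by simp)
          _).trans (mag.sub (by simp))
      have m12 : σ₂ 12 = f.expoN t := by rw [mag 12 (by decide)]; simp
      have m9 : σ₂ 9 = σ₁ 9 := by rw [mag 9 (by decide)]; simp
      have m10 : σ₂ 10 = t := by rw [mag 10 (by decide)]; simp [k10]
      have m11 : σ₂ 11 = k - t := by rw [mag 11 (by decide)]; simp [k11]
      have m7 := hag2 7 (by decide)
      have m6 := hag2 6 (by decide)
      have hH2 := hσ.agree hag2 (by decide)
      refine Tri.assign_cons S.bits (σ 7) (by decide) (by simp [Arith.eval, m7])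
        (hx.fits S (by have := S.n_pos; omega))
        (Tri.assign_cons S.bits ((f.expoN t : ℤ) - g i) (by decide) ?_
          (S.fits_sub (f.expoN_le t) (hg i le_rfl))
        (Tri.cons (Tri.mono (powCode_spec S (c := 15) (x := x) (e := f.expoN t - g i) ?_ ?_ ?_ ?_)
          le_rfl ?_)))
      · have e6 : Function.update σ₂ 17 (σ 7) 6 = σ 6 := by simp [m6]
        have e14 : Function.update σ₂ 17 (σ 7) 14 = i := by simp [m14]
        have e12 : Function.update σ₂ 17 (σ 7) 12 = f.expoN t := by simp [m12]
        simp only [Arith.eval, nodeArith, e6, e14, e12, Int.toNat_natCast, hnode i le_rfl]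
      · simp [hH2.unit_eq]
      · simpa using hx
      · simp
      · have := f.expoN_le t; omega
      · rintro σ₃ ⟨hz, pag⟩
        have p13 : σ₃ 13 = σ₂ 13 := by rw [pag 13 (by decide)]; simp
        have p9 : σ₃ 9 = σ₁ 9 := by rw [pag 9 (by decide)]; simp [m9]
        have p10 : σ₃ 10 = t := by rw [pag 10 (by decide)]; simp [m10]
        have p11 : σ₃ 11 = k - t := by rw [pag 11 (by decide)]; simp [m11]
        have hag3 : Agree [9, 10, 11, 12, 13, 14, 15, 16, 17, 18, 19] σ σ₃ :=
          ((hag2.update (by simp) _).update (by simp) _).trans (pag.sub (by simp))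
        have herr := f.gterm_error (g := g) (i := i) (x := x) (t := t) hi
          (fun s hs => hg s hs.le) S.W_pos S.one_le_X S.one_le_coef (E.coef_le t) (E.oracle t htk)
          (hz.mono S.one_le_X (by norm_num))
        rw [← m13, ← p13] at herr
        have hnew : |((σ₁ 9 + σ₃ 13 * σ₃ 18 : ℤ) : ℝ) -
            (∑ t ∈ Finset.range (t + 1), f.gterm g i x t) * W ^ 2| ≤
            (t + 1 : ℕ) * (W * termErr n k Φ X) := by
          rw [Finset.sum_range_succ, add_mul]
          push_cast
          rw [abs_le] at herr k9 ⊢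
          constructor <;> linarith [herr.1, herr.2, k9.1, k9.2]
        refine Tri.assign_cons S.bits (σ₁ 9 + σ₃ 13 * σ₃ 18) (by decide)
          (by simp only [Arith.eval, p9]) (S.fits 7 (by norm_num) (hfin (t + 1) htk _ hnew))
          (Tri.assign_cons S.bits ((t + 1 : ℕ) : ℤ) (by decide) ?_
            (S.fits_index (by omega) (by omega))
          (Tri.assign_cons S.bits ((k : ℤ) - (t + 1 : ℕ)) (by decide) ?_
            (S.fits_index (by omega) (by omega))
          (Tri.nil S.bits ⟨htk, ?_, ?_, ?_, ?_⟩)))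
        · simp [Arith.eval, p10]
        · simp [Arith.eval, p11]; ring
        · simpa using hnew
        · simp
        · simp
        · exact ((hag3.update (by simp) _).update (by simp) _).update (by simp) _
    · rw [powSteps]; omega
  · rintro t σ₁ ⟨ht, k9, k10, k11, hag⟩ hle
    obtain rfl : t = k := by omega
    refine Tri.nil S.bits ⟨?_, hfin _ le_rfl _ k9, hag⟩
    rw [f.gsum_eq_sum_range]; exact k9
  · refine ⟨Nat.zero_le _, ?_, ?_, ?_, ?_⟩
    · simp
    · simp
    · simp
    · exact (((Agree.refl _ _).update (by simp) _).update (by simp) _).update (by simp) _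

end Sum

/-! ### Selection of an admissible point -/

open Arith in
/-- Register `7 :=` the point of the multipoint whose index is in register `25`. -/
def candCode : Program := block [
  assign 7 (sub (div (add (mul (var 4) (mul (var 0) (var 0)))
    (mul (sub (var 25) (mul (var 0) (var 0))) (var 5))) (mul (var 0) (var 0))) (lit 4)),
  .branch 7 (block []) (assign 7 (lit 0))]

open Arith in
/-- Register `27 := |register 9|`. -/
def absCode : Program := block [
  assign 27 (var 9),
  .branch 27 (block []) (assign 27 (sub (lit 0) (var 27)))]

open Arith in
/-- Register `21 :=` the least of the absolute values of the fractional derivatives at the point in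
register `7`. -/
def minCode : Program := block [
  assign 8 (lit 0), assign 21 (lit 0), assign 22 (var 0),
  .loop 22 (block [
    sumCode, absCode,
    assign 31 (sub (var 21) (var 27)),
    -- In the first round register `8` is `0` and the minimum is initialised; only afterwards is it
    -- compared.
    .branch 8
      (.branch 31 (assign 21 (var 27)) (block []))
      (assign 21 (var 27)),
    assign 8 (add (var 8) (lit 1)),
    assign 22 (sub (var 22) (lit 1))])]

open Arith in
/-- Register `24 :=` the index of the point with the largest minimum, register `23 :=` that
minimum. -/
def bestCode : Program := block [
  -- The value `-1` is below every computed minimum, so the first point is always taken.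
  assign 6 (lit 0), assign 23 (lit (-1)), assign 24 (lit 0), assign 25 (lit 0),
  assign 26 (add (mul (lit 2) (mul (var 0) (var 0))) (lit 1)),
  .loop 26 (block [
    candCode, minCode,
    assign 31 (sub (var 21) (var 23)),
    .branch 31 (block [assign 23 (var 21), assign 24 (var 25)]) (block []),
    assign 25 (add (var 25) (lit 1)),
    assign 26 (sub (var 26) (lit 1))])]

/-- Registers `4` and `5` hold approximations of the center and the radius. -/
structure Disk (m r X : ℝ) (W : ℤ) (σ : ℕ → ℤ) : Prop where
  r_pos : 0 < r
  r_lt : r < m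
  le_X : m + r ≤ X
  center : |m * W - σ 4| < 2
  radius : |r * W - σ 5| < 2

theorem Disk.agree {m r X : ℝ} {W : ℤ} {σ σ' : ℕ → ℤ} (h : Disk m r X W σ) (h4 : σ' 4 = σ 4)
    (h5 : σ' 5 = σ 5) : Disk m r X W σ' :=
  ⟨h.r_pos, h.r_lt, h.le_X, by rw [h4]; exact h.center, by rw [h5]; exact h.radius⟩

section Select

variable {n k : ℕ} {τ : ℝ} {f : Nomial n k τ} {O : ℕ → ℕ → ℤ} {μ : ℕ → ℤ} {β κ : ℕ} {W : ℤ}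
  {X Φ Z m r : ℝ}

theorem Disk.abs_le {σ : ℕ → ℤ} (D : Disk m r X W σ) (S : Scale n k β W X Φ Z) :
    |(σ 4 : ℝ)| ≤ Z ^ 3 ∧ |(σ 5 : ℝ)| ≤ Z ^ 3 := by
  have h1 := abs_lt.1 D.center
  have h2 := abs_lt.1 D.radius
  have h3 := D.r_pos
  have h4 := D.r_lt
  have h5 := D.le_X
  have hX : X ≤ Z := by simpa using S.X_pow_le (a := 1) (by omega)
  have hW := S.W_pos'
  have hWZ := S.W_le
  have hZ := S.large
  have hZ1 : (2 : ℝ) ≤ Z := le_trans (by norm_num) hZ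
  have e1 : m * W ≤ Z * Z := by gcongr; linarith
  have e2 : r * W ≤ Z * Z := by gcongr; linarith
  have e3 : 0 ≤ m * W := mul_nonneg (by linarith) hW.le
  have e4 : 0 ≤ r * W := by positivity
  have e5 : Z * Z + 2 ≤ Z ^ 3 := by nlinarith
  constructor <;> rw [_root_.abs_le] <;> constructor <;> linarith

theorem candCode_spec (S : Scale n k β W X Φ Z) {σ : ℕ → ℤ} (hσ : Header k n κ W σ)
    (D : Disk m r X W σ) {j : ℕ} (hj : j ≤ 2 * k ^ 2) (h25 : σ 25 = j) :
    Tri O μ β candCode σ 4 fun σ' => Low W X 15 (σ' 7) (candidate k m r j) 1 ∧ Agree [7] σ σ' := by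
  have hk := S.two_le
  set x₀ := (σ 4 * ((k : ℤ) * k) + ((j : ℤ) - (k : ℤ) * k) * σ 5) / ((k : ℤ) * k) - 4 with hx₀
  have hlow := low_candidate (by omega) D.r_pos D.r_lt D.le_X S.one_le_X S.W_pos D.center D.radius
    hj rfl
  have hev : Arith.eval μ σ (.sub (.div (.add (.mul (.var 4) (.mul (.var 0) (.var 0)))
      (.mul (.sub (.var 25) (.mul (.var 0) (.var 0))) (.var 5))) (.mul (.var 0) (.var 0)))
      (.lit 4)) = x₀ := by
    simp only [Arith.eval, hσ.k_eq, h25, hx₀]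
  refine Tri.steps (N := 1 + ((1 + 1) + 1)) (Tri.assign_cons S.bits x₀ (by decide) hev ?_
    (Tri.cons (Tri.branch S.bits (by norm_num) (fun hp => ?_) (fun hn => ?_)))) le_rfl
  · have hnum : |((σ 4 * ((k : ℤ) * k) + ((j : ℤ) - (k : ℤ) * k) * σ 5 : ℤ) : ℝ)| ≤ 2 * Z ^ 5 := by
      obtain ⟨h4, h5⟩ := D.abs_le S
      have hkZ : (k : ℝ) ≤ Z := by have := S.k_le'; linarith
      have hkk : (k : ℝ) * k ≤ Z * Z := by have := S.Z_pos; gcongr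
      have hjk : |(j : ℝ) - k * k| ≤ k * k := by
        have : (j : ℝ) ≤ 2 * (k * k) := by
          have : j ≤ 2 * (k * k) := by rw [← pow_two]; exact hj
          exact_mod_cast this
        have : (0 : ℝ) ≤ j := by positivity
        rw [abs_le]; constructor <;> linarith
      have z := S.Z_pos
      push_cast
      refine (abs_add_le _ _).trans ?_
      rw [abs_mul (σ 4 : ℝ), abs_mul ((j : ℝ) - k * k),
        abs_of_nonneg (show (0 : ℝ) ≤ (k : ℝ) * k by positivity)]
      calc _ ≤ Z ^ 3 * (Z * Z) + (Z * Z) * Z ^ 3 := by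
            have := hjk.trans hkk
            gcongr
        _ = 2 * Z ^ 5 := by ring
    set N₀ := σ 4 * ((k : ℤ) * k) + ((j : ℤ) - (k : ℤ) * k) * σ 5 with hN₀
    have hq : |((N₀ / ((k : ℤ) * k) : ℤ) : ℝ)| ≤ 2 * Z ^ 5 := by
      refine le_trans ?_ hnum
      rw [← Int.cast_abs, ← Int.cast_abs, Int.abs_eq_natAbs, Int.abs_eq_natAbs]
      exact_mod_cast Int.natAbs_ediv_le_natAbs _ _
    refine S.fits 6 (by norm_num) ?_
    have hZ : (6 : ℝ) ≤ Z := le_trans (by norm_num) S.large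
    have hZ5 : 1 ≤ Z ^ 5 := one_le_pow₀ S.one_le
    have h6 : 6 * Z ^ 5 ≤ Z ^ 6 := by
      calc 6 * Z ^ 5 ≤ Z * Z ^ 5 := by gcongr
        _ = Z ^ 6 := by ring
    rw [hx₀]
    push_cast at hq ⊢
    rw [abs_le] at hq ⊢
    constructor <;> linarith [hq.1, hq.2]
  · rw [Function.update_self] at hp
    refine Tri.nil S.bits (Tri.nil S.bits ⟨?_, (Agree.refl _ _).update (by simp) _⟩)
    rw [Function.update_self]
    rwa [max_eq_right hp.le] at hlow
  · rw [Function.update_self] at hn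
    refine Tri.assign S.bits (by decide) (S.fits_lit (by simp [Arith.eval])) (Tri.nil S.bits ⟨?_,
      ((Agree.refl _ _).update (by simp) _).update (by simp) _⟩)
    rw [Function.update_self]
    rwa [max_eq_left hn] at hlow

theorem absCode_spec (hβ : 64 ≤ β) {σ : ℕ → ℤ} (h : (σ 9).natAbs < 2 ^ β) :
    Tri O μ β absCode σ 4 fun σ' => σ' 27 = |σ 9| ∧ Agree [27] σ σ' := by
  refine Tri.steps (N := 1 + ((1 + 1) + 1)) (Tri.assign_cons hβ (σ 9) (by decide) rfl h
    (Tri.cons (Tri.branch hβ (by norm_num) (fun hp => ?_) (fun hn => ?_)))) le_rfl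
  · rw [Function.update_self] at hp
    refine Tri.nil hβ (Tri.nil hβ ⟨?_, (Agree.refl _ _).update (by simp) _⟩)
    rw [Function.update_self, abs_of_pos hp]
  · rw [Function.update_self] at hn
    have hev : Arith.eval μ (Function.update σ 27 (σ 9)) (.sub (.lit 0) (.var 27)) = |σ 9| := by
      simp [Arith.eval, abs_of_nonpos hn]
    refine Tri.assign hβ (by decide) (by rw [hev, Int.natAbs_abs]; exact h)
      (Tri.nil hβ ⟨?_, ((Agree.refl _ _).update (by simp) _).update (by simp) _⟩)
    rw [Function.update_self, hev]

/-- The number of steps of `minCode`. -/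
def minSteps (n k : ℕ) : ℕ := k * (sumSteps n k + 12) + 5

/-- Taking a minimum does not amplify errors: the running value stays below every true absolute
value plus `δ`, and above at least one of them minus `δ`. -/
theorem minCode_spec (E : Env f O μ β κ W X Φ Z) {σ : ℕ → ℤ} (hσ : Header k n κ W σ)
    (h6 : σ 6 = 0) {x : ℝ} (hx : Low W X 15 (σ 7) x 1) :
    Tri O μ β minCode σ (minSteps n k) fun σ' =>
      |(σ' 21 : ℝ) - f.minAbs x * W ^ 2| ≤ k * (W * termErr n k Φ X) ∧ 0 ≤ σ' 21 ∧
        (σ' 21 : ℝ) ≤ Z ^ 7 ∧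
        Agree [8, 9, 10, 11, 12, 13, 14, 15, 16, 17, 18, 19, 21, 22, 27, 31] σ σ' := by
  have S := E.scale
  set δ : ℝ := k * (W * termErr n k Φ X) with hδ
  have hk := S.two_le
  have hW2 : (0 : ℝ) < (W : ℝ) ^ 2 := by have := S.W_pos'; positivity
  refine Tri.steps (N := 1 + (1 + (1 + (((k - 0) * ((sumSteps n k + 11) + 1) + 1) + 1))))
    (Tri.assign_cons S.bits 0 (by decide) rfl (S.fits_lit (by norm_num))
    (Tri.assign_cons S.bits 0 (by decide) rfl (S.fits_lit (by norm_num))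
    (Tri.assign_cons S.bits k (by decide) (by simp [Arith.eval, hσ.k_eq])
      (S.fits_index (by omega) (by omega))
    (Tri.cons (Tri.loop S.bits (by norm_num) (L := k) (p₀ := 0)
    (fun p σ' => p ≤ k ∧ (∀ s < p, (σ' 21 : ℝ) ≤ |f.gsum f.expoN s x| * W ^ 2 + δ) ∧
      (0 < p → ∃ s < p, |f.gsum f.expoN s x| * W ^ 2 - δ ≤ σ' 21) ∧ 0 ≤ σ' 21 ∧
      (σ' 21 : ℝ) ≤ Z ^ 7 ∧ σ' 8 = p ∧ σ' 22 = k - p ∧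
      Agree [8, 9, 10, 11, 12, 13, 14, 15, 16, 17, 18, 19, 21, 22, 27, 31] σ σ')
      ?_ ?_ (Nat.zero_le _) ?_)))))
    (le_of_eq (by rw [minSteps, Nat.sub_zero]; ring))
  · rintro p σ₁ ⟨hp, hup, hlo, h0, hZ, k8, k22, hag⟩ hpos
    have hpk : p < k := by omega
    refine ⟨hpk, Tri.steps (N := sumSteps n k + (4 + (1 + (3 + (1 + (1 + 1)))))) (Tri.cons (Tri.mono
      (sumCode_spec E (g := f.expoN) (x := x) hpk.le (fun s _ => by have := f.expoN_le s; omega)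
        (hσ.agree hag (by decide)) ?_ ?_ k8) le_rfl ?_)) (by omega)⟩
    · intro s _
      rw [hag 6 (by decide), h6, E.mem_eq]; ring
    · rw [hag 7 (by decide)]; exact hx
    · rintro σ₂ ⟨herr, hb, hag2⟩
      have k21 : σ₂ 21 = σ₁ 21 := hag2 21 (by decide)
      have k8' : σ₂ 8 = p := (hag2 8 (by decide)).trans k8
      have k22' : σ₂ 22 = k - p := (hag2 22 (by decide)).trans k22
      have hag2' := hag.trans (hag2.sub
        (L' := [8, 9, 10, 11, 12, 13, 14, 15, 16, 17, 18, 19, 21, 22, 27, 31]) (by simp))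
      have hfit := S.fits 7 (by norm_num) hb
      refine Tri.cons (Tri.mono (absCode_spec S.bits hfit) le_rfl ?_)
      rintro σ₃ ⟨k27, hag3⟩
      set T : ℤ := |σ₂ 9| with hT
      have hT0 : 0 ≤ T := abs_nonneg _
      have hTZ : (T : ℝ) ≤ Z ^ 7 := by rw [hT]; push_cast; exact hb
      have hfitT : T.natAbs < 2 ^ β := by rw [hT, Int.natAbs_abs]; exact hfit
      have hTerr : |(T : ℝ) - |f.gsum f.expoN p x| * W ^ 2| ≤ δ := by
        have h1 := abs_abs_sub_abs_le_abs_sub (σ₂ 9 : ℝ) (f.gsum f.expoN p x * (W : ℝ) ^ 2)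
        rw [abs_mul _ ((W : ℝ) ^ 2), abs_of_pos hW2] at h1
        rw [hT]; push_cast
        exact h1.trans herr
      rw [abs_le] at hTerr
      have j21 : σ₃ 21 = σ₁ 21 := (hag3 21 (by decide)).trans k21
      have j8 : σ₃ 8 = p := (hag3 8 (by decide)).trans k8'
      have j22 : σ₃ 22 = k - p := (hag3 22 (by decide)).trans k22'
      have hag3' := hag2'.trans (hag3.sub
        (L' := [8, 9, 10, 11, 12, 13, 14, 15, 16, 17, 18, 19, 21, 22, 27, 31]) (by simp))
      have hend : ∀ σ₄ : ℕ → ℤ, (σ₄ 21 = T ∧ (p = 0 ∨ T ≤ σ₁ 21) ∨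
          σ₄ 21 = σ₁ 21 ∧ 0 < p ∧ σ₁ 21 ≤ T) → Agree [21, 31] σ₃ σ₄ →
          Tri O μ β (block [assign 8 (.add (.var 8) (.lit 1)), assign 22 (.sub (.var 22) (.lit 1))])
            σ₄ (1 + (1 + 1)) fun σ' => p + 1 ≤ k ∧
              (∀ s < p + 1, (σ' 21 : ℝ) ≤ |f.gsum f.expoN s x| * W ^ 2 + δ) ∧
              (0 < p + 1 → ∃ s < p + 1, |f.gsum f.expoN s x| * W ^ 2 - δ ≤ σ' 21) ∧ 0 ≤ σ' 21 ∧
              (σ' 21 : ℝ) ≤ Z ^ 7 ∧ σ' 8 = (p + 1 : ℕ) ∧ σ' 22 = k - (p + 1 : ℕ) ∧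
              Agree [8, 9, 10, 11, 12, 13, 14, 15, 16, 17, 18, 19, 21, 22, 27, 31] σ σ' := by
        intro σ₄ hmin hag4
        have i8 : σ₄ 8 = p := (hag4 8 (by decide)).trans j8
        have i22 : σ₄ 22 = k - p := (hag4 22 (by decide)).trans j22
        have hag4' := hag3'.trans (hag4.sub
          (L' := [8, 9, 10, 11, 12, 13, 14, 15, 16, 17, 18, 19, 21, 22, 27, 31]) (by simp))
        refine Tri.assign_cons S.bits ((p + 1 : ℕ) : ℤ) (by decide) (by simp [Arith.eval, i8])
            (S.fits_index (by omega) (by omega))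
          (Tri.assign_cons S.bits ((k : ℤ) - (p + 1 : ℕ)) (by decide)
            (by simp [Arith.eval, i22]; ring) (S.fits_index (by omega) (by omega))
          (Tri.nil S.bits ?_))
        have e21 : Function.update (Function.update σ₄ 8 ((p + 1 : ℕ) : ℤ)) 22
            ((k : ℤ) - (p + 1 : ℕ)) 21 = σ₄ 21 := by simp
        rw [e21]
        refine ⟨hpk, ?_, ?_, ?_, ?_, by simp, by simp, (hag4'.update (by simp) _).update
          (by simp) _⟩
        · intro s hs
          rcases Nat.lt_succ_iff_lt_or_eq.1 hs with hs | rfl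
          · have := hup s hs
            rcases hmin with ⟨e, h | h⟩ | ⟨e, _, _⟩
            · omega
            · have h' : (T : ℝ) ≤ σ₁ 21 := by exact_mod_cast h
              rw [e]; linarith
            · rw [e]; exact this
          · rcases hmin with ⟨e, h⟩ | ⟨e, _, h⟩
            · rw [e]; linarith
            · have h' : (σ₁ 21 : ℝ) ≤ T := by exact_mod_cast h
              rw [e]; linarith
        · intro _
          rcases hmin with ⟨e, h⟩ | ⟨e, h, _⟩
          · exact ⟨p, Nat.lt_succ_self p, by rw [e]; linarith⟩
          · obtain ⟨s, hs, hs'⟩ := hlo h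
            exact ⟨s, hs.trans (Nat.lt_succ_self p), by rw [e]; exact hs'⟩
        · rcases hmin with ⟨e, h⟩ | ⟨e, h, _⟩ <;> rw [e] <;> assumption
        · rcases hmin with ⟨e, h⟩ | ⟨e, h, _⟩ <;> rw [e] <;> assumption
      refine Tri.assign_cons S.bits (σ₁ 21 - T) (by decide)
        (by simp only [Arith.eval, j21, k27]) ?_
        (Tri.cons (Tri.branch (N := 2) S.bits (by norm_num) (fun hp8 => ?_) (fun hn8 => ?_)))
      · refine S.fits 7 (by norm_num) ?_
        have e1 : (0 : ℝ) ≤ T := by exact_mod_cast hT0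
        have e2 : (0 : ℝ) ≤ σ₁ 21 := by exact_mod_cast h0
        push_cast
        rw [abs_le]; constructor <;> linarith
      · have hp8' : 0 < p := by simpa [j8] using hp8
        refine Tri.branch (N := 1) S.bits (by norm_num) (fun h31 => ?_) (fun h31 => ?_)
        · rw [Function.update_self] at h31
          refine Tri.assign S.bits (by decide) (by simpa [Arith.eval, k27] using hfitT) (hend _
            (Or.inl ⟨by simp [Arith.eval, k27], Or.inr (by omega)⟩)
            (((Agree.refl _ _).update (by simp) _).update (by simp) _))
        · rw [Function.update_self] at h31
          exact Tri.nil S.bits (hend _ (Or.inr ⟨by simp [j21], hp8', by omega⟩)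
            ((Agree.refl _ _).update (by simp) _))
      · have hn8' : p = 0 := by
          have : (p : ℤ) ≤ 0 := by simpa [j8] using hn8
          omega
        refine Tri.steps (N := 1) (Tri.assign S.bits (by decide)
          (by simpa [Arith.eval, k27] using hfitT) (hend _
            (Or.inl ⟨by simp [Arith.eval, k27], Or.inl hn8'⟩)
            (((Agree.refl _ _).update (by simp) _).update (by simp) _))) (by norm_num)
  · rintro p σ₁ ⟨hp, hup, hlo, h0, hZ, k8, k22, hag⟩ hle
    obtain rfl : p = k := by omega
    refine Tri.nil S.bits ⟨?_, h0, hZ, hag⟩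
    obtain ⟨s, hs, hs'⟩ := hlo (by omega)
    have h1 := f.minAbs_le x hs
    have h2 : ((σ₁ 21 : ℝ) - δ) / W ^ 2 ≤ f.minAbs x := f.le_minAbs x fun i hi => by
      rw [div_le_iff₀ hW2]
      linarith [hup i hi]
    rw [div_le_iff₀ hW2] at h2
    have h3 : f.minAbs x * W ^ 2 ≤ |f.gsum f.expoN s x| * W ^ 2 := by gcongr
    rw [abs_le]; constructor <;> linarith
  · refine ⟨Nat.zero_le _, by simp, by simp, by simp, ?_, by simp, by simp,
      (((Agree.refl _ _).update (by simp) _).update (by simp) _).update (by simp) _⟩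
    have := S.Z_pos
    simp; positivity

/-- The number of steps of `bestCode`. -/
def bestSteps (n k : ℕ) : ℕ := (2 * k ^ 2 + 1) * (minSteps n k + 13) + 7

/-- Only two facts about the selected index are kept: the stored value is at most its true minimum
plus `δ`, and at least every true minimum minus `δ`. Near-optimality, and so admissibility, follows
once `δ` is small. -/
theorem bestCode_spec (E : Env f O μ β κ W X Φ Z) {σ : ℕ → ℤ} (hσ : Header k n κ W σ)
    (D : Disk m r X W σ) :
    Tri O μ β bestCode σ (bestSteps n k) fun σ' =>
      (∃ j ≤ 2 * k ^ 2, σ' 24 = j ∧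
        (σ' 23 : ℝ) ≤ f.minAbs (candidate k m r j) * W ^ 2 + k * (W * termErr n k Φ X)) ∧
      (∀ j ≤ 2 * k ^ 2,
        f.minAbs (candidate k m r j) * W ^ 2 ≤ σ' 23 + k * (W * termErr n k Φ X)) ∧
      0 ≤ σ' 23 ∧ (σ' 23 : ℝ) ≤ Z ^ 7 ∧
        Agree [6, 7, 8, 9, 10, 11, 12, 13, 14, 15, 16, 17, 18, 19, 21, 22, 23, 24, 25, 26, 27, 31]
          σ σ' := by
  have S := E.scale
  set δ : ℝ := k * (W * termErr n k Φ X) with hδ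
  have hk := S.two_le
  have hZ1 := S.one_le
  have hidx : ∀ v : ℤ, 0 ≤ v → v ≤ 2 * (k : ℤ) ^ 2 + 1 → v.natAbs < 2 ^ β := by
    intro v h0 hv
    refine S.fits 3 (by norm_num) ?_
    have h1 : (0 : ℝ) ≤ v := by exact_mod_cast h0
    have h2 : (v : ℝ) ≤ 2 * (k : ℝ) ^ 2 + 1 := by exact_mod_cast hv
    have h3 : (k : ℝ) ≤ Z := by have := S.k_le'; linarith
    have h4 : (3 : ℝ) ≤ Z := le_trans (by norm_num) S.large
    have h5 : (k : ℝ) ^ 2 ≤ Z ^ 2 := by gcongr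
    have h6 : 1 ≤ Z ^ 2 := one_le_pow₀ hZ1
    rw [abs_of_nonneg h1]
    calc (v : ℝ) ≤ 2 * Z ^ 2 + Z ^ 2 := by linarith
      _ = 3 * Z ^ 2 := by ring
      _ ≤ Z * Z ^ 2 := by gcongr
      _ = Z ^ 3 := by ring
  refine Tri.steps (N := 1 + (1 + (1 + (1 + (1 + (((2 * k ^ 2 + 1 - 0) * ((minSteps n k + 12) + 1)
    + 1) + 1))))))
    (Tri.assign_cons S.bits 0 (by decide) rfl (S.fits_lit (by norm_num))
    (Tri.assign_cons S.bits (-1) (by decide) rfl (S.fits_lit (by norm_num))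
    (Tri.assign_cons S.bits 0 (by decide) rfl (S.fits_lit (by norm_num))
    (Tri.assign_cons S.bits 0 (by decide) rfl (S.fits_lit (by norm_num))
    (Tri.assign_cons S.bits (2 * (k : ℤ) ^ 2 + 1) (by decide)
      (by simp [Arith.eval, hσ.k_eq, pow_two]) (hidx _ (by positivity) le_rfl)
    (Tri.cons (Tri.loop S.bits (by norm_num) (L := 2 * k ^ 2 + 1) (p₀ := 0)
    (fun p σ' => p ≤ 2 * k ^ 2 + 1 ∧ (p = 0 ∧ σ' 23 = -1 ∨ (∃ j < p, σ' 24 = j ∧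
        (σ' 23 : ℝ) ≤ f.minAbs (candidate k m r j) * W ^ 2 + δ) ∧ 0 ≤ σ' 23) ∧
      (∀ j < p, f.minAbs (candidate k m r j) * W ^ 2 ≤ σ' 23 + δ) ∧
      (σ' 23 : ℝ) ≤ Z ^ 7 ∧ σ' 25 = p ∧ σ' 26 = 2 * (k : ℤ) ^ 2 + 1 - p ∧ σ' 6 = 0 ∧
      Agree [6, 7, 8, 9, 10, 11, 12, 13, 14, 15, 16, 17, 18, 19, 21, 22, 23, 24, 25, 26, 27, 31]
        σ σ') ?_ ?_ (Nat.zero_le _) ?_)))))))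
    (le_of_eq (by rw [bestSteps, Nat.sub_zero]; ring))
  · rintro p σ₁ ⟨hp, hbest, hall, hZ, k25, k26, k6, hag⟩ hpos
    have hpk : p < 2 * k ^ 2 + 1 := by zify; omega
    have hH := hσ.agree hag (by decide)
    refine ⟨hpk, Tri.steps (N := 4 + (minSteps n k + (1 + (4 + (1 + (1 + 1)))))) (Tri.cons (Tri.mono
      (candCode_spec S hH (D.agree (hag 4 (by decide)) (hag 5 (by decide)))
        (Nat.lt_succ_iff.1 hpk) k25) le_rfl ?_)) (by omega)⟩
    rintro σ₂ ⟨hlow, hag2⟩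
    refine Tri.cons (Tri.mono (minCode_spec E (hH.agree hag2 (by decide))
      ((hag2 6 (by decide)).trans k6) hlow) le_rfl ?_)
    rintro σ₃ ⟨herr, hM0, hMZ, hag3⟩
    rw [abs_le] at herr
    have hag3' := (hag.trans (hag2.sub (L' := [6, 7, 8, 9, 10, 11, 12, 13, 14, 15, 16, 17, 18, 19,
      21, 22, 23, 24, 25, 26, 27, 31]) (by simp))).trans (hag3.sub (by simp))
    have j23 : σ₃ 23 = σ₁ 23 := (hag3 23 (by decide)).trans (hag2 23 (by decide))
    have j24 : σ₃ 24 = σ₁ 24 := (hag3 24 (by decide)).trans (hag2 24 (by decide))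
    have j25 : σ₃ 25 = p := ((hag3 25 (by decide)).trans (hag2 25 (by decide))).trans k25
    have j26 : σ₃ 26 = 2 * (k : ℤ) ^ 2 + 1 - p :=
      ((hag3 26 (by decide)).trans (hag2 26 (by decide))).trans k26
    have j6 : σ₃ 6 = 0 := ((hag3 6 (by decide)).trans (hag2 6 (by decide))).trans k6
    have hend : ∀ σ₄ : ℕ → ℤ, (σ₄ 23 = σ₃ 21 ∧ σ₄ 24 = p ∧ σ₁ 23 < σ₃ 21 ∨
        σ₄ 23 = σ₁ 23 ∧ σ₄ 24 = σ₁ 24 ∧ σ₃ 21 ≤ σ₁ 23) → Agree [23, 24, 31] σ₃ σ₄ →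
        Tri O μ β (block [assign 25 (.add (.var 25) (.lit 1)), assign 26 (.sub (.var 26) (.lit 1))])
          σ₄ (1 + (1 + 1)) fun σ' => p + 1 ≤ 2 * k ^ 2 + 1 ∧
            (p + 1 = 0 ∧ σ' 23 = -1 ∨ (∃ j < p + 1, σ' 24 = j ∧
              (σ' 23 : ℝ) ≤ f.minAbs (candidate k m r j) * W ^ 2 + δ) ∧ 0 ≤ σ' 23) ∧
            (∀ j < p + 1, f.minAbs (candidate k m r j) * W ^ 2 ≤ σ' 23 + δ) ∧
            (σ' 23 : ℝ) ≤ Z ^ 7 ∧ σ' 25 = (p + 1 : ℕ) ∧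
            σ' 26 = 2 * (k : ℤ) ^ 2 + 1 - (p + 1 : ℕ) ∧ σ' 6 = 0 ∧
            Agree [6, 7, 8, 9, 10, 11, 12, 13, 14, 15, 16, 17, 18, 19, 21, 22, 23, 24, 25, 26, 27,
              31] σ σ' := by
      intro σ₄ hmax hag4
      have i25 : σ₄ 25 = p := (hag4 25 (by decide)).trans j25
      have i26 : σ₄ 26 = 2 * (k : ℤ) ^ 2 + 1 - p := (hag4 26 (by decide)).trans j26
      have i6 : σ₄ 6 = 0 := (hag4 6 (by decide)).trans j6
      have hag4' := hag3'.trans (hag4.sub (L' := [6, 7, 8, 9, 10, 11, 12, 13, 14, 15, 16, 17, 18,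
        19, 21, 22, 23, 24, 25, 26, 27, 31]) (by simp))
      have hpk' : ((p : ℤ)) + 1 ≤ 2 * (k : ℤ) ^ 2 + 1 := by exact_mod_cast hpk
      refine Tri.assign_cons S.bits ((p + 1 : ℕ) : ℤ) (by decide) (by simp [Arith.eval, i25])
          (hidx _ (by positivity) (by push_cast; omega))
        (Tri.assign_cons S.bits (2 * (k : ℤ) ^ 2 + 1 - (p + 1 : ℕ)) (by decide)
          (by simp [Arith.eval, i26]; ring) (hidx _ (by push_cast; omega) (by push_cast; omega))
        (Tri.nil S.bits ?_))
      set σ₅ := Function.update (Function.update σ₄ 25 ((p + 1 : ℕ) : ℤ)) 26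
          (2 * (k : ℤ) ^ 2 + 1 - (p + 1 : ℕ)) with hσ₅
      have e23 : σ₅ 23 = σ₄ 23 := by simp [hσ₅]
      have e24 : σ₅ 24 = σ₄ 24 := by simp [hσ₅]
      have e6 : σ₅ 6 = 0 := by simp [hσ₅, i6]
      rw [e23, e24]
      refine ⟨hpk, Or.inr ?_, ?_, ?_, by simp [hσ₅], by simp [hσ₅], e6,
        (hag4'.update (by simp) _).update (by simp) _⟩
      · rcases hmax with ⟨e, e', h⟩ | ⟨e, e', h⟩
        · exact ⟨⟨p, Nat.lt_succ_self p, e', by rw [e]; linarith⟩, by rw [e]; exact hM0⟩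
        · rcases hbest with ⟨_, h1⟩ | ⟨⟨j, hj, hj', hj''⟩, h0⟩
          · omega
          · exact ⟨⟨j, hj.trans (Nat.lt_succ_self p), e'.trans hj', by rw [e]; exact hj''⟩,
              by rw [e]; exact h0⟩
      · intro j hj
        rcases Nat.lt_succ_iff_lt_or_eq.1 hj with hj | rfl
        · have := hall j hj
          rcases hmax with ⟨e, _, h⟩ | ⟨e, _, h⟩
          · have h' : (σ₁ 23 : ℝ) < σ₃ 21 := by exact_mod_cast h
            rw [e]; linarith
          · rw [e]; exact this
        · rcases hmax with ⟨e, _, h⟩ | ⟨e, _, h⟩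
          · rw [e]; linarith
          · have h' : (σ₃ 21 : ℝ) ≤ σ₁ 23 := by exact_mod_cast h
            rw [e]; linarith
      · rcases hmax with ⟨e, _, h⟩ | ⟨e, _, h⟩ <;> rw [e] <;> assumption
    have hM0' : (0 : ℝ) ≤ σ₃ 21 := by exact_mod_cast hM0
    have hfitM : (σ₃ 21).natAbs < 2 ^ β := S.fits 7 (by norm_num) (by
      rw [abs_of_nonneg hM0']; exact hMZ)
    have h1 : -1 ≤ σ₁ 23 := by rcases hbest with ⟨_, h⟩ | ⟨_, h⟩ <;> omega
    refine Tri.assign_cons S.bits (σ₃ 21 - σ₁ 23) (by decide)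
      (by simp only [Arith.eval, j23]) ?_
      (Tri.cons (Tri.branch (N := 3) S.bits (by norm_num) (fun h31 => ?_) (fun h31 => ?_)))
    · refine S.fits 8 (by norm_num) ?_
      have h1' : (-1 : ℝ) ≤ σ₁ 23 := by exact_mod_cast h1
      have hZ2 : (2 : ℝ) ≤ Z := le_trans (by norm_num) S.large
      have hZ7 : 1 ≤ Z ^ 7 := one_le_pow₀ hZ1
      have e8 : 2 * Z ^ 7 ≤ Z ^ 8 := by
        calc 2 * Z ^ 7 ≤ Z * Z ^ 7 := by gcongr
          _ = Z ^ 8 := by ring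
      push_cast
      rw [abs_le]; constructor <;> linarith
    · rw [Function.update_self] at h31
      refine Tri.steps (N := 1 + (1 + 1)) (Tri.assign_cons S.bits (σ₃ 21) (by decide)
        (by simp [Arith.eval]) hfitM (Tri.assign_cons S.bits p (by decide)
        (by simp [Arith.eval, j25]) (hidx _ (by positivity) (by omega)) (Tri.nil S.bits
        (hend _ (Or.inl ⟨by simp, by simp, by omega⟩) ?_)))) le_rfl
      exact (((Agree.refl _ _).update (by simp) _).update (by simp) _).update (by simp) _
    · rw [Function.update_self] at h31
      exact Tri.steps (N := 1) (Tri.nil S.bits (hend _ (Or.inr ⟨by simp [j23], by simp [j24],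
        by omega⟩) ((Agree.refl _ _).update (by simp) _))) (by norm_num)
  · rintro p σ₁ ⟨hp, hbest, hall, hZ, k25, k26, k6, hag⟩ hle
    obtain rfl : p = 2 * k ^ 2 + 1 := by
      have : (2 * (k : ℤ) ^ 2 + 1) ≤ p := by omega
      have : 2 * k ^ 2 + 1 ≤ p := by exact_mod_cast this
      omega
    rcases hbest with ⟨h, _⟩ | ⟨⟨j, hj, hj', hj''⟩, h0⟩
    · omega
    · exact Tri.nil S.bits ⟨⟨j, Nat.lt_succ_iff.1 hj, hj', hj''⟩,
        fun j hj => hall j (Nat.lt_succ_iff.2 hj), h0, hZ, hag⟩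
  · refine ⟨Nat.zero_le _, Or.inl ⟨rfl, by simp⟩, by simp, ?_, by simp, by simp, by simp, ?_⟩
    · have := S.Z_pos
      simp only [ne_eq, Nat.reduceEqDiff, not_false_eq_true, Function.update_of_ne,
        Function.update_self]
      push_cast
      have : 0 ≤ Z ^ 7 := by positivity
      linarith
    · exact (((((Agree.refl _ _).update (by simp) _).update (by simp) _).update (by simp) _).update
        (by simp) _).update (by simp) _

end Select

/-! ### The tests -/

open Arith in
/-- For the radius in register `35`: register `39 :=` the absolute value of the test coefficient
whose index is in register `36`, register `38 :=` the sum of the other ones. -/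
def coefCode : Program := block [
  assign 38 (lit 0), assign 39 (lit 0), assign 40 (var 3), assign 8 (lit 0),
  -- Only the coefficients `0, …, k` are computed. Those up to `k ^ 2` differ from this by a tail
  -- controlled by `Nomial.testSum_le`.
  assign 41 (add (var 0) (lit 1)),
  .loop 41 (block [
    sumCode,
    assign 9 (mul (var 9) (var 40)),
    absCode,
    -- A branch only recognises positive numbers; the square is positive exactly when the two
    -- indices differ.
    assign 46 (mul (sub (var 8) (var 36)) (sub (var 8) (var 36))),
    .branch 46 (assign 38 (add (var 38) (var 27))) (assign 39 (var 27)),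
    assign 40 (div (mul (var 40) (var 35)) (mul (var 3) (add (var 8) (lit 1)))),
    assign 8 (add (var 8) (lit 1)),
    assign 41 (sub (var 41) (lit 1))])]

/-- The error of a test coefficient. -/
def coefErr (n k : ℕ) (N Φ X : ℝ) : ℝ := 6 * k ^ 2 * (2 * n) ^ k * N * Φ * X ^ (3 * n)

theorem sum_erase_succ (a : ℕ → ℝ) (p l : ℕ) : ∑ u ∈ (Finset.range (p + 1)).erase l, a u =
    ∑ u ∈ (Finset.range p).erase l, a u + if p = l then 0 else a p := by
  rw [Finset.range_add_one]
  split_ifs with h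
  · subst h
    rw [Finset.erase_insert Finset.notMem_range_self, add_zero,
      Finset.erase_eq_of_notMem Finset.notMem_range_self]
  · rw [Finset.erase_insert_of_ne h, Finset.sum_insert, add_comm]
    exact fun h' => Finset.notMem_range_self (Finset.mem_of_mem_erase h')

/-- The number of steps of `coefCode`. -/
def coefSteps (n k : ℕ) : ℕ := (k + 1) * (sumSteps n k + 13) + 7

section Tests

variable {n k : ℕ} {τ : ℝ} {f : Nomial n k τ} {O : ℕ → ℕ → ℤ} {μ : ℕ → ℤ} {β κ : ℕ} {W : ℤ}
  {X Φ Z m r : ℝ}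

theorem Env.abs_gsum_le (E : Env f O μ β κ W X Φ Z) {u : ℕ} (hu : u ≤ k) {c : ℝ} (hc0 : 0 ≤ c)
    (hc : c ≤ X) : |f.gsum id u c| ≤ k * (Φ * (2 * n) ^ k * X ^ n) := by
  have S := E.scale
  rw [f.gsum_eq_sum_range]
  refine (Finset.abs_sum_le_sum_abs _ _).trans ((Finset.sum_le_card_nsmul _ _ _ fun s _ =>
    f.abs_gterm_le hu (fun s hs => ?_) S.one_le_X hc0 hc (E.coef_le s)).trans ?_)
  · have := S.k_le; have := S.n_pos; simp only [id]; omega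
  · rw [Finset.card_range, nsmul_eq_mul]

/-- The coefficient is the derivative, known in units `W ^ (-2)`, times `ρ ^ u / u!`, known in units
`1 / W`; hence the scale `W ^ 3`. The exponent `3n` arises from `u ≤ k ≤ n + 1 ≤ 2n`. -/
theorem Env.coef_error (E : Env f O μ β κ W X Φ Z) {u : ℕ} (hu : u ≤ k) {c : ℝ} (hc0 : 0 ≤ c)
    (hc : c ≤ X) {N ρ : ℝ} (hN : 32 * n ≤ N) {T y : ℤ}
    (hT : |(T : ℝ) - f.gsum id u c * W ^ 2| ≤ k * (W * termErr n k Φ X))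
    (hy : Low W X (u * (4 * N + 1)) y (ρ ^ u / u.factorial) u) :
    |(|T * y| : ℤ) - |diskCoeff f.poly c ρ u| * (W : ℝ) ^ 3| ≤ W ^ 2 * coefErr n k N Φ X := by
  have S := E.scale
  have hW := S.W_pos'
  have hn : (1 : ℝ) ≤ n := by exact_mod_cast S.n_pos
  have hN0 : 0 < N := by linarith
  have hX1 := S.one_le_X
  have hX0 := S.X_pos
  have hΦ := S.one_le_coef
  have hΦ0 : 0 < Φ := by linarith
  have hk1 : (1 : ℝ) ≤ k := by exact_mod_cast (by have := S.two_le; omega : 1 ≤ k)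
  have huk : (u : ℝ) ≤ k := by exact_mod_cast hu
  have hy0 : (0 : ℝ) ≤ y := by exact_mod_cast hy.nonneg
  have e1 := E.abs_gsum_le hu hc0 hc
  have hXu : X ^ n * X ^ u ≤ X ^ (3 * n) := by
    rw [← pow_add]
    exact pow_le_pow_right₀ hX1 (by have := S.k_le; have := S.n_pos; omega)
  have h1 : |f.gsum id u c * (W : ℝ) ^ 2| ≤ k * (Φ * (2 * n) ^ k * X ^ n) * W ^ 2 := by
    rw [abs_mul, abs_of_nonneg (by positivity : (0 : ℝ) ≤ (W : ℝ) ^ 2)]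
    gcongr
  have h2 : |ρ ^ u / u.factorial * W - y| ≤ k * (5 * N) * X ^ u := by
    rw [abs_of_nonneg (sub_nonneg.2 hy.le)]
    refine hy.error.trans ?_
    have : 4 * N + 1 ≤ 5 * N := by linarith
    gcongr
  have h3 : |(y : ℝ)| ≤ X ^ u * W := by
    rw [abs_of_nonneg hy0]; exact hy.le_pow S.W_pos
  rw [abs_sub_comm] at hT
  have key := abs_mul_sub_mul_le hT h2 h1 h3
  have h4 : f.gsum id u c * (W : ℝ) ^ 2 * (ρ ^ u / u.factorial * W) =
      diskCoeff f.poly c ρ u * W ^ 3 := by rw [f.diskCoeff_eq]; ring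
  rw [h4, abs_sub_comm] at key
  have h5 := (abs_abs_sub_abs_le_abs_sub ((T : ℝ) * y) (diskCoeff f.poly c ρ u * (W : ℝ) ^ 3)).trans
    key
  rw [abs_mul (diskCoeff f.poly c ρ u), abs_of_nonneg (by positivity : (0 : ℝ) ≤ (W : ℝ) ^ 3)] at h5
  push_cast
  refine h5.trans ?_
  rw [termErr, coefErr]
  have h18 : 18 * (n : ℝ) ≤ k * N := by nlinarith
  calc k * (Φ * (2 * n) ^ k * X ^ n) * W ^ 2 * (k * (5 * N) * X ^ u) +
        k * (W * (18 * n * (2 * n) ^ k * Φ * X ^ n)) * (X ^ u * W)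
      = W ^ 2 * (k * Φ * (2 * n) ^ k * (k * (5 * N) + 18 * n)) * (X ^ n * X ^ u) := by ring
    _ ≤ W ^ 2 * (k * Φ * (2 * n) ^ k * (k * (5 * N) + k * N)) * X ^ (3 * n) := by gcongr
    _ = W ^ 2 * (6 * k ^ 2 * (2 * n) ^ k * N * Φ * X ^ (3 * n)) := by ring

/-- Each update of `ρ ^ u / u!` is one multiplication by the radius and one division by `u + 1`. By
`Low.mul_div` this adds `4 N + 1` to the error constant. -/
theorem coefCode_spec (E : Env f O μ β κ W X Φ Z) {σ : ℕ → ℤ} (hσ : Header k n κ W σ)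
    (h6 : σ 6 = 1) {c : ℝ} (hc : Low W X 15 (σ 7) c 1) {N ρ : ℝ} (hN : 32 * n ≤ N)
    (hρ : Low W X (4 * N) (σ 35) ρ 1) {l : ℕ} (hl : l ≤ k) (h36 : σ 36 = l) :
    Tri O μ β coefCode σ (coefSteps n k) fun σ' =>
      |(σ' 38 : ℝ) - (∑ u ∈ (Finset.range (k + 1)).erase l, |diskCoeff f.poly c ρ u|) * W ^ 3| ≤
        (k + 1) * (W ^ 2 * coefErr n k N Φ X) ∧
      |(σ' 39 : ℝ) - |diskCoeff f.poly c ρ l| * W ^ 3| ≤ W ^ 2 * coefErr n k N Φ X ∧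
      |(σ' 38 : ℝ)| ≤ Z ^ 11 ∧ |(σ' 39 : ℝ)| ≤ Z ^ 11 ∧
      Agree [8, 9, 10, 11, 12, 13, 14, 15, 16, 17, 18, 19, 27, 38, 39, 40, 41, 46] σ σ' := by
  have S := E.scale
  set δ : ℝ := W ^ 2 * coefErr n k N Φ X with hδ
  have hk := S.two_le
  have hc1 : c ≤ X := by simpa using hc.val_le
  have hZ := S.Z_pos
  have hZ1 := S.one_le
  have hkZ : (k : ℝ) + 2 ≤ Z := S.k_le'
  have hpartial : ∀ p ≤ k + 1, (p : ℝ) * Z ^ 10 ≤ Z ^ 11 := fun p hp => by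
    have : (p : ℝ) ≤ k + 1 := by exact_mod_cast hp
    calc (p : ℝ) * Z ^ 10 ≤ Z * Z ^ 10 := by gcongr; linarith
      _ = Z ^ 11 := by ring
  refine Tri.steps (N := 1 + (1 + (1 + (1 + (1 + (((k + 1 - 0) * ((sumSteps n k + 12) + 1) + 1) +
      1))))))
    (Tri.assign_cons S.bits 0 (by decide) rfl (S.fits_lit (by norm_num))
    (Tri.assign_cons S.bits 0 (by decide) rfl (S.fits_lit (by norm_num))
    (Tri.assign_cons S.bits W (by decide) (by simp [Arith.eval, hσ.unit_eq])
      (S.fits_nat S.W_pos.le S.W_le)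
    (Tri.assign_cons S.bits 0 (by decide) rfl (S.fits_lit (by norm_num))
    (Tri.assign_cons S.bits ((k : ℤ) + 1) (by decide) (by simp [Arith.eval, hσ.k_eq])
      (S.fits_index (by omega) (by omega))
    (Tri.cons (Tri.loop S.bits (by norm_num) (L := k + 1) (p₀ := 0)
    (fun p σ' => p ≤ k + 1 ∧ Low W X (p * (4 * N + 1)) (σ' 40) (ρ ^ p / p.factorial) p ∧
      |(σ' 38 : ℝ) - (∑ u ∈ (Finset.range p).erase l, |diskCoeff f.poly c ρ u|) * W ^ 3| ≤ p * δ ∧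
      (l < p → |(σ' 39 : ℝ) - |diskCoeff f.poly c ρ l| * W ^ 3| ≤ δ) ∧
      (0 ≤ σ' 38 ∧ (σ' 38 : ℝ) ≤ p * Z ^ 10) ∧ (0 ≤ σ' 39 ∧ (σ' 39 : ℝ) ≤ Z ^ 10) ∧
      σ' 8 = p ∧ σ' 41 = k + 1 - p ∧
      Agree [8, 9, 10, 11, 12, 13, 14, 15, 16, 17, 18, 19, 27, 38, 39, 40, 41, 46] σ σ')
      ?_ ?_ (Nat.zero_le _) ?_)))))))
    (le_of_eq (by rw [coefSteps, Nat.sub_zero]; ring))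
  · rintro p σ₁ ⟨hp, hy, hS, hA, ⟨hS0, hSZ⟩, ⟨hA0, hAZ⟩, k8, k41, hag⟩ hpos
    have hpk : p < k + 1 := by omega
    have hH := hσ.agree hag (by decide)
    refine ⟨hpk, Tri.steps (N := sumSteps n k + (1 + (4 + (1 + (2 + (1 + (1 + (1 + 1))))))))
      (Tri.cons (Tri.mono (sumCode_spec E (g := id) (x := c) (Nat.lt_succ_iff.1 hpk)
        (fun s hs => ?_) hH ?_ ?_ k8) le_rfl ?_)) (by omega)⟩
    · have := S.k_le; have := S.n_pos; simp only [id]; omega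
    · intro s _
      rw [hag 6 (by decide), h6]; simp
    · rw [hag 7 (by decide)]; exact hc
    rintro σ₂ ⟨herr, hb, hag2⟩
    have hag2' := hag.trans (hag2.sub (L' := [8, 9, 10, 11, 12, 13, 14, 15, 16, 17, 18, 19, 27, 38,
      39, 40, 41, 46]) (by simp))
    have hcoef := E.coef_error (Nat.lt_succ_iff.1 hpk) hc.val_nonneg hc1 hN herr hy
    have i40 : σ₂ 40 = σ₁ 40 := hag2 40 (by decide)
    have hyZ : (σ₁ 40 : ℝ) ≤ Z ^ 3 := hy.le_cube S (by have := S.k_le; omega)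
    have hy0 : (0 : ℝ) ≤ σ₁ 40 := by exact_mod_cast hy.nonneg
    have hTy : |((σ₂ 9 * σ₁ 40 : ℤ) : ℝ)| ≤ Z ^ 10 := by
      push_cast
      rw [abs_mul, abs_of_nonneg hy0]
      calc _ ≤ Z ^ 7 * Z ^ 3 := by gcongr
        _ = Z ^ 10 := by ring
    set T : ℤ := |σ₂ 9 * σ₁ 40| with hT
    have hT0 : 0 ≤ T := abs_nonneg _
    have hTZ : (T : ℝ) ≤ Z ^ 10 := by rw [hT, Int.cast_abs]; exact hTy
    refine Tri.assign_cons S.bits (σ₂ 9 * σ₁ 40) (by decide) (by simp [Arith.eval, i40])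
      (S.fits 10 (by norm_num) hTy) (Tri.cons (Tri.mono (absCode_spec S.bits ?_) le_rfl ?_))
    · simpa using S.fits 10 (by norm_num) hTy
    rintro σ₃ ⟨k27, hag3⟩
    rw [Function.update_self, ← hT] at k27
    have hag3' := (hag2'.update (x := 9) (by simp) (σ₂ 9 * σ₁ 40)).trans (hag3.sub (L' := [8, 9, 10,
      11, 12, 13, 14, 15, 16, 17, 18, 19, 27, 38, 39, 40, 41, 46]) (by simp))
    have j8 : σ₃ 8 = p := by rw [hag3 8 (by decide)]; simpa [hag2 8 (by decide)] using k8
    have j40 : σ₃ 40 = σ₁ 40 := by rw [hag3 40 (by decide)]; simpa using i40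
    have j38 : σ₃ 38 = σ₁ 38 := by rw [hag3 38 (by decide)]; simpa using hag2 38 (by decide)
    have j39 : σ₃ 39 = σ₁ 39 := by rw [hag3 39 (by decide)]; simpa using hag2 39 (by decide)
    have j41 : σ₃ 41 = k + 1 - p := by
      rw [hag3 41 (by decide)]; simpa [hag2 41 (by decide)] using k41
    have j36 : σ₃ 36 = l := (hag3' 36 (by decide)).trans h36
    have j35 : σ₃ 35 = σ 35 := hag3' 35 (by decide)
    have j3 := (hσ.agree hag3' (by decide)).unit_eq
    have hend : ∀ σ₄ : ℕ → ℤ, (p ≠ l ∧ σ₄ 38 = σ₁ 38 + T ∧ σ₄ 39 = σ₁ 39 ∨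
        p = l ∧ σ₄ 38 = σ₁ 38 ∧ σ₄ 39 = T) → Agree [38, 39, 46] σ₃ σ₄ →
        Tri O μ β (block [
          assign 40 (.div (.mul (.var 40) (.var 35)) (.mul (.var 3) (.add (.var 8) (.lit 1)))),
          assign 8 (.add (.var 8) (.lit 1)), assign 41 (.sub (.var 41) (.lit 1))])
          σ₄ (1 + (1 + (1 + 1))) fun σ' => p + 1 ≤ k + 1 ∧
          Low W X ((p + 1 : ℕ) * (4 * N + 1)) (σ' 40) (ρ ^ (p + 1) / (p + 1).factorial) (p + 1) ∧
          |(σ' 38 : ℝ) - (∑ u ∈ (Finset.range (p + 1)).erase l, |diskCoeff f.poly c ρ u|) * W ^ 3| ≤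
            (p + 1 : ℕ) * δ ∧
          (l < p + 1 → |(σ' 39 : ℝ) - |diskCoeff f.poly c ρ l| * W ^ 3| ≤ δ) ∧
          (0 ≤ σ' 38 ∧ (σ' 38 : ℝ) ≤ (p + 1 : ℕ) * Z ^ 10) ∧ (0 ≤ σ' 39 ∧ (σ' 39 : ℝ) ≤ Z ^ 10) ∧
          σ' 8 = (p + 1 : ℕ) ∧ σ' 41 = k + 1 - (p + 1 : ℕ) ∧
          Agree [8, 9, 10, 11, 12, 13, 14, 15, 16, 17, 18, 19, 27, 38, 39, 40, 41, 46] σ σ' := by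
      intro σ₄ hcase hag4
      have i8 : σ₄ 8 = p := (hag4 8 (by decide)).trans j8
      have i41 : σ₄ 41 = k + 1 - p := (hag4 41 (by decide)).trans j41
      have i40 : σ₄ 40 = σ₁ 40 := (hag4 40 (by decide)).trans j40
      have i35 : σ₄ 35 = σ 35 := (hag4 35 (by decide)).trans j35
      have i3 : σ₄ 3 = W := (hag4 3 (by decide)).trans j3
      have hag4' := hag3'.trans (hag4.sub (L' := [8, 9, 10, 11, 12, 13, 14, 15, 16, 17, 18, 19, 27,
        38, 39, 40, 41, 46]) (by simp))
      have hy' := hy.mul_div S.W_pos S.one_le_X hρ (d := (p + 1 : ℕ)) (by positivity)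
      have hy'' : Low W X ((p + 1 : ℕ) * (4 * N + 1)) (σ₁ 40 * σ 35 / (W * (p + 1 : ℕ)))
          (ρ ^ (p + 1) / (p + 1).factorial) (p + 1) := by
        have e1 : ρ ^ (p + 1) / ((p + 1).factorial : ℝ) =
            ρ ^ p / p.factorial * ρ / ((p + 1 : ℕ) : ℤ) := by
          rw [Nat.factorial_succ]; push_cast
          have : ((p : ℝ) + 1) ≠ 0 := by positivity
          have : (p.factorial : ℝ) ≠ 0 := by positivity
          field_simp
          try ring
        rw [e1]
        refine hy'.mono S.one_le_X (le_of_eq ?_)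
        push_cast; ring
      refine Tri.assign_cons S.bits (σ₁ 40 * σ 35 / (W * (p + 1 : ℕ))) (by decide)
          (by simp [Arith.eval, i40, i35, i3, i8])
          (hy''.fits S (by have := S.k_le; omega))
        (Tri.assign_cons S.bits ((p + 1 : ℕ) : ℤ) (by decide) (by simp [Arith.eval, i8])
          (S.fits_index (by omega) (by omega))
        (Tri.assign_cons S.bits ((k : ℤ) + 1 - (p + 1 : ℕ)) (by decide)
          (by simp [Arith.eval, i41]; ring) (S.fits_index (by omega) (by omega))
        (Tri.nil S.bits ?_)))
      set σ₅ := Function.update (Function.update (Function.update σ₄ 40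
        (σ₁ 40 * σ 35 / (W * (p + 1 : ℕ)))) 8 ((p + 1 : ℕ) : ℤ)) 41 ((k : ℤ) + 1 - (p + 1 : ℕ))
        with hσ₅
      have e38 : σ₅ 38 = σ₄ 38 := by simp [hσ₅]
      have e39 : σ₅ 39 = σ₄ 39 := by simp [hσ₅]
      have e40 : σ₅ 40 = σ₁ 40 * σ 35 / (W * (p + 1 : ℕ)) := by simp [hσ₅]
      rw [e38, e39, e40]
      have hp1 : ((p + 1 : ℕ) : ℝ) = p + 1 := by push_cast; ring
      have hδ0 : 0 ≤ δ := (abs_nonneg _).trans hcoef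
      have hZ10 : 0 ≤ Z ^ 10 := by positivity
      refine ⟨hpk, hy'', ?_, ?_, ?_, ?_, by simp [hσ₅], by simp [hσ₅],
        ((hag4'.update (by simp) _).update (by simp) _).update (by simp) _⟩
      · rw [sum_erase_succ, hp1]
        rw [abs_le] at hS hcoef ⊢
        rcases hcase with ⟨hne, e, _⟩ | ⟨heq, e, _⟩
        · rw [e, if_neg hne]; push_cast; constructor <;> linarith [hS.1, hS.2, hcoef.1, hcoef.2]
        · rw [e, if_pos heq, add_zero]; constructor <;> linarith [hS.1, hS.2]
      · intro hlp
        rcases hcase with ⟨hne, _, e⟩ | ⟨heq, _, e⟩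
        · rw [e]; exact hA (by omega)
        · rw [e, ← heq]; exact hcoef
      · rw [hp1]
        rcases hcase with ⟨hne, e, _⟩ | ⟨heq, e, _⟩
        · rw [e]; push_cast; exact ⟨by omega, by linarith⟩
        · rw [e]; exact ⟨hS0, by linarith⟩
      · rcases hcase with ⟨hne, _, e⟩ | ⟨heq, _, e⟩
        · rw [e]; exact ⟨hA0, hAZ⟩
        · rw [e]; exact ⟨hT0, hTZ⟩
    have hfitT : T.natAbs < 2 ^ β := by
      rw [hT, Int.natAbs_abs]; exact S.fits 10 (by norm_num) hTy
    refine Tri.assign_cons S.bits (((p : ℤ) - l) * (p - l)) (by decide)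
      (by simp [Arith.eval, j8, j36]) ?_
      (Tri.cons (Tri.branch (N := 1) S.bits (by norm_num) (fun h46 => ?_) (fun h46 => ?_)))
    · refine S.fits 2 (by norm_num) ?_
      have h1 : (p : ℝ) ≤ k := by exact_mod_cast Nat.lt_succ_iff.1 hpk
      have h2 : (l : ℝ) ≤ k := by exact_mod_cast hl
      have h3 : (0 : ℝ) ≤ p := by positivity
      have h4 : (0 : ℝ) ≤ l := by positivity
      push_cast
      have h5 : |(p : ℝ) - l| ≤ Z := by rw [abs_le]; constructor <;> linarith
      rw [abs_mul, pow_two]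
      gcongr
    · rw [Function.update_self] at h46
      have hne : p ≠ l := fun h => by rw [h] at h46; simp at h46
      have hev : Arith.eval μ (Function.update σ₃ 46 (((p : ℤ) - l) * (p - l)))
          (.add (.var 38) (.var 27)) = σ₁ 38 + T := by simp [Arith.eval, j38, k27]
      refine Tri.assign S.bits (by decide) ?_ (hend _ (Or.inl ⟨hne, ?_, ?_⟩)
        (((Agree.refl _ _).update (by simp) _).update (by simp) _))
      · rw [hev]
        refine S.fits 11 (by norm_num) ?_
        have h1 : (0 : ℝ) ≤ σ₁ 38 := by exact_mod_cast hS0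
        have h2 : (0 : ℝ) ≤ T := by exact_mod_cast hT0
        have h3 := hpartial (p + 1) hpk
        push_cast at h3 ⊢
        rw [abs_of_nonneg (by linarith)]
        linarith
      · rw [hev, Function.update_self]
      · simp [j39]
    · rw [Function.update_self] at h46
      have heq : p = l := by
        have h1 : ((p : ℤ) - l) * (p - l) = 0 := le_antisymm h46 (mul_self_nonneg _)
        have := mul_self_eq_zero.1 h1
        omega
      refine Tri.assign S.bits (by decide) (by simpa [Arith.eval, k27] using hfitT)
        (hend _ (Or.inr ⟨heq, by simp [j38], by simp [Arith.eval, k27]⟩)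
        (((Agree.refl _ _).update (by simp) _).update (by simp) _))
  · rintro p σ₁ ⟨hp, hy, hS, hA, ⟨hS0, hSZ⟩, ⟨hA0, hAZ⟩, k8, k41, hag⟩ hle
    obtain rfl : p = k + 1 := by omega
    have h1 : (0 : ℝ) ≤ σ₁ 38 := by exact_mod_cast hS0
    have h2 : (0 : ℝ) ≤ σ₁ 39 := by exact_mod_cast hA0
    refine Tri.nil S.bits ⟨?_, hA (by omega), ?_, ?_, hag⟩
    · push_cast at hS; exact hS
    · rw [abs_of_nonneg h1]; exact hSZ.trans (hpartial _ le_rfl)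
    · rw [abs_of_nonneg h2]; exact hAZ.trans (pow_le_pow_right₀ hZ1 (by norm_num))
  · refine ⟨Nat.zero_le _, ?_, by simp, by simp, by simp, ?_, by simp, by simp, ?_⟩
    · simpa using (Low.one (X := X) S.W_pos)
    · simp; positivity
    · exact (((((Agree.refl _ _).update (by simp) _).update (by simp) _).update (by simp) _).update
        (by simp) _).update (by simp) _

end Tests

open Arith in
/-- The tests on one disk. -/
def rowCode : Program := block [
  assign 36 (lit 0), assign 37 (add (var 0) (lit 1)),
  .loop 37 (block [
    coefCode,
    -- The threshold is `16705 / 16384 = 65/64 * 257/256`, strictly inside the tolerance band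
    -- between `65/64` and `65/64 * 129/128`; the two gaps absorb the computational errors.
    assign 46 (sub (mul (lit 16384) (var 39)) (mul (lit 16705) (var 38))),
    .branch 46
      -- All tests are carried out, but register `43` is cleared at the first success so that later
      -- ones are not recorded.
      (.branch 43 (block [assign 43 (lit 0), assign 44 (var 32), assign 45 (var 36)]) (block []))
      (block []),
    assign 36 (add (var 36) (lit 1)),
    assign 37 (sub (var 37) (lit 1))])]

open Arith in
/-- Register `35 :=` the radius with factor in register `34`. -/
def radCode : Program := block [
  assign 35 (mul (sub (var 5) (lit 2)) (var 34)),
  .branch 35 (block []) (assign 35 (lit 0))]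

open Arith in
/-- All tests on the disks around the point with index in register `24`. -/
def testCode : Program := block [
  assign 25 (var 24), candCode, assign 6 (lit 1), assign 34 (mul (lit 32) (var 1)),
  assign 43 (lit 1), assign 44 (lit 0), assign 45 (lit 0), assign 32 (lit 0),
  assign 33 (add (var 0) (lit 1)),
  .loop 33 (block [
    radCode, rowCode,
    assign 34 (mul (var 34) (mul (lit 256)
      (mul (mul (var 1) (var 1)) (mul (mul (var 1) (var 1)) (var 1))))),
    assign 32 (add (var 32) (lit 1)),
    assign 33 (sub (var 33) (lit 1))])]

/-! ### Bookkeeping for the first successful test. -/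

/-- The ratio of the radius of the `i`-th disk and `r`. -/
def radiusFactor (n i : ℕ) : ℕ := 32 * n * (256 * n ^ 5) ^ i

theorem radiusFactor_mul (n i : ℕ) (r : ℝ) : radiusFactor n i * r = testRadius n r i := by
  rw [radiusFactor, testRadius]; push_cast; ring

/-- The tests before `(i, l)`, in the order of the two loops, have been done: either all of them
may be answered negatively and register `43` is `1`, or register `43` is `0` and registers `44`,
`45` hold the first one that succeeds. -/
def Progress (Y N : ℕ → ℕ → Prop) (k i l : ℕ) (σ : ℕ → ℤ) : Prop :=
  (σ 43 = 1 ∧ ∀ a b, b ≤ k → (a < i ∨ a = i ∧ b < l) → N a b) ∨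
  (σ 43 = 0 ∧ ∃ a b : ℕ, a ≤ k ∧ b ≤ k ∧ σ 44 = a ∧ σ 45 = b ∧ Y a b ∧
    ∀ a' b', b' ≤ k → (a' < a ∨ a' = a ∧ b' < b) → N a' b')

theorem Progress.congr {Y N : ℕ → ℕ → Prop} {k i l : ℕ} {σ σ' : ℕ → ℤ} (h : Progress Y N k i l σ)
    (h43 : σ' 43 = σ 43) (h44 : σ' 44 = σ 44) (h45 : σ' 45 = σ 45) : Progress Y N k i l σ' := by
  rw [Progress, h43, h44, h45]; exact h

theorem Progress.next {Y N : ℕ → ℕ → Prop} {k i : ℕ} {σ : ℕ → ℤ}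
    (h : Progress Y N k i (k + 1) σ) : Progress Y N k (i + 1) 0 σ := by
  rcases h with ⟨h, h'⟩ | h
  · exact Or.inl ⟨h, fun a b hb hab => h' a b hb (by omega)⟩
  · exact Or.inr h

/-- The number of steps of `rowCode`. -/
def rowSteps (n k : ℕ) : ℕ := (k + 1) * (coefSteps n k + 11) + 4

/-- The number of steps of `testCode`. -/
def testSteps (n k : ℕ) : ℕ := (k + 1) * (rowSteps n k + 9) + 14

/-- The decisions that the computed sums allow. -/
def Decides {n k : ℕ} {τ : ℝ} (f : Nomial n k τ) (c r : ℝ) (W : ℤ) (Φ X : ℝ)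
    (Y N : ℕ → ℕ → Prop) : Prop :=
  ∀ i ≤ k, ∀ l ≤ k, ∀ S A : ℤ,
    |(S : ℝ) - (∑ u ∈ (Finset.range (k + 1)).erase l,
      |diskCoeff f.poly c (testRadius n r i) u|) * W ^ 3| ≤
        (k + 1) * (W ^ 2 * coefErr n k (radiusFactor n i) Φ X) →
    |(A : ℝ) - |diskCoeff f.poly c (testRadius n r i) l| * W ^ 3| ≤
        W ^ 2 * coefErr n k (radiusFactor n i) Φ X →
    (16705 * S < 16384 * A → Y i l) ∧ (16384 * A ≤ 16705 * S → N i l)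

section Tests

variable {n k : ℕ} {τ : ℝ} {f : Nomial n k τ} {O : ℕ → ℕ → ℤ} {μ : ℕ → ℤ} {β κ : ℕ} {W : ℤ}
  {X Φ Z m r : ℝ}

theorem le_radiusFactor (hn : 1 ≤ n) (i : ℕ) : (32 * n : ℝ) ≤ radiusFactor n i := by
  have : 32 * n ≤ radiusFactor n i := by
    rw [radiusFactor]
    exact Nat.le_mul_of_pos_right _ (by positivity)
  exact_mod_cast this

/-- The predicates `Y` and `N` are abstract, which separates the control flow from the numerical
meaning of a comparison; the latter enters only through `Decides`. -/
theorem rowCode_spec (E : Env f O μ β κ W X Φ Z) {Y N : ℕ → ℕ → Prop} {c : ℝ}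
    (hdec : Decides f c r W Φ X Y N) {σ : ℕ → ℤ} (hσ : Header k n κ W σ)
    (h6 : σ 6 = 1) (hc : Low W X 15 (σ 7) c 1) {i : ℕ} (hi : i ≤ k)
    (hρ : Low W X (4 * radiusFactor n i) (σ 35) (testRadius n r i) 1) (h32 : σ 32 = i)
    (hP : Progress Y N k i 0 σ) :
    Tri O μ β rowCode σ (rowSteps n k) fun σ' => Progress Y N k i (k + 1) σ' ∧
      Agree [8, 9, 10, 11, 12, 13, 14, 15, 16, 17, 18, 19, 27, 36, 37, 38, 39, 40, 41, 43, 44, 45,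
        46] σ σ' := by
  have S := E.scale
  have hk := S.two_le
  refine Tri.steps (N := 1 + (1 + (((k + 1 - 0) * ((coefSteps n k + 10) + 1) + 1) + 1)))
    (Tri.assign_cons S.bits 0 (by decide) rfl (S.fits_lit (by norm_num))
    (Tri.assign_cons S.bits ((k : ℤ) + 1) (by decide) (by simp [Arith.eval, hσ.k_eq])
      (S.fits_index (by omega) (by omega))
    (Tri.cons (Tri.loop S.bits (by norm_num) (L := k + 1) (p₀ := 0)
    (fun p σ' => p ≤ k + 1 ∧ Progress Y N k i p σ' ∧ σ' 36 = p ∧ σ' 37 = k + 1 - p ∧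
      Agree [8, 9, 10, 11, 12, 13, 14, 15, 16, 17, 18, 19, 27, 36, 37, 38, 39, 40, 41, 43, 44, 45,
        46] σ σ') ?_ ?_ (Nat.zero_le _) ?_))))
    (by
      have : (k + 1 - 0) * (coefSteps n k + 10 + 1) ≤ (k + 1) * (coefSteps n k + 11) :=
        Nat.mul_le_mul le_rfl (by omega)
      rw [rowSteps]; omega)
  · rintro p σ₁ ⟨hp, hprog, k36, k37, hag⟩ hpos
    have hpk : p ≤ k := by omega
    have hH := hσ.agree hag (by decide)
    refine ⟨by omega, Tri.steps (N := coefSteps n k + (1 + (6 + (1 + (1 + 1)))))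
      (Tri.cons (Tri.mono (coefCode_spec E hH ((hag 6 (by decide)).trans h6)
        (c := c) (by rw [hag 7 (by decide)]; exact hc) (le_radiusFactor S.n_pos i)
        (by rw [hag 35 (by decide)]; exact hρ) hpk k36) le_rfl ?_)) (by omega)⟩
    rintro σ₂ ⟨hS, hA, hSZ, hAZ, hag2⟩
    have hag2' := hag.trans (hag2.sub (L' := [8, 9, 10, 11, 12, 13, 14, 15, 16, 17, 18, 19, 27, 36,
      37, 38, 39, 40, 41, 43, 44, 45, 46]) (by simp))
    obtain ⟨hY, hN⟩ := hdec i hi p hpk _ _ hS hA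
    have j36 : σ₂ 36 = p := (hag2 36 (by decide)).trans k36
    have j37 : σ₂ 37 = k + 1 - p := (hag2 37 (by decide)).trans k37
    have j32 : σ₂ 32 = i := (hag2' 32 (by decide)).trans h32
    have hprog2 : Progress Y N k i p σ₂ := hprog.congr (hag2 43 (by decide)) (hag2 44 (by decide))
      (hag2 45 (by decide))
    have hend : ∀ σ₄ : ℕ → ℤ, Progress Y N k i (p + 1) σ₄ → Agree [43, 44, 45, 46] σ₂ σ₄ →
        Tri O μ β (block [assign 36 (.add (.var 36) (.lit 1)),
          assign 37 (.sub (.var 37) (.lit 1))]) σ₄ (1 + (1 + 1)) fun σ' => p + 1 ≤ k + 1 ∧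
            Progress Y N k i (p + 1) σ' ∧ σ' 36 = (p + 1 : ℕ) ∧ σ' 37 = k + 1 - (p + 1 : ℕ) ∧
            Agree [8, 9, 10, 11, 12, 13, 14, 15, 16, 17, 18, 19, 27, 36, 37, 38, 39, 40, 41, 43,
              44, 45, 46] σ σ' := by
      intro σ₄ hprog4 hag4
      have i36 : σ₄ 36 = p := (hag4 36 (by decide)).trans j36
      have i37 : σ₄ 37 = k + 1 - p := (hag4 37 (by decide)).trans j37
      have hag4' := hag2'.trans (hag4.sub (L' := [8, 9, 10, 11, 12, 13, 14, 15, 16, 17, 18, 19, 27,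
        36, 37, 38, 39, 40, 41, 43, 44, 45, 46]) (by simp))
      exact Tri.assign_cons S.bits ((p + 1 : ℕ) : ℤ) (by decide) (by simp [Arith.eval, i36])
          (S.fits_index (by omega) (by omega))
        (Tri.assign_cons S.bits ((k : ℤ) + 1 - (p + 1 : ℕ)) (by decide)
          (by simp [Arith.eval, i37]; ring) (S.fits_index (by omega) (by omega))
        (Tri.nil S.bits ⟨by omega, hprog4.congr (by simp) (by simp) (by simp), by simp, by simp,
          (hag4'.update (by simp) _).update (by simp) _⟩))
    refine Tri.assign_cons S.bits (16384 * σ₂ 39 - 16705 * σ₂ 38) (by decide)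
      (by simp [Arith.eval]) ?_
      (Tri.cons (Tri.branch (N := 5) S.bits (by norm_num) (fun h46 => ?_) (fun h46 => ?_)))
    · refine S.fits 12 (by norm_num) ?_
      have hZ : (33089 : ℝ) ≤ Z := le_trans (by norm_num) S.large
      have hZ0 := S.Z_pos
      have h1 : 33089 * Z ^ 11 ≤ Z ^ 12 := by
        calc 33089 * Z ^ 11 ≤ Z * Z ^ 11 := by gcongr
          _ = Z ^ 12 := by ring
      rw [abs_le] at hSZ hAZ ⊢
      push_cast
      constructor <;> linarith [hSZ.1, hSZ.2, hAZ.1, hAZ.2]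
    · rw [Function.update_self] at h46
      have hyes := hY (by omega)
      refine Tri.branch (N := 4) S.bits (by norm_num) (fun h43 => ?_) (fun h43 => ?_)
      · rw [Function.update_of_ne (by norm_num)] at h43
        have hall : ∀ a b, b ≤ k → (a < i ∨ a = i ∧ b < p) → N a b := by
          rcases hprog2 with ⟨_, h⟩ | ⟨h, _⟩
          · exact h
          · omega
        refine Tri.steps (N := 1 + (1 + (1 + 1)))
          (Tri.assign_cons S.bits 0 (by decide) rfl (S.fits_lit (by norm_num))
          (Tri.assign_cons S.bits i (by decide) (by simp [Arith.eval, j32])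
            (S.fits_index (by omega) (by omega))
          (Tri.assign_cons S.bits p (by decide) (by simp [Arith.eval, j36])
            (S.fits_index (by omega) (by omega)) (Tri.nil S.bits
          (hend _ (Or.inr ⟨by simp, i, p, hi, hpk, by simp, by simp, hyes, hall⟩) ?_))))) le_rfl
        exact ((((Agree.refl _ _).update (by simp) _).update (by simp) _).update (by simp)
          _).update (by simp) _
      · rw [Function.update_of_ne (by norm_num)] at h43
        refine Tri.steps (N := 1) (Tri.nil S.bits (hend _ (Or.inr ⟨?_, ?_⟩)
          ((Agree.refl _ _).update (by simp) _))) (by norm_num)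
        · rcases hprog2 with ⟨h, _⟩ | ⟨h, _⟩
          · omega
          · simpa using h
        · rcases hprog2 with ⟨h, _⟩ | ⟨_, h⟩
          · omega
          · simpa using h
    · rw [Function.update_self] at h46
      have hno := hN (by omega)
      refine Tri.steps (N := 1) (Tri.nil S.bits (hend _ ?_
          ((Agree.refl _ _).update (by simp) _))) (by norm_num)
      refine Progress.congr (σ := σ₂) ?_ (by simp) (by simp) (by simp)
      rcases hprog2 with ⟨h, h'⟩ | h
      · refine Or.inl ⟨h, fun a b hb hab => ?_⟩
        by_cases hab' : a = i ∧ b = p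
        · rw [hab'.1, hab'.2]; exact hno
        · exact h' a b hb (by omega)
      · exact Or.inr h
  · rintro p σ₁ ⟨hp, hprog, k36, k37, hag⟩ hle
    obtain rfl : p = k + 1 := by omega
    exact Tri.nil S.bits ⟨hprog, hag⟩
  · exact ⟨Nat.zero_le _, hP.congr (by simp) (by simp) (by simp), by simp, by simp,
      ((Agree.refl _ _).update (by simp) _).update (by simp) _⟩

theorem radCode_spec (S : Scale n k β W X Φ Z) {σ : ℕ → ℤ} (D : Disk m r X W σ) {N : ℕ}
    (hN : 0 < N) (hNZ : (N : ℝ) ≤ Z) (hNX : N * r ≤ X) (h34 : σ 34 = N) :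
    Tri O μ β radCode σ 4 fun σ' => Low W X (4 * N) (σ' 35) (N * r) 1 ∧ Agree [35] σ σ' := by
  have hlow := low_radius (N := (N : ℤ)) D.r_pos (by exact_mod_cast hN) S.one_le_X S.W_pos D.radius
    (by exact_mod_cast hNX) rfl
  push_cast at hlow
  refine Tri.steps (N := 1 + ((1 + 1) + 1)) (Tri.assign_cons S.bits ((σ 5 - 2) * N) (by decide)
    (by simp [Arith.eval, h34]) ?_
    (Tri.cons (Tri.branch S.bits (by norm_num) (fun hp => ?_) (fun hn => ?_)))) le_rfl
  · refine S.fits 5 (by norm_num) ?_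
    have h1 := (D.abs_le S).2
    have hZ : (2 : ℝ) ≤ Z := le_trans (by norm_num) S.large
    have hZ1 := S.one_le
    have h3 : |(σ 5 : ℝ) - 2| ≤ Z ^ 4 := by
      have h4 : 1 ≤ Z ^ 3 := one_le_pow₀ hZ1
      have h5 : 2 * Z ^ 3 ≤ Z ^ 4 := by
        calc 2 * Z ^ 3 ≤ Z * Z ^ 3 := by gcongr
          _ = Z ^ 4 := by ring
      have h7 : 2 ≤ Z ^ 3 := by
        calc (2 : ℝ) ≤ Z ^ 1 := by rwa [pow_one]
          _ ≤ Z ^ 3 := pow_le_pow_right₀ hZ1 (by norm_num)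
      rw [abs_le] at h1 ⊢
      constructor <;> linarith [h1.1, h1.2]
    push_cast
    rw [abs_mul, abs_of_nonneg (show (0 : ℝ) ≤ (N : ℝ) by positivity)]
    calc _ ≤ Z ^ 4 * Z := by gcongr
      _ = Z ^ 5 := by ring
  · rw [Function.update_self] at hp
    refine Tri.nil S.bits (Tri.nil S.bits ⟨?_, (Agree.refl _ _).update (by simp) _⟩)
    rw [Function.update_self]
    rwa [max_eq_right hp.le] at hlow
  · rw [Function.update_self] at hn
    refine Tri.assign S.bits (by decide) (S.fits_lit (by simp [Arith.eval])) (Tri.nil S.bits ⟨?_,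
      ((Agree.refl _ _).update (by simp) _).update (by simp) _⟩)
    rw [Function.update_self]
    rwa [max_eq_left hn] at hlow

theorem Scale.radiusFactor_le (S : Scale n k β W X Φ Z) {i : ℕ} (hi : i ≤ k + 1) :
    (radiusFactor n i : ℝ) ≤ Z := by
  refine le_trans ?_ S.spread
  rw [radiusFactor]; push_cast
  have h1 := one_le_spread (n := n) (by have := S.n_pos; omega)
  gcongr

theorem testCode_spec (E : Env f O μ β κ W X Φ Z) {Y N : ℕ → ℕ → Prop} {j : ℕ}
    (hdec : Decides f (candidate k m r j) r W Φ X Y N) {σ : ℕ → ℤ} (hσ : Header k n κ W σ)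
    (D : Disk m r X W σ) (hj : j ≤ 2 * k ^ 2) (h24 : σ 24 = j)
    (hX : ∀ i ≤ k, testRadius n r i ≤ X) (hfit : (σ 24).natAbs < 2 ^ β) :
    Tri O μ β testCode σ (testSteps n k) fun σ' => Progress Y N k (k + 1) 0 σ' ∧ σ' 24 = j := by
  have S := E.scale
  have hk := S.two_le
  refine Tri.steps (N := 1 + (4 + (1 + (1 + (1 + (1 + (1 + (1 + (1 +
    (((k + 1 - 0) * ((rowSteps n k + 8) + 1) + 1) + 1))))))))))
    (Tri.assign_cons S.bits j (by decide) (by simp [Arith.eval, h24]) (by rwa [h24] at hfit)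
    (Tri.cons (Tri.mono (candCode_spec S (κ := κ)
      (hσ.agree ((Agree.refl [25] _).update (by simp) _) (by decide))
      (D.agree (by simp) (by simp)) hj (by simp)) le_rfl ?_)))
    (by rw [testSteps, Nat.sub_zero]; linarith)
  rintro σ₀ ⟨hlow, hag0⟩
  have hag0' : Agree [6, 7, 8, 9, 10, 11, 12, 13, 14, 15, 16, 17, 18, 19, 25, 27, 32, 33, 34, 35,
      36, 37, 38, 39, 40, 41, 43, 44, 45, 46] σ σ₀ :=
    ((Agree.refl _ _).update (by simp) _).trans (hag0.sub (by simp))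
  have hH0 := hσ.agree hag0' (by decide)
  refine Tri.assign_cons S.bits 1 (by decide) rfl (S.fits_lit (by norm_num))
    (Tri.assign_cons S.bits (radiusFactor n 0) (by decide)
      (by simp [Arith.eval, hH0.n_eq, radiusFactor])
      (S.fits_nat (by positivity) (by exact_mod_cast S.radiusFactor_le (Nat.zero_le _)))
    (Tri.assign_cons S.bits 1 (by decide) rfl (S.fits_lit (by norm_num))
    (Tri.assign_cons S.bits 0 (by decide) rfl (S.fits_lit (by norm_num))
    (Tri.assign_cons S.bits 0 (by decide) rfl (S.fits_lit (by norm_num))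
    (Tri.assign_cons S.bits 0 (by decide) rfl (S.fits_lit (by norm_num))
    (Tri.assign_cons S.bits ((k : ℤ) + 1) (by decide) (by simp [Arith.eval, hH0.k_eq])
      (S.fits_index (by omega) (by omega))
    (Tri.cons (Tri.loop S.bits (by norm_num) (L := k + 1) (p₀ := 0)
    (fun p σ' => p ≤ k + 1 ∧ Progress Y N k p 0 σ' ∧ σ' 32 = p ∧ σ' 33 = k + 1 - p ∧ σ' 6 = 1 ∧
      σ' 7 = σ₀ 7 ∧ σ' 34 = radiusFactor n p ∧
      Agree [6, 7, 8, 9, 10, 11, 12, 13, 14, 15, 16, 17, 18, 19, 25, 27, 32, 33, 34, 35, 36, 37, 38,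
        39, 40, 41, 43, 44, 45, 46] σ σ') ?_ ?_ (Nat.zero_le _) ?_))))))))
  · rintro p σ₁ ⟨hp, hprog, k32, k33, k6, k7, k34, hag⟩ hpos
    have hpk : p ≤ k := by omega
    have hH := hσ.agree hag (by decide)
    have hpos' : 0 < radiusFactor n p := by
      have := S.n_pos
      rw [radiusFactor]; positivity
    refine ⟨by omega, Tri.steps (N := 4 + (rowSteps n k + (1 + (1 + (1 + 1)))))
      (Tri.cons (Tri.mono (radCode_spec S (D.agree (hag 4 (by decide)) (hag 5 (by decide)))
        hpos' (S.radiusFactor_le (by omega)) (by rw [radiusFactor_mul]; exact hX p hpk) k34)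
        le_rfl ?_)) (by omega)⟩
    rintro σ₂ ⟨hρ, hag2⟩
    rw [radiusFactor_mul] at hρ
    refine Tri.cons (Tri.mono (rowCode_spec E hdec (hH.agree hag2 (by decide))
      ((hag2 6 (by decide)).trans k6) (by rw [hag2 7 (by decide), k7]; exact hlow) hpk hρ
      ((hag2 32 (by decide)).trans k32) (hprog.congr (hag2 43 (by decide)) (hag2 44 (by decide))
      (hag2 45 (by decide)))) le_rfl ?_)
    rintro σ₃ ⟨hprog3, hag3⟩
    have hag3' := (hag.trans (hag2.sub (L' := [6, 7, 8, 9, 10, 11, 12, 13, 14, 15, 16, 17, 18, 19,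
      25, 27, 32, 33, 34, 35, 36, 37, 38, 39, 40, 41, 43, 44, 45, 46]) (by simp))).trans
      (hag3.sub (by simp))
    have hH3 := hσ.agree hag3' (by decide)
    have j34 : σ₃ 34 = radiusFactor n p :=
      ((hag3 34 (by decide)).trans (hag2 34 (by decide))).trans k34
    have j32 : σ₃ 32 = p := ((hag3 32 (by decide)).trans (hag2 32 (by decide))).trans k32
    have j33 : σ₃ 33 = k + 1 - p := ((hag3 33 (by decide)).trans (hag2 33 (by decide))).trans k33
    have j6 : σ₃ 6 = 1 := ((hag3 6 (by decide)).trans (hag2 6 (by decide))).trans k6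
    have j7 : σ₃ 7 = σ₀ 7 := ((hag3 7 (by decide)).trans (hag2 7 (by decide))).trans k7
    exact Tri.assign_cons S.bits (radiusFactor n (p + 1)) (by decide)
        (by simp [Arith.eval, j34, hH3.n_eq, radiusFactor]; ring)
        (S.fits_nat (by positivity) (by exact_mod_cast S.radiusFactor_le (by omega)))
      (Tri.assign_cons S.bits ((p + 1 : ℕ) : ℤ) (by decide) (by simp [Arith.eval, j32])
        (S.fits_index (by omega) (by omega))
      (Tri.assign_cons S.bits ((k : ℤ) + 1 - (p + 1 : ℕ)) (by decide)
        (by simp [Arith.eval, j33]; ring) (S.fits_index (by omega) (by omega))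
      (Tri.nil S.bits ⟨by omega, (hprog3.next).congr (by simp) (by simp) (by simp), by simp,
        by simp, by simpa using j6, by simpa using j7, by simp,
        ((hag3'.update (by simp) _).update (by simp) _).update (by simp) _⟩)))
  · rintro p σ₁ ⟨hp, hprog, k32, k33, k6, k7, k34, hag⟩ hle
    obtain rfl : p = k + 1 := by omega
    exact Tri.nil S.bits ⟨hprog, (hag 24 (by decide)).trans h24⟩
  · exact ⟨Nat.zero_le _, Or.inl ⟨by simp, fun a b _ h => by omega⟩, by simp, by simp, by simp,
      by simp, by simp, ((((((hag0'.update (by simp) _).update (by simp) _).update (by simp)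
        _).update (by simp) _).update (by simp) _).update (by simp) _).update (by simp) _⟩

end Tests

/-! ### The precision loop -/

open Arith in
/-- Register `28 := (2 ^ 27 n ^ 9) ^ k`, and the initial precision. -/
def setupCode : Program := block [
  assign 28 (lit 1), assign 11 (var 0),
  .loop 11 (block [
    assign 28 (mul (var 28) (mul (lit 134217728) (mul (mul (mul (var 1) (var 1)) (var 1))
      (mul (mul (mul (var 1) (var 1)) (var 1)) (mul (mul (var 1) (var 1)) (var 1)))))),
    assign 11 (sub (var 11) (lit 1))]),
  assign 2 (lit 1), assign 3 (lit 4), assign 30 (lit 1)]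

open Arith in
/-- Double the precision and read the disk. -/
def readCode : Program := block [
  -- With `W = 2 ^ (κ + 1)`, doubling `κ` means passing to `W ^ 2 / 2 = 2 ^ (2κ + 1)`.
  assign 2 (mul (lit 2) (var 2)), assign 3 (div (mul (var 3) (var 3)) (lit 2)),
  .query 4 0 2, assign 20 (add (var 0) (lit 1)), .query 5 20 2]

open Arith in
/-- Register `18 := max(1, m + r) ^ n`. -/
def sizeCode : Program := block [
  -- The last index of the multipoint is the point `m + r`; `candCode` is reused to compute it.
  assign 25 (mul (lit 2) (mul (var 0) (var 0))), candCode,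
  assign 17 (var 7), assign 31 (sub (var 3) (var 7)),
  .branch 31 (assign 17 (var 3)) (block []),
  assign 16 (var 1), powCode]

open Arith in
/-- Register `29 := ∑ t, (f_t ^ 2 + 1)`. -/
def heightCode : Program := block [
  assign 29 (lit 0), assign 10 (lit 0), assign 11 (var 0),
  .loop 11 (block [
    .query 13 10 2,
    assign 29 (add (var 29) (add (mul (var 13) (var 13)) (mul (var 3) (var 3)))),
    assign 10 (add (var 10) (lit 1)),
    assign 11 (sub (var 11) (lit 1))])]

open Arith in
/-- Register `30 := 0` if the precision is sufficient. -/
def exitCode : Program := block [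
  -- Register `23` carries `W ^ 2`, the height sum `W ^ 2` and the cube of the power `W ^ 3`. Up to
  -- rounding the comparison says that the best minimum times `W` exceeds the safety factor times `∑
  -- (f_t ^ 2 + 1) X ^ (3n)`.
  assign 31 (sub (mul (var 23) (mul (mul (var 3) (var 3)) (mul (var 3) (var 3))))
    (mul (mul (var 28) (var 29)) (mul (var 18) (mul (var 18) (var 18))))),
  .branch 31 (block [
    assign 31 (sub (var 3) (mul (lit 32) (var 1))),
    .branch 31 (assign 30 (lit 0)) (block [])]) (block [])]

/-- One round. -/
def roundCode : Program := block [readCode, bestCode, sizeCode, heightCode, exitCode]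

/-- `∑ t, (f_t ^ 2 + 1)` as computed from the oracle answers. -/
def heightSum (k : ℕ) (O : ℕ → ℕ → ℤ) (κ : ℕ) (W : ℤ) : ℤ :=
  ∑ t ∈ Finset.range k, (O t κ * O t κ + W * W)

/-- A bound for the coefficients that is known from the oracle answers. -/
def heightBound (k : ℕ) (O : ℕ → ℕ → ℤ) (κ : ℕ) (W : ℤ) : ℝ := 2 * heightSum k O κ W / W ^ 2

/-- The safety factor `(2 ^ 27 n ^ 9) ^ k`. -/
def safety (n k : ℕ) : ℕ := (134217728 * n ^ 9) ^ k

/-- A round that found the `j`-th point with minimum `best` and size estimate `z`. -/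
structure Selected {n k : ℕ} {τ : ℝ} (f : Nomial n k τ) (m r X Φ : ℝ) (W : ℤ) (j : ℕ)
    (best z : ℤ) : Prop where
  index_le : j ≤ 2 * k ^ 2
  best_le : (best : ℝ) ≤ f.minAbs (candidate k m r j) * W ^ 2 + k * (W * termErr n k Φ X)
  le_best : ∀ j ≤ 2 * k ^ 2,
    f.minAbs (candidate k m r j) * W ^ 2 ≤ best + k * (W * termErr n k Φ X)
  size : Low W X (16 * n) z (X ^ n) n

/-- The criterion for the end of the precision loop. -/
def Sufficient (n k : ℕ) (O : ℕ → ℕ → ℤ) (κ : ℕ) (W best z : ℤ) : Prop :=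
  safety n k * heightSum k O κ W * z ^ 3 < best * W ^ 4 ∧ 32 * n < W

/-- The situation after a round. -/
def AfterRound {n k : ℕ} {τ : ℝ} (f : Nomial n k τ) (m r X : ℝ) (O : ℕ → ℕ → ℤ) (κ : ℕ) (W : ℤ)
    (σ : ℕ → ℤ) : Prop :=
  ∃ (j : ℕ) (best z : ℤ), σ 24 = j ∧ Selected f m r X (heightBound k O κ W) W j best z ∧
    (0 < σ 30 ∧ ¬ Sufficient n k O κ W best z ∨ σ 30 ≤ 0 ∧ Sufficient n k O κ W best z)

theorem Low.max {W : ℤ} {X c : ℝ} {z : ℤ} {v : ℝ} (hW : 0 < W) (hX : 1 ≤ X) (hc : 0 ≤ c)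
    (h : Low W X c z v 1) : Low W X c (max z W) (max v 1) 1 := by
  have hW' : (0 : ℝ) < W := by exact_mod_cast hW
  have h1 := h.error
  rw [pow_one] at h1
  refine ⟨hW.le.trans (le_max_right _ _), ?_, ?_, zero_le_one.trans (le_max_right _ _), ?_⟩
  · push_cast
    refine max_le (h.le.trans ?_) ?_
    · gcongr; exact le_max_left _ _
    · calc (W : ℝ) = 1 * W := (one_mul _).symm
        _ ≤ _ := by gcongr; exact le_max_right _ _
  · push_cast
    rw [pow_one, max_mul_of_nonneg _ _ hW'.le, one_mul, sub_le_iff_le_add]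
    refine max_le ?_ ?_
    · have := le_max_left (z : ℝ) W; linarith
    · have := le_max_right (z : ℝ) W
      have : 0 ≤ c * X := by positivity
      linarith
  · rw [pow_one]
    have := h.val_le
    rw [pow_one] at this
    exact max_le this hX

/-- The number of steps of `roundCode`. -/
def roundSteps (n k : ℕ) : ℕ := bestSteps n k + powSteps n + 6 * k + 40

section Loop

variable {n k : ℕ} {τ : ℝ} {f : Nomial n k τ} {O : ℕ → ℕ → ℤ} {μ : ℕ → ℤ} {β κ : ℕ} {W : ℤ}
  {X Φ Z m r : ℝ}

theorem candidate_last (hk : 0 < k) : candidate k m r (2 * k ^ 2) = m + r := by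
  rw [candidate, multipointAt]; push_cast
  have : (k : ℝ) ≠ 0 := by positivity
  field_simp
  ring

theorem sizeCode_spec (S : Scale n k β W X Φ Z) {σ : ℕ → ℤ} (hσ : Header k n κ W σ)
    (D : Disk m r X W σ) (hX : X = max (m + r) 1) :
    Tri O μ β sizeCode σ (powSteps n + 11) fun σ' => Low W X (16 * n) (σ' 18) (X ^ n) n ∧
      Agree [7, 16, 17, 18, 19, 25, 31] σ σ' := by
  have hk := S.two_le
  have hkZ : (k : ℝ) ≤ Z := by have := S.k_le'; linarith
  have hZ1 := S.one_le
  have hZ := S.Z_pos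
  refine Tri.steps (N := 1 + (4 + (1 + (1 + (2 + (1 + (powSteps n + 1)))))))
    (Tri.assign_cons S.bits ((2 * k ^ 2 : ℕ) : ℤ) (by decide)
      (by simp [Arith.eval, hσ.k_eq, pow_two]) ?_
    (Tri.cons (Tri.mono (candCode_spec S (κ := κ)
      (hσ.agree ((Agree.refl [25] _).update (by simp) _) (by decide))
      (D.agree (by simp) (by simp)) le_rfl (by simp)) le_rfl ?_)))
    (by omega)
  · refine S.fits 3 (by norm_num) ?_
    have h2 : (2 : ℝ) ≤ Z := le_trans (by norm_num) S.large
    push_cast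
    rw [abs_of_nonneg (by positivity)]
    calc 2 * (k : ℝ) ^ 2 ≤ Z * Z ^ 2 := by gcongr
      _ = Z ^ 3 := by ring
  rintro σ₁ ⟨hlow, hag⟩
  rw [candidate_last (by omega)] at hlow
  have hmax := hlow.max S.W_pos S.one_le_X (by norm_num)
  rw [← hX] at hmax
  have hag1 : Agree [7, 16, 17, 18, 19, 25, 31] σ σ₁ :=
    ((Agree.refl _ _).update (by simp) _).trans (hag.sub (by simp))
  have hH := hσ.agree hag1 (by decide)
  have hx0 := hlow.nonneg
  have hfitx := hlow.fits S (by omega)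
  have hxZ : (σ₁ 7 : ℝ) ≤ Z ^ 3 := hlow.le_cube S (by omega)
  have hx0' : (0 : ℝ) ≤ σ₁ 7 := by exact_mod_cast hx0
  have hend : ∀ σ₂ : ℕ → ℤ, σ₂ 17 = max (σ₁ 7) W → Agree [17, 31] σ₁ σ₂ →
      Tri O μ β (block [assign 16 (.var 1), powCode]) σ₂ (1 + (powSteps n + 1)) fun σ' =>
        Low W X (16 * n) (σ' 18) (X ^ n) n ∧ Agree [7, 16, 17, 18, 19, 25, 31] σ σ' := by
    intro σ₂ h17 hag2
    have hag2' := hag1.trans (hag2.sub (L' := [7, 16, 17, 18, 19, 25, 31]) (by simp))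
    have hH2 := hσ.agree hag2' (by decide)
    refine Tri.assign_cons S.bits n (by decide) (by simp [Arith.eval, hH2.n_eq])
      (S.fits_nat (by positivity) (by
        have := S.n_le
        have h0 : (0 : ℝ) ≤ n := by positivity
        rw [Int.cast_natCast]; linarith))
      (Tri.cons (Tri.mono (powCode_spec S (c := 15) (x := X) (e := n) ?_ ?_ ?_ le_rfl) le_rfl ?_))
    · simp [hH2.unit_eq]
    · simpa [h17] using hmax
    · simp
    · rintro σ₃ ⟨hz, hag3⟩
      exact Tri.nil S.bits ⟨hz.mono S.one_le_X (by norm_num),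
        (hag2'.update (by simp) _).trans (hag3.sub (by simp))⟩
  refine Tri.assign_cons S.bits (σ₁ 7) (by decide) rfl hfitx
    (Tri.assign_cons S.bits (W - σ₁ 7) (by decide) (by simp [Arith.eval, hH.unit_eq]) ?_
    (Tri.cons (Tri.branch (N := 1) S.bits (by norm_num) (fun hp => ?_) (fun hn => ?_))))
  · refine S.fits 3 (by norm_num) ?_
    have h1 := S.W_le
    have h2 := S.W_pos'
    have h3 : Z ≤ Z ^ 3 := by
      calc Z = Z ^ 1 := (pow_one _).symm
        _ ≤ Z ^ 3 := pow_le_pow_right₀ hZ1 (by norm_num)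
    push_cast
    rw [abs_le]; constructor <;> linarith
  · rw [Function.update_self] at hp
    refine Tri.assign S.bits (by decide) ?_ (hend _ ?_
      ((((Agree.refl _ _).update (by simp) _).update (by simp) _).update (by simp) _))
    · simpa [Arith.eval, hH.unit_eq] using S.fits_nat S.W_pos.le S.W_le
    · rw [Function.update_self, max_eq_right (by omega)]
      simp [Arith.eval, hH.unit_eq]
  · rw [Function.update_self] at hn
    refine Tri.nil S.bits (hend _ ?_
      (((Agree.refl _ _).update (by simp) _).update (by simp) _))
    rw [max_eq_left (by omega)]
    simp

theorem heightSum_le (hW : 0 < W) (hΦ : heightBound k O κ W ≤ Z) (hWZ : (W : ℝ) ≤ Z) :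
    (heightSum k O κ W : ℝ) ≤ Z ^ 3 := by
  have hW' : (0 : ℝ) < W := by exact_mod_cast hW
  have h1 : (heightSum k O κ W : ℝ) = heightBound k O κ W * W ^ 2 / 2 := by
    rw [heightBound]; field_simp
  have hZ : 0 < Z := hW'.trans_le hWZ
  have h2 : heightBound k O κ W * (W : ℝ) ^ 2 ≤ Z * Z ^ 2 := by gcongr
  have h3 : 0 ≤ Z * Z ^ 2 := by positivity
  rw [h1]
  calc heightBound k O κ W * W ^ 2 / 2 ≤ Z * Z ^ 2 := by linarith
    _ = Z ^ 3 := by ring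

theorem heightCode_spec (E : Env f O μ β κ W X (heightBound k O κ W) Z) {σ : ℕ → ℤ}
    (hσ : Header k n κ W σ) :
    Tri O μ β heightCode σ (6 * k + 5) fun σ' => σ' 29 = heightSum k O κ W ∧
      Agree [10, 11, 13, 29] σ σ' := by
  have S := E.scale
  have hpart : ∀ p ≤ k, (∑ t ∈ Finset.range p, (O t κ * O t κ + W * W)).natAbs < 2 ^ β := by
    intro p hp
    have h0 : ∀ q, 0 ≤ ∑ t ∈ Finset.range q, (O t κ * O t κ + W * W) := fun q =>
      Finset.sum_nonneg fun t _ => add_nonneg (mul_self_nonneg _) (mul_self_nonneg _)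
    have h1 : ∑ t ∈ Finset.range p, (O t κ * O t κ + W * W) ≤ heightSum k O κ W :=
      Finset.sum_le_sum_of_subset_of_nonneg (Finset.range_mono hp)
        fun t _ _ => add_nonneg (mul_self_nonneg _) (mul_self_nonneg _)
    refine S.fits 3 (by norm_num) ?_
    rw [abs_of_nonneg (by exact_mod_cast h0 p)]
    refine le_trans (by exact_mod_cast h1) (heightSum_le S.W_pos ?_ S.W_le)
    have := S.coef_le
    linarith
  refine Tri.steps (N := 1 + (1 + (1 + (((k - 0) * (5 + 1) + 1) + 1))))
    (Tri.assign_cons S.bits 0 (by decide) rfl (S.fits_lit (by norm_num))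
    (Tri.assign_cons S.bits 0 (by decide) rfl (S.fits_lit (by norm_num))
    (Tri.assign_cons S.bits k (by decide) (by simp [Arith.eval, hσ.k_eq])
      (S.fits_index (by omega) (by omega))
    (Tri.cons (Tri.loop S.bits (by norm_num) (L := k) (p₀ := 0)
    (fun p σ' => p ≤ k ∧ σ' 29 = ∑ t ∈ Finset.range p, (O t κ * O t κ + W * W) ∧ σ' 10 = p ∧
      σ' 11 = k - p ∧ Agree [10, 11, 13, 29] σ σ') ?_ ?_ (Nat.zero_le _) ?_))))) (by omega)
  · rintro p σ₁ ⟨hp, k29, k10, k11, hag⟩ hpos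
    have hpk : p < k := by omega
    have hH := hσ.agree hag (by decide)
    refine ⟨hpk, Tri.steps (N := 1 + (1 + (1 + (1 + 1)))) (Tri.cons (Tri.query S.bits (by norm_num)
      (by norm_num) ?_ ?_ (Tri.assign_cons S.bits (∑ t ∈ Finset.range (p + 1),
      (O t κ * O t κ + W * W)) (by decide) ?_ (hpart _ hpk)
      (Tri.assign_cons S.bits ((p + 1 : ℕ) : ℤ) (by decide) ?_ (S.fits_index (by omega) (by omega))
      (Tri.assign_cons S.bits ((k : ℤ) - (p + 1 : ℕ)) (by decide) ?_
        (S.fits_index (by omega) (by omega)) (Tri.nil S.bits ⟨hpk, ?_, ?_, ?_, ?_⟩)))))) le_rfl⟩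
    · simpa [hH.prec_eq] using E.prec_le
    · simpa [k10, hH.prec_eq] using S.fits 2 (by norm_num) (E.abs_oracle_le hpk)
    · rw [Finset.sum_range_succ]
      simp [Arith.eval, k29, k10, hH.prec_eq, hH.unit_eq]
    · simp [Arith.eval, k10]
    · simp [Arith.eval, k11]; ring
    · simp
    · simp
    · simp
    · exact (((hag.update (by simp) _).update (by simp) _).update (by simp) _).update (by simp) _
  · rintro p σ₁ ⟨hp, k29, k10, k11, hag⟩ hle
    obtain rfl : p = k := by omega
    exact Tri.nil S.bits ⟨k29, hag⟩
  · exact ⟨Nat.zero_le _, by simp, by simp, by simp,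
      (((Agree.refl _ _).update (by simp) _).update (by simp) _).update (by simp) _⟩

theorem exitCode_spec (E : Env f O μ β κ W X (heightBound k O κ W) Z) {σ : ℕ → ℤ}
    (hσ : Header k n κ W σ) (hQ : (safety n k : ℝ) ≤ Z) (h28 : σ 28 = safety n k)
    (h29 : σ 29 = heightSum k O κ W) (h0 : 0 ≤ σ 23) (hbest : (σ 23 : ℝ) ≤ Z ^ 7)
    (hz : Low W X (16 * n) (σ 18) (X ^ n) n) (h30 : 0 < σ 30) :
    Tri O μ β exitCode σ 7 fun σ' =>
      (0 < σ' 30 ∧ ¬ Sufficient n k O κ W (σ 23) (σ 18) ∨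
        σ' 30 ≤ 0 ∧ Sufficient n k O κ W (σ 23) (σ 18)) ∧ Agree [30, 31] σ σ' := by
  have S := E.scale
  have hZ := S.Z_pos
  have hZ1 := S.one_le
  have hF0 : 0 ≤ heightSum k O κ W :=
    Finset.sum_nonneg fun t _ => add_nonneg (mul_self_nonneg _) (mul_self_nonneg _)
  have hF := heightSum_le S.W_pos (by have := S.coef_le; linarith : heightBound k O κ W ≤ Z) S.W_le
  have hzZ : (σ 18 : ℝ) ≤ Z ^ 3 := hz.le_cube S (by omega)
  have hz0 : (0 : ℝ) ≤ σ 18 := by exact_mod_cast hz.nonneg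
  have hF0' : (0 : ℝ) ≤ heightSum k O κ W := by exact_mod_cast hF0
  have hb0 : (0 : ℝ) ≤ σ 23 := by exact_mod_cast h0
  have hW := S.W_pos'
  have hWZ := S.W_le
  set V : ℤ := σ 23 * W ^ 4 - safety n k * heightSum k O κ W * σ 18 ^ 3 with hV
  refine Tri.steps (N := 1 + (5 + 1)) (Tri.assign_cons S.bits V (by decide) ?_ ?_
    (Tri.cons (Tri.branch (N := 4) S.bits (by norm_num) (fun hp => ?_) (fun hn => ?_)))) le_rfl
  · simp only [Arith.eval, hσ.unit_eq, h28, h29, hV]; ring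
  · refine S.fits 13 (by norm_num) ?_
    have e1 : (σ 23 : ℝ) * W ^ 4 ≤ Z ^ 13 := by
      calc (σ 23 : ℝ) * W ^ 4 ≤ Z ^ 7 * Z ^ 4 := by gcongr
        _ = Z ^ 11 := by ring
        _ ≤ Z ^ 13 := pow_le_pow_right₀ hZ1 (by norm_num)
    have e2 : (safety n k : ℝ) * heightSum k O κ W * σ 18 ^ 3 ≤ Z ^ 13 := by
      calc (safety n k : ℝ) * heightSum k O κ W * σ 18 ^ 3 ≤ Z * Z ^ 3 * (Z ^ 3) ^ 3 := by gcongr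
        _ = Z ^ 13 := by ring
    have e3 : 0 ≤ (σ 23 : ℝ) * W ^ 4 := by positivity
    have e4 : 0 ≤ (safety n k : ℝ) * heightSum k O κ W * σ 18 ^ 3 := by positivity
    rw [hV]; push_cast
    rw [abs_le]; constructor <;> linarith
  · rw [Function.update_self] at hp
    refine Tri.steps (N := 1 + (2 + 1)) (Tri.assign_cons S.bits (W - 32 * n) (by decide)
      (by simp [Arith.eval, hσ.unit_eq, hσ.n_eq]) ?_
      (Tri.cons (Tri.branch (N := 1) S.bits (by norm_num) (fun hp' => ?_) (fun hn' => ?_)))) le_rfl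
    · refine S.fits 2 (by norm_num) ?_
      have h1 := S.n_le
      have h2 : (16 : ℝ) ≤ Z := le_trans (by norm_num) S.large
      have h3 : (0 : ℝ) ≤ n := by positivity
      have h4 : 16 * (2 * (n : ℝ)) ≤ Z * Z := by
        have : 2 * (n : ℝ) ≤ Z := by linarith
        gcongr
      have h5 : Z ≤ Z * Z := le_mul_of_one_le_left hZ.le hZ1
      push_cast
      rw [pow_two, abs_le]; constructor <;> linarith
    · rw [Function.update_self] at hp'
      refine Tri.assign S.bits (by decide) (S.fits_lit (by simp [Arith.eval])) (Tri.nil S.bits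
        (Tri.nil S.bits ⟨Or.inr ⟨by simp [Arith.eval], by omega, by omega⟩, ?_⟩))
      exact (((Agree.refl _ _).update (by simp) _).update (by simp) _).update (by simp) _
    · rw [Function.update_self] at hn'
      refine Tri.nil S.bits (Tri.nil S.bits (Tri.nil S.bits ⟨Or.inl ⟨by simpa using h30,
        fun h => ?_⟩, ((Agree.refl _ _).update (by simp) _).update (by simp) _⟩))
      have := h.2
      omega
  · rw [Function.update_self] at hn
    refine Tri.steps (N := 1) (Tri.nil S.bits (Tri.nil S.bits ⟨Or.inl ⟨by simpa using h30,
        fun h => ?_⟩, (Agree.refl _ _).update (by simp) _⟩)) (by norm_num)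
    have := h.1
    omega

theorem readCode_spec (S : Scale n k β W X Φ Z) (hκ : 2 * κ ≤ β) {W₀ : ℤ}
    (hW : W = W₀ * W₀ / 2) {σ : ℕ → ℤ} (hσ : Header k n κ W₀ σ) (hκZ : (2 * κ : ℕ) ≤ Z)
    (hr : 0 < r) (hrm : r < m) (hX : m + r ≤ X) (hm' : |m * W - O k (2 * κ)| < 2)
    (hr' : |r * W - O (k + 1) (2 * κ)| < 2) :
    Tri O μ β readCode σ 6 fun σ' => Header k n (2 * κ) W σ' ∧ Disk m r X W σ' ∧
      Agree [2, 3, 4, 5, 20] σ σ' := by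
  have hD : Disk m r X W (Function.update (Function.update σ 4 (O k (2 * κ))) 5
      (O (k + 1) (2 * κ))) := ⟨hr, hrm, hX, by simpa using hm', by simpa using hr'⟩
  obtain ⟨b4, b5⟩ := hD.abs_le S
  simp only [ne_eq, Nat.reduceEqDiff, not_false_eq_true, Function.update_of_ne,
    Function.update_self] at b4 b5
  have htn : (2 * (κ : ℤ)).toNat = 2 * κ := by omega
  refine Tri.steps (N := 1 + (1 + (1 + (1 + (1 + 1))))) (Tri.assign_cons S.bits ((2 * κ : ℕ) : ℤ)
    (by decide) (by simp [Arith.eval, hσ.prec_eq]) (S.fits_nat (by positivity)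
      (by exact_mod_cast hκZ))
    (Tri.assign_cons S.bits W (by decide) (by simp [Arith.eval, hσ.unit_eq, hW])
      (S.fits_nat S.W_pos.le S.W_le)
    (Tri.cons (Tri.query S.bits (by norm_num) (by norm_num) ?_ ?_
    (Tri.assign_cons S.bits ((k + 1 : ℕ) : ℤ) (by decide) ?_ (S.fits_index (by omega) (by omega))
    (Tri.cons (Tri.query S.bits (by norm_num) (by norm_num) ?_ ?_ (Tri.nil S.bits
      ⟨⟨?_, ?_, ?_, ?_⟩, ?_, ?_⟩)))))))) le_rfl
  · simpa [htn] using hκ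
  · simpa [hσ.k_eq, htn] using S.fits 3 (by norm_num) b4
  · simp [Arith.eval, hσ.k_eq]
  · simpa [htn] using hκ
  · simpa [htn] using S.fits 3 (by norm_num) b5
  · simp [hσ.k_eq]
  · simp [hσ.n_eq]
  · simp
  · simp
  · exact hD.agree (by simp [hσ.k_eq, htn]) (by simp [htn])
  · exact (((((Agree.refl _ _).update (by simp) _).update (by simp) _).update (by simp) _).update
      (by simp) _).update (by simp) _

theorem roundCode_spec (E : Env f O μ β (2 * κ) W X (heightBound k O (2 * κ) W) Z)
    (hX : X = max (m + r) 1) (hQ : (safety n k : ℝ) ≤ Z) (hr : 0 < r) (hrm : r < m)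
    (hm' : |m * W - O k (2 * κ)| < 2) (hr' : |r * W - O (k + 1) (2 * κ)| < 2)
    (hκZ : (2 * κ : ℕ) ≤ Z) {W₀ : ℤ} (hW : W = W₀ * W₀ / 2) {σ : ℕ → ℤ}
    (hσ : Header k n κ W₀ σ) (h28 : σ 28 = safety n k) (h30 : 0 < σ 30) :
    Tri O μ β roundCode σ (roundSteps n k) fun σ' => Header k n (2 * κ) W σ' ∧ Disk m r X W σ' ∧
      σ' 28 = safety n k ∧ AfterRound f m r X O (2 * κ) W σ' := by
  have S := E.scale
  refine Tri.steps (N := 6 + (bestSteps n k + ((powSteps n + 11) + ((6 * k + 5) + (7 + 1)))))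
    (Tri.cons (Tri.mono (readCode_spec S E.prec_le hW hσ hκZ hr hrm (by
      rw [hX]; exact le_max_left _ _) hm' hr') le_rfl ?_)) (by rw [roundSteps]; omega)
  rintro σ₁ ⟨hH1, hD1, hag1⟩
  refine Tri.cons (Tri.mono (bestCode_spec E hH1 hD1) le_rfl ?_)
  rintro σ₂ ⟨⟨j, hj, k24, hbest⟩, hall, h0, hZ, hag2⟩
  have hH2 := hH1.agree hag2 (by decide)
  have hD2 := hD1.agree (hag2 4 (by decide)) (hag2 5 (by decide))
  refine Tri.cons (Tri.mono (sizeCode_spec S hH2 hD2 hX) le_rfl ?_)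
  rintro σ₃ ⟨hz, hag3⟩
  refine Tri.cons (Tri.mono (heightCode_spec E (hH2.agree hag3 (by decide))) le_rfl ?_)
  rintro σ₄ ⟨k29, hag4⟩
  have e18 : σ₄ 18 = σ₃ 18 := hag4 18 (by decide)
  have e23 : σ₄ 23 = σ₂ 23 := (hag4 23 (by decide)).trans (hag3 23 (by decide))
  have e28 : σ₄ 28 = safety n k := ((((hag4 28 (by decide)).trans (hag3 28 (by decide))).trans
    (hag2 28 (by decide))).trans (hag1 28 (by decide))).trans h28
  have e30 : σ₄ 30 = σ 30 := (((hag4 30 (by decide)).trans (hag3 30 (by decide))).trans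
    (hag2 30 (by decide))).trans (hag1 30 (by decide))
  have hH4 := (hH2.agree hag3 (by decide)).agree hag4 (by decide)
  refine Tri.cons (Tri.mono (exitCode_spec E hH4 hQ e28 k29 (by rw [e23]; exact h0)
    (by rw [e23]; exact hZ) (by rw [e18]; exact hz) (by rw [e30]; exact h30)) le_rfl ?_)
  rintro σ₅ ⟨hexit, hag5⟩
  rw [e18, e23] at hexit
  refine Tri.nil S.bits ⟨hH4.agree hag5 (by decide), hD2.agree ?_ ?_,
    (hag5 28 (by decide)).trans e28, j, σ₂ 23, σ₃ 18, ?_, ⟨hj, hbest, hall, hz⟩, hexit⟩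
  · rw [hag5 4 (by decide), hag4 4 (by decide), hag3 4 (by decide)]
  · rw [hag5 5 (by decide), hag4 5 (by decide), hag3 5 (by decide)]
  · rw [hag5 24 (by decide), hag4 24 (by decide), hag3 24 (by decide), k24]

theorem safety_mono {p : ℕ} (hn : 1 ≤ n) (hp : p ≤ k) : safety n p ≤ safety n k :=
  Nat.pow_le_pow_right (by positivity) hp

theorem setupCode_spec (S : Scale n k β W X Φ Z) (hQ : (safety n k : ℝ) ≤ Z) {σ : ℕ → ℤ}
    (h0 : σ 0 = k) (h1 : σ 1 = n) :
    Tri O μ β setupCode σ (4 * k + 7) fun σ' => Header k n 1 4 σ' ∧ σ' 28 = safety n k ∧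
      0 < σ' 30 := by
  have hfit : ∀ p ≤ k, ((safety n p : ℕ) : ℤ).natAbs < 2 ^ β := fun p hp =>
    S.fits_nat (by positivity) (le_trans (by
      rw [Int.cast_natCast]; exact_mod_cast safety_mono S.n_pos hp) hQ)
  refine Tri.steps (N := 1 + (1 + (((k - 0) * (3 + 1) + 1) + (1 + (1 + (1 + 1))))))
    (Tri.assign_cons S.bits 1 (by decide) rfl (S.fits_lit (by norm_num))
    (Tri.assign_cons S.bits k (by decide) (by simp [Arith.eval, h0])
      (S.fits_index (by omega) (by omega))
    (Tri.cons (Tri.loop S.bits (by norm_num) (L := k) (p₀ := 0)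
    (fun p σ' => p ≤ k ∧ σ' 28 = safety n p ∧ σ' 11 = k - p ∧ Agree [11, 28] σ σ')
      ?_ ?_ (Nat.zero_le _) ?_)))) (by omega)
  · rintro p σ₁ ⟨hp, k28, k11, hag⟩ hpos
    have hpk : p < k := by omega
    have k1 : σ₁ 1 = n := (hag 1 (by decide)).trans h1
    refine ⟨hpk, Tri.steps (N := 1 + (1 + 1)) (Tri.assign_cons S.bits (safety n (p + 1)) (by decide)
      ?_ (hfit _ hpk) (Tri.assign_cons S.bits ((k : ℤ) - (p + 1 : ℕ)) (by decide) ?_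
      (S.fits_index (by omega) (by omega)) (Tri.nil S.bits ⟨hpk, ?_, ?_, ?_⟩))) le_rfl⟩
    · simp only [Arith.eval, k28, k1, safety]; push_cast; ring
    · simp [Arith.eval, k11]; ring
    · simp
    · simp
    · exact (hag.update (by simp) _).update (by simp) _
  · rintro p σ₁ ⟨hp, k28, k11, hag⟩ hle
    obtain rfl : p = k := by omega
    refine Tri.assign_cons S.bits 1 (by decide) rfl (S.fits_lit (by norm_num))
      (Tri.assign_cons S.bits 4 (by decide) rfl (S.fits_lit (by norm_num))
      (Tri.assign_cons S.bits 1 (by decide) rfl (S.fits_lit (by norm_num))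
      (Tri.nil S.bits ⟨⟨?_, ?_, ?_, ?_⟩, ?_, ?_⟩)))
    · simp [hag 0 (by decide), h0]
    · simp [hag 1 (by decide), h1]
    · simp
    · simp
    · simpa using k28
    · simp
  · exact ⟨Nat.zero_le _, by simp [safety], by simp,
      ((Agree.refl _ _).update (by simp) _).update (by simp) _⟩

end Loop

/-! ### The whole program -/

open Arith in
/-- The program. -/
def wrapperProgram : Program := block [
  setupCode, .loop 30 roundCode, testCode,
  assign 0 (var 24), assign 1 (var 44), assign 2 (var 45)]

/-- The number of steps of the program with `L` rounds. -/
def wrapperSteps (n k L : ℕ) : ℕ := 4 * k + 12 + L * (roundSteps n k + 1) + testSteps n k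

section Program

variable {n k : ℕ} {τ : ℝ} {f : Nomial n k τ} {O : ℕ → ℕ → ℤ} {μ : ℕ → ℤ} {β L : ℕ}
  {X Z m r : ℝ}

/-- After `p ≥ 1` rounds the precision is `2 ^ p`; the initial precision `1` is never used for
reading. The hypothesis `hend` bounds the number of rounds, `hdec` makes any exit sound, and
`hforced` excludes that no test succeeds. -/
theorem wrapperProgram_spec (hL : 1 ≤ L)
    (hE : ∀ p, 1 ≤ p → p ≤ L → Env f O μ β (2 ^ p) (2 ^ (2 ^ p + 1)) X
      (heightBound k O (2 ^ p) (2 ^ (2 ^ p + 1))) Z)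
    (hX : X = max (m + r) 1) (hQ : (safety n k : ℝ) ≤ Z) (hr : 0 < r) (hrm : r < m)
    (hm' : ∀ p, |m * (2 ^ (2 ^ p + 1) : ℤ) - O k (2 ^ p)| < 2)
    (hr' : ∀ p, |r * (2 ^ (2 ^ p + 1) : ℤ) - O (k + 1) (2 ^ p)| < 2)
    (hκZ : ∀ p ≤ L, ((2 ^ p : ℕ) : ℝ) ≤ Z) (hXρ : ∀ i ≤ k, testRadius n r i ≤ X)
    (hend : ∀ j best z, Selected f m r X (heightBound k O (2 ^ L) (2 ^ (2 ^ L + 1)))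
      (2 ^ (2 ^ L + 1)) j best z → Sufficient n k O (2 ^ L) (2 ^ (2 ^ L + 1)) best z)
    {Y N : ℕ → ℕ → ℕ → Prop} {A : ℕ → Prop}
    (hdec : ∀ p j best z, 1 ≤ p → p ≤ L →
      Selected f m r X (heightBound k O (2 ^ p) (2 ^ (2 ^ p + 1))) (2 ^ (2 ^ p + 1)) j best z →
      Sufficient n k O (2 ^ p) (2 ^ (2 ^ p + 1)) best z →
      A j ∧ Decides f (candidate k m r j) r (2 ^ (2 ^ p + 1))
        (heightBound k O (2 ^ p) (2 ^ (2 ^ p + 1))) X (Y j) (N j))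
    (hforced : ∀ j ≤ 2 * k ^ 2, ¬ ∀ a ≤ k, ∀ b ≤ k, N j a b)
    {σ : ℕ → ℤ} (h0 : σ 0 = k) (h1 : σ 1 = n) :
    Tri O μ β wrapperProgram σ (wrapperSteps n k L) fun σ' => ∃ j a b : ℕ, j ≤ 2 * k ^ 2 ∧ a ≤ k ∧
      b ≤ k ∧ σ' 0 = j ∧ σ' 1 = a ∧ σ' 2 = b ∧ A j ∧ Y j a b ∧
      ∀ a' b', b' ≤ k → (a' < a ∨ a' = a ∧ b' < b) → N j a' b' := by
  have S := (hE 1 le_rfl hL).scale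
  have hk := S.two_le
  refine Tri.steps (N := (4 * k + 7) + (((L - 0) * (roundSteps n k + 1) + 1) + (testSteps n k +
    (1 + (1 + (1 + 1)))))) (Tri.cons (Tri.mono (setupCode_spec S hQ h0 h1) le_rfl ?_))
    (by rw [wrapperSteps, Nat.sub_zero]; omega)
  rintro σ₁ ⟨hH1, k28, k30⟩
  refine Tri.cons (Tri.loop S.bits (by norm_num) (L := L) (p₀ := 0)
    (fun p σ' => p ≤ L ∧ Header k n (2 ^ p) (2 ^ (2 ^ p + 1)) σ' ∧ σ' 28 = safety n k ∧
      (p = 0 ∧ 0 < σ' 30 ∨ 1 ≤ p ∧ Disk m r X (2 ^ (2 ^ p + 1)) σ' ∧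
        AfterRound f m r X O (2 ^ p) (2 ^ (2 ^ p + 1)) σ')) ?_ ?_ (Nat.zero_le _) ?_)
  · rintro p σ₂ ⟨hp, hH, h28, hcase⟩ h30
    -- After round `L` the criterion holds, so its flag cannot still be positive.
    have hpL : p < L := by
      refine lt_of_le_of_ne hp fun h => ?_
      subst h
      rcases hcase with ⟨h, _⟩ | ⟨_, _, j, best, z, _, hsel, hex⟩
      · omega
      · rcases hex with ⟨_, h⟩ | ⟨h, _⟩
        · exact h (hend j best z hsel)
        · omega
    have e1 : 2 ^ (p + 1) = 2 * 2 ^ p := by ring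
    have hE' := hE (p + 1) (by omega) hpL
    have hm'' := hm' (p + 1)
    have hr'' := hr' (p + 1)
    have hκ' := hκZ (p + 1) hpL
    rw [e1] at hE' hm'' hr'' hκ'
    refine ⟨hpL, Tri.mono (roundCode_spec hE' hX hQ hr hrm hm'' hr'' hκ'
      (W₀ := 2 ^ (2 ^ p + 1)) ?_ hH h28 h30) le_rfl ?_⟩
    · rw [← pow_add]
      have e2 : 2 ^ p + 1 + (2 ^ p + 1) = 2 * 2 ^ p + 1 + 1 := by ring
      rw [e2, pow_succ]
      generalize (2 : ℤ) ^ (2 * 2 ^ p + 1) = x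
      omega
    · rintro σ₃ ⟨g1, g2, g3, g4⟩
      rw [e1]
      exact ⟨hpL, g1, g3, Or.inr ⟨by omega, g2, g4⟩⟩
  · rintro p σ₂ ⟨hp, hH, h28, hcase⟩ h30
    rcases hcase with ⟨_, h⟩ | ⟨hp1, hD, j, best, z, h24, hsel, hex⟩
    · omega
    have hsuf : Sufficient n k O (2 ^ p) (2 ^ (2 ^ p + 1)) best z := by
      rcases hex with ⟨h, _⟩ | ⟨_, h⟩
      · omega
      · exact h
    obtain ⟨hA, hd⟩ := hdec p j best z hp1 hp hsel hsuf
    have hE' := hE p hp1 hp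
    have hfitj : ((j : ℕ) : ℤ).natAbs < 2 ^ β := by
      refine S.fits 3 (by norm_num) ?_
      have h2 : (2 : ℝ) ≤ Z := le_trans (by norm_num) S.large
      have hkZ : (k : ℝ) ≤ Z := by have := S.k_le'; linarith
      have hj : (j : ℝ) ≤ 2 * (k : ℝ) ^ 2 := by exact_mod_cast hsel.index_le
      rw [Int.cast_natCast, abs_of_nonneg (by positivity)]
      calc (j : ℝ) ≤ 2 * (k : ℝ) ^ 2 := hj
        _ ≤ Z * Z ^ 2 := by gcongr
        _ = Z ^ 3 := by ring
    refine Tri.cons (Tri.mono (testCode_spec hE' hd (by exact_mod_cast hH) hD hsel.index_le h24 hXρ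
      (by rw [h24]; exact hfitj)) le_rfl ?_)
    rintro σ₃ ⟨hprog, g24⟩
    -- If no success were recorded, all tests could be answered negatively, contrary to `hforced`.
    rcases hprog with ⟨_, hall⟩ | ⟨_, a, b, ha, hb, g44, g45, hY, hN⟩
    · exact absurd (fun a ha b hb => hall a b hb (Or.inl (by omega))) (hforced j hsel.index_le)
    · exact Tri.assign_cons S.bits j (by decide) (by simp [Arith.eval, g24]) hfitj
        (Tri.assign_cons S.bits a (by decide) (by simp [Arith.eval, g44])
          (S.fits_index (by omega) (by omega))
        (Tri.assign_cons S.bits b (by decide) (by simp [Arith.eval, g45])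
          (S.fits_index (by omega) (by omega))
        (Tri.nil S.bits ⟨j, a, b, hsel.index_le, ha, hb, by simp, by simp, by simp, hA, hY, hN⟩)))
  · exact ⟨Nat.zero_le _, by simpa using hH1, k28, Or.inl ⟨rfl, k30⟩⟩

end Program

/-! ### The criterion is sound and eventually holds -/

/-- Comparing approximate sums amounts to a legitimate answer of the test. -/
theorem decision {El Sb Sf Am ε A S V : ℝ} (hV : 0 < V) (hS : |S - Sb * V| ≤ ε)
    (hA : |A - El * V| ≤ ε) (hε : ε ≤ Am * V / 2 ^ 13) (h1 : Sb ≤ Sf) (h2 : Sf ≤ Sb + Am / 2 ^ 11)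
    (hAm : Am ≤ El ∨ Am ≤ Sb) (h0 : 0 < Am) :
    (16705 * S < 16384 * A → 65 / 64 * Sf < El) ∧
    (16384 * A ≤ 16705 * S → El ≤ 65 / 64 * Sf ∨
      1 / (1 + 1 / 128) * El < 65 / 64 * Sf ∧ 65 / 64 * Sf ≤ (1 + 1 / 128) * El) := by
  rw [abs_le] at hS hA
  constructor
  · intro h
    have key : 16705 * Sb * V < 16384 * El * V + 33089 * (Am * V / 2 ^ 13) := by linarith
    have key' : 16705 * Sb < 16384 * El + 33089 * (Am / 2 ^ 13) := by
      have : 16705 * Sb * V < (16384 * El + 33089 * (Am / 2 ^ 13)) * V := by linarith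
      exact lt_of_mul_lt_mul_right this hV.le
    -- If the largest coefficient is one of those in `Sb`, the inequality `key'` itself transfers
    -- the bound to `El`. All errors are thus small relative to `El`.
    have hAE : Am ≤ El := by
      rcases hAm with h | h
      · exact h
      · linarith
    linarith
  · intro h
    by_cases hle : El ≤ 65 / 64 * Sf
    · exact Or.inl hle
    · push Not at hle
      have key : 16384 * El * V ≤ 16705 * Sb * V + 33089 * (Am * V / 2 ^ 13) := by linarith
      have key' : 16384 * El ≤ 16705 * Sb + 33089 * (Am / 2 ^ 13) := by
        have : 16384 * El * V ≤ (16705 * Sb + 33089 * (Am / 2 ^ 13)) * V := by linarith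
        exact le_of_mul_le_mul_right this hV
      have hAE : Am ≤ El := by
        rcases hAm with h | h
        · exact h
        · linarith
      -- The true inequality holds but the computed one does not, so the two sides are within the
      -- tolerance and Undecided is legitimate.
      refine Or.inr ⟨?_, by linarith⟩
      have : (1 : ℝ) / (1 + 1 / 128) = 128 / 129 := by norm_num
      rw [this]
      linarith

/-- The program does not know `τ`, so the bound on the coefficients is extracted from the oracle
answers. It is never too small, and it overestimates a true bound `T` by at most `10 k T ^ 2`, which
keeps the final precision under control. -/
theorem heightSum_bounds {k : ℕ} {O : ℕ → ℕ → ℤ} {κ : ℕ} {W : ℤ} (hW : 4 ≤ W) (hk : 0 < k)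
    {b : ℕ → ℝ} (hO : ∀ t < k, |b t * W - O t κ| < 2) :
    1 ≤ heightBound k O κ W ∧ (∀ t < k, |b t| ≤ heightBound k O κ W) ∧
      ∀ T : ℝ, 1 ≤ T → (∀ t < k, |b t| ≤ T) → heightBound k O κ W ≤ 10 * k * T ^ 2 := by
  have hW' : (4 : ℝ) ≤ W := by exact_mod_cast hW
  have hW0 : (0 : ℝ) < W := by linarith
  have hsum : (heightSum k O κ W : ℝ) = ∑ t ∈ Finset.range k, ((O t κ : ℝ) ^ 2 + W ^ 2) := by
    rw [heightSum]; push_cast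
    exact Finset.sum_congr rfl fun t _ => by ring
  have hone : ∀ t < k, (O t κ : ℝ) ^ 2 + W ^ 2 ≤ heightSum k O κ W := fun t ht => by
    rw [hsum]
    exact Finset.single_le_sum (f := fun t => (O t κ : ℝ) ^ 2 + (W : ℝ) ^ 2)
      (fun t _ => by positivity) (Finset.mem_range.2 ht)
  refine ⟨?_, fun t ht => ?_, fun T hT hb => ?_⟩
  · rw [heightBound, le_div_iff₀ (by positivity)]
    have := hone 0 hk
    have h0 : (0 : ℝ) ≤ (O 0 κ : ℝ) ^ 2 := by positivity
    have h1 : (0 : ℝ) ≤ (W : ℝ) ^ 2 := by positivity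
    linarith
  · rw [heightBound, le_div_iff₀ (by positivity)]
    have h1 := hone t ht
    have h2 := abs_lt.1 (hO t ht)
    have h3 : |b t| * W ≤ |(O t κ : ℝ)| + 2 := by
      have e0 : |b t| * W = |b t * W| := by rw [abs_mul, abs_of_pos hW0]
      rw [e0]
      have := abs_sub_abs_le_abs_sub (b t * W) (O t κ)
      linarith [hO t ht]
    have h4 : |b t| * (W : ℝ) ^ 2 ≤ (|(O t κ : ℝ)| + 2) * W := by
      calc |b t| * (W : ℝ) ^ 2 = |b t| * W * W := by ring
        _ ≤ _ := by gcongr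
    have h5 : |(O t κ : ℝ)| ^ 2 = (O t κ : ℝ) ^ 2 := sq_abs _
    nlinarith [sq_nonneg (|(O t κ : ℝ)| - W)]
  · rw [heightBound, div_le_iff₀ (by positivity), hsum]
    have : ∀ t ∈ Finset.range k, (O t κ : ℝ) ^ 2 + W ^ 2 ≤ 5 * T ^ 2 * W ^ 2 := by
      intro t ht
      rw [Finset.mem_range] at ht
      have h3 : |(O t κ : ℝ)| ≤ 2 * T * W := by
        have e1 := abs_sub_abs_le_abs_sub (O t κ : ℝ) (b t * W)
        rw [abs_sub_comm, abs_mul, abs_of_pos hW0] at e1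
        have e2 : |b t| * W ≤ T * W := by gcongr; exact hb t ht
        have e3 : 1 * (W : ℝ) ≤ T * W := by gcongr
        linarith [hO t ht]
      have h4 : (O t κ : ℝ) ^ 2 ≤ (2 * T * W) ^ 2 := by
        rw [← sq_abs]; gcongr
      have h5 : 1 * (W : ℝ) ^ 2 ≤ T ^ 2 * W ^ 2 := by
        gcongr; exact one_le_pow₀ hT
      nlinarith
    have h6 := Finset.sum_le_card_nsmul _ _ _ this
    rw [Finset.card_range, nsmul_eq_mul] at h6
    linarith

/-- Explains the safety factor: by `k ≤ 2 ^ k` and `n ≤ n ^ k` every factor of the error is turned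
into a `k`-th power. -/
theorem coefErr_mul_le {n k : ℕ} (hn : 1 ≤ n) (hk : 2 ≤ k) {Φ X : ℝ} (hΦ : 0 ≤ Φ) (hX : 0 ≤ X) :
    2 ^ 20 * ((k + 1) * coefErr n k (radiusFactor n k) Φ X) ≤ safety n k * Φ * X ^ (3 * n) := by
  have h1 : 2 ^ 20 * ((k + 1) * (6 * k ^ 2 * (2 * n) ^ k * radiusFactor n k)) ≤ safety n k := by
    rw [radiusFactor, safety]
    have e1 : k + 1 ≤ 2 ^ k := Nat.lt_two_pow_self
    have e2 : k ^ 2 ≤ (2 ^ k) ^ 2 := Nat.pow_le_pow_left Nat.lt_two_pow_self.le 2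
    have e3 : 2 ^ 28 ≤ (2 ^ 14) ^ k := by
      calc 2 ^ 28 = (2 ^ 14) ^ 2 := by norm_num
        _ ≤ _ := Nat.pow_le_pow_right (by norm_num) hk
    have e4 : n ≤ n ^ k := Nat.le_self_pow (by omega) n
    have e5 : (n ^ k) ^ 7 ≤ (n ^ k) ^ 9 := Nat.pow_le_pow_right (by positivity) (by norm_num)
    calc 2 ^ 20 * ((k + 1) * (6 * k ^ 2 * (2 * n) ^ k * (32 * n * (256 * n ^ 5) ^ k)))
        ≤ 2 ^ 20 * (2 ^ k * (6 * (2 ^ k) ^ 2 * (2 * n) ^ k * (32 * n ^ k * (256 * n ^ 5) ^ k))) := by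
          gcongr
      _ = (2 ^ 20 * 6 * 32) * ((2 ^ k) ^ 4 * 256 ^ k) * (n ^ k) ^ 7 := by
          rw [mul_pow, mul_pow, ← pow_mul n 5 k, mul_comm 5 k, pow_mul n k 5]; ring
      _ ≤ 2 ^ 28 * ((2 ^ k) ^ 4 * 256 ^ k) * (n ^ k) ^ 9 := by gcongr; norm_num
      _ ≤ (2 ^ 14) ^ k * ((2 ^ k) ^ 4 * 256 ^ k) * (n ^ k) ^ 9 := by gcongr
      _ = (2 ^ 26 * n ^ 9) ^ k := by
          rw [mul_pow, ← pow_mul n 9 k, mul_comm 9 k, pow_mul n k 9, ← pow_mul 2 k 4, mul_comm k 4,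
            pow_mul 2 4 k, ← mul_pow, ← mul_pow]
          norm_num
      _ ≤ (134217728 * n ^ 9) ^ k := by gcongr; norm_num
  have h2 : (2 ^ 20 * ((k + 1) * (6 * k ^ 2 * (2 * n) ^ k * radiusFactor n k)) : ℝ) ≤ safety n k := by
    exact_mod_cast h1
  calc 2 ^ 20 * ((k + 1) * coefErr n k (radiusFactor n k) Φ X)
      = (2 ^ 20 * ((k + 1) * (6 * k ^ 2 * (2 * n) ^ k * radiusFactor n k)) : ℝ) *
        (Φ * X ^ (3 * n)) := by rw [coefErr]; ring
    _ ≤ safety n k * (Φ * X ^ (3 * n)) := by gcongr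
    _ = _ := by ring

/-- Lets a single quantity, `finalErr`, dominate the errors of both the point selection and the
tests. -/
theorem termErr_le_coefErr {n k : ℕ} (hn : 1 ≤ n) (hk : 2 ≤ k) {Φ X : ℝ} (hΦ : 0 ≤ Φ) (hX : 1 ≤ X) :
    k * termErr n k Φ X ≤ (k + 1) * coefErr n k (radiusFactor n k) Φ X := by
  have h1 := le_radiusFactor hn k
  have hk' : (2 : ℝ) ≤ k := by exact_mod_cast hk
  have h2 : X ^ n ≤ X ^ (3 * n) := pow_le_pow_right₀ hX (by omega)
  have h3 : 18 * (n : ℝ) ≤ 6 * k ^ 2 * radiusFactor n k := by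
    have h4 : (1 : ℝ) ≤ 6 * k ^ 2 := by nlinarith
    have h5 := mul_le_mul_of_nonneg_right h4 (show (0 : ℝ) ≤ radiusFactor n k by positivity)
    have h6 : (0 : ℝ) ≤ n := by positivity
    linarith
  have hX0 : 0 ≤ X := by linarith
  have hn0 : (0 : ℝ) ≤ n := by positivity
  rw [termErr, coefErr]
  calc k * (18 * n * (2 * n) ^ k * Φ * X ^ n) = k * ((18 * n) * ((2 * n) ^ k * Φ) * X ^ n) := by ring
    _ ≤ (k + 1) * ((6 * k ^ 2 * radiusFactor n k) * ((2 * n) ^ k * Φ) * X ^ (3 * n)) := by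
        gcongr; linarith
    _ = _ := by ring

section Sound

variable {n k : ℕ} {τ : ℝ} {f : Nomial n k τ} {O : ℕ → ℕ → ℤ} {κ : ℕ} {W : ℤ} {X m r : ℝ}

/-- The guaranteed error `H` at the end of the precision loop. -/
def finalErr (n k : ℕ) (Φ X : ℝ) : ℝ := (k + 1) * coefErr n k (radiusFactor n k) Φ X

/-- The second condition `W > 32 n` makes the computed power at least half of the true one, since
its error is `16 n X ^ n` units. The halves of the three powers and the one in `heightBound` cost `2
^ 4` of the `2 ^ 20` available. -/
theorem Selected.lt_best {j : ℕ} {best z : ℤ} (hW : 4 ≤ W)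
    (hX : 1 ≤ X) (hs : Selected f m r X (heightBound k O κ W) W j best z)
    (hsuf : Sufficient n k O κ W best z) (hΦ : 1 ≤ heightBound k O κ W) :
    2 ^ 16 * (finalErr n k (heightBound k O κ W) X * W) < best := by
  have hn := f.one_le
  have hk := f.two_le
  set Φ := heightBound k O κ W with hΦd
  have hW' : (4 : ℝ) ≤ W := by exact_mod_cast hW
  have hW0 : (0 : ℝ) < W := by linarith
  have hX0 : 0 < X := by linarith
  obtain ⟨hs1, hs2⟩ := hsuf
  have hs1' : (safety n k : ℝ) * heightSum k O κ W * z ^ 3 < best * W ^ 4 := by exact_mod_cast hs1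
  have hs2' : 32 * (n : ℝ) < W := by exact_mod_cast hs2
  have hF : (heightSum k O κ W : ℝ) = Φ * W ^ 2 / 2 := by rw [hΦd, heightBound]; field_simp
  have hz : X ^ n * (W / 2) ≤ z := by
    have h1 := hs.size.error
    have h2 : 16 * (n : ℝ) * X ^ n ≤ W / 2 * X ^ n := by gcongr; linarith
    linarith
  have hz3 : (X ^ n * (W / 2)) ^ 3 ≤ (z : ℝ) ^ 3 := by gcongr
  have h1 : (safety n k : ℝ) * (Φ * W ^ 2 / 2) * (X ^ n * (W / 2)) ^ 3 ≤
      safety n k * heightSum k O κ W * z ^ 3 := by rw [hF]; gcongr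
  have h2 : (safety n k : ℝ) * (Φ * W ^ 2 / 2) * (X ^ n * (W / 2)) ^ 3 =
      safety n k * Φ * X ^ (3 * n) * W / 16 * W ^ 4 := by
    rw [mul_comm 3 n, pow_mul]; ring
  have h3 : safety n k * Φ * X ^ (3 * n) * W / 16 < best := by
    rw [h2] at h1
    exact lt_of_mul_lt_mul_right (h1.trans_lt hs1') (by positivity)
  have h4 := mul_le_mul_of_nonneg_right (coefErr_mul_le hn hk (by linarith : 0 ≤ Φ) hX0.le) hW0.le
  rw [finalErr]
  linarith

/-- The computed minimum exceeds its error by `2 ^ 16`, so the selected point is optimal up to a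
factor close to one, well within the factor `8` of admissibility. -/
theorem Selected.lt_minAbs {j : ℕ} {best z : ℤ} (hW : 4 ≤ W)
    (hX : 1 ≤ X) (hs : Selected f m r X (heightBound k O κ W) W j best z)
    (hsuf : Sufficient n k O κ W best z) (hΦ : 1 ≤ heightBound k O κ W) :
    2 ^ 13 * finalErr n k (heightBound k O κ W) X < f.minAbs (candidate k m r j) * W ∧
      ∀ j' ≤ 2 * k ^ 2, f.minAbs (candidate k m r j') ≤ 8 * f.minAbs (candidate k m r j) := by
  have h := hs.lt_best hW hX hsuf hΦ
  set Φ := heightBound k O κ W with hΦd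
  have hW' : (4 : ℝ) ≤ W := by exact_mod_cast hW
  have hW0 : (0 : ℝ) < W := by linarith
  have hδ : k * (W * termErr n k Φ X) ≤ finalErr n k Φ X * W := by
    have := mul_le_mul_of_nonneg_right
      (termErr_le_coefErr f.one_le f.two_le (by linarith : 0 ≤ Φ) hX) hW0.le
    rw [finalErr]; linarith
  have h1 := hs.best_le
  have hH : 0 ≤ finalErr n k Φ X := by
    rw [finalErr, coefErr]
    have : 0 ≤ Φ := by linarith
    have : 0 ≤ X := by linarith
    positivity
  have hHW : 0 ≤ finalErr n k Φ X * W := by positivity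
  refine ⟨?_, fun j' hj' => ?_⟩
  · have h2 : 2 ^ 13 * finalErr n k Φ X * W < f.minAbs (candidate k m r j) * W * W := by
      have : f.minAbs (candidate k m r j) * W * W = f.minAbs (candidate k m r j) * W ^ 2 := by ring
      linarith
    exact lt_of_mul_lt_mul_right h2 hW0.le
  · have h2 := hs.le_best j' hj'
    have h3 : f.minAbs (candidate k m r j') * (W : ℝ) ^ 2 ≤
        8 * f.minAbs (candidate k m r j) * (W : ℝ) ^ 2 := by linarith
    exact le_of_mul_le_mul_right h3 (by positivity)

theorem gsum_zero {g g' : ℕ → ℕ} (h : g 0 = g' 0) (x : ℝ) : f.gsum g 0 x = f.gsum g' 0 x := by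
  simp [Nomial.gsum, h]

theorem expoN_zero (f : Nomial n k τ) : f.expoN 0 = 0 := by
  have h0 : 0 < k := by have := f.two_le; omega
  rw [Nomial.expoN, dif_pos h0]; exact f.expo_zero

/-- Soundness of the stopping criterion. The minimum at `c` bounds the largest coefficient from
below, so the absolute errors of all tests become relative errors of at most `2 ^ (-13)`, as
`decision` requires. -/
theorem Selected.decides {j : ℕ} {best z : ℤ} (hr : 0 < r)
    (hm : r + 2 * blowup n k * n * r ≤ m) (hW : 4 ≤ W)
    (hX : 1 ≤ X) (hs : Selected f m r X (heightBound k O κ W) W j best z)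
    (hsuf : Sufficient n k O κ W best z) (hΦ : 1 ≤ heightBound k O κ W) :
    IsAdmissible f.minAbs (multipoint m (k ^ 2) (r / k ^ 2)) (candidate k m r j) ∧
    Decides f (candidate k m r j) r W (heightBound k O κ W) X
      (fun i l => TestAnswer f.poly k (candidate k m r j) (testRadius n r i) l .yes)
      (fun i l => TestAnswer f.poly k (candidate k m r j) (testRadius n r i) l .no ∨
        TestAnswer f.poly k (candidate k m r j) (testRadius n r i) l .undecided) := by
  obtain ⟨hM, hadm⟩ := hs.lt_minAbs hW hX hsuf hΦ
  have hk := f.two_le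
  have hn := f.one_le
  have hW' : (4 : ℝ) ≤ W := by exact_mod_cast hW
  have hW0 : (0 : ℝ) < W := by linarith
  set Φ := heightBound k O κ W with hΦd
  set c := candidate k m r j with hc
  have hkk : k ≤ k ^ 2 := Nat.le_self_pow (by norm_num) k
  refine ⟨⟨⟨j, hs.index_le, rfl⟩, ?_⟩, ?_⟩
  · rintro y ⟨j', hj', rfl⟩
    have h1 := hadm j' hj'
    rw [abs_of_nonneg (f.minAbs_nonneg _), abs_of_nonneg (f.minAbs_nonneg _)]
    change 1 / 8 * f.minAbs (candidate k m r j') ≤ _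
    linarith
  · intro i hi l hl S A hS hA
    set ρ := testRadius n r i with hρ
    have hρ0 : 0 < ρ := testRadius_pos (by omega) hr i
    have hρc : ρ * (n : ℝ) ^ 16 ≤ c := testRadius_mul_le (by omega) hr hm
      (candidate_mem (by omega) hr hs.index_le).1 hi
    obtain ⟨u₀, hu₀, hmax⟩ := Finset.exists_max_image (Finset.range k)
      (fun u => |diskCoeff f.poly c ρ u|) ⟨0, Finset.mem_range.2 (by omega)⟩
    rw [Finset.mem_range] at hu₀
    set Am := |diskCoeff f.poly c ρ u₀| with hAm
    have hall : ∀ u < k, |diskCoeff f.poly c ρ u| ≤ Am := fun u hu =>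
      hmax u (Finset.mem_range.2 hu)
    -- The minimum includes `|f(c)|`, which is the zeroth Taylor coefficient whatever the radius.
    have ha0 : f.minAbs c ≤ Am := by
      refine le_trans ?_ (hall 0 (by omega))
      rw [f.diskCoeff_eq, gsum_zero (g' := f.expoN) (by simp [expoN_zero])]
      simpa using f.minAbs_le c (i := 0) (by omega)
    have hH0 : 0 ≤ finalErr n k Φ X := by
      rw [finalErr, coefErr]
      have : 0 ≤ Φ := by linarith
      have : 0 ≤ X := by linarith
      positivity
    have hMpos : 0 < f.minAbs c := by
      have : 0 < f.minAbs c * W := lt_of_le_of_lt (by positivity) hM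
      exact pos_of_mul_pos_left this hW0.le
    have hfac : (radiusFactor n i : ℝ) ≤ radiusFactor n k := by
      have : radiusFactor n i ≤ radiusFactor n k :=
        Nat.mul_le_mul_left _ (Nat.pow_le_pow_right (by positivity) hi)
      exact_mod_cast this
    have hcoef : coefErr n k (radiusFactor n i) Φ X ≤ coefErr n k (radiusFactor n k) Φ X := by
      rw [coefErr, coefErr]
      have : 0 ≤ Φ := by linarith
      have : 0 ≤ X := by linarith
      gcongr
    have hcoef0 : 0 ≤ coefErr n k (radiusFactor n i) Φ X := by
      rw [coefErr]
      have : 0 ≤ Φ := by linarith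
      have : 0 ≤ X := by linarith
      positivity
    set ε := (k + 1) * ((W : ℝ) ^ 2 * coefErr n k (radiusFactor n i) Φ X) with hε
    have hε1 : ε ≤ Am * W ^ 3 / 2 ^ 13 := by
      have h1 : ε ≤ finalErr n k Φ X * W ^ 2 := by
        rw [hε, finalErr]
        calc (k + 1) * ((W : ℝ) ^ 2 * coefErr n k (radiusFactor n i) Φ X)
            ≤ (k + 1) * ((W : ℝ) ^ 2 * coefErr n k (radiusFactor n k) Φ X) := by gcongr
          _ = _ := by ring
      have h2 : 2 ^ 13 * finalErr n k Φ X * (W : ℝ) ^ 2 ≤ Am * W * W ^ 2 := by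
        have : f.minAbs c * W ≤ Am * W := by gcongr
        have := hM.le.trans this
        gcongr
      have h3 : Am * (W : ℝ) * W ^ 2 = Am * W ^ 3 := by ring
      linarith
    have hε2 : (W : ℝ) ^ 2 * coefErr n k (radiusFactor n i) Φ X ≤ ε := by
      rw [hε]
      refine le_mul_of_one_le_left (by positivity) ?_
      have : (0 : ℝ) ≤ k := by positivity
      linarith
    obtain ⟨hs1, hs2⟩ := f.testSum_le hρ0 hρc hall (b := k + 1) (l := l) (by omega) (by omega)
    have hAm' : Am ≤ |diskCoeff f.poly c ρ l| ∨
        Am ≤ ∑ u ∈ (Finset.range (k + 1)).erase l, |diskCoeff f.poly c ρ u| := by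
      by_cases h : u₀ = l
      · left; rw [hAm, h]
      · right
        exact Finset.single_le_sum (f := fun u => |diskCoeff f.poly c ρ u|)
          (fun u _ => abs_nonneg _)
          (Finset.mem_erase.2 ⟨h, Finset.mem_range.2 (by omega)⟩)
    obtain ⟨d1, d2⟩ := decision (S := S) (A := A) (by positivity) hS (hA.trans hε2) hε1 hs1 hs2 hAm'
      (hMpos.trans_le ha0)
    refine ⟨fun h => ?_, fun h => ?_⟩
    · exact d1 (by exact_mod_cast h)
    · exact d2 (by exact_mod_cast h)

/-- High precision is sufficient. -/
theorem Selected.sufficient {j : ℕ} {best z : ℤ} (hW : 4 ≤ W) (hX : 1 ≤ X)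
    (hs : Selected f m r X (heightBound k O κ W) W j best z)
    (hO : ∀ t < k, |f.coefN t * W - O t κ| < 2) {T M : ℝ} (hT : 1 ≤ T)
    (hfT : ∀ t < k, |f.coefN t| ≤ T) {j' : ℕ} (hj' : j' ≤ 2 * k ^ 2)
    (hM : M ≤ f.minAbs (candidate k m r j')) (h1 : 32 * (n : ℝ) < W)
    (h2 : 6 * k * safety n k * T ^ 2 * X ^ (3 * n) < M * W) : Sufficient n k O κ W best z := by
  have hk := f.two_le
  have hn := f.one_le
  obtain ⟨b1, b2, b3⟩ := heightSum_bounds hW (by omega : 0 < k) hO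
  have b3 := b3 T hT hfT
  set Φ := heightBound k O κ W with hΦd
  have hW' : (4 : ℝ) ≤ W := by exact_mod_cast hW
  have hW0 : (0 : ℝ) < W := by linarith
  have hX0 : 0 < X := by linarith
  have hF : (heightSum k O κ W : ℝ) = Φ * W ^ 2 / 2 := by rw [hΦd, heightBound]; field_simp
  have hz : (z : ℝ) ≤ X ^ n * W := hs.size.le_pow (by omega)
  have hz0 : (0 : ℝ) ≤ z := by exact_mod_cast hs.size.nonneg
  set Q : ℝ := (safety n k : ℝ) with hQ
  set P := X ^ (3 * n) with hP
  have hPpos : 0 < P := by positivity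
  have e1 : Q * heightSum k O κ W * z ^ 3 ≤ 5 * k * Q * T ^ 2 * P * W * W ^ 4 := by
    rw [hF]
    calc Q * (Φ * W ^ 2 / 2) * z ^ 3 ≤ Q * ((10 * k * T ^ 2) * W ^ 2 / 2) * (X ^ n * W) ^ 3 := by
          gcongr
      _ = _ := by rw [hP, mul_comm 3 n, pow_mul]; ring
  have e2 : k * (W * termErr n k Φ X) ≤ k * Q * T ^ 2 * P * W := by
    have g1 := termErr_le_coefErr hn hk (by linarith : 0 ≤ Φ) hX
    have g2 := coefErr_mul_le hn hk (by linarith : 0 ≤ Φ) hX0.le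
    have g3 : Q * Φ * P ≤ Q * (10 * k * T ^ 2) * P := by gcongr
    have g4 : k * termErr n k Φ X ≤ k * Q * T ^ 2 * P := by
      have : 0 ≤ k * Q * T ^ 2 * P := by positivity
      linarith
    calc k * (W * termErr n k Φ X) = k * termErr n k Φ X * W := by ring
      _ ≤ _ := by gcongr
  have e3 : M * W ^ 2 ≤ best + k * (W * termErr n k Φ X) := by
    refine le_trans ?_ (hs.le_best j' hj')
    gcongr
  have e4 : 6 * k * Q * T ^ 2 * P * W < M * W * W := by gcongr
  have e5 : 5 * k * Q * T ^ 2 * P * W < best := by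
    have : M * W * W = M * (W : ℝ) ^ 2 := by ring
    linarith
  have e6 : 5 * k * Q * T ^ 2 * P * W * (W : ℝ) ^ 4 < best * W ^ 4 := by gcongr
  refine ⟨?_, by exact_mod_cast h1⟩
  have := e1.trans_lt e6
  rw [hQ] at this
  exact_mod_cast this

end Sound

/-! ### From the final machine state to a run, and the parameters that make it possible. -/

section Run

variable {n k : ℕ} {τ : ℝ} {f : Nomial n k τ} {m r : ℝ}

/-- Answers for the tests that were not performed can be supplied. -/
theorem exists_run {j a b : ℕ} (hj : j ≤ 2 * k ^ 2) (ha : a ≤ k) (hb : b ≤ k)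
    (hadm : IsAdmissible f.minAbs (multipoint m (k ^ 2) (r / k ^ 2)) (candidate k m r j))
    (hY : TestAnswer f.poly k (candidate k m r j) (testRadius n r a) b .yes)
    (hN : ∀ a' b', b' ≤ k → (a' < a ∨ a' = a ∧ b' < b) →
      TestAnswer f.poly k (candidate k m r j) (testRadius n r a') b' .no ∨
        TestAnswer f.poly k (candidate k m r j) (testRadius n r a') b' .undecided) :
    ∃ v, IsRun f m r j v ∧ runOutput k v = some (a, b) := by
  classical
  -- Before the success a legitimate negative answer is chosen; after it any legitimate answer will
  -- do, and one exists because the exact inequality either holds or fails.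
  have hex : ∀ a' b', ∃ w, b' ≤ k →
      TestAnswer f.poly k (candidate k m r j) (testRadius n r a') b' w ∧
      (a' = a ∧ b' = b → w = .yes) ∧ (a' < a ∨ a' = a ∧ b' < b → w ≠ .yes) := by
    intro a' b'
    by_cases hb' : b' ≤ k
    · by_cases h1 : a' = a ∧ b' = b
      · obtain ⟨rfl, rfl⟩ := h1
        exact ⟨.yes, fun _ => ⟨hY, fun _ => rfl, fun h => by omega⟩⟩
      · by_cases h2 : a' < a ∨ a' = a ∧ b' < b
        · rcases hN a' b' hb' h2 with h | h
          · exact ⟨.no, fun _ => ⟨h, fun h' => absurd h' h1, fun _ => by decide⟩⟩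
          · exact ⟨.undecided, fun _ => ⟨h, fun h' => absurd h' h1, fun _ => by decide⟩⟩
        · by_cases h3 : TestAnswer f.poly k (candidate k m r j) (testRadius n r a') b' .yes
          · exact ⟨.yes, fun _ => ⟨h3, fun _ => rfl, fun h => absurd h h2⟩⟩
          · exact ⟨.no, fun _ => ⟨not_lt.1 h3, fun h' => absurd h' h1, fun _ => by decide⟩⟩
    · exact ⟨.no, fun h => absurd h hb'⟩
  choose v hv using hex
  refine ⟨v, ⟨hj, hadm, fun i _ l hl => (hv i l hl).1⟩, runOutput_eq_some_iff.2 ⟨ha, hb,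
    (hv a b hb).2.1 ⟨rfl, rfl⟩, fun i' _ l' hl' h => ?_⟩⟩
  by_contra hlt
  exact (hv i' l' hl').2.2 (by omega) h

/-- The numerical conditions on the parameters of the analysis: the number `L` of rounds, the bit
length `β` and the bound `Z` of the numbers that occur. -/
structure Params (f : Nomial n k τ) (m r : ℝ) (L β : ℕ) (Z : ℝ) : Prop where
  rounds_pos : 1 ≤ L
  prec_le : 2 ^ L ≤ β
  bits : 64 ≤ β
  pow_lt : Z ^ 20 < 2 ^ β
  large : 2 ^ 64 ≤ Z
  unit_le : (2 : ℝ) ^ (2 ^ L + 1) ≤ Z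
  X_pow : (max (m + r) 1) ^ (n + 1) ≤ Z
  coef_le : 10 * k * (2 ^ τ) ^ 2 + 3 ≤ Z
  n_pow : (2 * n : ℝ) ^ k ≤ Z
  k_le : (k : ℝ) + 2 ≤ Z
  n_le : 2 * (n : ℝ) + 2 ≤ Z
  spread : 32 * (n : ℝ) * (256 * (n : ℝ) ^ 5) ^ (k + 1) ≤ Z
  safety_le : (safety n k : ℝ) ≤ Z
  unit_gt : 32 * (n : ℝ) < 2 ^ (2 ^ L + 1)
  enough : 6 * k * safety n k * (2 ^ τ) ^ 2 * (max (m + r) 1) ^ (3 * n) <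
    (2 * 2 ^ τ)⁻¹ * (min 1 r / (8 * k ^ 4 * (n : ℝ) ^ k * (2 ^ τ) ^ 2)) ^ k * 2 ^ (2 ^ L + 1)

theorem Nomial.abs_coefN_le (f : Nomial n k τ) (t : ℕ) : |f.coefN t| ≤ 2 ^ τ := by
  rw [Nomial.coefN]
  split_ifs
  · exact f.abs_coef_le _
  · rw [abs_zero]; positivity

theorem Params.env {L β : ℕ} {Z : ℝ} (H : Params f m r L β Z) {O : ℕ → ℕ → ℤ}
    (hO : IsOracle f m r O) {p : ℕ} (hp1 : 1 ≤ p) (hpL : p ≤ L) :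
    Env f O f.initState.mem β (2 ^ p) (2 ^ (2 ^ p + 1)) (max (m + r) 1)
      (heightBound k O (2 ^ p) (2 ^ (2 ^ p + 1))) Z := by
  have hk := f.two_le
  have hpow : 2 ^ p ≤ 2 ^ L := Nat.pow_le_pow_right (by norm_num) hpL
  have hor : ∀ t < k, |f.coefN t * ((2 ^ (2 ^ p + 1) : ℤ) : ℝ) - O t (2 ^ p)| < 2 := by
    intro t ht
    rw [Nomial.coefN, dif_pos ht]
    exact IsApprox.abs_sub_lt rfl (hO.coef ⟨t, ht⟩ (2 ^ p) (by positivity))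
  have hp2 : 2 ≤ 2 ^ p := by
    calc 2 = 2 ^ 1 := rfl
      _ ≤ 2 ^ p := Nat.pow_le_pow_right (by norm_num) hp1
  have hW4 : (4 : ℤ) ≤ 2 ^ (2 ^ p + 1) := by
    calc (4 : ℤ) = 2 ^ 2 := by norm_num
      _ ≤ _ := pow_le_pow_right₀ (by norm_num) (by omega)
  obtain ⟨b1, b2, b3⟩ := heightSum_bounds hW4 (by omega : 0 < k) hor
  have b3 := b3 (2 ^ τ) f.one_le_height fun t _ => f.abs_coefN_le t
  refine ⟨⟨H.bits, H.pow_lt, H.large, by omega, ?_, le_max_right _ _, H.X_pow, b1,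
    by linarith [H.coef_le], f.one_le, H.n_pow, hk, f.le_succ, H.k_le, H.n_le, H.spread⟩,
    fun a => ?_, hpow.trans H.prec_le, fun t => ?_, hor⟩
  · refine le_trans ?_ H.unit_le
    push_cast
    exact pow_le_pow_right₀ (by norm_num) (by omega)
  · rw [Nomial.initState, Nomial.expoN]
    split_ifs with h <;> simp [h]
  · by_cases ht : t < k
    · exact b2 t ht
    · rw [Nomial.coefN, dif_neg ht, abs_zero]; linarith

/-- Combines the lower bound of `Nomial.exists_large_minAbs`, which through `enough` forces the
criterion at round `L`, with `Nomial.exists_forced_yes`, which contradicts a run of purely negative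
answers. -/
theorem Params.run {L β : ℕ} {Z : ℝ} (H : Params f m r L β Z) (hr : 0 < r)
    (hm : r + 2 * blowup n k * n * r ≤ m) {O : ℕ → ℕ → ℤ} (hO : IsOracle f m r O) :
    ∃ (s : State) (t j i l : ℕ) (v : ℕ → ℕ → Verdict),
      Exec O wrapperProgram f.initState s t ∧ Reports s j i l ∧
      IsRun f m r j v ∧ runOutput k v = some (i, l) ∧ t ≤ wrapperSteps n k L * stepCost β := by
  have hk := f.two_le
  have hn := f.one_le
  have hn' : (1 : ℝ) ≤ n := by exact_mod_cast hn
  have hrm : r < m := by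
    have : 0 < 2 * blowup n k * n * r := by rw [blowup]; positivity
    linarith
  have hunit : ∀ p, 1 ≤ p → (4 : ℤ) ≤ 2 ^ (2 ^ p + 1) := fun p hp => by
    have hp2 : 2 ≤ 2 ^ p := by
      calc 2 = 2 ^ 1 := rfl
        _ ≤ 2 ^ p := Nat.pow_le_pow_right (by norm_num) hp
    calc (4 : ℤ) = 2 ^ 2 := by norm_num
      _ ≤ _ := pow_le_pow_right₀ (by norm_num) (by omega)
  have hX1 : 1 ≤ max (m + r) 1 := le_max_right _ _
  obtain ⟨j₀, hj₀, hM⟩ := f.exists_large_minAbs hr hm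
  have key := wrapperProgram_spec H.rounds_pos (fun p h1 h2 => H.env hO h1 h2) rfl H.safety_le hr
    hrm (fun p => IsApprox.abs_sub_lt rfl (hO.center (2 ^ p) (by positivity)))
    (fun p => IsApprox.abs_sub_lt rfl (hO.radius (2 ^ p) (by positivity)))
    (fun p hp => ?_) (fun i hi => ?_) (fun j best z hs => ?_)
    (fun p j best z h1 h2 hs hsuf => hs.decides hr hm (hunit p h1) hX1 hsuf
      (H.env hO h1 h2).scale.one_le_coef)
    (fun j hj hall => ?_) (σ := f.initState.reg) (by simp [Nomial.initState])
    (by simp [Nomial.initState])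
  · have S := (H.env hO le_rfl H.rounds_pos).scale
    have hinit : Represents β f.initState.mem f.initState.reg f.initState := by
      refine ⟨rfl, fun _ _ => rfl, fun a => ?_, fun d _ => ?_⟩
      · rw [(H.env hO le_rfl H.rounds_pos).mem_eq]
        refine S.fits_nat (by positivity) ?_
        have h1 : (f.expoN a : ℝ) ≤ n := by exact_mod_cast f.expoN_le a
        have := H.n_le
        rw [Int.cast_natCast]; linarith
      · simp only [Nomial.initState]
        split_ifs
        · exact S.fits_index (by omega) (by omega)
        · refine S.fits_nat (by positivity) ?_
          have := H.n_le
          rw [Int.cast_natCast]; linarith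
        · exact S.fits_lit (by norm_num)
    obtain ⟨s', t, σ', hex, ht, hrep, j, a, b, hj, ha, hb, e0, e1, e2, hadm, hY, hN⟩ :=
      key f.initState hinit
    obtain ⟨v, hv, hv'⟩ := exists_run hj ha hb hadm hY hN
    refine ⟨s', t, j, a, b, v, hex, ⟨?_, ?_, ?_⟩, hv, hv', ht⟩
    · rw [hrep.2.1 0 (by norm_num), e0]
    · rw [hrep.2.1 1 (by norm_num), e1]
    · rw [hrep.2.1 2 (by norm_num), e2]
  · refine le_trans ?_ H.unit_le
    have h1 : 2 ^ p ≤ 2 ^ (2 ^ L + 1) := Nat.pow_le_pow_right (by norm_num)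
      (by have := (Nat.lt_two_pow_self (n := L)); omega)
    exact_mod_cast h1
  · refine le_trans ?_ (le_max_left _ _)
    have h1 := testRadius_mul_le (by omega) hr hm le_rfl hi
    have h2 : (1 : ℝ) ≤ (n : ℝ) ^ 16 := one_le_pow₀ hn'
    have h3 := le_mul_of_one_le_right (testRadius_pos (by omega : 0 < n) hr i).le h2
    linarith
  · refine hs.sufficient (hunit L H.rounds_pos) hX1 (H.env hO H.rounds_pos le_rfl).oracle
      f.one_le_height (fun t _ => f.abs_coefN_le t) hj₀ hM ?_ ?_
    · exact_mod_cast H.unit_gt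
    · exact_mod_cast H.enough
  · obtain ⟨a, ha, b, hb, hab⟩ := f.exists_forced_yes hr hm
      (candidate_mem (by omega) hr hj).1
    rcases hall a ha.le b hb.le with h | h
    · exact absurd (hab _ h) (by decide)
    · exact absurd (hab _ h) (by decide)

end Run

/-! ### Parameters -/

/-- `0 ≤ x ≤ 2 ^ e` -/
def PowLe (x e : ℝ) : Prop := 0 ≤ x ∧ x ≤ 2 ^ e

namespace PowLe

variable {x y e e' : ℝ}

theorem mul (hx : PowLe x e) (hy : PowLe y e') : PowLe (x * y) (e + e') :=
  ⟨mul_nonneg hx.1 hy.1, by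
    rw [Real.rpow_add (by norm_num)]
    exact mul_le_mul hx.2 hy.2 hy.1 (by positivity)⟩

theorem pow (hx : PowLe x e) (k : ℕ) : PowLe (x ^ k) (k * e) :=
  ⟨pow_nonneg hx.1 k, by
    rw [mul_comm, Real.rpow_mul (by norm_num), Real.rpow_natCast]
    exact pow_le_pow_left₀ hx.1 hx.2 k⟩

theorem const {N : ℕ} (h0 : 0 ≤ x) (h : x ≤ 2 ^ N) : PowLe x N :=
  ⟨h0, by rw [Real.rpow_natCast]; exact h⟩

theorem natCast (k : ℕ) : PowLe k k :=
  const (by positivity) (by exact_mod_cast (Nat.lt_two_pow_self (n := k)).le)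

theorem le_pow (hx : PowLe x e) {N : ℕ} (h : e ≤ N) : x ≤ 2 ^ N := by
  rw [← Real.rpow_natCast]
  exact hx.2.trans (Real.rpow_le_rpow_of_exponent_le (by norm_num) h)

theorem lt_pow (hx : PowLe x e) {N : ℕ} (h : e < N) : x < 2 ^ N := by
  rw [← Real.rpow_natCast]
  exact hx.2.trans_lt (Real.rpow_lt_rpow_of_exponent_lt (by norm_num) h)

theorem logb (hx : 0 < x) : PowLe x (Real.logb 2 x) :=
  ⟨hx.le, by rw [Real.rpow_logb (by norm_num) (by norm_num) hx]⟩

end PowLe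

/-- Since `r ≤ m / (2n)`, replacing `m + r` by `m` costs at most `(1 + 1/(2n)) ^ n ≤ e ^ (1/2) ≤ 2`,
so `r` does not enter the bound for the powers. -/
theorem max_pow_le {n : ℕ} (hn : 1 ≤ n) {m r : ℝ} (hr : 0 < r) (h : 2 * n * r ≤ m) :
    (max (m + r) 1) ^ n ≤ 2 * (max 1 m) ^ n := by
  have hn' : (1 : ℝ) ≤ n := by exact_mod_cast hn
  have hm : 0 < m := lt_of_lt_of_le (by positivity) h
  have h1 : max (m + r) 1 ≤ max 1 m * (1 / (2 * n) + 1) := by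
    have hpos : (0 : ℝ) < 1 / (2 * n) := by positivity
    refine max_le ?_ ?_
    · have : r ≤ m * (1 / (2 * n)) := by
        rw [mul_one_div, le_div_iff₀ (by positivity)]; linarith
      calc m + r ≤ m * (1 / (2 * n) + 1) := by linarith
        _ ≤ _ := by gcongr; exact le_max_right _ _
    · calc (1 : ℝ) ≤ 1 * (1 / (2 * n) + 1) := by linarith
        _ ≤ _ := by gcongr; exact le_max_left _ _
  have h2 : ((1 : ℝ) / (2 * n) + 1) ^ n ≤ 2 := by
    calc ((1 : ℝ) / (2 * n) + 1) ^ n ≤ (Real.exp (1 / (2 * n))) ^ n := by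
          gcongr; exact Real.add_one_le_exp _
      _ = Real.exp (1 / 2) := by
          rw [← Real.exp_nat_mul]; congr 1; field_simp
      _ ≤ 2 := by
          have h3 : Real.exp (1 / 2) ^ 2 = Real.exp 1 := by
            rw [← Real.exp_nat_mul]; congr 1; norm_num
          have h4 := Real.exp_one_lt_d9
          by_contra hlt
          push Not at hlt
          nlinarith
  have h0 : 0 ≤ max (m + r) 1 := zero_le_one.trans (le_max_right _ _)
  have h3 : 0 ≤ max 1 m := zero_le_one.trans (le_max_left _ _)
  calc (max (m + r) 1) ^ n ≤ (max 1 m * (1 / (2 * n) + 1)) ^ n := by gcongr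
    _ = (max 1 m) ^ n * (1 / (2 * n) + 1) ^ n := mul_pow _ _ _
    _ ≤ (max 1 m) ^ n * 2 := by gcongr
    _ = _ := mul_comm _ _

/-- The second factor of the cost bound. -/
def inputSize (n k : ℕ) (τ m r : ℝ) : ℝ :=
  (k : ℝ) ^ 2 * Real.logb 2 n + n * Real.logb 2 (max 1 m) + τ + Real.logb 2 (max 1 (1 / r))

section Params

variable {n k : ℕ} {τ : ℝ} {m r : ℝ}

/-- The hypothesis on `m` forces `m / r ≥ 2 ^ (8k + 5)`. Hence additive constants and terms linear
in `k` are absorbed by the logarithms in `inputSize`. -/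
theorem le_logb_add_logb (hn : 1 ≤ n) (hr : 0 < r) (hm : r + 2 * blowup n k * n * r ≤ m) :
    8 * (k : ℝ) + 5 ≤ Real.logb 2 (max 1 m) + Real.logb 2 (max 1 (1 / r)) := by
  have hn' : (1 : ℝ) ≤ n := by exact_mod_cast hn
  have h1 : (0 : ℝ) < max 1 m := lt_of_lt_of_le zero_lt_one (le_max_left _ _)
  have h2 : (0 : ℝ) < max 1 (1 / r) := lt_of_lt_of_le zero_lt_one (le_max_left _ _)
  rw [← Real.logb_mul h1.ne' h2.ne', Real.le_logb_iff_rpow_le (by norm_num) (by positivity)]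
  have h3 : (2 : ℝ) ^ (8 * (k : ℝ) + 5) = 2 ^ (8 * k + 5) := by
    rw [← Real.rpow_natCast]; push_cast; rfl
  have h4 : m * (1 / r) ≤ max 1 m * max 1 (1 / r) := by
    gcongr
    · exact le_max_right _ _
    · exact le_max_right _ _
  refine le_trans ?_ h4
  rw [h3, mul_one_div, le_div_iff₀ hr]
  have h5 : (1 : ℝ) ≤ (n : ℝ) ^ (5 * k + 16) * n := by
    rw [← pow_succ]; exact one_le_pow₀ hn'
  have h6 : (2 : ℝ) ^ (8 * k + 5) * r * 1 ≤ 2 ^ (8 * k + 5) * r * ((n : ℝ) ^ (5 * k + 16) * n) := by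
    gcongr
  have h7 : 2 * blowup n k * n * r = 2 ^ (8 * k + 5) * r * ((n : ℝ) ^ (5 * k + 16) * n) := by
    rw [blowup]; ring
  linarith

/-- Every quantity is at most `2` to a fixed multiple of `E = k * inputSize`. With `e` the ceiling
of `E`, a precision of `15 e` suffices and doubling ends below `30 e`; all numbers are measured by
`Z = 2 ^ (40 e)`, and `Z ^ 20 < 2 ^ (800 e + 1)` gives `β`. -/
theorem exists_params (f : Nomial n k τ) (hr : 0 < r) (hm : r + 2 * blowup n k * n * r ≤ m) :
    ∃ e : ℕ, 1 ≤ e ∧ (e : ℝ) ≤ 2 * (k * inputSize n k τ m r) ∧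
      Params f m r (Nat.clog 2 (15 * e)) (800 * e + 1) (2 ^ (40 * e)) := by
  have hk := f.two_le
  have hn := f.one_le
  have hk' : (2 : ℝ) ≤ k := by exact_mod_cast hk
  have hn' : (1 : ℝ) ≤ n := by exact_mod_cast hn
  have hT := f.one_le_height
  have hτ : 0 ≤ τ := by
    by_contra h
    push Not at h
    have := Real.rpow_lt_one_of_one_lt_of_neg (x := 2) (by norm_num) h
    linarith
  have hm1 : (0 : ℝ) < max 1 m := lt_of_lt_of_le zero_lt_one (le_max_left _ _)
  have hr1 : (0 : ℝ) < max 1 (1 / r) := lt_of_lt_of_le zero_lt_one (le_max_left _ _)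
  have hsum := le_logb_add_logb hn hr hm
  have ha0 : 0 ≤ Real.logb 2 n := Real.logb_nonneg (by norm_num) hn'
  have hl0 : 0 ≤ Real.logb 2 (max 1 m) := Real.logb_nonneg (by norm_num) (le_max_left _ _)
  have hρ0 : 0 ≤ Real.logb 2 (max 1 (1 / r)) := Real.logb_nonneg (by norm_num) (le_max_left _ _)
  have pn : PowLe n (Real.logb 2 n) := PowLe.logb (by linarith)
  have pm : PowLe (max 1 m) (Real.logb 2 (max 1 m)) := PowLe.logb hm1
  have pr : PowLe (max 1 (1 / r)) (Real.logb 2 (max 1 (1 / r))) := PowLe.logb hr1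
  have pT : PowLe (2 ^ τ) τ := ⟨by positivity, le_rfl⟩
  have pk : PowLe k k := PowLe.natCast k
  have p2 : PowLe 2 (1 : ℕ) := PowLe.const (by norm_num) (by norm_num)
  have hXn : PowLe ((max (m + r) 1) ^ n) (((1 : ℕ) : ℝ) + n * Real.logb 2 (max 1 m)) := by
    have h0 : 0 ≤ max (m + r) 1 := zero_le_one.trans (le_max_right _ _)
    refine ⟨pow_nonneg h0 n, (max_pow_le hn hr ?_).trans (p2.mul (pm.pow n)).2⟩
    have hR : 1 ≤ blowup n k := by
      rw [blowup]
      exact one_le_mul_of_one_le_of_one_le (one_le_pow₀ (by norm_num)) (one_le_pow₀ hn')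
    have : 2 * (n : ℝ) * r * 1 ≤ 2 * n * r * blowup n k := by gcongr
    linarith
  set B := inputSize n k τ m r with hB
  rw [inputSize] at hB
  set a := Real.logb 2 n
  set lm := Real.logb 2 (max 1 m)
  set ρ := Real.logb 2 (max 1 (1 / r))
  set E := k * B with hE
  have hnl : lm ≤ n * lm := le_mul_of_one_le_left hl0 hn'
  have hk2a : 0 ≤ (k : ℝ) ^ 2 * a := by positivity
  have hka0 : 0 ≤ k * a := by positivity
  have hB1 : 8 * (k : ℝ) + 5 ≤ B := by rw [hB]; linarith
  have hEsum : E = k * (k * (k * a)) + k * (n * lm) + k * τ + k * ρ := by rw [hE, hB]; ring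
  have i1 : 2 * (k * a) ≤ k * (k * a) := by gcongr
  have i2 : 2 * (k * (k * a)) ≤ k * (k * (k * a)) := by gcongr
  have i3 : 2 * (n * lm) ≤ k * (n * lm) := by gcongr
  have i4 : 2 * τ ≤ k * τ := by gcongr
  have i5 : 2 * ρ ≤ k * ρ := by gcongr
  have i6 : a ≤ k * a := le_mul_of_one_le_left ha0 (by linarith)
  have i7 : k * (8 * (k : ℝ) + 5) ≤ E := by rw [hE]; gcongr
  have i8 : 2 * (k : ℝ) ≤ k * k := by gcongr
  have i9 : 0 ≤ n * lm := by positivity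
  refine ⟨⌈E⌉₊, ?_, ?_, ?_⟩
  · exact Nat.one_le_ceil_iff.2 (by linarith)
  · have := Nat.ceil_lt_add_one (show 0 ≤ E by linarith)
    linarith
  have hceil : E ≤ (⌈E⌉₊ : ℝ) := Nat.le_ceil E
  set e := ⌈E⌉₊
  have he1 : 1 ≤ e := by
    have : (0 : ℝ) < e := by linarith
    exact_mod_cast this
  have he2 : 2 ≤ e := by
    have : (2 : ℝ) ≤ e := by linarith
    exact_mod_cast this
  set L := Nat.clog 2 (15 * e) with hL
  have hL1 : 15 * e ≤ 2 ^ L := Nat.le_pow_clog (by norm_num) _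
  have hLpos : 1 ≤ L := Nat.clog_pos (by norm_num) (by omega)
  have hL2 : 2 ^ L ≤ 30 * e := by
    have h1 : 2 ^ L.pred < 15 * e := Nat.pow_pred_clog_lt_self (by norm_num) (by omega)
    obtain ⟨L', hL'⟩ : ∃ L', L = L' + 1 := ⟨L - 1, by omega⟩
    rw [hL'] at h1 ⊢
    rw [Nat.pred_succ] at h1
    rw [pow_succ]; omega
  have hζ : ((40 * e : ℕ) : ℝ) = 40 * e := by push_cast; ring
  have hU : (15 : ℝ) * e ≤ ((2 ^ L + 1 : ℕ) : ℝ) := by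
    have : 15 * e ≤ 2 ^ L + 1 := by omega
    exact_mod_cast this
  refine ⟨hLpos, by omega, by omega, ?_, ?_, ?_, ?_, ?_, ?_, ?_, ?_, ?_, ?_, ?_, ?_⟩
  · rw [← pow_mul]
    exact pow_lt_pow_right₀ (by norm_num) (by omega)
  · exact pow_le_pow_right₀ (by norm_num) (by omega)
  · exact pow_le_pow_right₀ (by norm_num) (by omega)
  · have h1 : (max (m + r) 1) ^ (n + 1) ≤ (max (m + r) 1) ^ n * (max (m + r) 1) ^ n := by
      rw [← pow_add]
      exact pow_le_pow_right₀ (le_max_right _ _) (by omega)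
    refine h1.trans ((hXn.mul hXn).le_pow ?_)
    rw [hζ]; push_cast; linarith
  · have h1 : 10 * k * ((2 : ℝ) ^ τ) ^ 2 + 3 ≤ 16 * (k * ((2 : ℝ) ^ τ) ^ 2) := by
      have : (1 : ℝ) ≤ ((2 : ℝ) ^ τ) ^ 2 := one_le_pow₀ hT
      nlinarith
    refine h1.trans (((PowLe.const (N := 4) (by norm_num) (by norm_num)).mul
      (pk.mul (pT.pow 2))).le_pow ?_)
    rw [hζ]; push_cast; linarith
  · refine ((p2.mul pn).pow k).le_pow ?_
    rw [hζ, mul_add]; push_cast; linarith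
  · have h1 : (k : ℝ) + 2 ≤ 2 * k := by linarith
    refine h1.trans ((p2.mul pk).le_pow ?_)
    rw [hζ]; push_cast; linarith
  · have h1 : 2 * (n : ℝ) + 2 ≤ 2 * (2 * n) := by linarith
    refine h1.trans ((p2.mul (p2.mul pn)).le_pow ?_)
    rw [hζ]; push_cast; linarith
  · refine (((PowLe.const (N := 5) (by norm_num) (by norm_num)).mul pn).mul
      (((PowLe.const (N := 8) (by norm_num) (by norm_num)).mul (pn.pow 5)).pow (k + 1))).le_pow ?_
    rw [hζ]; push_cast; linarith
  · rw [safety]; push_cast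
    refine (((PowLe.const (N := 27) (by norm_num) (by norm_num)).mul (pn.pow 9)).pow k).le_pow ?_
    rw [hζ]; push_cast; linarith
  · refine ((PowLe.const (N := 5) (by norm_num) (by norm_num)).mul pn).lt_pow ?_
    refine lt_of_lt_of_le ?_ hU
    push_cast; linarith
  · have hD : min 1 r = (max 1 (1 / r))⁻¹ := by
      rcases le_total 1 r with h | h
      · rw [min_eq_left h, max_eq_left ((div_le_one hr).2 h), inv_one]
      · rw [min_eq_right h, max_eq_right ((one_le_div hr).2 h), one_div, inv_inv]
    have h1 : (2 * (2 : ℝ) ^ τ)⁻¹ * (min 1 r / (8 * k ^ 4 * (n : ℝ) ^ k * ((2 : ℝ) ^ τ) ^ 2)) ^ k =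
        (2 * 2 ^ τ * (8 * k ^ 4 * (n : ℝ) ^ k * ((2 : ℝ) ^ τ) ^ 2 * max 1 (1 / r)) ^ k)⁻¹ := by
      rw [hD, inv_div_left, inv_pow, ← mul_inv]
    rw [h1, inv_mul_eq_div, lt_div_iff₀ (by positivity), mul_comm 3 n, pow_mul, safety]
    push_cast
    refine ((((((PowLe.const (N := 3) (by norm_num) (by norm_num)).mul pk).mul
      (((PowLe.const (N := 27) (by norm_num) (by norm_num)).mul (pn.pow 9)).pow k)).mul
      (pT.pow 2)).mul (hXn.pow 3)).mul ((p2.mul pT).mul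
      ((((((PowLe.const (N := 3) (by norm_num) (by norm_num)).mul (pk.pow 4)).mul (pn.pow k)).mul
      (pT.pow 2)).mul pr).pow k))).lt_pow ?_
    refine lt_of_lt_of_le ?_ hU
    push_cast
    linarith

end Params

/-! ### The number of bit operations -/

theorem natCast_le_logb {L : ℕ} {x : ℝ} (h : 2 ^ L ≤ x) : (L : ℝ) ≤ Real.logb 2 x := by
  have hx : 0 < x := lt_of_lt_of_le (by positivity) h
  rw [Real.le_logb_iff_rpow_le (by norm_num) hx, Real.rpow_natCast]
  exact h

theorem size_le_logb {y : ℕ} (hy : 1 ≤ y) {x : ℝ} (h : (y : ℝ) ≤ x) :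
    (y.size : ℝ) ≤ Real.logb 2 x + 1 := by
  have h1 : 0 < y.size := Nat.size_pos.2 hy
  obtain ⟨s, hs⟩ : ∃ s, y.size = s + 1 := ⟨y.size - 1, by omega⟩
  have h2 : 2 ^ s ≤ y := Nat.lt_size.1 (by omega)
  have h3 := natCast_le_logb (L := s) (x := x) (le_trans (by exact_mod_cast h2) h)
  rw [hs]; push_cast; linarith

/-- A call of `sumCode` takes `O(k (k + log n))` steps. One round makes about `2 k ^ 2 * k` calls,
the tests `(k + 1) ^ 3`; both lead to `k ^ 4 (k + log n)`. -/
theorem wrapperSteps_le {n k L : ℕ} (hn : 1 ≤ n) (hk : 2 ≤ k) :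
    (wrapperSteps n k L : ℝ) ≤ 92 * (L + 1) * ((k : ℝ) ^ 4 * (k + Real.logb 2 n)) := by
  have hk' : (2 : ℝ) ≤ k := by exact_mod_cast hk
  have hn' : (1 : ℝ) ≤ n := by exact_mod_cast hn
  have hq := size_le_logb hn le_rfl
  have ha0 : 0 ≤ Real.logb 2 n := Real.logb_nonneg (by norm_num) hn'
  have hq0 : (0 : ℝ) ≤ n.size := by positivity
  set q : ℝ := (n.size : ℝ)
  set s := k + Real.logb 2 n with hs
  have hs2 : k ≤ s := by linarith
  have hs0 : 0 < s := by linarith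
  have e1 : 2 * s ≤ k * s := by gcongr
  have e2 : 2 * (k * s) ≤ k * (k * s) := by gcongr
  have e3 : 2 * (k * (k * s)) ≤ k * (k * (k * s)) := by gcongr
  have e4 : 2 * (k * (k * (k * s))) ≤ k * (k * (k * (k * s))) := by gcongr
  have hsum : (sumSteps n k : ℝ) ≤ 20 * (k * s) := by
    rw [sumSteps]; push_cast
    have : 5 * k + 7 * q + 15 ≤ 18 * s := by linarith
    have : k * (5 * k + 7 * q + 15) ≤ k * (18 * s) := by gcongr
    linarith
  have hmin : (minSteps n k : ℝ) ≤ 24 * (k * (k * s)) := by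
    rw [minSteps]; push_cast
    have : (sumSteps n k : ℝ) + 12 ≤ 23 * (k * s) := by linarith
    have : k * ((sumSteps n k : ℝ) + 12) ≤ k * (23 * (k * s)) := by gcongr
    linarith
  have hbest : (bestSteps n k : ℝ) ≤ 59 * (k * (k * (k * (k * s)))) := by
    rw [bestSteps]; push_cast
    have h1 : (minSteps n k : ℝ) + 13 ≤ 26 * (k * (k * s)) := by linarith
    have h2 : 2 * (k : ℝ) ^ 2 + 1 ≤ 9 / 4 * (k * k) := by nlinarith
    have : (2 * (k : ℝ) ^ 2 + 1) * ((minSteps n k : ℝ) + 13) ≤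
        9 / 4 * (k * k) * (26 * (k * (k * s))) := by gcongr
    linarith
  have hround : (roundSteps n k : ℝ) + 1 ≤ 62 * (k * (k * (k * (k * s)))) := by
    rw [roundSteps, powSteps]; push_cast
    linarith
  have hk1 : (k : ℝ) + 1 ≤ 3 / 2 * k := by linarith
  have hcoef : (coefSteps n k : ℝ) ≤ 37 * (k * (k * s)) := by
    rw [coefSteps]; push_cast
    have : (sumSteps n k : ℝ) + 13 ≤ 24 * (k * s) := by linarith
    have : ((k : ℝ) + 1) * ((sumSteps n k : ℝ) + 13) ≤ 3 / 2 * k * (24 * (k * s)) := by gcongr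
    linarith
  have hrow : (rowSteps n k : ℝ) ≤ 59 * (k * (k * (k * s))) := by
    rw [rowSteps]; push_cast
    have : (coefSteps n k : ℝ) + 11 ≤ 39 * (k * (k * s)) := by linarith
    have : ((k : ℝ) + 1) * ((coefSteps n k : ℝ) + 11) ≤ 3 / 2 * k * (39 * (k * (k * s))) := by
      gcongr
    linarith
  have htest : (testSteps n k : ℝ) ≤ 91 * (k * (k * (k * (k * s)))) := by
    rw [testSteps]; push_cast
    have : (rowSteps n k : ℝ) + 9 ≤ 60 * (k * (k * (k * s))) := by linarith
    have : ((k : ℝ) + 1) * ((rowSteps n k : ℝ) + 9) ≤ 3 / 2 * k * (60 * (k * (k * (k * s)))) := by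
      gcongr
    linarith
  have hLr : (L : ℝ) * ((roundSteps n k : ℝ) + 1) ≤ L * (62 * (k * (k * (k * (k * s))))) := by gcongr
  have hpos : 0 ≤ (L : ℝ) * (k * (k * (k * (k * s)))) := by positivity
  have hfin : 92 * (L + 1) * ((k : ℝ) ^ 4 * s) = 92 * (L * (k * (k * (k * (k * s))))) +
      92 * (k * (k * (k * (k * s)))) := by ring
  rw [hfin, wrapperSteps]; push_cast
  linarith

/-- The constant of the cost bound. -/
def costConstant : ℕ := 92 * 3 * 400 * 32040 * 2 * 169

/-- Numbers have `O(k * inputSize)` bits, and the remaining factor `k` completes `k ^ 5`. Of the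
three logarithms one counts the rounds and two come from `mulCost`. -/
theorem cost_le {n k e : ℕ} {τ m r : ℝ} (hn : 1 ≤ n) (hk : 2 ≤ k) (he : 1 ≤ e)
    (hE : (e : ℝ) ≤ 2 * (k * inputSize n k τ m r)) :
    (wrapperSteps n k (Nat.clog 2 (15 * e)) : ℝ) * stepCost (800 * e + 1) ≤
      costConstant * (costBound n k τ m r * Real.logb 2 (2 + costBound n k τ m r) ^ 3) := by
  have hk' : (2 : ℝ) ≤ k := by exact_mod_cast hk
  have hn' : (1 : ℝ) ≤ n := by exact_mod_cast hn
  have he' : (1 : ℝ) ≤ e := by exact_mod_cast he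
  have ha0 : 0 ≤ Real.logb 2 n := Real.logb_nonneg (by norm_num) hn'
  set E := k * inputSize n k τ m r with hEd
  set s := k + Real.logb 2 n with hs
  set G := (k : ℝ) ^ 4 * s with hG
  have hcost : costBound n k τ m r = G * E := by
    rw [costBound, hG, hEd, inputSize]; ring
  have hG32 : 32 ≤ G := by
    calc (32 : ℝ) = 2 ^ 4 * 2 := by norm_num
      _ ≤ (k : ℝ) ^ 4 * s := by gcongr; linarith
  have hE0 : 0 ≤ E := by linarith
  rw [hcost]
  have heC : 16 * (e : ℝ) ≤ 2 + G * E := by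
    have : 32 * E ≤ G * E := by gcongr
    linarith
  set ℓ := Real.logb 2 (2 + G * E) with hℓ
  have hGE : 0 ≤ G * E := by positivity
  have hℓ1 : 1 ≤ ℓ := by
    rw [hℓ, Real.le_logb_iff_rpow_le (by norm_num) (by linarith), Real.rpow_one]
    linarith
  have hL : ((Nat.clog 2 (15 * e) : ℕ) : ℝ) + 1 ≤ 3 * ℓ := by
    have h1 : 2 ^ (Nat.clog 2 (15 * e)).pred < 15 * e :=
      Nat.pow_pred_clog_lt_self (by norm_num) (by omega)
    have hpos : 0 < Nat.clog 2 (15 * e) := Nat.clog_pos (by norm_num) (by omega)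
    obtain ⟨L', hL'⟩ : ∃ L', Nat.clog 2 (15 * e) = L' + 1 := ⟨Nat.clog 2 (15 * e) - 1, by omega⟩
    rw [hL', Nat.pred_succ] at h1
    have h2 : (2 : ℝ) ^ L' ≤ 15 * e := by exact_mod_cast h1.le
    have h3 := natCast_le_logb (L := L') (x := 2 + G * E) (by linarith)
    rw [hL']; push_cast
    linarith
  have hsize : ((40 * (800 * e + 1)).size : ℝ) ≤ 13 * ℓ := by
    have h1 : ((40 * (800 * e + 1) : ℕ) : ℝ) ≤ 2 ^ 11 * (2 + G * E) := by push_cast; linarith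
    have h2 := size_le_logb (by omega) h1
    rw [Real.logb_mul (by norm_num) (by linarith), ← hℓ, Real.logb_pow,
      Real.logb_self_eq_one (by norm_num)] at h2
    push_cast at h2 ⊢
    linarith
  have hstep : (stepCost (800 * e + 1) : ℝ) ≤ 400 * (32040 * (2 * E) * (13 * ℓ) ^ 2) := by
    rw [stepCost, mulCost]
    push_cast
    have h1 : (40 : ℝ) * (800 * e + 1) ≤ 32040 * (2 * E) := by linarith
    gcongr
  have hsteps := wrapperSteps_le (L := Nat.clog 2 (15 * e)) hn hk
  rw [← hs, ← hG] at hsteps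
  calc (wrapperSteps n k (Nat.clog 2 (15 * e)) : ℝ) * stepCost (800 * e + 1)
      ≤ (92 * (3 * ℓ) * G) * (400 * (32040 * (2 * E) * (13 * ℓ) ^ 2)) := by
        refine mul_le_mul (hsteps.trans ?_) hstep (by positivity) (by positivity)
        gcongr
    _ = costConstant * (G * E * ℓ ^ 3) := by rw [costConstant]; push_cast; ring

end SparseRoots

end

theorem mainTheorem8 :
    -- every run returns, and what it returns is correct
    (∀ (n k : ℕ) (τ : ℝ) (f : Nomial n k τ) (m r : ℝ), 0 < r →
      r + 2 * blowup n k * n * r ≤ m →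
      ∀ (j : ℕ) (v : ℕ → ℕ → Verdict), IsRun f m r j v →
        ∃ i l : ℕ, runOutput k v = some (i, l) ∧
          Metric.ball (m : ℂ) r ⊆ Metric.ball (candidate k m r j : ℂ) (testRadius n r i) ∧
          testRadius n r i ≤ blowup n k * r ∧
          m - r ≤ candidate k m r j ∧ candidate k m r j ≤ m + r ∧
          rootCount f.poly (candidate k m r j) (testRadius n r i) = l) ∧
    -- one program carries out such a run on all inputs within the stated bit complexity
    (∃ (P : Program) (K c : ℕ),
      ∀ (n k : ℕ) (τ : ℝ) (f : Nomial n k τ) (m r : ℝ), 0 < r →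
        r + 2 * blowup n k * n * r ≤ m →
        ∀ O : ℕ → ℕ → ℤ, IsOracle f m r O →
          ∃ (s : State) (t j i l : ℕ) (v : ℕ → ℕ → Verdict),
            Exec O P f.initState s t ∧ Reports s j i l ∧
            IsRun f m r j v ∧ runOutput k v = some (i, l) ∧
            (t : ℝ) ≤ K * (costBound n k τ m r *
              Real.logb 2 (2 + costBound n k τ m r) ^ c)) := by
  refine ⟨run_correct, wrapperProgram, costConstant, 3, fun n k τ f m r hr hm O hO => ?_⟩
  obtain ⟨e, he1, heE, H⟩ := exists_params f hr hm
  obtain ⟨s, t, j, i, l, v, h1, h2, h3, h4, ht⟩ := H.run hr hm hO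
  refine ⟨s, t, j, i, l, v, h1, h2, h3, h4, le_trans ?_ (cost_le f.one_le f.two_le he1 heE)⟩
  exact_mod_cast ht
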